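/- Let $X$ be a non-empty compact complex manifold of dimension $n$, and let $F$ be a holomorphic line bundle over $X$. A Hermitian algebraic function on $F$ is a holomorphic section $Q$ over $X\times\overline X$ of the line bundle with fibres $F_x\otimes\overline{F_y}$ such that $Q(x,\bar y)=\overline{Q(y,\bar x)}$; for $v\in F^*_x$, $w\in F^*_y$ write $Q(v,\bar w)=\langle Q(x,\bar y),v\otimes\bar w\rangle$. It is positive if $Q(v,\bar v)>0$ for all $0\ne v\in F^*$; then $h_Q(v,w)=Q(v,\bar w)$ is a Hermitian metric on $F^*$, with curvature form $\Theta_{h_Q}=-\sqrt{-1}\,\partial\bar\partial\log h_Q(e,e)$, where $e$ is any local non-vanishing holomorphic section of $F^*$. A positive $Q$ satisfies the strong global Cauchy–Schwarz condition if $|Q(v,\bar w)|^2<Q(v,\bar v)Q(w,\bar w)$ for all non-zero $v,w\in F^*$ over different points of $X$, and $\Theta_{h_Q}$ is negative definite. $Q$ is a sum (resp. a maximal sum) of Hermitian squares if $Q(x,\bar x)=\sum_i s_i(x)\overline{s_i(x)}$ for all $x\in X$, for some finite subset (resp. some basis) $\{s_0,\dots,s_N\}$ of $H^0(X,F)$.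 Let $L$ and $E$ be holomorphic line bundles over $X$, and let $R$ and $P$ be positive Hermitian algebraic functions on $L$ and $E$ respectively, such that $R$ satisfies the strong global Cauchy–Schwarz condition. Let $\Omega$ be the volume form on $X$ induced from $R$: in local holomorphic coordinates $z$, and with $e$ a local non-vanishing holomorphic section of $L^*$, $$\Omega=\det\Big(\frac{\partial^2\log h_R(e,e)}{\partial z_j\,\partial\bar z_k}\Big)\,dV(z),$$ where $dV(z)$ is Lebesgue measure on $\mathbb C^n$ (that is, $\Omega=\omega^n/n!$ for $\omega=\frac{\sqrt{-1}}2\partial\bar\partial\log h_R(e,e)$). For $m\ge 1$ and $s\in H^0(X,L^m\otimes E)$ put, with $Q=R^mP$, $$\|s\|^2=\int_X\frac{s(x)\overline{s(x)}}{Q(x,\bar x)}\,\Omega(x),\qquad \mathbf K_{R^mP,\Omega}(s,s)=\iint_{X\times X}\frac{Q(x,\bar y)\,s(y)\overline{s(x)}}{Q(x,\bar x)\,Q(y,\bar y)}\,\Omega(x)\Omega(y).$$ There is a constant $C>0$ such that $$\Big|\mathbf K_{R^mP,\Omega}(s,s)-\frac{\pi^n}{m^n}\|s\|^2\Big|\le\frac{C}{m^{n+1}}\|s\|^2\qquad\text{for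 all integers } m\ge 1 \text{ and all } s\in H^0(X,L^m\otimes E).\tag{$*$}$$ Moreover, for every constant $C>0$ satisfying $(*)$, and for every integer $m>C/\pi^n$ (resp. $m\ge C/\pi^n$), the Hermitian algebraic function $R^mP$ on $L^m\otimes E$ is a maximal sum of Hermitian squares (resp. a sum of Hermitian squares). In particular, in both cases there are an integer $N\ge 0$ (depending on $m$) and a holomorphic map $\phi:X\to\mathbb P^N$ such that the Hermitian holomorphic line bundle $((L^m\otimes E)^*,h_{R^mP})$ is isometric to $(\phi^*\mathcal O_{\mathbb P^N}(-1),\phi^*h_N)$, where $h_N$ is the Hermitian metric on $\mathcal O_{\mathbb P^N}(-1)$ induced by $\sum_{i=0}^N|z_i|^2$. -/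

import Mathlib

open Bundle Set MeasureTheory
open scoped Manifold ContDiff LinearAlgebra.Projectivization ComplexConjugate ComplexOrder

noncomputable section

/-! ## Holomorphic line bundles

Throughout, a complex manifold of dimension `n` is a space `X` with
`[ChartedSpace (Fin n → ℂ) X] [IsManifold 𝓘(ℂ, Fin n → ℂ) ω X]`, and a holomorphic line bundle on
`X` is given by its cocycle of transition functions: it is a `Z : VectorBundleCore ℂ X ℂ ι` with
`[Z.IsContMDiff 𝓘(ℂ, Fin n → ℂ) ω]`.  Here `Z.coordChange i j x` (a `ℂ`-linear map `ℂ → ℂ`)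
is the transition from the frame `i` to the frame `j`.  The fibre `Z.Fiber x` is a copy of `ℂ`,
in which a vector is recorded by its coordinate in the frame `Z.indexAt x`. -/

namespace LineBundle

section Algebra

variable {X : Type*} [TopologicalSpace X] {ι ι' : Type*}

/-- The transition function `g_{ij}(x) ∈ ℂ` of a line bundle. -/
def transitionFn (Z : VectorBundleCore ℂ X ℂ ι) (i j : ι) (x : X) : ℂ := Z.coordChange i j x 1

theorem coordChange_apply (Z : VectorBundleCore ℂ X ℂ ι) (i j : ι) (x : X) (v : ℂ) :
    Z.coordChange i j x v = transitionFn Z i j x * v := by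
  have h := (Z.coordChange i j x).map_smul v 1
  simp only [smul_eq_mul, mul_one] at h
  rw [h, transitionFn, mul_comm]

theorem trans_self (Z : VectorBundleCore ℂ X ℂ ι) (i : ι) {x : X} (hx : x ∈ Z.baseSet i) :
    transitionFn Z i i x = 1 := Z.coordChange_self i x hx 1

theorem trans_mul (Z : VectorBundleCore ℂ X ℂ ι) (i j k : ι) {x : X}
    (hx : x ∈ Z.baseSet i ∩ Z.baseSet j ∩ Z.baseSet k) :
    transitionFn Z j k x * transitionFn Z i j x = transitionFn Z i k x := by
  rw [← coordChange_apply]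
  exact Z.coordChange_comp i j k x hx 1

theorem continuousOn_trans (Z : VectorBundleCore ℂ X ℂ ι) (i j : ι) :
    ContinuousOn (transitionFn Z i j) (Z.baseSet i ∩ Z.baseSet j) :=
  (Z.continuousOn_coordChange i j).clm_apply continuousOn_const

/-- The dual line bundle `F^*`, with transition functions `g_{ij}⁻¹ = g_{ji}`.  The duality pairing
of `F^*_x` with `F_x` is multiplication of coordinates. -/
def dual (Z : VectorBundleCore ℂ X ℂ ι) : VectorBundleCore ℂ X ℂ ι where
  baseSet := Z.baseSet
  isOpen_baseSet := Z.isOpen_baseSet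
  indexAt := Z.indexAt
  mem_baseSet_at := Z.mem_baseSet_at
  coordChange i j x := Z.coordChange j i x
  coordChange_self := Z.coordChange_self
  continuousOn_coordChange i j := by
    rw [inter_comm]
    exact Z.continuousOn_coordChange j i
  coordChange_comp i j k x hx v := by
    simp only [coordChange_apply]
    rw [← trans_mul Z k j i ⟨⟨hx.2, hx.1.2⟩, hx.1.1⟩]
    ring

/-- The tensor product `F ⊗ G` of two line bundles, with transition functions `g_{ij} g'_{i'j'}`.
The product `F_x × G_x → (F ⊗ G)_x` is multiplication of coordinates. -/
def tensor (Z : VectorBundleCore ℂ X ℂ ι) (Z' : VectorBundleCore ℂ X ℂ ι') :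
    VectorBundleCore ℂ X ℂ (ι × ι') where
  baseSet i := Z.baseSet i.1 ∩ Z'.baseSet i.2
  isOpen_baseSet i := (Z.isOpen_baseSet i.1).inter (Z'.isOpen_baseSet i.2)
  indexAt x := (Z.indexAt x, Z'.indexAt x)
  mem_baseSet_at x := ⟨Z.mem_baseSet_at x, Z'.mem_baseSet_at x⟩
  coordChange i j x :=
    (transitionFn Z i.1 j.1 x * transitionFn Z' i.2 j.2 x) • ContinuousLinearMap.id ℂ ℂ
  coordChange_self i x hx v := by
    simp [trans_self Z i.1 hx.1, trans_self Z' i.2 hx.2]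
  continuousOn_coordChange i j := by
    refine ContinuousOn.smul (M := ℂ) (X := ℂ →L[ℂ] ℂ) (ContinuousOn.mul ?_ ?_) continuousOn_const
    · exact (continuousOn_trans Z i.1 j.1).mono fun x hx => ⟨hx.1.1, hx.2.1⟩
    · exact (continuousOn_trans Z' i.2 j.2).mono fun x hx => ⟨hx.1.2, hx.2.2⟩
  coordChange_comp i j k x hx v := by
    simp only [smul_apply, ContinuousLinearMap.id_apply, smul_eq_mul]
    rw [← trans_mul Z i.1 j.1 k.1 ⟨⟨hx.1.1.1, hx.1.2.1⟩, hx.2.1⟩,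
      ← trans_mul Z' i.2 j.2 k.2 ⟨⟨hx.1.1.2, hx.1.2.2⟩, hx.2.2⟩]
    ring

/-- The tensor power `F^m` of a line bundle, with transition functions `g_{ij}^m`. -/
def tpow (Z : VectorBundleCore ℂ X ℂ ι) (m : ℕ) : VectorBundleCore ℂ X ℂ ι where
  baseSet := Z.baseSet
  isOpen_baseSet := Z.isOpen_baseSet
  indexAt := Z.indexAt
  mem_baseSet_at := Z.mem_baseSet_at
  coordChange i j x := (transitionFn Z i j x ^ m) • ContinuousLinearMap.id ℂ ℂ
  coordChange_self i x hx v := by simp [trans_self Z i hx]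
  continuousOn_coordChange i j := ((continuousOn_trans Z i j).pow m).smul continuousOn_const
  coordChange_comp i j k x hx v := by
    simp only [smul_apply, ContinuousLinearMap.id_apply, smul_eq_mul]
    rw [← trans_mul Z i j k hx]
    ring

theorem trans_tensor (Z : VectorBundleCore ℂ X ℂ ι) (Z' : VectorBundleCore ℂ X ℂ ι')
    (i j : ι × ι') (x : X) :
    transitionFn (tensor Z Z') i j x = transitionFn Z i.1 j.1 x * transitionFn Z' i.2 j.2 x := by
  simp [transitionFn, tensor]

theorem trans_tpow (Z : VectorBundleCore ℂ X ℂ ι) (m : ℕ) (i j : ι) (x : X) :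
    transitionFn (tpow Z m) i j x = transitionFn Z i j x ^ m := by
  simp [transitionFn, tpow]

/-- The coordinate of a vector of `F_x` in the frame `indexAt x`. -/
def coord (Z : VectorBundleCore ℂ X ℂ ι) {x : X} (v : Z.Fiber x) : ℂ := v

/-- The coordinate in the frame `i` of the vector of `F_x` whose coordinate in the frame
`indexAt x` is `1`.  So a vector `v` of `F_x` has coordinate `frameFactor Z i x * coord Z v` in the
frame `i`. -/
def frameFactor (Z : VectorBundleCore ℂ X ℂ ι) (i : ι) (x : X) : ℂ := transitionFn Z (Z.indexAt x) i x

end Algebra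

section Holomorphic

variable {n : ℕ} {X : Type*} [TopologicalSpace X] [ChartedSpace (Fin n → ℂ) X] {ι ι' : Type*}

theorem contMDiffOn_trans (Z : VectorBundleCore ℂ X ℂ ι)
    [Z.IsContMDiff 𝓘(ℂ, Fin n → ℂ) ω] (i j : ι) :
    ContMDiffOn 𝓘(ℂ, Fin n → ℂ) 𝓘(ℂ, ℂ) ω (transitionFn Z i j) (Z.baseSet i ∩ Z.baseSet j) :=
  (Z.contMDiffOn_coordChange 𝓘(ℂ, Fin n → ℂ) i j).clm_apply contMDiffOn_const

instance (Z : VectorBundleCore ℂ X ℂ ι) [Z.IsContMDiff 𝓘(ℂ, Fin n → ℂ) ω] :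
    (dual Z).IsContMDiff 𝓘(ℂ, Fin n → ℂ) ω where
  contMDiffOn_coordChange i j := by
    have h := Z.contMDiffOn_coordChange (n := ω) 𝓘(ℂ, Fin n → ℂ) j i
    rw [inter_comm] at h
    exact h

instance (Z : VectorBundleCore ℂ X ℂ ι) (Z' : VectorBundleCore ℂ X ℂ ι')
    [Z.IsContMDiff 𝓘(ℂ, Fin n → ℂ) ω] [Z'.IsContMDiff 𝓘(ℂ, Fin n → ℂ) ω] :
    (tensor Z Z').IsContMDiff 𝓘(ℂ, Fin n → ℂ) ω where
  contMDiffOn_coordChange i j := by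
    have h1 := (contMDiffOn_trans (n := n) Z i.1 j.1).mono
      (t := (tensor Z Z').baseSet i ∩ (tensor Z Z').baseSet j) fun x hx => ⟨hx.1.1, hx.2.1⟩
    have h2 := (contMDiffOn_trans (n := n) Z' i.2 j.2).mono
      (t := (tensor Z Z').baseSet i ∩ (tensor Z Z').baseSet j) fun x hx => ⟨hx.1.2, hx.2.2⟩
    exact (h1.smul h2).smul contMDiffOn_const

instance (Z : VectorBundleCore ℂ X ℂ ι) [Z.IsContMDiff 𝓘(ℂ, Fin n → ℂ) ω] (m : ℕ) :
    (tpow Z m).IsContMDiff 𝓘(ℂ, Fin n → ℂ) ω where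
  contMDiffOn_coordChange i j :=
    ((contMDiffOn_trans Z i j).pow m).smul contMDiffOn_const

variable (n) in
/-- The complex vector space `H^0(X, F)` of global holomorphic sections of `F`. -/
abbrev Sections (Z : VectorBundleCore ℂ X ℂ ι) : Type _ :=
  ContMDiffSection 𝓘(ℂ, Fin n → ℂ) ℂ ω Z.Fiber

/-- The coordinate of `s(x) ∈ F_x` in the frame `indexAt x`. -/
def sval {Z : VectorBundleCore ℂ X ℂ ι} (s : Sections n Z) (x : X) : ℂ := coord Z (s x)

end Holomorphic

end LineBundle

open LineBundle

/-! ## Hermitian algebraic functions -/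

section HermitianAlgebraic

variable (n : ℕ) {X : Type*} [TopologicalSpace X] [ChartedSpace (Fin n → ℂ) X] {ι ι' : Type*}

/-- A Hermitian algebraic function on the line bundle `F`: a holomorphic section `Q` over the
product of `X` with its conjugate manifold of the line bundle with fibres `F_x ⊗ conj(F_y)`, with
`Q(x, ȳ)` equal to the conjugate of `Q(y, x̄)`.

`toFun x y` is the coordinate of `Q(x, ȳ)` with respect to the frame `indexAt x` of `F_x` and the
conjugate of the frame `indexAt y` of `F_y`; hence
`frameFactor Z i x * conj (frameFactor Z j y) * toFun x y` is its coordinate with respect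
to the frames `i`, `j`, and the latter must be holomorphic in charts.  A chart of the conjugate
manifold is the complex conjugate of a chart of `X`. -/
structure HermitianAlgebraic (Z : VectorBundleCore ℂ X ℂ ι) where
  toFun : X → X → ℂ
  hermitian : ∀ x y, toFun y x = conj (toFun x y)
  holomorphic : ∀ (i j : ι) (a b : X),
    DifferentiableOn ℂ
      (fun p : (Fin n → ℂ) × (Fin n → ℂ) =>
        frameFactor Z i ((chartAt (Fin n → ℂ) a).symm p.1) *
          conj (frameFactor Z j ((chartAt (Fin n → ℂ) b).symm (star p.2))) *
          toFun ((chartAt (Fin n → ℂ) a).symm p.1) ((chartAt (Fin n → ℂ) b).symm (star p.2)))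
      {p | (p.1 ∈ (chartAt (Fin n → ℂ) a).target ∧
            (chartAt (Fin n → ℂ) a).symm p.1 ∈ Z.baseSet i) ∧
          (star p.2 ∈ (chartAt (Fin n → ℂ) b).target ∧
            (chartAt (Fin n → ℂ) b).symm (star p.2) ∈ Z.baseSet j)}

namespace HermitianAlgebraic

variable {n}

/-- The product `Q₁Q₂`, a Hermitian algebraic function on `F₁ ⊗ F₂`. -/
def mul {Z : VectorBundleCore ℂ X ℂ ι} {Z' : VectorBundleCore ℂ X ℂ ι'}
    (Q : HermitianAlgebraic n Z) (Q' : HermitianAlgebraic n Z') :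
    HermitianAlgebraic n (tensor Z Z') where
  toFun x y := Q.toFun x y * Q'.toFun x y
  hermitian x y := by rw [Q.hermitian x y, Q'.hermitian x y, map_mul]
  holomorphic i j a b := by
    refine (((Q.holomorphic i.1 j.1 a b).mono ?_).mul
      ((Q'.holomorphic i.2 j.2 a b).mono ?_)).congr ?_
    · exact fun p hp => ⟨⟨hp.1.1, hp.1.2.1⟩, ⟨hp.2.1, hp.2.2.1⟩⟩
    · exact fun p hp => ⟨⟨hp.1.1, hp.1.2.2⟩, ⟨hp.2.1, hp.2.2.2⟩⟩
    · intro p _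
      simp only [frameFactor, trans_tensor, map_mul, Pi.mul_apply]
      simp only [tensor]
      ring

/-- The power `Q^m`, a Hermitian algebraic function on `F^m`. -/
def pow {Z : VectorBundleCore ℂ X ℂ ι} (Q : HermitianAlgebraic n Z) (m : ℕ) :
    HermitianAlgebraic n (tpow Z m) where
  toFun x y := Q.toFun x y ^ m
  hermitian x y := by rw [Q.hermitian x y, map_pow]
  holomorphic i j a b := by
    refine ((Q.holomorphic i j a b).pow m).congr ?_
    intro p _
    simp only [frameFactor, trans_tpow, map_pow, Pi.pow_apply]
    simp only [tpow]
    ring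

variable {Z : VectorBundleCore ℂ X ℂ ι}

/-- The function `Q(v, w̄)`, `v, w ∈ F^*`, on the total space of the dual bundle:
the pairing of `Q(x, ȳ) ∈ F_x ⊗ conj(F_y)` with `v ⊗ w̄`, for `v ∈ F^*_x` and `w ∈ F^*_y`. -/
def onDual (Q : HermitianAlgebraic n Z) (v w : TotalSpace ℂ (dual Z).Fiber) : ℂ :=
  Q.toFun v.proj w.proj * coord (dual Z) v.snd * conj (coord (dual Z) w.snd)

/-- `Q` is positive: `Q(v, v̄) > 0` for `0 ≠ v ∈ F^*` (this number is real because `Q` is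
Hermitian). -/
def IsPositive (Q : HermitianAlgebraic n Z) : Prop :=
  ∀ v : TotalSpace ℂ (dual Z).Fiber, v.snd ≠ 0 → 0 < (Q.onDual v v).re

/-- The metric `h_Q(v, w) = Q(v, w̄)` on `F^*`, for `v, w ∈ F^*_x`. -/
def metric (Q : HermitianAlgebraic n Z) (x : X) (v w : (dual Z).Fiber x) : ℂ :=
  Q.onDual ⟨x, v⟩ ⟨x, w⟩

/-! ### Curvature -/

/-- The holomorphic local frame `e` of `F^*` dual to the frame `i` of `F`, at the point `x`. -/
def dualFrame (Z : VectorBundleCore ℂ X ℂ ι) (i : ι) (x : X) : (dual Z).Fiber x :=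
  frameFactor Z i x

/-- `log h_Q(e, e)` for the local frame `e` of `F^*` dual to the frame `i`. -/
def logMetric (Q : HermitianAlgebraic n Z) (i : ι) (x : X) : ℝ :=
  Real.log (Q.metric x (dualFrame Z i x) (dualFrame Z i x)).re

end HermitianAlgebraic

variable {n}

/-- `∂f/∂z_j = (∂f/∂x_j - √-1 ∂f/∂y_j) / 2`. -/
def dz (j : Fin n) (f : (Fin n → ℂ) → ℂ) (z : Fin n → ℂ) : ℂ :=
  (fderiv ℝ f z (Pi.single j 1) - Complex.I * fderiv ℝ f z (Pi.single j Complex.I)) / 2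

/-- `∂f/∂z̄_j = (∂f/∂x_j + √-1 ∂f/∂y_j) / 2`. -/
def dzbar (j : Fin n) (f : (Fin n → ℂ) → ℂ) (z : Fin n → ℂ) : ℂ :=
  (fderiv ℝ f z (Pi.single j 1) + Complex.I * fderiv ℝ f z (Pi.single j Complex.I)) / 2

namespace HermitianAlgebraic

variable {Z : VectorBundleCore ℂ X ℂ ι}

/-- The matrix `(Θ_{jk})` at `z` of the curvature form
`Θ_{h_Q} = -√-1 ∂∂̄ log h_Q(e, e) = √-1 ∑ Θ_{jk} dz_j ∧ dz̄_k` in the coordinates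
`chartAt a` (it does not depend on the local frame `e` of `F^*`; we use the frame that is
attached to the point). -/
def curvature (Q : HermitianAlgebraic n Z) (a : X) (z : Fin n → ℂ) :
    Matrix (Fin n) (Fin n) ℂ :=
  Matrix.of fun j k =>
    -dz j (dzbar k fun z' =>
      (Q.logMetric (Z.indexAt ((chartAt (Fin n → ℂ) a).symm z))
        ((chartAt (Fin n → ℂ) a).symm z') : ℂ)) z

/-- The strong global Cauchy-Schwarz condition. -/
structure IsSGCS (Q : HermitianAlgebraic n Z) : Prop where
  cauchySchwarz : ∀ v w : TotalSpace ℂ (dual Z).Fiber, v.snd ≠ 0 → w.snd ≠ 0 →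
    v.proj ≠ w.proj → ‖Q.onDual v w‖ ^ 2 < (Q.onDual v v).re * (Q.onDual w w).re
  curvature_neg : ∀ (a : X), ∀ z ∈ (chartAt (Fin n → ℂ) a).target, (-Q.curvature a z).PosDef

end HermitianAlgebraic

/-! ### The volume form -/

variable (n) in
theorem exists_chart_cover (X : Type*) [TopologicalSpace X] [CompactSpace X]
    [ChartedSpace (Fin n → ℂ) X] :
    ∃ (k : ℕ) (c : Fin k → X), ∀ x, ∃ i, x ∈ (chartAt (Fin n → ℂ) (c i)).source := by
  obtain ⟨t, ht⟩ := CompactSpace.elim_nhds_subcover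
    (fun x : X => (chartAt (Fin n → ℂ) x).source)
    (fun x => chart_source_mem_nhds (Fin n → ℂ) x)
  refine ⟨t.card, fun i => t.equivFin.symm i, fun x => ?_⟩
  have hx : x ∈ ⋃ y ∈ t, (chartAt (Fin n → ℂ) y).source := by rw [ht]; trivial
  simp only [mem_iUnion] at hx
  obtain ⟨y, hy, hxy⟩ := hx
  exact ⟨t.equivFin ⟨y, hy⟩, by simpa using hxy⟩

variable (n) in
/-- The number of charts in a finite cover of `X` by charts of its atlas. -/
def coverCard (X : Type*) [TopologicalSpace X] [CompactSpace X] [ChartedSpace (Fin n → ℂ) X] : ℕ :=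
  (exists_chart_cover n X).choose

variable (n) in
/-- The charts of a finite cover of `X` are `chartAt (coverPt i)`. -/
def coverPt (X : Type*) [TopologicalSpace X] [CompactSpace X] [ChartedSpace (Fin n → ℂ) X] :
    Fin (coverCard n X) → X :=
  (exists_chart_cover n X).choose_spec.choose

variable (n) in
/-- The points of the `i`-th chart of the cover which are in no earlier chart.  These Borel sets
form a partition of `X`. -/
def coverPiece (X : Type*) [TopologicalSpace X] [CompactSpace X] [ChartedSpace (Fin n → ℂ) X]
    (i : Fin (coverCard n X)) : Set X :=
  {x | x ∈ (chartAt (Fin n → ℂ) (coverPt n X i)).source ∧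
    ∀ j < i, x ∉ (chartAt (Fin n → ℂ) (coverPt n X j)).source}

namespace HermitianAlgebraic

variable {Z : VectorBundleCore ℂ X ℂ ι} [CompactSpace X] [MeasurableSpace X]

/-- The volume form `Ω = ωⁿ / n!`, as a measure on `X`, of the Kähler form
`ω = (√-1/2) ∂∂̄ log h_Q = (√-1/2) ∑ (-Θ_{jk}) dz_j ∧ dz̄_k`.  In the coordinates `z` of any
chart it is `det(-Θ_{jk})` times Lebesgue measure; here it is assembled from the pieces of a
partition of `X` into Borel sets, each of which is inside one chart. -/
def volumeMeasure (Q : HermitianAlgebraic n Z) : Measure X :=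
  Measure.sum fun i : Fin (coverCard n X) =>
    ((volume.withDensity fun z : Fin n → ℂ =>
        ENNReal.ofReal (-Q.curvature (coverPt n X i) z).det.re).restrict
      (chartAt (Fin n → ℂ) (coverPt n X i) '' coverPiece n X i)).map
      (chartAt (Fin n → ℂ) (coverPt n X i)).symm

/-! ### The `L²` product and the integral operator -/

/-- The `L²` product `(s, t) = ∫_X s(x) conj(t(x)) / Q(x, x̄) Ω(x)` on `H^0(X, F)`. -/
def l2Inner (Q : HermitianAlgebraic n Z) (Ω : Measure X) (s t : Sections n Z) : ℂ :=
  ∫ x, sval s x * conj (sval t x) / Q.toFun x x ∂Ω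

/-- The `L²` norm `‖s‖ = √(s, s)`. -/
def l2Norm (Q : HermitianAlgebraic n Z) (Ω : Measure X) (s : Sections n Z) : ℝ :=
  √(Q.l2Inner Ω s s).re

/-- The integral operator `K_{Q,Ω}(s, t)`, a Hermitian form on `H^0(X, F)`. -/
def kernelForm (Q : HermitianAlgebraic n Z) (Ω : Measure X) (s t : Sections n Z) : ℂ :=
  ∫ p : X × X, Q.toFun p.1 p.2 * sval s p.2 * conj (sval t p.1) /
    (Q.toFun p.1 p.1 * Q.toFun p.2 p.2) ∂(Ω.prod Ω)

end HermitianAlgebraic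

/-! ## Sums of squares and maps to projective space -/

namespace HermitianAlgebraic

variable {Z : VectorBundleCore ℂ X ℂ ι}

/-- `Q` is a sum of Hermitian squares: `Q(x, x̄) = ∑ s(x) conj(s(x))`, the sum over a finite subset
of `H^0(X, F)`. -/
def IsSumOfSquares (Q : HermitianAlgebraic n Z) : Prop :=
  ∃ S : Finset (Sections n Z), ∀ x, Q.toFun x x = ∑ s ∈ S, sval s x * conj (sval s x)

/-- `Q` is a maximal sum of Hermitian squares: `Q(x, x̄) = ∑ s_i(x) conj(s_i(x))`, the sum over a
basis `s_0, …, s_N` of `H^0(X, F)`. -/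
def IsMaximalSumOfSquares [Z.IsContMDiff 𝓘(ℂ, Fin n → ℂ) ω] (Q : HermitianAlgebraic n Z) : Prop :=
  ∃ (N : ℕ) (s : Module.Basis (Fin (N + 1)) ℂ (Sections n Z)),
    ∀ x, Q.toFun x x = ∑ i, sval (s i) x * conj (sval (s i) x)

end HermitianAlgebraic

variable (n) in
/-- A map `φ` to `ℙ^N` is holomorphic: in terms of the standard affine charts
`{ζ_i ≠ 0}` with coordinates `ζ_j / ζ_i` of `ℙ^N`, the preimage of each of these charts is open, and
on it the coordinates of `φ` are holomorphic. -/
def IsHolomorphicToProj {N : ℕ} (φ : X → ℙ ℂ (Fin (N + 1) → ℂ)) : Prop :=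
  ∀ i, IsOpen {x | (φ x).rep i ≠ 0} ∧
    ∀ j, ContMDiffOn 𝓘(ℂ, Fin n → ℂ) 𝓘(ℂ, ℂ) ω (fun x => (φ x).rep j / (φ x).rep i)
      {x | (φ x).rep i ≠ 0}

/-- `(F^*, h_Q)` is isometric to `(φ^* O(-1), φ^* h_N)`: there is an isomorphism `ψ` of holomorphic
line bundles that preserves the metrics.  The fibre of `O(-1)` at `p ∈ ℙ^N` is the line
`p.submodule` in `ℂ^{N+1}`, so `O(-1)` is a holomorphic subbundle of the trivial bundle
`ℙ^N × ℂ^{N+1}`, and `h_N(u, v) = ∑ u_i conj(v_i)`. -/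
def HermitianAlgebraic.IsometricToPullback {Z : VectorBundleCore ℂ X ℂ ι}
    (Q : HermitianAlgebraic n Z) {N : ℕ} (φ : X → ℙ ℂ (Fin (N + 1) → ℂ)) : Prop :=
  ∃ ψ : ∀ x, (dual Z).Fiber x ≃ₗ[ℂ] (φ x).submodule,
    ContMDiff (𝓘(ℂ, Fin n → ℂ).prod 𝓘(ℂ, ℂ)) 𝓘(ℂ, Fin (N + 1) → ℂ) ω
      (fun v : TotalSpace ℂ (dual Z).Fiber => (ψ v.proj v.snd : Fin (N + 1) → ℂ)) ∧
    ∀ x (v w : (dual Z).Fiber x),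
      Q.metric x v w =
        ∑ i, (ψ x v : Fin (N + 1) → ℂ) i * conj ((ψ x w : Fin (N + 1) → ℂ) i)

/-- The inequality
`|K_{R^mP,Ω}(s, s) - (π^n / m^n) ‖s‖²| ≤ (C / m^{n+1}) ‖s‖²` for all `m ≥ 1` and all
`s ∈ H^0(X, L^m ⊗ E)`, where `Ω` is the volume form induced from `R`. -/
def AsymptoticBound [CompactSpace X] [MeasurableSpace X] {L : VectorBundleCore ℂ X ℂ ι}
    {E : VectorBundleCore ℂ X ℂ ι'} (R : HermitianAlgebraic n L) (P : HermitianAlgebraic n E)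
    (C : ℝ) : Prop :=
  ∀ m : ℕ, 1 ≤ m → ∀ s : Sections n (tensor (tpow L m) E),
    ‖((R.pow m).mul P).kernelForm R.volumeMeasure s s -
        ((Real.pi ^ n / m ^ n * ((R.pow m).mul P).l2Norm R.volumeMeasure s ^ 2 : ℝ) : ℂ)‖ ≤
      C / m ^ (n + 1) * ((R.pow m).mul P).l2Norm R.volumeMeasure s ^ 2

end HermitianAlgebraic

end

noncomputable section

/-! ## Holomorphic functions of several variables -/

namespace SeveralVariables

open Metric Filter Topology

universe u

variable {E : Type u} [NormedAddCommGroup E] [NormedSpace ℂ E]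
  {F : Type u} [NormedAddCommGroup F] [NormedSpace ℂ F]

/-! Write `Q = R^m P` and consider the operator sending a section `s` to `x ↦ ∫ Q(x, ȳ) s(y) / Q(y,
ȳ) Ω(y)`; the form `K(s, s)` pairs its value at `s` with `s`. If `b_i` is an `L²`-orthonormal basis
of the sections, expanding the kernel `Q(x, ȳ)` in `b` in both variables gives `Q(x, x̄) = ∑ K(b_j,
b_i) b_i(x) conj(b_j(x))` (`toFun_self_eq_sum`). Diagonalizing this Hermitian matrix shows that `Q`
is a sum of squares when `K ≥ 0`, and a maximal one when `K > 0`. The bound (∗) gives `K(s, s) ≥ m⁻ⁿ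
(πⁿ - C / m) ‖s‖²`, whence both thresholds. The sections in the squares have no common zero because
`Q` is positive, and pairing a vector of the dual fibre with them is the required isometry onto the
pulled back tautological bundle.

The analytic content is therefore (∗): the operator is `(π / m)ⁿ` times the identity up to a
relative error `O(1 / m)`. Fix `x`. The integrand equals `Q(x, x̄) f(y) c_R(x, y)^m c_P(x, y)`,
where `c_Q = |Q(x, ȳ)|² / (Q(x, x̄) Q(y, ȳ))` is `cosSq` and `f = s / Q(·, x̄)` is holomorphic near
`x` (`weighted_eq`). Here `-log c_R` is Calabi's diastasis `D` of the potential `log R`. In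
coordinates that normalize the curvature at `x` linearly, `D` is `|w|²` plus cubic terms of types
(2, 1) and (1, 2) plus `O(|w|⁴)`, and the volume density is `1` plus a linear term plus `O(|w|²)`
(`exists_isApproxGaussian`).

The Gaussian main term reproduces `f(0)` by the mean value property. The corrections of relative
order `m^(-1/2)` have to cancel. Those of types (2, 1) and (1, 0) integrate to zero against a
holomorphic function by invariance under the circle (`integral_mul_of_homogeneous`). Those of types
(1, 2) and (0, 1) need not vanish separately; but both come from one symmetric tensor, since the
density is the determinant of the Hessian of the potential, and together they form a
`∂̄`-divergence, which integrates to zero against a holomorphic function up to derivatives of the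
cut-off (`integral_cubic`). What is left carries a factor `1 / m` and a weaker Gaussian
(`exists_norm_integral_sub_le`).

Away from `x`, strict Cauchy-Schwarz and compactness bound `c_R` by `exp(-ε)`
(`exists_cosSq_le_exp`). The resulting pointwise error is an integral of the norm of `s` against
`c_R^(m/6) / m`, together with a diagonal term. The kernel `c_R^(m/6)` has integrals of order `m⁻ⁿ`
in each variable, so Schur's test converts the pointwise bounds into (∗) (`exists_asymptoticBound`).
Constants are uniform in `x` because they depend only on local bounds for `log R` and `log P`.

That a finite orthonormal basis exists is also proved: the mean value property bounds the supremum
of a section by its `L²` norm (`exists_normAt_sq_le`), and this bounds the size of every orthonormal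
family. -/

theorem norm_add_smul_sub_le (x v : E) {ζ : ℂ} {r R : ℝ} (hζ : ‖ζ‖ ≤ r) (hr : r * ‖v‖ < R) :
    x + ζ • v ∈ ball x R := by
  rw [mem_ball, dist_eq_norm, add_sub_cancel_left, norm_smul]
  exact (mul_le_mul_of_nonneg_right hζ (norm_nonneg _)).trans_lt hr

theorem hasDerivAt_line {f : E → F} {x v : E} {ζ : ℂ} (hf : DifferentiableAt ℂ f (x + ζ • v)) :
    HasDerivAt (fun ξ : ℂ => f (x + ξ • v)) (fderiv ℂ f (x + ζ • v) v) ζ := by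
  have h1 : HasDerivAt (fun ξ : ℂ => x + ξ • v) v ζ := by
    simpa using ((hasDerivAt_id ζ).smul_const v).const_add x
  exact hf.hasFDerivAt.comp_hasDerivAt ζ h1

/-- Cauchy's estimate for the derivative. -/
theorem norm_fderiv_le {f : E → F} {x : E} {R r M : ℝ} (hr : 0 < r) (hrR : r < R)
    (hf : DifferentiableOn ℂ f (ball x R)) (hM : ∀ y ∈ ball x R, ‖f y‖ ≤ M) :
    ‖fderiv ℂ f x‖ ≤ M / r := by
  have hM0 : 0 ≤ M := (norm_nonneg _).trans (hM x (mem_ball_self (hr.trans hrR)))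
  refine ContinuousLinearMap.opNorm_le_bound _ (by positivity) fun v => ?_
  rcases eq_or_ne v 0 with rfl | hv
  · simp
  have hv' : 0 < ‖v‖ := norm_pos_iff.2 hv
  have hrv : r / ‖v‖ * ‖v‖ < R := by rwa [div_mul_cancel₀ _ hv'.ne']
  have hd : ∀ ζ ∈ closedBall (0 : ℂ) (r / ‖v‖), x + ζ • v ∈ ball x R := fun ζ hζ =>
    norm_add_smul_sub_le x v (by simpa using hζ) hrv
  have hdiff : ∀ ζ ∈ closedBall (0 : ℂ) (r / ‖v‖),
      HasDerivAt (fun ξ : ℂ => f (x + ξ • v)) (fderiv ℂ f (x + ζ • v) v) ζ := fun ζ hζ =>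
    hasDerivAt_line (hf.differentiableAt (isOpen_ball.mem_nhds (hd ζ hζ)))
  have h := Complex.norm_deriv_le_of_forall_mem_sphere_norm_le (c := (0 : ℂ)) (R := r / ‖v‖)
    (C := M) (f := fun ξ : ℂ => f (x + ξ • v)) (by positivity)
    (DifferentiableOn.diffContOnCl fun ζ hζ => ?_)
    (fun ζ hζ => hM _ (hd ζ (sphere_subset_closedBall hζ)))
  · rw [(hdiff 0 (by simp; positivity)).deriv] at h
    simp only [zero_smul, add_zero] at h
    refine h.trans_eq ?_
    field_simp
  · exact (hdiff ζ (closure_ball_subset_closedBall hζ)).differentiableAt.differentiableWithinAt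

/-- Cauchy's estimate is applied to the difference of `f` and its translate by `y - x`, which is
uniformly small near `x` by uniform continuity on a compact ball. -/
theorem continuousOn_fderiv [FiniteDimensional ℂ E] {f : E → F} {U : Set E} (hU : IsOpen U)
    (hf : DifferentiableOn ℂ f U) : ContinuousOn (fderiv ℂ f) U := by
  intro x hx
  have : ProperSpace E := FiniteDimensional.proper ℂ E
  obtain ⟨R, hR, hRU⟩ := Metric.isOpen_iff.1 hU x hx
  have hcb : closedBall x (R / 2) ⊆ U := (closedBall_subset_ball (by linarith)).trans hRU
  have huc : UniformContinuousOn f (closedBall x (R / 2)) :=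
    (isCompact_closedBall x (R / 2)).uniformContinuousOn_of_continuous
      (hf.continuousOn.mono hcb)
  refine ContinuousAt.continuousWithinAt ?_
  rw [Metric.continuousAt_iff]
  intro ε hε
  obtain ⟨δ, hδ, H⟩ := Metric.uniformContinuousOn_iff.1 huc (ε / 2 * (R / 8)) (by positivity)
  refine ⟨min δ (R / 4), by positivity, fun {y} hy => ?_⟩
  have hy1 : dist y x < δ := hy.trans_le (min_le_left _ _)
  have hy2 : dist y x < R / 4 := hy.trans_le (min_le_right _ _)
  have hmem : ∀ z ∈ ball x (R / 4), z ∈ closedBall x (R / 2) ∧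
      z + (y - x) ∈ closedBall x (R / 2) := by
    intro z hz
    rw [mem_ball] at hz
    constructor
    · rw [mem_closedBall]; linarith
    · rw [mem_closedBall, dist_eq_norm]
      rw [dist_eq_norm] at hz hy2
      calc ‖z + (y - x) - x‖ = ‖(z - x) + (y - x)‖ := by congr 1; abel
        _ ≤ _ := (norm_add_le _ _).trans (by linarith)
  have hd : ∀ z ∈ ball x (R / 4),
      HasFDerivAt (fun z => f (z + (y - x)) - f z) (fderiv ℂ f (z + (y - x)) - fderiv ℂ f z) z := by
    intro z hz
    have h1 := (hf.differentiableAt (hU.mem_nhds (hcb (hmem z hz).2))).hasFDerivAt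
    have h2 := (hf.differentiableAt (hU.mem_nhds (hcb (hmem z hz).1))).hasFDerivAt
    exact ((hasFDerivAt_comp_add_right (y - x)).2 h1).sub h2
  have h := norm_fderiv_le (f := fun z => f (z + (y - x)) - f z) (x := x) (R := R / 4) (r := R / 8)
    (M := ε / 2 * (R / 8)) (by linarith) (by linarith)
    (fun z hz => (hd z hz).differentiableAt.differentiableWithinAt)
    (fun z hz => by
      rw [← dist_eq_norm]
      refine (H _ (hmem z hz).2 _ (hmem z hz).1 ?_).le
      rwa [dist_eq_norm, add_sub_cancel_left, ← dist_eq_norm])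
  rw [(hd x (mem_ball_self (by linarith))).fderiv, add_sub_cancel, mul_div_cancel_right₀ _
    (by positivity)] at h
  rw [dist_eq_norm]
  linarith

/-- This is the one-variable Cauchy formula on the complex line `ζ ↦ x + ζ v`. Its right side
involves only values of `f`, so it can be differentiated in `x` under the integral. -/
theorem fderiv_apply_eq_circleIntegral [CompleteSpace F] {f : E → F} {x v : E} {R t : ℝ}
    (hf : DifferentiableOn ℂ f (ball x R)) (ht : 0 < t) (htv : t * ‖v‖ < R) :
    fderiv ℂ f x v =
      (2 * Real.pi * Complex.I : ℂ)⁻¹ • ∮ ζ in C(0, t), ((ζ - 0) ^ 2)⁻¹ • f (x + ζ • v) := by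
  have hd : ∀ ζ ∈ (fun ζ : ℂ => x + ζ • v) ⁻¹' ball x R, HasDerivAt (fun ξ : ℂ => f (x + ξ • v))
      (fderiv ℂ f (x + ζ • v) v) ζ := fun ζ hζ => hasDerivAt_line (hf.differentiableAt
        (isOpen_ball.mem_nhds hζ))
  have hsub : ∀ ζ ∈ closedBall (0 : ℂ) t, x + ζ • v ∈ ball x R := fun ζ hζ =>
    norm_add_smul_sub_le x v (by simpa using hζ) htv
  have h2 := Complex.two_pi_I_inv_smul_circleIntegral_sub_sq_inv_smul_of_differentiable
    (isOpen_ball.preimage (by fun_prop)) hsub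
    (fun ζ hζ => (hd ζ hζ).differentiableAt.differentiableWithinAt) (mem_ball_self ht)
  rw [h2, (hd 0 (hsub 0 (by simpa using ht.le))).deriv]
  simp

/-- The circle integral for `fderiv ℂ f x v` is differentiated under the integral sign. Continuity
of the first derivative supplies the dominating bound, and finitely many directions `v` suffice in
finite dimension. -/
theorem differentiableOn_fderiv [FiniteDimensional ℂ E] [CompleteSpace F] {f : E → F} {U : Set E}
    (hU : IsOpen U) (hf : DifferentiableOn ℂ f U) : DifferentiableOn ℂ (fderiv ℂ f) U := by
  have hc := continuousOn_fderiv hU hf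
  have : ProperSpace E := FiniteDimensional.proper ℂ E
  have key : ∀ v : E, DifferentiableOn ℂ (fun x => fderiv ℂ f x v) U := by
    intro v x hx
    obtain ⟨R, hR, hRU⟩ := Metric.isOpen_iff.1 hU x hx
    -- The radius makes `t ‖v‖ < R / 4`, so the circles about points of the ball of radius `R / 4`
    -- stay in the closed ball of radius `R / 2`; the `+ 1` covers `v = 0`.
    set t : ℝ := R / (4 * (‖v‖ + 1)) with ht
    have ht0 : 0 < t := by positivity
    have htv : t * ‖v‖ < R / 4 := by
      rw [ht, div_mul_eq_mul_div, div_lt_div_iff₀ (by positivity) (by positivity)]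
      nlinarith [norm_nonneg v]
    have hmem : ∀ y ∈ ball x (R / 4), ∀ θ : ℝ,
        y + circleMap 0 t θ • v ∈ closedBall x (R / 2) := by
      intro y hy θ
      have h1 : y + circleMap 0 t θ • v ∈ ball y (R / 4) :=
        norm_add_smul_sub_le y v (by simp [abs_of_pos ht0]) htv
      rw [mem_ball] at h1 hy
      rw [mem_closedBall]
      linarith [dist_triangle (y + circleMap 0 t θ • v) y x]
    have hcb : closedBall x (R / 2) ⊆ U := (closedBall_subset_ball (by linarith)).trans hRU
    have hcirc : ∀ y, Continuous fun θ : ℝ => y + circleMap 0 t θ • v := fun y => by fun_prop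
    have hcf : ∀ y ∈ ball x (R / 4), Continuous fun θ : ℝ => f (y + circleMap 0 t θ • v) :=
      fun y hy => hf.continuousOn.comp_continuous (hcirc y) fun θ => hcb (hmem y hy θ)
    have hcf' : ∀ y ∈ ball x (R / 4),
        Continuous fun θ : ℝ => fderiv ℂ f (y + circleMap 0 t θ • v) :=
      fun y hy => hc.comp_continuous (hcirc y) fun θ => hcb (hmem y hy θ)
    have hnz : ∀ θ : ℝ, (circleMap 0 t θ - 0) ^ 2 ≠ 0 := fun θ => by
      simp [circleMap, ht0.ne']
    set k : ℝ → ℂ := fun θ => deriv (circleMap 0 t) θ * ((circleMap 0 t θ - 0) ^ 2)⁻¹ with hk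
    have hkc : Continuous k := by
      refine Continuous.mul ?_ (Continuous.inv₀ (by fun_prop) hnz)
      have : deriv (circleMap 0 t) = fun θ => circleMap 0 t θ * Complex.I := by
        ext θ; simp [deriv_circleMap]
      rw [this]; fun_prop
    obtain ⟨M, hM⟩ := (isCompact_closedBall x (R / 2)).exists_bound_of_continuousOn
      (hc.mono hcb)
    have hI := intervalIntegral.hasFDerivAt_integral_of_dominated_of_fderiv_le (𝕜 := ℂ)
      (μ := volume) (a := 0) (b := 2 * Real.pi) (x₀ := x) (s := ball x (R / 4))
      (F := fun y θ => k θ • f (y + circleMap 0 t θ • v))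
      (F' := fun y θ => k θ • fderiv ℂ f (y + circleMap 0 t θ • v))
      (bound := fun θ => ‖k θ‖ * M) (ball_mem_nhds x (by positivity))
      (by
        filter_upwards [ball_mem_nhds x (show 0 < R / 4 by positivity)] with y hy
        exact (hkc.smul (hcf y hy)).aestronglyMeasurable)
      ((hkc.smul (hcf x (mem_ball_self (by positivity)))).intervalIntegrable _ _)
      ((hkc.smul (hcf' x (mem_ball_self (by positivity)))).aestronglyMeasurable)
      (by
        refine Eventually.of_forall fun θ _ y hy => ?_
        rw [norm_smul]
        exact mul_le_mul_of_nonneg_left (hM _ (hmem y hy θ)) (norm_nonneg _))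
      ((hkc.norm.mul continuous_const).intervalIntegrable _ _)
      (by
        refine Eventually.of_forall fun θ _ y hy => ?_
        have h1 := (hf.differentiableAt (hU.mem_nhds (hcb (hmem y hy θ)))).hasFDerivAt
        exact ((hasFDerivAt_comp_add_right _).2 h1).const_smul (k θ))
    have hfin : DifferentiableAt ℂ (fun y => (2 * Real.pi * Complex.I : ℂ)⁻¹ •
        ∮ ζ in C(0, t), ((ζ - 0) ^ 2)⁻¹ • f (y + ζ • v)) x := by
      have := (hI.const_smul (2 * Real.pi * Complex.I : ℂ)⁻¹).differentiableAt
      simpa only [circleIntegral, hk, mul_smul, Pi.smul_def] using this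
    refine (hfin.congr_of_eventuallyEq ?_).differentiableWithinAt
    filter_upwards [ball_mem_nhds x (show 0 < R / 4 by positivity)] with y hy
    refine fderiv_apply_eq_circleIntegral (hf.mono ?_) ht0 htv
    intro z hz
    refine hcb ?_
    rw [mem_ball] at hz hy
    rw [mem_closedBall]
    linarith [dist_triangle z y x]
  let b := Module.finBasis ℂ E
  have heq : fderiv ℂ f = fun x => ∑ i,
      (ContinuousLinearMap.smulRightL ℂ E F (LinearMap.toContinuousLinearMap (b.coord i)))
        (fderiv ℂ f x (b i)) := by
    ext x v
    conv_lhs => rw [← b.sum_repr v, map_sum]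
    simp only [map_smul]
    simp
  rw [heq]
  refine DifferentiableOn.fun_sum fun i _ => ?_
  exact (ContinuousLinearMap.differentiable _).comp_differentiableOn (key (b i))

/-- Bootstrapping: each derivative is again complex differentiable. The induction quantifies over
the target because passing to the derivative replaces `G` by `E →L[ℂ] G`; keeping both spaces in one
universe makes this possible. -/
theorem contDiffOn_infty [FiniteDimensional ℂ E] [CompleteSpace F] {f : E → F} {U : Set E}
    (hU : IsOpen U) (hf : DifferentiableOn ℂ f U) : ContDiffOn ℂ ∞ f U := by
  have : ∀ (k : ℕ) (G : Type u) [NormedAddCommGroup G] [NormedSpace ℂ G] [CompleteSpace G]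
      (g : E → G), DifferentiableOn ℂ g U → ContDiffOn ℂ k g U := by
    intro k
    induction k with
    | zero => exact fun G _ _ _ g hg => contDiffOn_zero.2 hg.continuousOn
    | succ k ih =>
      intro G _ _ _ g hg
      rw [Nat.cast_succ, contDiffOn_succ_iff_fderiv_of_isOpen hU]
      exact ⟨hg, by simp, ih _ _ (differentiableOn_fderiv hU hg)⟩
  exact _root_.contDiffOn_infty.2 fun k => this k F f hf

/-- Cauchy's estimate is iterated, giving up slightly more than `ρ` of the radius per derivative;
hence the requirement `k * ρ < R`. -/
theorem norm_iteratedFDeriv_le [FiniteDimensional ℂ E] (k : ℕ) {ρ : ℝ} (hρ : 0 < ρ) :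
    ∀ {G : Type u} [NormedAddCommGroup G] [NormedSpace ℂ G] [CompleteSpace G] {g : E → G} {x : E}
      {M R : ℝ}, k * ρ < R → DifferentiableOn ℂ g (ball x R) → (∀ y ∈ ball x R, ‖g y‖ ≤ M) →
      ‖iteratedFDeriv ℂ k g x‖ ≤ M / ρ ^ k := by
  induction k with
  | zero =>
    intro G _ _ _ g x M R hR hg hM
    simpa using hM x (mem_ball_self (by simpa using hR))
  | succ k ih =>
    intro G _ _ _ g x M R hR hg hM
    push_cast at hR
    obtain ⟨r, hr1, hr2⟩ := exists_between (show ρ < R - k * ρ by linarith)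
    have hsub : ∀ y ∈ ball x (R - r), ball y r ⊆ ball x R := fun y hy z hz => by
      rw [mem_ball] at *
      linarith [dist_triangle z y x]
    rw [← norm_iteratedFDeriv_fderiv]
    refine (ih (M := M / ρ) (R := R - r) (by linarith) ((differentiableOn_fderiv isOpen_ball hg).mono
      (ball_subset_ball (by linarith))) fun y hy => ?_).trans_eq ?_
    · exact norm_fderiv_le hρ hr1 (hg.mono (hsub y hy)) fun z hz => hM z (hsub y hy hz)
    · rw [pow_succ']; field_simp

theorem iteratedDeriv_line [FiniteDimensional ℂ E] [CompleteSpace F] {f : E → F} {x v : E} {R : ℝ}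
    (hf : DifferentiableOn ℂ f (ball x R)) (k : ℕ) :
    ∀ ζ : ℂ, x + ζ • v ∈ ball x R → iteratedDeriv k (fun ξ : ℂ => f (x + ξ • v)) ζ =
      iteratedFDeriv ℂ k f (x + ζ • v) (fun _ => v) := by
  induction k with
  | zero => simp
  | succ k ih =>
    intro ζ hζ
    rw [iteratedDeriv_succ]
    have hcont : Continuous fun ξ : ℂ => x + ξ • v := by fun_prop
    have hev : (iteratedDeriv k fun ξ : ℂ => f (x + ξ • v)) =ᶠ[𝓝 ζ]
        fun ξ => iteratedFDeriv ℂ k f (x + ξ • v) (fun _ => v) := by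
      filter_upwards [hcont.continuousAt.preimage_mem_nhds (isOpen_ball.mem_nhds hζ)] with ξ hξ
      exact ih ξ hξ
    rw [hev.deriv_eq]
    have hd : DifferentiableAt ℂ (iteratedFDeriv ℂ k f) (x + ζ • v) :=
      ((contDiffOn_infty isOpen_ball hf).contDiffAt
        (isOpen_ball.mem_nhds hζ)).differentiableAt_iteratedFDeriv
          (by exact_mod_cast WithTop.coe_lt_coe.2 (ENat.natCast_lt_top k))
    have h := hasDerivAt_line hd
    have h2 := (ContinuousMultilinearMap.apply ℂ (fun _ : Fin k => E) F
      (fun _ => v)).hasFDerivAt.comp_hasDerivAt ζ h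
    rw [show (fun ξ : ℂ => iteratedFDeriv ℂ k f (x + ξ • v) fun _ => v) =
      (ContinuousMultilinearMap.apply ℂ (fun _ : Fin k => E) F (fun _ => v)) ∘
        fun ξ : ℂ => iteratedFDeriv ℂ k f (x + ξ • v) from rfl, h2.deriv]
    rw [iteratedFDeriv_succ_apply_left]
    rfl

/-- A complex differentiable function on an open subset of a finite-dimensional space is
analytic. -/
theorem analyticOnNhd [FiniteDimensional ℂ E] [CompleteSpace F] {f : E → F} {U : Set E}
    (hU : IsOpen U) (hf : DifferentiableOn ℂ f U) : AnalyticOnNhd ℂ f U := by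
  intro x hx
  have : ProperSpace E := FiniteDimensional.proper ℂ E
  obtain ⟨R', hR', hRU⟩ := Metric.isOpen_iff.1 hU x hx
  obtain ⟨M, hM⟩ := (isCompact_closedBall x (R' / 2)).exists_bound_of_continuousOn
    (hf.continuousOn.mono ((closedBall_subset_ball (by linarith)).trans hRU))
  obtain ⟨R, hRdef⟩ : ∃ R, R = R' / 2 := ⟨_, rfl⟩
  rw [← hRdef] at hM
  have hR : 0 < R := by rw [hRdef]; positivity
  have hfR : DifferentiableOn ℂ f (ball x R) :=
    hf.mono ((ball_subset_ball (by linarith)).trans hRU)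
  have hMR : ∀ y ∈ ball x R, ‖f y‖ ≤ M := fun y hy => hM y (ball_subset_closedBall hy)
  have hM0 : 0 ≤ M := (norm_nonneg _).trans (hMR x (mem_ball_self hR))
  let p : FormalMultilinearSeries ℂ E F := fun k =>
    (k.factorial : ℂ)⁻¹ • iteratedFDeriv ℂ k f x
  -- The iterated Cauchy estimate with `ρ = R / (2k)` bounds the `k`-th coefficient by `M (2k / R)^k
  -- / k!`, and `k^k / k! ≤ e^k` leads to the radius `R / (2e)`.
  set r : NNReal := ⟨R / (2 * Real.exp 1), by positivity⟩ with hrdef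
  have hr : (r : ℝ) = R / (2 * Real.exp 1) := rfl
  have hr0 : 0 < (r : ℝ) := by rw [hr]; positivity
  have hrR : (r : ℝ) < R := by
    rw [hr, div_lt_iff₀ (by positivity)]
    nlinarith [Real.add_one_le_exp 1]
  refine ⟨p, r, ?_⟩
  refine ⟨?_, by exact_mod_cast hr0, fun {y} hy => ?_⟩
  · refine p.le_radius_of_bound M fun k => ?_
    simp only [p]
    rw [norm_smul, norm_inv, Complex.norm_natCast]
    rcases Nat.eq_zero_or_pos k with rfl | hk
    · simpa using hMR x (mem_ball_self hR)
    have hk' : (0 : ℝ) < k := by exact_mod_cast hk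
    have h1 := norm_iteratedFDeriv_le (ρ := R / (2 * k)) k (by positivity) (R := R)
      (by field_simp; norm_num) hfR hMR
    calc _ ≤ (k.factorial : ℝ)⁻¹ * (M / (R / (2 * k)) ^ k) * r ^ k := by gcongr
      _ = M * ((k : ℝ) ^ k / k.factorial) / Real.exp 1 ^ k := by
          rw [hr, div_pow, div_pow, mul_pow, mul_pow]
          have : R ^ k ≠ 0 := by positivity
          field_simp
      _ ≤ M := by
          rw [div_le_iff₀ (by positivity), ← Real.exp_nat_mul, mul_one]
          exact mul_le_mul_of_nonneg_left (Real.pow_div_factorial_le_exp _ hk'.le k) hM0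
  · have hy' : ‖y‖ < R := by
      have : ‖y‖ < r := by simpa [← ofReal_norm, ENNReal.ofReal_lt_coe_iff] using hy
      linarith
    -- On the line through `x` and `x + y` the one-variable Taylor series converges on a disc of
    -- radius `q > 1`; evaluation at `1` sums the series of `f` at `x + y`.
    obtain ⟨q, hq1, hq2⟩ : ∃ q : ℝ, 1 < q ∧ q * ‖y‖ < R := by
      rcases (norm_nonneg y).eq_or_lt with h0 | h0
      · exact ⟨2, by norm_num, by rw [← h0]; linarith⟩
      · obtain ⟨q, h1, h2⟩ := exists_between ((one_lt_div h0).2 hy')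
        exact ⟨q, h1, (lt_div_iff₀ h0).1 h2⟩
    have hd : DifferentiableOn ℂ (fun ξ : ℂ => f (x + ξ • y)) (ball 0 q) := fun ζ hζ =>
      (hasDerivAt_line (hfR.differentiableAt (isOpen_ball.mem_nhds
        (norm_add_smul_sub_le x y (by simpa using (mem_ball.1 hζ).le)
          hq2)))).differentiableAt.differentiableWithinAt
    have h := Complex.hasSum_taylorSeries_on_ball hd (z := 1) (by simpa using hq1)
    simp only [one_smul] at h
    convert! h using 2 with k
    simp only [p]
    have := iteratedDeriv_line (v := y) hfR k 0 (by simpa using hR)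
    simp only [zero_smul, add_zero] at this
    simp [this]

theorem contDiffOn [FiniteDimensional ℂ E] [CompleteSpace F] {f : E → F} {U : Set E} {k : ℕ∞ω}
    (hU : IsOpen U) (hf : DifferentiableOn ℂ f U) : ContDiffOn ℂ k f U :=
  (analyticOnNhd hU hf).contDiffOn hU.uniqueDiffOn

end SeveralVariables

end

noncomputable section

/-! ## Gaussian integrals of holomorphic functions -/

namespace Gaussian

open Metric Filter Topology

variable {n : ℕ}

/-- The square of the Euclidean norm on `ℂⁿ`. -/
def normSq (w : Fin n → ℂ) : ℝ := ∑ j, ‖w j‖ ^ 2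

theorem normSq_nonneg (w : Fin n → ℂ) : 0 ≤ normSq w := Finset.sum_nonneg fun _ _ => by positivity

@[fun_prop]
theorem continuous_normSq : Continuous (normSq : (Fin n → ℂ) → ℝ) := by
  unfold normSq; fun_prop

theorem contDiff_normSq {k : ℕ∞ω} : ContDiff ℝ k (normSq : (Fin n → ℂ) → ℝ) := by
  unfold normSq
  exact ContDiff.sum fun j _ => (contDiff_norm_sq ℝ).comp (contDiff_apply ℝ ℂ j)

theorem normSq_zero : normSq (0 : Fin n → ℂ) = 0 := by simp [normSq]

theorem normSq_smul (c : ℂ) (w : Fin n → ℂ) : normSq (c • w) = ‖c‖ ^ 2 * normSq w := by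
  simp [normSq, Finset.mul_sum, mul_pow]

theorem norm_apply_le_sqrt_normSq (w : Fin n → ℂ) (j : Fin n) : ‖w j‖ ≤ √(normSq w) := by
  refine Real.le_sqrt_of_sq_le ?_
  exact Finset.single_le_sum (f := fun j => ‖w j‖ ^ 2) (fun _ _ => by positivity)
    (Finset.mem_univ j)

theorem norm_le_sqrt_normSq (w : Fin n → ℂ) : ‖w‖ ≤ √(normSq w) :=
  (pi_norm_le_iff_of_nonneg (Real.sqrt_nonneg _)).2 (norm_apply_le_sqrt_normSq w)

theorem normSq_le_card_mul_norm_sq (w : Fin n → ℂ) : normSq w ≤ n * ‖w‖ ^ 2 := by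
  refine (Finset.sum_le_card_nsmul _ _ (‖w‖ ^ 2) fun j _ => ?_).trans_eq (by simp)
  exact pow_le_pow_left₀ (norm_nonneg _) (norm_le_pi_norm w j) 2

theorem isCompact_normSq_le (r : ℝ) : IsCompact {w : Fin n → ℂ | normSq w ≤ r} := by
  refine Metric.isCompact_of_isClosed_isBounded (isClosed_le continuous_normSq continuous_const) ?_
  refine (isBounded_closedBall (x := (0 : Fin n → ℂ)) (r := √r)).subset fun w hw => ?_
  rw [mem_closedBall_zero_iff]
  exact (norm_le_sqrt_normSq w).trans (Real.sqrt_le_sqrt hw)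

theorem isOpen_normSq_lt (r : ℝ) : IsOpen {w : Fin n → ℂ | normSq w < r} :=
  isOpen_lt continuous_normSq continuous_const

theorem exp_neg_mul_normSq (b : ℝ) (w : Fin n → ℂ) :
    Real.exp (-b * normSq w) = ∏ j, Real.exp (-b * ‖w j‖ ^ (2 : ℝ)) := by
  rw [← Real.exp_sum, normSq, Finset.mul_sum]
  simp

theorem integral_exp_neg_mul_normSq {b : ℝ} (hb : 0 < b) :
    ∫ w : Fin n → ℂ, Real.exp (-b * normSq w) = (Real.pi / b) ^ n := by
  simp_rw [exp_neg_mul_normSq]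
  rw [integral_fintype_prod_volume_eq_pow (fun z : ℂ => Real.exp (-b * ‖z‖ ^ (2 : ℝ))),
    Complex.integral_exp_neg_mul_rpow (by norm_num) hb]
  simp [Real.rpow_neg_one, div_eq_mul_inv, show (1 : ℝ) + 1 = 2 by norm_num]

theorem integrable_exp_neg_mul_normSq {b : ℝ} (hb : 0 < b) :
    Integrable fun w : Fin n → ℂ => Real.exp (-b * normSq w) := by
  simp_rw [exp_neg_mul_normSq]
  refine Integrable.fintype_prod (f := fun _ (z : ℂ) => Real.exp (-b * ‖z‖ ^ (2 : ℝ))) fun _ => ?_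
  by_contra h
  have := Complex.integral_exp_neg_mul_rpow (p := 2) (by norm_num) hb
  rw [integral_undef h] at this
  have h2 : 0 < Real.pi * b ^ (-2 / 2 : ℝ) * Real.Gamma (2 / 2 + 1) :=
    mul_pos (mul_pos Real.pi_pos (Real.rpow_pos_of_pos hb _)) (Real.Gamma_pos_of_pos (by norm_num))
  exact h2.ne this

theorem measurePreserving_smul_of_norm_eq_one {c : ℂ} (hc : ‖c‖ = 1) :
    MeasurePreserving (fun w : Fin n → ℂ => c • w) := by
  have h : MeasurePreserving (fun z : ℂ => c * z) :=
    (rotation (⟨c, by simpa [Submonoid.unitSphere] using hc⟩ : Circle)).measurePreserving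
  exact volume_preserving_pi fun _ : Fin n => h

theorem integral_smul_of_norm_eq_one {c : ℂ} (hc : ‖c‖ = 1) (g : (Fin n → ℂ) → ℂ) :
    ∫ w, g (c • w) = ∫ w, g w :=
  (measurePreserving_smul_of_norm_eq_one hc).integral_comp
    (Homeomorph.smulOfNeZero c (by rintro rfl; simp at hc)).measurableEmbedding g

theorem continuous_mul_of_eq_zero {f k : (Fin n → ℂ) → ℂ} {r r' : ℝ} (hr : r' < r)
    (hf : ContinuousOn f {w | normSq w < r}) (hk : Continuous k)
    (hk0 : ∀ w, r' < normSq w → k w = 0) : Continuous fun w => f w * k w := by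
  rw [continuous_iff_continuousAt]
  intro w
  rcases lt_or_ge (normSq w) r with h | h
  · exact (hf.continuousAt ((isOpen_normSq_lt r).mem_nhds h)).mul hk.continuousAt
  · refine (continuousAt_const (y := (0 : ℂ))).congr ?_
    filter_upwards [(isOpen_lt continuous_const continuous_normSq).mem_nhds
      (show r' < normSq w by linarith)] with y hy
    rw [hk0 y hy, mul_zero]

theorem hasCompactSupport_of_eq_zero {k : (Fin n → ℂ) → ℂ} {r' : ℝ}
    (hk0 : ∀ w, r' < normSq w → k w = 0) : HasCompactSupport k := by
  refine HasCompactSupport.intro (isCompact_normSq_le r') fun w hw => hk0 w ?_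
  simpa using hw

/-- The mean value property of holomorphic functions, for weights that are homogeneous under
the action of the unit circle. -/
theorem integral_mul_of_homogeneous {f k : (Fin n → ℂ) → ℂ} {r r' : ℝ} (hr : r' < r)
    (hf : DifferentiableOn ℂ f {w | normSq w < r}) (hk : Continuous k)
    (hk0 : ∀ w, r' < normSq w → k w = 0) (p : ℕ)
    (hkp : ∀ c : ℂ, ‖c‖ = 1 → ∀ w, k (c • w) = c ^ p * k w) :
    ∫ w, f w * k w = (0 : ℂ) ^ p * f 0 * ∫ w, k w := by
  set G : (Fin n → ℂ) → ℂ := fun w => f w * k w with hG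
  have hGc : Continuous G := continuous_mul_of_eq_zero hr hf.continuousOn hk hk0
  have hG0 : ∀ w, r' < normSq w → G w = 0 := fun w hw => by simp [hG, hk0 w hw]
  obtain ⟨M, hM⟩ := (hasCompactSupport_of_eq_zero hG0).exists_bound_of_continuous hGc
  -- Lebesgue measure is invariant under `w ↦ e^{iθ} w`, so the integral may be averaged over `θ`
  -- and the order of integration exchanged.
  set μ : Measure ℝ := volume.restrict (Ioc 0 (2 * Real.pi)) with hμ
  have hnorm : ∀ θ : ℝ, ‖circleMap 0 1 θ‖ = 1 := fun θ => by simp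
  have hint : Integrable (Function.uncurry fun (θ : ℝ) (w : Fin n → ℂ) => G (circleMap 0 1 θ • w))
      (μ.prod volume) := by
    refine Integrable.mono' (g := fun q : ℝ × (Fin n → ℂ) =>
      (fun _ : ℝ => M) q.1 * ({w | normSq w ≤ r'}.indicator (fun _ => (1 : ℝ))) q.2)
      (Integrable.mul_prod (integrable_const M) ?_) ?_ ?_
    · rw [integrable_indicator_iff (isCompact_normSq_le r').isClosed.measurableSet]
      exact integrableOn_const (isCompact_normSq_le r').measure_lt_top.ne
    · refine Continuous.aestronglyMeasurable ?_
      simp only [Function.uncurry_def]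
      fun_prop
    · refine Eventually.of_forall fun q => ?_
      simp only [Function.uncurry_def]
      by_cases h : normSq q.2 ≤ r'
      · simpa [indicator_of_mem (show q.2 ∈ {w | normSq w ≤ r'} from h)] using hM _
      · rw [hG0 _ (by rw [normSq_smul, hnorm]; simpa using h)]
        simp [h]
  have hswap := integral_integral_swap hint
  have h1 : (∫ θ, (∫ w : Fin n → ℂ, G (circleMap 0 1 θ • w)) ∂μ) = (2 * Real.pi : ℂ) * ∫ w, G w := by
    simp_rw [fun θ => integral_smul_of_norm_eq_one (hnorm θ) G]
    rw [integral_const]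
    simp [hμ, Real.pi_pos.le]
  -- For fixed `w` the average is the mean over the circle of the holomorphic function `ζ ↦ ζ^p f(ζ
  -- w)`, whose value at the centre is `0^p f(0)`. It vanishes for `p > 0`, while `0^0 = 1` covers
  -- the invariant weights.
  have h2 : ∀ w, ∫ θ, G (circleMap 0 1 θ • w) ∂μ = (2 * Real.pi : ℂ) * (0 ^ p * f 0 * k w) := by
    intro w
    by_cases h : normSq w ≤ r'
    · have hmem : ∀ ζ : ℂ, ‖ζ‖ ≤ 1 → ζ • w ∈ {w | normSq w < r} := fun ζ hζ => by
        rw [mem_ofPred_eq, normSq_smul]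
        have : ‖ζ‖ ^ 2 ≤ 1 := pow_le_one₀ (norm_nonneg _) hζ
        nlinarith [normSq_nonneg w]
      have hd : DiffContOnCl ℂ (fun ζ : ℂ => ζ ^ p * f (ζ • w)) (ball 0 |1|) := by
        refine DifferentiableOn.diffContOnCl fun ζ hζ => ?_
        have hζ1 : ‖ζ‖ ≤ 1 := by simpa using closure_ball_subset_closedBall hζ
        have hfd := hf.differentiableAt ((isOpen_normSq_lt r).mem_nhds (hmem ζ hζ1))
        refine DifferentiableAt.differentiableWithinAt ?_
        exact (differentiableAt_id.pow p).mul (hfd.comp ζ (by fun_prop))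
      have hav := hd.circleAverage
      rw [Real.circleAverage_def, intervalIntegral.integral_of_le (by positivity)] at hav
      simp only [zero_smul] at hav
      have : ∀ θ, G (circleMap 0 1 θ • w) =
          (circleMap 0 1 θ ^ p * f (circleMap 0 1 θ • w)) * k w := fun θ => by
        simp only [hG]
        rw [hkp _ (hnorm θ)]; ring
      simp_rw [this]
      rw [integral_mul_const, ← hav, Complex.real_smul]
      have hpi : (Real.pi : ℂ) ≠ 0 := by exact_mod_cast Real.pi_ne_zero
      push_cast
      field_simp
      ring
    · push Not at h
      rw [hk0 w h]
      simp only [mul_zero]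
      refine (integral_congr_ae (Eventually.of_forall fun θ => ?_)).trans (integral_zero _ _)
      exact hG0 _ (by rw [normSq_smul, hnorm]; simpa using h)
  rw [h1] at hswap
  simp_rw [h2] at hswap
  rw [integral_const_mul, integral_const_mul] at hswap
  exact mul_left_cancel₀ (by exact_mod_cast Real.two_pi_pos.ne') hswap

/-! ### Integration by parts -/

theorem integral_dzbar_eq_zero {F : (Fin n → ℂ) → ℂ} (hF : ContDiff ℝ 1 F)
    (hc : HasCompactSupport F) (p : Fin n) : ∫ w, dzbar p F w = 0 := by
  have hcont : Continuous (fderiv ℝ F) := hF.continuous_fderiv one_ne_zero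
  have hi : ∀ v, Integrable fun w => fderiv ℝ F w v := fun v =>
    (hcont.clm_apply continuous_const).integrable_of_hasCompactSupport (hc.fderiv_apply ℝ v)
  have h0 : ∀ v, ∫ w, fderiv ℝ F w v = 0 := fun v => by
    have := integral_mul_fderiv_eq_neg_fderiv_mul_of_integrable (μ := volume)
      (f := fun _ : Fin n → ℂ => (1 : ℂ)) (g := F) (v := v) (by simp) (by simpa using hi v)
      (by simpa using hF.continuous.integrable_of_hasCompactSupport hc)
      (fun _ _ => by fun_prop) fun w _ => hF.differentiable one_ne_zero w
    simpa using this
  simp only [dzbar]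
  rw [integral_div, integral_add (hi _) ((hi _).const_mul _), integral_const_mul, h0, h0]
  simp

theorem dzbar_mul {F G : (Fin n → ℂ) → ℂ} {w : Fin n → ℂ} (hF : DifferentiableAt ℝ F w)
    (hG : DifferentiableAt ℝ G w) (p : Fin n) :
    dzbar p (fun w => F w * G w) w = dzbar p F w * G w + F w * dzbar p G w := by
  simp only [dzbar, fderiv_fun_mul hF hG, add_apply, smul_apply, smul_eq_mul]
  ring

theorem dzbar_of_differentiableAt {f : (Fin n → ℂ) → ℂ} {w : Fin n → ℂ}
    (hf : DifferentiableAt ℂ f w) (p : Fin n) : dzbar p f w = 0 := by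
  have h : (Pi.single p Complex.I : Fin n → ℂ) = Complex.I • Pi.single p 1 := by
    rw [← Pi.single_smul]; simp
  simp only [dzbar, hf.fderiv_restrictScalars ℝ, ContinuousLinearMap.coe_restrictScalars', h,
    map_smul, smul_eq_mul]
  rw [← mul_assoc, Complex.I_mul_I]
  ring

theorem dzbar_sum {ι : Type*} (s : Finset ι) {F : ι → (Fin n → ℂ) → ℂ} {w : Fin n → ℂ}
    (hF : ∀ i ∈ s, DifferentiableAt ℝ (F i) w) (p : Fin n) :
    dzbar p (fun w => ∑ i ∈ s, F i w) w = ∑ i ∈ s, dzbar p (F i) w := by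
  simp only [dzbar, fderiv_fun_sum hF, sum_apply, Finset.mul_sum]
  rw [← Finset.sum_add_distrib, Finset.sum_div]

theorem differentiableAt_conj_apply (k : Fin n) (w : Fin n → ℂ) :
    DifferentiableAt ℝ (fun w : Fin n → ℂ => conj (w k)) w :=
  (Complex.conjCLE.differentiable.comp (by fun_prop)).differentiableAt

theorem dzbar_conj_apply (k p : Fin n) (w : Fin n → ℂ) :
    dzbar p (fun w : Fin n → ℂ => conj (w k)) w = if p = k then 1 else 0 := by
  have h : HasFDerivAt (fun w : Fin n → ℂ => conj (w k))
      ((Complex.conjCLE : ℂ →L[ℝ] ℂ).comp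
        (ContinuousLinearMap.proj (R := ℝ) (φ := fun _ : Fin n => ℂ) k)) w :=
    ((Complex.conjCLE : ℂ →L[ℝ] ℂ).comp
        (ContinuousLinearMap.proj (R := ℝ) (φ := fun _ : Fin n => ℂ) k)).hasFDerivAt
  simp only [dzbar, h.fderiv]
  by_cases hk : p = k
  · subst hk; simp
  · simp [hk]

theorem dzbar_cexp {u : (Fin n → ℂ) → ℂ} {w : Fin n → ℂ} (hu : DifferentiableAt ℝ u w)
    (p : Fin n) : dzbar p (fun w => Complex.exp (u w)) w = Complex.exp (u w) * dzbar p u w := by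
  simp only [dzbar, hu.hasFDerivAt.cexp.fderiv, smul_apply, smul_eq_mul]
  ring

theorem ofReal_normSq (w : Fin n → ℂ) : (normSq w : ℂ) = ∑ j, w j * conj (w j) := by
  simp [normSq, Complex.mul_conj, Complex.normSq_eq_norm_sq]

theorem dzbar_exp_neg_mul_normSq (m : ℝ) (w : Fin n → ℂ) (p : Fin n) :
    dzbar p (fun w => Complex.exp (-m * normSq w)) w =
      -m * w p * Complex.exp (-m * normSq w) := by
  have hd : ∀ j : Fin n, DifferentiableAt ℝ (fun w : Fin n → ℂ => w j * conj (w j)) w :=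
    fun j => (by fun_prop : DifferentiableAt ℝ (fun w : Fin n → ℂ => w j) w).mul
      (differentiableAt_conj_apply j w)
  have hs : DifferentiableAt ℝ (fun w : Fin n → ℂ => ∑ j, w j * conj (w j)) w :=
    DifferentiableAt.fun_sum fun j _ => hd j
  simp_rw [ofReal_normSq]
  rw [dzbar_cexp (u := fun w => -m * ∑ j, w j * conj (w j)) ((differentiableAt_const _).fun_mul hs),
    dzbar_mul (differentiableAt_const _) hs,
    dzbar_sum _ fun j _ => hd j, dzbar_of_differentiableAt (by fun_prop)]
  have : ∀ j : Fin n, dzbar p (fun w : Fin n → ℂ => w j * conj (w j)) w =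
      if p = j then w j else 0 := fun j => by
    rw [dzbar_mul (by fun_prop) (differentiableAt_conj_apply j w), dzbar_conj_apply,
      dzbar_of_differentiableAt (by fun_prop)]
    simp
  simp_rw [this]
  simp
  ring

end Gaussian

end

/-! ### Cut-off functions, cubic terms and the first-order expansion of the weight -/

noncomputable section

namespace Gaussian

open Metric Filter Topology

variable {n : ℕ}

/-- A smooth cut-off function, equal to `1` for `|w|² ≤ δ² / 4` and to `0` for `|w|² ≥ δ² / 2`. -/
def cutoff (δ : ℝ) (w : Fin n → ℂ) : ℝ := Real.smoothTransition (2 - 4 * normSq w / δ ^ 2)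

theorem contDiff_cutoff (δ : ℝ) {k : ℕ∞} : ContDiff ℝ k (cutoff δ : (Fin n → ℂ) → ℝ) :=
  Real.smoothTransition.contDiff.comp
    (contDiff_const.sub ((contDiff_const.mul contDiff_normSq).div_const _))

@[fun_prop]
theorem continuous_cutoff (δ : ℝ) : Continuous (cutoff δ : (Fin n → ℂ) → ℝ) :=
  (contDiff_cutoff δ (k := 0)).continuous

theorem cutoff_nonneg (δ : ℝ) (w : Fin n → ℂ) : 0 ≤ cutoff δ w := Real.smoothTransition.nonneg _

theorem cutoff_le_one (δ : ℝ) (w : Fin n → ℂ) : cutoff δ w ≤ 1 := Real.smoothTransition.le_one _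

theorem cutoff_eq_one {δ : ℝ} (hδ : 0 < δ) {w : Fin n → ℂ} (hw : normSq w ≤ δ ^ 2 / 4) :
    cutoff δ w = 1 := by
  refine Real.smoothTransition.one_of_one_le ?_
  have : 4 * normSq w / δ ^ 2 ≤ 1 := by rw [div_le_one (by positivity)]; linarith
  linarith

theorem cutoff_eq_zero {δ : ℝ} (hδ : 0 < δ) {w : Fin n → ℂ} (hw : δ ^ 2 / 2 ≤ normSq w) :
    cutoff δ w = 0 := by
  refine Real.smoothTransition.zero_of_nonpos ?_
  have : 2 ≤ 4 * normSq w / δ ^ 2 := by rw [le_div_iff₀ (by positivity)]; linarith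
  linarith

/-- A quadratic bound is preferred to an indicator function: under a Gaussian of rate `m` a factor
`|w|²` is worth `1 / m`. -/
theorem one_sub_cutoff_le {δ : ℝ} (hδ : 0 < δ) (w : Fin n → ℂ) :
    1 - cutoff δ w ≤ 4 * normSq w / δ ^ 2 := by
  have hN := normSq_nonneg w
  rcases le_or_gt (normSq w) (δ ^ 2 / 4) with h | h
  · rw [cutoff_eq_one hδ h, sub_self]; positivity
  · refine (sub_le_self 1 (cutoff_nonneg δ w)).trans ?_
    rw [le_div_iff₀ (by positivity)]; linarith

theorem cutoff_smul (δ : ℝ) {c : ℂ} (hc : ‖c‖ = 1) (w : Fin n → ℂ) :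
    cutoff δ (c • w) = cutoff δ w := by simp [cutoff, normSq_smul, hc]

theorem continuous_dzbar_cutoff (δ : ℝ) (p : Fin n) :
    Continuous fun w : Fin n → ℂ => dzbar p (fun w => (cutoff δ w : ℂ)) w := by
  have h : ContDiff ℝ 1 fun w : Fin n → ℂ => (cutoff δ w : ℂ) :=
    Complex.ofRealCLM.contDiff.comp (contDiff_cutoff δ (k := 1))
  have hc := h.continuous_fderiv one_ne_zero
  unfold dzbar
  fun_prop

theorem dzbar_cutoff_eq_zero {δ : ℝ} (hδ : 0 < δ) {w : Fin n → ℂ} (hw : δ ^ 2 / 2 < normSq w)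
    (p : Fin n) : dzbar p (fun w => (cutoff δ w : ℂ)) w = 0 := by
  have h : (fun w : Fin n → ℂ => (cutoff δ w : ℂ)) =ᶠ[𝓝 w] fun _ => 0 := by
    filter_upwards [(isOpen_lt continuous_const continuous_normSq).mem_nhds hw] with y hy
    rw [cutoff_eq_zero hδ (le_of_lt hy)]; simp
  simp [dzbar, h.fderiv_eq]

theorem exists_dzbar_cutoff_le (n : ℕ) {δ : ℝ} (hδ : 0 < δ) : ∃ C, 0 ≤ C ∧ ∀ (p : Fin n) w,
    ‖dzbar p (fun w : Fin n → ℂ => (cutoff δ w : ℂ)) w‖ ≤ C := by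
  have h : ∀ p : Fin n, ∃ C, ∀ w, ‖dzbar p (fun w : Fin n → ℂ => (cutoff δ w : ℂ)) w‖ ≤ C :=
    fun p => (hasCompactSupport_of_eq_zero
      (fun w hw => dzbar_cutoff_eq_zero hδ hw p)).exists_bound_of_continuous
        (continuous_dzbar_cutoff δ p)
  choose C hC using h
  have hC0 : ∀ p, 0 ≤ C p := fun p => (norm_nonneg _).trans (hC p 0)
  exact ⟨∑ p, C p, Finset.sum_nonneg fun p _ => hC0 p, fun p w => (hC p w).trans
    (Finset.single_le_sum (fun p _ => hC0 p) (Finset.mem_univ p))⟩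

/-- The coefficients `½ ∑ h_{pkl} w̄_k w̄_l` of a cubic form of type `(1, 2)`. -/
def cubicCoeff (h : Fin n → Fin n → Fin n → ℂ) (p : Fin n) (w : Fin n → ℂ) : ℂ :=
  1 / 2 * ∑ k, ∑ l, h p k l * (conj (w k) * conj (w l))

/-- The trace `∑ h_{ppl} w̄_l`. -/
def cubicTrace (h : Fin n → Fin n → Fin n → ℂ) (w : Fin n → ℂ) : ℂ :=
  ∑ p, ∑ l, h p p l * conj (w l)

theorem contDiff_cubicCoeff (h : Fin n → Fin n → Fin n → ℂ) (p : Fin n) {k : ℕ∞ω} :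
    ContDiff ℝ k (cubicCoeff h p) := by
  have hc : ∀ k' : Fin n, ContDiff ℝ k fun w : Fin n → ℂ => conj (w k') := fun k' =>
    Complex.conjCLE.contDiff.comp (contDiff_apply ℝ ℂ k')
  unfold cubicCoeff
  exact contDiff_const.mul (ContDiff.sum fun k' _ => ContDiff.sum fun l _ =>
    contDiff_const.mul ((hc k').mul (hc l)))

@[fun_prop]
theorem continuous_cubicCoeff (h : Fin n → Fin n → Fin n → ℂ) (p : Fin n) :
    Continuous (cubicCoeff h p) := (contDiff_cubicCoeff h p (k := 0)).continuous

@[fun_prop]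
theorem continuous_cubicTrace (h : Fin n → Fin n → Fin n → ℂ) : Continuous (cubicTrace h) := by
  unfold cubicTrace
  have hc : ∀ k : Fin n, Continuous fun w : Fin n → ℂ => conj (w k) := fun k =>
    Complex.continuous_conj.comp (continuous_apply k)
  fun_prop

theorem norm_cubicCoeff_le {h : Fin n → Fin n → Fin n → ℂ} {M : ℝ}
    (hM : ∀ p k l, ‖h p k l‖ ≤ M) (p : Fin n) (w : Fin n → ℂ) :
    ‖cubicCoeff h p w‖ ≤ n ^ 2 * M * normSq w := by
  have hN := normSq_nonneg w
  have hM0 : 0 ≤ M := (norm_nonneg _).trans (hM p p p)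
  have h1 : ∀ k l, ‖h p k l * (conj (w k) * conj (w l))‖ ≤ M * normSq w := fun k l => by
    rw [norm_mul, norm_mul, RCLike.norm_conj, RCLike.norm_conj]
    refine mul_le_mul (hM p k l) ?_ (by positivity) hM0
    have := mul_le_mul (norm_apply_le_sqrt_normSq w k) (norm_apply_le_sqrt_normSq w l)
      (norm_nonneg _) (Real.sqrt_nonneg _)
    rwa [Real.mul_self_sqrt hN] at this
  have h2 : ‖∑ k, ∑ l, h p k l * (conj (w k) * conj (w l))‖ ≤ n * (n * (M * normSq w)) := by
    refine (norm_sum_le_of_le _ fun k _ => norm_sum_le_of_le _ fun l _ => h1 k l).trans_eq ?_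
    simp
  rw [cubicCoeff, norm_mul]
  have : ‖(1 / 2 : ℂ)‖ ≤ 1 := by norm_num
  calc _ ≤ 1 * (n * (n * (M * normSq w))) := mul_le_mul this h2 (norm_nonneg _) zero_le_one
    _ = _ := by ring

theorem norm_cubicTrace_le {h : Fin n → Fin n → Fin n → ℂ} {M : ℝ}
    (hM : ∀ p k l, ‖h p k l‖ ≤ M) (w : Fin n → ℂ) :
    ‖cubicTrace h w‖ ≤ n ^ 2 * M * √(normSq w) := by
  have h1 : ∀ p l, ‖h p p l * conj (w l)‖ ≤ M * √(normSq w) := fun p l => by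
    rw [norm_mul, RCLike.norm_conj]
    exact mul_le_mul (hM p p l) (norm_apply_le_sqrt_normSq w l) (norm_nonneg _)
      ((norm_nonneg _).trans (hM p p l))
  refine (norm_sum_le_of_le _ fun k _ => norm_sum_le_of_le _ fun l _ => h1 k l).trans_eq ?_
  simp
  ring

theorem dzbar_cubicCoeff {h : Fin n → Fin n → Fin n → ℂ} (p : Fin n) (w : Fin n → ℂ) :
    dzbar p (cubicCoeff h p) w =
      1 / 2 * (∑ l, h p p l * conj (w l) + ∑ k, h p k p * conj (w k)) := by
  have hd : ∀ k l : Fin n, DifferentiableAt ℝ (fun w : Fin n → ℂ => conj (w k) * conj (w l)) w :=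
    fun k l => (differentiableAt_conj_apply k w).mul (differentiableAt_conj_apply l w)
  have hd2 : ∀ k l : Fin n,
      DifferentiableAt ℝ (fun w : Fin n → ℂ => h p k l * (conj (w k) * conj (w l))) w :=
    fun k l => (differentiableAt_const _).mul (hd k l)
  have hd3 : ∀ k : Fin n,
      DifferentiableAt ℝ (fun w : Fin n → ℂ => ∑ l, h p k l * (conj (w k) * conj (w l))) w :=
    fun k => DifferentiableAt.fun_sum fun l _ => hd2 k l
  have hterm : ∀ k l : Fin n, dzbar p (fun w : Fin n → ℂ => h p k l * (conj (w k) * conj (w l))) w =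
      (if p = k then h p k l * conj (w l) else 0) + (if p = l then h p k l * conj (w k) else 0) := by
    intro k l
    rw [dzbar_mul (differentiableAt_const _) (hd k l), dzbar_mul (differentiableAt_conj_apply k w)
      (differentiableAt_conj_apply l w), dzbar_conj_apply, dzbar_conj_apply,
      dzbar_of_differentiableAt (differentiableAt_const _)]
    split_ifs <;> ring
  unfold cubicCoeff
  rw [dzbar_mul (differentiableAt_const _) (DifferentiableAt.fun_sum fun k _ => hd3 k),
    dzbar_of_differentiableAt (differentiableAt_const _), dzbar_sum _ fun k _ => hd3 k]
  simp_rw [fun k => dzbar_sum Finset.univ (fun l _ => hd2 k l) p, hterm, Finset.sum_add_distrib]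
  rw [zero_mul, zero_add]
  congr 2
  · rw [Finset.sum_comm]; simp
  · simp

/-- Symmetry in the last two indices makes the two sums produced by the product rule equal, which
cancels the factor `1 / 2`. -/
theorem sum_dzbar_cubicCoeff {h : Fin n → Fin n → Fin n → ℂ} (hsymm : ∀ p k l, h p k l = h p l k)
    (w : Fin n → ℂ) : ∑ p, dzbar p (cubicCoeff h p) w = cubicTrace h w := by
  refine Finset.sum_congr rfl fun p _ => ?_
  rw [dzbar_cubicCoeff]
  simp_rw [fun k => hsymm p k p]
  ring

/-- The type `(1, 2)` terms are exact up to the derivative of the cut-off function. -/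
theorem integral_cubic {δ : ℝ} (hδ : 0 < δ) (m : ℝ) {f : (Fin n → ℂ) → ℂ}
    (hf : DifferentiableOn ℂ f {w | normSq w < δ ^ 2}) {h : Fin n → Fin n → Fin n → ℂ}
    (hsymm : ∀ p k l, h p k l = h p l k) :
    ∫ w, f w * (cutoff δ w * (Complex.exp (-m * normSq w) *
      (cubicTrace h w - m * ∑ p, w p * cubicCoeff h p w))) =
    -∫ w, f w * ∑ p, dzbar p (fun w => (cutoff δ w : ℂ)) w *
      (cubicCoeff h p w * Complex.exp (-m * normSq w)) := by
  have hδ2 : δ ^ 2 / 2 < δ ^ 2 := by have : 0 < δ ^ 2 := by positivity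
                                     linarith
  have hexp : ∀ {k : ℕ∞ω}, ContDiff ℝ k fun w : Fin n → ℂ => Complex.exp (-m * normSq w) :=
    (contDiff_const.mul (Complex.ofRealCLM.contDiff.comp contDiff_normSq)).cexp
  have hχ : ContDiff ℝ 1 fun w : Fin n → ℂ => (cutoff δ w : ℂ) :=
    Complex.ofRealCLM.contDiff.comp (contDiff_cutoff δ (k := 1))
  have hexpc : Continuous fun w : Fin n → ℂ => Complex.exp (-m * normSq w) :=
    (hexp (k := 0)).continuous
  -- The field `K_p = χ b_p e^{-m|w|²}`, with `b_p` the cubic coefficients. Its `∂̄`-divergence is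
  -- the weight on the left side plus terms in which the derivative falls on `χ`; multiplication by
  -- the holomorphic `f` adds nothing, so the integral of the total divergence is zero.
  let K : Fin n → (Fin n → ℂ) → ℂ := fun p w =>
    cutoff δ w * (cubicCoeff h p w * Complex.exp (-m * normSq w))
  have hK : ∀ p, ContDiff ℝ 1 (K p) := fun p => hχ.mul ((contDiff_cubicCoeff h p).mul hexp)
  have hK0 : ∀ p w, δ ^ 2 / 2 < normSq w → K p w = 0 := fun p w hw => by
    simp [K, cutoff_eq_zero hδ hw.le]
  have hFc : ∀ p, ContDiff ℝ 1 fun w => f w * K p w := fun p => by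
    rw [contDiff_iff_contDiffAt]
    intro w
    rcases lt_or_ge (normSq w) (δ ^ 2) with hw | hw
    · exact (((SeveralVariables.contDiffOn (isOpen_normSq_lt _) hf).contDiffAt
        ((isOpen_normSq_lt _).mem_nhds hw)).restrict_scalars ℝ).mul (hK p).contDiffAt
    · refine (contDiffAt_const (c := (0 : ℂ))).congr_of_eventuallyEq ?_
      filter_upwards [(isOpen_lt continuous_const continuous_normSq).mem_nhds
        (show δ ^ 2 / 2 < normSq w by linarith)] with y hy
      rw [hK0 p y hy, mul_zero]
  have hF0 : ∀ p w, δ ^ 2 / 2 < normSq w → f w * K p w = 0 := fun p w hw => by rw [hK0 p w hw, mul_zero]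
  have hz := fun p => integral_dzbar_eq_zero (hFc p) (hasCompactSupport_of_eq_zero (hF0 p)) p
  have hdz : ∀ p w, dzbar p (fun w => f w * K p w) w =
      f w * (dzbar p (fun w => (cutoff δ w : ℂ)) w *
        (cubicCoeff h p w * Complex.exp (-m * normSq w))) +
      f w * (cutoff δ w * (Complex.exp (-m * normSq w) *
        (dzbar p (cubicCoeff h p) w - m * (w p * cubicCoeff h p w)))) := by
    intro p w
    have hb := (contDiff_cubicCoeff h p (k := 1)).differentiable one_ne_zero w
    have he := (hexp (k := 1)).differentiable one_ne_zero w
    rcases lt_or_ge (normSq w) (δ ^ 2) with hw | hw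
    · have hfd := hf.differentiableAt ((isOpen_normSq_lt _).mem_nhds hw)
      rw [dzbar_mul (hfd.restrictScalars ℝ) ((hK p).differentiable one_ne_zero w),
        dzbar_of_differentiableAt hfd, dzbar_mul (hχ.differentiable one_ne_zero w) (hb.fun_mul he),
        dzbar_mul hb he, dzbar_exp_neg_mul_normSq]
      ring
    · have h0 : (fun w => f w * K p w) =ᶠ[𝓝 w] fun _ => 0 := by
        filter_upwards [(isOpen_lt continuous_const continuous_normSq).mem_nhds
          (show δ ^ 2 / 2 < normSq w by linarith)] with y hy
        exact hF0 p y hy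
      rw [dzbar_cutoff_eq_zero hδ (by linarith), cutoff_eq_zero hδ (by linarith)]
      simp [dzbar, h0.fderiv_eq]
  have hc1 : ∀ p, Continuous fun w => f w * (dzbar p (fun w => (cutoff δ w : ℂ)) w *
        (cubicCoeff h p w * Complex.exp (-m * normSq w))) := fun p =>
    continuous_mul_of_eq_zero hδ2 hf.continuousOn
      ((continuous_dzbar_cutoff δ p).mul ((continuous_cubicCoeff h p).mul hexpc))
      fun w hw => by rw [dzbar_cutoff_eq_zero hδ hw]; simp
  have hi1 : ∀ p, Integrable fun w => f w * (dzbar p (fun w => (cutoff δ w : ℂ)) w *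
        (cubicCoeff h p w * Complex.exp (-m * normSq w))) := fun p =>
    (hc1 p).integrable_of_hasCompactSupport (hasCompactSupport_of_eq_zero (r' := δ ^ 2 / 2)
      fun w hw => by rw [dzbar_cutoff_eq_zero hδ hw]; simp)
  have hi : ∀ p, Integrable fun w => dzbar p (fun w => f w * K p w) w := fun p => by
    have hcf := (hFc p).continuous_fderiv one_ne_zero
    have hcs : HasCompactSupport (fderiv ℝ fun w => f w * K p w) :=
      (hasCompactSupport_of_eq_zero (hF0 p)).fderiv ℝ
    have hv : ∀ v, Integrable fun w => fderiv ℝ (fun w => f w * K p w) w v := fun v =>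
      (hcf.clm_apply continuous_const).integrable_of_hasCompactSupport
        ((hasCompactSupport_of_eq_zero (hF0 p)).fderiv_apply ℝ v)
    exact ((hv _).add ((hv _).const_mul _)).div_const 2
  have hi2 : ∀ p, Integrable fun w => f w * (cutoff δ w * (Complex.exp (-m * normSq w) *
        (dzbar p (cubicCoeff h p) w - m * (w p * cubicCoeff h p w)))) := fun p => by
    refine ((hi p).sub (hi1 p)).congr (Eventually.of_forall fun w => ?_)
    simp only [Pi.sub_apply, hdz p w]
    ring
  have hsplit : ∀ p, ∫ w, f w * (cutoff δ w * (Complex.exp (-m * normSq w) *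
        (dzbar p (cubicCoeff h p) w - m * (w p * cubicCoeff h p w)))) =
      -∫ w, f w * (dzbar p (fun w => (cutoff δ w : ℂ)) w *
        (cubicCoeff h p w * Complex.exp (-m * normSq w))) := fun p => by
    have := hz p
    simp_rw [hdz p] at this
    rw [integral_add (hi1 p) (hi2 p)] at this
    rw [eq_neg_iff_add_eq_zero, add_comm, this]
  simp_rw [← sum_dzbar_cubicCoeff hsymm, Finset.mul_sum, ← Finset.sum_sub_distrib, Finset.mul_sum]
  rw [integral_finsetSum _ fun p _ => hi2 p, integral_finsetSum _ fun p _ => hi1 p,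
    ← Finset.sum_neg_distrib]
  exact Finset.sum_congr rfl fun p _ => hsplit p

/-- Powers of `t = m|w|²` are traded for `exp(t / 8)`. The error terms use this factor at most
twice, so at least `3/4` of the Gaussian exponent survives. -/
theorem pow_le_mul_exp {t : ℝ} (ht : 0 ≤ t) (k : ℕ) :
    t ^ k ≤ k.factorial * 8 ^ k * Real.exp (t / 8) := by
  have h := Real.pow_div_factorial_le_exp (t / 8) (by positivity) k
  rw [div_le_iff₀ (by positivity), div_pow, div_le_iff₀ (by positivity)] at h
  linarith

/-- The error of the expansion of `exp (-x) J` to first order. -/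
theorem norm_exp_mul_sub_le {M m r : ℝ} (hM : 0 ≤ M) (hm : 0 < m) (hr : 0 ≤ r) (hr1 : r ≤ 1)
    {x x₀ J j₀ : ℂ} (h1 : ‖x - x₀‖ ≤ m * M * r ^ 4) (h2 : ‖x₀‖ ≤ m * M * r ^ 3)
    (h3 : ‖x‖ ≤ m * r ^ 2 / 8) (h4 : ‖J - 1 - j₀‖ ≤ M * r ^ 2) (h5 : ‖j₀‖ ≤ M * r) :
    ‖Complex.exp (-x) * J - (1 - x₀ + j₀)‖ ≤
      (12288 * M ^ 2 * (1 + 2 * M) + 136 * M + 512 * M ^ 2) / m * Real.exp (m * r ^ 2 / 4) := by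
  set t := m * r ^ 2 with ht
  have ht0 : 0 ≤ t := by positivity
  have hx : ‖x‖ ≤ 2 * m * M * r ^ 3 := by
    have : m * M * r ^ 4 ≤ m * M * r ^ 3 :=
      mul_le_mul_of_nonneg_left (pow_le_pow_of_le_one hr hr1 (by norm_num)) (by positivity)
    calc ‖x‖ = ‖(x - x₀) + x₀‖ := by ring_nf
      _ ≤ _ := (norm_add_le _ _).trans (by linarith)
  have hJ1 : ‖J - 1‖ ≤ 2 * M * r := by
    have : M * r ^ 2 ≤ M * r := mul_le_mul_of_nonneg_left (by nlinarith) hM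
    calc ‖J - 1‖ = ‖(J - 1 - j₀) + j₀‖ := by ring_nf
      _ ≤ _ := (norm_add_le _ _).trans (by linarith)
  have hJ : ‖J‖ ≤ 1 + 2 * M := by
    calc ‖J‖ = ‖1 + (J - 1)‖ := by ring_nf
      _ ≤ ‖(1 : ℂ)‖ + ‖J - 1‖ := norm_add_le _ _
      _ ≤ _ := by rw [norm_one]; nlinarith
  have he : ‖Complex.exp (-x) - 1 + x‖ ≤ (2 * m * M * r ^ 3) ^ 2 * Real.exp (t / 8) := by
    have := Complex.norm_exp_sub_sum_le_norm_mul_exp (-x) 2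
    simp only [Finset.sum_range_succ, Finset.sum_range_zero, norm_neg] at this
    simp only [pow_zero, Nat.factorial, Nat.cast_one, div_one, pow_one, zero_add] at this
    rw [show Complex.exp (-x) - 1 + x = Complex.exp (-x) - (1 + -x / ((0 + 1 : ℕ) * 1 : ℕ)) by
      push_cast; ring]
    refine this.trans ?_
    gcongr
  have e1 := pow_le_mul_exp ht0 1
  have e2 := pow_le_mul_exp ht0 2
  have e3 := pow_le_mul_exp ht0 3
  norm_num [Nat.factorial] at e1 e2 e3
  have hE1 : 1 ≤ Real.exp (t / 8) := Real.one_le_exp (by positivity)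
  have hE2 : Real.exp (t / 4) = Real.exp (t / 8) * Real.exp (t / 8) := by
    rw [← Real.exp_add]; ring_nf
  set X := Real.exp (t / 8) with hX
  have hXX : X ≤ X * X := by nlinarith
  have hr2 : r ^ 2 = t / m := by rw [ht]; field_simp
  -- The four terms are the quadratic remainder of the exponential, the remainders of `J` and `x`,
  -- and the product of the two first-order terms. With `r² = t / m` each is at most a polynomial in
  -- `t`, possibly times `exp(t / 8)`, divided by `m`. The numbers `8`, `128`, `3072` are `k! 8^k`
  -- for `k = 1, 2, 3`.
  calc ‖Complex.exp (-x) * J - (1 - x₀ + j₀)‖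
      = ‖(Complex.exp (-x) - 1 + x) * J + (J - 1 - j₀) + (x₀ - x) - x * (J - 1)‖ := by ring_nf
    _ ≤ ‖Complex.exp (-x) - 1 + x‖ * ‖J‖ + ‖J - 1 - j₀‖ + ‖x₀ - x‖ + ‖x‖ * ‖J - 1‖ := by
        rw [← norm_mul, ← norm_mul]
        exact (norm_sub_le _ _).trans (add_le_add_left ((norm_add_le _ _).trans
          (add_le_add_left (norm_add_le _ _) _)) _)
    _ ≤ (2 * m * M * r ^ 3) ^ 2 * X * (1 + 2 * M) + M * r ^ 2 + m * M * r ^ 4 +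
          (2 * m * M * r ^ 3) * (2 * M * r) := by
        rw [norm_sub_rev x₀ x]
        gcongr
    _ = (4 * M ^ 2 * (1 + 2 * M) * t ^ 3 * X + M * t + M * t ^ 2 + 4 * M ^ 2 * t ^ 2) / m := by
        rw [show (2 * m * M * r ^ 3) ^ 2 = 4 * m ^ 2 * M ^ 2 * (r ^ 2) ^ 3 by ring,
          show m * M * r ^ 4 = m * M * (r ^ 2) ^ 2 by ring,
          show (2 * m * M * r ^ 3) * (2 * M * r) = 4 * m * M ^ 2 * (r ^ 2) ^ 2 by ring, hr2]
        field_simp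
    _ ≤ (4 * M ^ 2 * (1 + 2 * M) * (3072 * X) * X + M * (8 * (X * X)) + M * (128 * (X * X)) +
          4 * M ^ 2 * (128 * (X * X))) / m := by
        have a1 : t ≤ 8 * (X * X) := by linarith
        have a2 : t ^ 2 ≤ 128 * (X * X) := by linarith
        gcongr
    _ = _ := by rw [hE2]; ring

end Gaussian

end

/-! ### Reproducing property of approximate Gaussians -/

noncomputable section

namespace Gaussian

open Metric Filter Topology

variable {n : ℕ}

/-- The weights that occur in the reproducing property of approximate Gaussians: `D` is a
potential and `J` a density on the ball of radius `δ`, which are given in terms of forms `a`, `α` of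
types `(2, 1)` and `(1, 0)` and a tensor `h` of type `(1, 2)`, up to errors of order `4` and `2`. -/
structure IsApproxGaussian (M δ : ℝ) (D J a α : (Fin n → ℂ) → ℂ)
    (h : Fin n → Fin n → Fin n → ℂ) : Prop where
  continuousOn_potential : ContinuousOn D {w | normSq w < δ ^ 2}
  continuousOn_density : ContinuousOn J {w | normSq w < δ ^ 2}
  continuous_cubic : Continuous a
  continuous_linear : Continuous α
  cubic_smul : ∀ c : ℂ, ‖c‖ = 1 → ∀ w, a (c • w) = c * a w
  linear_smul : ∀ c : ℂ, ‖c‖ = 1 → ∀ w, α (c • w) = c * α w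
  symm : ∀ p k l, h p k l = h p l k
  norm_cubic_le : ∀ w, ‖a w‖ ≤ M * √(normSq w) ^ 3
  norm_linear_le : ∀ w, ‖α w‖ ≤ M * √(normSq w)
  norm_tensor_le : ∀ p k l, ‖h p k l‖ ≤ M
  norm_potential_sub_le : ∀ w, normSq w < δ ^ 2 →
    ‖D w - (normSq w + (a w + ∑ p, w p * cubicCoeff h p w))‖ ≤ M * √(normSq w) ^ 4
  norm_density_sub_le : ∀ w, normSq w < δ ^ 2 →
    ‖J w - 1 - (α w + cubicTrace h w)‖ ≤ M * √(normSq w) ^ 2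
  norm_potential_le : ∀ w, normSq w < δ ^ 2 → ‖D w - normSq w‖ ≤ normSq w / 8

/-- All error weights are brought to this one form: support in `|w|² ≤ δ² / 2` and three quarters of
the Gaussian decay. -/
theorem norm_integral_mul_le {f g : (Fin n → ℂ) → ℂ} {δ C m : ℝ} (hδ : 0 < δ)
    (hf : ContinuousOn f {w | normSq w < δ ^ 2})
    (hg0 : ∀ w, δ ^ 2 / 2 < normSq w → g w = 0)
    (hg : ∀ w, normSq w ≤ δ ^ 2 / 2 → ‖g w‖ ≤ C * Real.exp (-(3 / 4 * m) * normSq w)) :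
    ‖∫ w, f w * g w‖ ≤ C * ∫ w in {w | normSq w ≤ δ ^ 2 / 2},
      ‖f w‖ * Real.exp (-(3 / 4 * m) * normSq w) := by
  have hδ2 : δ ^ 2 / 2 < δ ^ 2 := by have : 0 < δ ^ 2 := by positivity
                                     linarith
  have hcomp := isCompact_normSq_le (n := n) (δ ^ 2 / 2)
  have hcont : ContinuousOn (fun w => ‖f w‖ * Real.exp (-(3 / 4 * m) * normSq w))
      {w : Fin n → ℂ | normSq w ≤ δ ^ 2 / 2} :=
    (hf.mono fun w (hw : normSq w ≤ _) => show normSq w < _ by linarith).norm.mul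
      (by fun_prop)
  rw [← integral_const_mul, ← integral_indicator hcomp.isClosed.measurableSet]
  refine norm_integral_le_of_norm_le ?_ (Eventually.of_forall fun w => ?_)
  · rw [integrable_indicator_iff hcomp.isClosed.measurableSet]
    exact (hcont.integrableOn_compact hcomp).const_mul C
  · by_cases hw : normSq w ≤ δ ^ 2 / 2
    · rw [indicator_of_mem (show w ∈ {w | normSq w ≤ δ ^ 2 / 2} from hw), norm_mul]
      calc ‖f w‖ * ‖g w‖ ≤ ‖f w‖ * (C * Real.exp (-(3 / 4 * m) * normSq w)) := by
            gcongr; exact hg w hw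
        _ = _ := by ring
    · rw [indicator_of_notMem (show w ∉ {w | normSq w ≤ δ ^ 2 / 2} from hw),
        hg0 w (by simpa using hw)]
      simp

/-- The full Gaussian integral is `(π / m)^n`. The cut-off changes the integrand by at most `4|w|² /
δ²` times the Gaussian; half of the exponent absorbs `|w|²` at the price `2 / m`, and the remaining
Gaussian of rate `m / 2` costs `2^n`. -/
theorem exists_norm_integral_cutoff_sub_le (n : ℕ) {δ : ℝ} (hδ : 0 < δ) : ∃ C, 0 ≤ C ∧
    ∀ m : ℝ, 0 < m → ‖(∫ w : Fin n → ℂ, (cutoff δ w : ℂ) * Complex.exp (-m * normSq w)) -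
      ((Real.pi / m) ^ n : ℝ)‖ ≤ C / m * (Real.pi / m) ^ n := by
  refine ⟨2 ^ n * (8 / δ ^ 2), by positivity, fun m hm => ?_⟩
  have hχ : (fun w : Fin n → ℂ => (cutoff δ w : ℂ) * Complex.exp (-m * normSq w)) =
      fun w => ((cutoff δ w * Real.exp (-m * normSq w) : ℝ) : ℂ) := by
    ext w; push_cast; rfl
  have hi := integrable_exp_neg_mul_normSq (n := n) hm
  have hi2 := integrable_exp_neg_mul_normSq (n := n) (half_pos hm)
  have hiχ : Integrable fun w : Fin n → ℂ => cutoff δ w * Real.exp (-m * normSq w) := by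
    refine hi.mono' (by fun_prop) (Eventually.of_forall fun w => ?_)
    rw [Real.norm_of_nonneg (mul_nonneg (cutoff_nonneg δ w) (Real.exp_pos _).le)]
    exact mul_le_of_le_one_left (Real.exp_pos _).le (cutoff_le_one δ w)
  rw [hχ, integral_complex_ofReal, ← Complex.ofReal_sub, Complex.norm_real,
    ← integral_exp_neg_mul_normSq hm, ← integral_sub hiχ hi]
  have hb : ∀ w : Fin n → ℂ, ‖cutoff δ w * Real.exp (-m * normSq w) - Real.exp (-m * normSq w)‖ ≤
      8 / δ ^ 2 / m * Real.exp (-(m / 2) * normSq w) := by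
    intro w
    have hN := normSq_nonneg w
    rw [norm_sub_rev, ← one_sub_mul, Real.norm_of_nonneg (mul_nonneg
      (sub_nonneg.2 (cutoff_le_one δ w)) (Real.exp_pos _).le)]
    have h1 : m / 2 * normSq w ≤ Real.exp (m / 2 * normSq w) :=
      (by linarith [Real.add_one_le_exp (m / 2 * normSq w)])
    have h2 : normSq w ≤ 2 / m * Real.exp (m / 2 * normSq w) := by
      rw [div_mul_eq_mul_div, le_div_iff₀ hm]; linarith
    calc (1 - cutoff δ w) * Real.exp (-m * normSq w)
        ≤ 4 * (2 / m * Real.exp (m / 2 * normSq w)) / δ ^ 2 * Real.exp (-m * normSq w) := by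
          refine mul_le_mul_of_nonneg_right ((one_sub_cutoff_le hδ w).trans ?_) (Real.exp_pos _).le
          gcongr
      _ = 8 / δ ^ 2 / m * (Real.exp (m / 2 * normSq w) * Real.exp (-m * normSq w)) := by
          field_simp; ring
      _ = _ := by rw [← Real.exp_add]; ring_nf
  refine (norm_integral_le_of_norm_le (hi2.const_mul _) (Eventually.of_forall hb)).trans_eq ?_
  rw [integral_const_mul, integral_exp_neg_mul_normSq (half_pos hm),
    integral_exp_neg_mul_normSq hm]
  rw [show Real.pi / (m / 2) = 2 * (Real.pi / m) by field_simp, mul_pow]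
  ring

/-- Approximate Gaussians reproduce the values of holomorphic functions up to an error which is
smaller by a factor `1 / m`. -/
theorem exists_norm_integral_sub_le (n : ℕ) {M δ : ℝ} (hM : 0 ≤ M) (hδ : 0 < δ) (hδ1 : δ ≤ 1) :
    ∃ C, 0 ≤ C ∧ ∀ m : ℝ, 0 < m → ∀ (f D J a α : (Fin n → ℂ) → ℂ)
      (h : Fin n → Fin n → Fin n → ℂ), DifferentiableOn ℂ f {w | normSq w < δ ^ 2} →
      IsApproxGaussian M δ D J a α h →
      ‖(∫ w, f w * (cutoff δ w * (Complex.exp (-(m * D w)) * J w))) -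
          ((Real.pi / m) ^ n : ℝ) * f 0‖ ≤
        C / m * (∫ w in {w | normSq w ≤ δ ^ 2 / 2},
          ‖f w‖ * Real.exp (-(3 / 4 * m) * normSq w)) +
        C / m * (Real.pi / m) ^ n * ‖f 0‖ := by
  obtain ⟨C₀, hC₀, H₀⟩ := exists_norm_integral_cutoff_sub_le n hδ
  obtain ⟨C₁, hC₁, H₁⟩ := exists_dzbar_cutoff_le n hδ
  -- A common bound for the combined terms: the (1, 2) cubic form is at most `n³ M |w|³` and the
  -- trace at most `n² M |w|`, in addition to the bounds `M` for the other forms.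
  set M₁ : ℝ := (1 + n ^ 3 + n ^ 2) * M with hM₁
  have hM₁0 : 0 ≤ M₁ := by positivity
  set C₂ : ℝ := 12288 * M₁ ^ 2 * (1 + 2 * M₁) + 136 * M₁ + 512 * M₁ ^ 2 with hC₂
  have hC₂0 : 0 ≤ C₂ := by positivity
  set C₃ : ℝ := n * (C₁ * (n ^ 2 * M * 8)) with hC₃
  have hC₃0 : 0 ≤ C₃ := by positivity
  refine ⟨C₀ + C₂ + C₃, by positivity, fun m hm f D J a α h hf hG => ?_⟩
  have hδ2 : δ ^ 2 / 2 < δ ^ 2 := by have : 0 < δ ^ 2 := by positivity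
                                     linarith
  set e : (Fin n → ℂ) → ℂ := fun w => Complex.exp (-m * normSq w) with he
  have hec : Continuous e := by simp only [he]; fun_prop
  have henorm : ∀ w, ‖e w‖ = Real.exp (-m * normSq w) := fun w => by
    rw [he]; simp only []; rw [Complex.norm_exp]; simp
  set b : (Fin n → ℂ) → ℂ := fun w => ∑ p, w p * cubicCoeff h p w with hb
  have hbc : Continuous b := by simp only [hb]; fun_prop
  have hχ0 : ∀ w : Fin n → ℂ, δ ^ 2 / 2 < normSq w → (cutoff δ w : ℂ) = 0 := fun w hw => by
    rw [cutoff_eq_zero hδ hw.le]; simp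
  have hac := hG.continuous_cubic
  have hαc := hG.continuous_linear
  have hχc : Continuous fun w : Fin n → ℂ => (cutoff δ w : ℂ) := by fun_prop
  -- The integrand splits by type. `T0` is the Gaussian and gives the main term; `T1` and `T2` carry
  -- the forms of types (1, 0) and (2, 1), which have weight one under the circle and integrate to
  -- zero; `T3` joins the types (0, 1) and (1, 2) into a divergence; the remainder `R` is already
  -- smaller by `1 / m`.
  set T : (Fin n → ℂ) → ℂ := fun w => f w * (cutoff δ w * (Complex.exp (-(m * D w)) * J w)) with hT
  set T0 : (Fin n → ℂ) → ℂ := fun w => f w * (cutoff δ w * e w) with hT0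
  set T1 : (Fin n → ℂ) → ℂ := fun w => f w * (cutoff δ w * (e w * α w)) with hT1
  set T2 : (Fin n → ℂ) → ℂ := fun w => f w * (cutoff δ w * (e w * a w)) with hT2
  set T3 : (Fin n → ℂ) → ℂ := fun w => f w * (cutoff δ w * (e w * (cubicTrace h w - m * b w)))
    with hT3
  set R : (Fin n → ℂ) → ℂ := fun w => cutoff δ w * (Complex.exp (-(m * D w)) * J w -
    e w * (1 - m * (a w + b w) + (α w + cubicTrace h w))) with hR
  have hint : ∀ k : (Fin n → ℂ) → ℂ, Continuous k → Integrable fun w => f w * (cutoff δ w * k w) :=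
    fun k hk => (continuous_mul_of_eq_zero (k := fun w => (cutoff δ w : ℂ) * k w) hδ2
      hf.continuousOn (hχc.mul hk)
      fun w hw => by rw [hχ0 w hw, zero_mul]).integrable_of_hasCompactSupport
        (hasCompactSupport_of_eq_zero (r' := δ ^ 2 / 2) fun w hw => by
          rw [hχ0 w hw, zero_mul, mul_zero])
  have hTi : Integrable T := by
    have hcont := continuous_mul_of_eq_zero (r' := δ ^ 2 / 2)
      (f := fun w => f w * (Complex.exp (-(m * D w)) * J w)) hδ2
      (hf.continuousOn.mul (((continuousOn_const.mul hG.continuousOn_potential).neg.cexp).mul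
        hG.continuousOn_density)) hχc hχ0
    refine (hcont.integrable_of_hasCompactSupport (hasCompactSupport_of_eq_zero (r' := δ ^ 2 / 2)
      fun w hw => by rw [hχ0 w hw, mul_zero])).congr (Eventually.of_forall fun w => ?_)
    simp only [hT]; ring
  have hT0i : Integrable T0 := hint e hec
  have hT1i : Integrable T1 := hint _ (hec.mul hαc)
  have hT2i : Integrable T2 := hint _ (hec.mul hac)
  have hT3i : Integrable T3 :=
    hint _ (hec.mul ((continuous_cubicTrace h).sub (continuous_const.mul hbc)))
  have hTsplit : ∀ w, T w = T0 w + T1 w - m * T2 w + T3 w + f w * R w := fun w => by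
    simp only [hT, hT0, hT1, hT2, hT3, hR]; ring
  have hT4i : Integrable fun w => f w * R w := by
    refine ((((hTi.sub hT0i).sub hT1i).add (hT2i.const_mul (m : ℂ))).sub hT3i).congr
      (Eventually.of_forall fun w => ?_)
    simp only [Pi.sub_apply, Pi.add_apply, hTsplit w]; ring
  have hI : ∫ w, T w = (∫ w, T0 w) + (∫ w, T1 w) - m * (∫ w, T2 w) + (∫ w, T3 w) +
      ∫ w, f w * R w := by
    have hTe : T = T0 + T1 - (fun w => m * T2 w) + T3 + fun w => f w * R w := funext hTsplit
    rw [hTe, integral_add' (((hT0i.add hT1i).sub (hT2i.const_mul _)).add hT3i) hT4i,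
      integral_add' ((hT0i.add hT1i).sub (hT2i.const_mul _)) hT3i,
      integral_sub' (hT0i.add hT1i) (hT2i.const_mul _), integral_add' hT0i hT1i, integral_const_mul]
  have hesmul : ∀ c : ℂ, ‖c‖ = 1 → ∀ w, e (c • w) = e w := fun c hc w => by
    simp [he, normSq_smul, hc]
  have hI0 : ∫ w, T0 w = f 0 * ∫ w : Fin n → ℂ, (cutoff δ w : ℂ) * e w := by
    have := integral_mul_of_homogeneous (k := fun w => (cutoff δ w : ℂ) * e w) hδ2 hf
      (hχc.mul hec) (fun w hw => by rw [hχ0 w hw, zero_mul]) 0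
      (fun c hc w => by rw [cutoff_smul δ hc, hesmul c hc]; ring)
    simpa using this
  have hI1 : ∫ w, T1 w = 0 := by
    have := integral_mul_of_homogeneous (k := fun w => (cutoff δ w : ℂ) * (e w * α w)) hδ2 hf
      (hχc.mul (hec.mul hαc)) (fun w hw => by rw [hχ0 w hw, zero_mul]) 1
      (fun c hc w => by rw [cutoff_smul δ hc, hesmul c hc, hG.linear_smul c hc]; ring)
    simpa using this
  have hI2 : ∫ w, T2 w = 0 := by
    have := integral_mul_of_homogeneous (k := fun w => (cutoff δ w : ℂ) * (e w * a w)) hδ2 hf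
      (hχc.mul (hec.mul hac)) (fun w hw => by rw [hχ0 w hw, zero_mul]) 1
      (fun c hc w => by rw [cutoff_smul δ hc, hesmul c hc, hG.cubic_smul c hc]; ring)
    simpa using this
  -- After integration by parts only derivatives of the cut-off remain, multiplied by cubic
  -- coefficients of size `|w|²`; this factor yields the `1 / m`.
  have hI3 : ‖∫ w, T3 w‖ ≤ C₃ / m * ∫ w in {w | normSq w ≤ δ ^ 2 / 2},
      ‖f w‖ * Real.exp (-(3 / 4 * m) * normSq w) := by
    have h3 := integral_cubic hδ m hf hG.symm
    have h3' : ∫ w, T3 w = -∫ w, f w * ∑ p, dzbar p (fun w => (cutoff δ w : ℂ)) w *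
      (cubicCoeff h p w * Complex.exp (-m * normSq w)) := h3
    rw [h3', norm_neg]
    refine norm_integral_mul_le hδ hf.continuousOn (fun w hw => ?_) fun w hw => ?_
    · exact Finset.sum_eq_zero fun p _ => by rw [dzbar_cutoff_eq_zero hδ hw, zero_mul]
    · have hN := normSq_nonneg w
      have ht : normSq w ≤ 8 / m * Real.exp (m * normSq w / 8) := by
        have := pow_le_mul_exp (t := m * normSq w) (by positivity) 1
        norm_num at this
        rw [div_mul_eq_mul_div, le_div_iff₀ hm]; linarith
      have hone : ∀ p, ‖dzbar p (fun w => (cutoff δ w : ℂ)) w *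
          (cubicCoeff h p w * Complex.exp (-m * normSq w))‖ ≤
          C₁ * (n ^ 2 * M * (8 / m * Real.exp (m * normSq w / 8)) *
            Real.exp (-m * normSq w)) := fun p => by
        rw [norm_mul, norm_mul]
        have := henorm w
        simp only [he] at this
        rw [this]
        have h1 := norm_cubicCoeff_le hG.norm_tensor_le p w
        have h2 : n ^ 2 * M * normSq w ≤ n ^ 2 * M * (8 / m * Real.exp (m * normSq w / 8)) := by
          gcongr
        refine mul_le_mul (H₁ p w) (mul_le_mul_of_nonneg_right (h1.trans h2) (Real.exp_pos _).le)
          (by positivity) hC₁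
      refine (norm_sum_le_of_le _ fun p _ => hone p).trans ?_
      rw [Finset.sum_const, Finset.card_univ, Fintype.card_fin, nsmul_eq_mul]
      have hexp : Real.exp (m * normSq w / 8) * Real.exp (-m * normSq w) ≤
          Real.exp (-(3 / 4 * m) * normSq w) := by
        rw [← Real.exp_add]
        refine Real.exp_le_exp.2 ?_
        have : 0 ≤ m * normSq w := by positivity
        linarith
      calc _ = C₃ / m * (Real.exp (m * normSq w / 8) * Real.exp (-m * normSq w)) := by
            rw [hC₃]; ring
        _ ≤ _ := by gcongr
  have hI4 : ‖∫ w, f w * R w‖ ≤ C₂ / m * ∫ w in {w | normSq w ≤ δ ^ 2 / 2},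
      ‖f w‖ * Real.exp (-(3 / 4 * m) * normSq w) := by
    refine norm_integral_mul_le hδ hf.continuousOn (fun w hw => ?_) fun w hw => ?_
    · simp only [hR]; rw [hχ0 w hw, zero_mul]
    · have hN := normSq_nonneg w
      have hwδ : normSq w < δ ^ 2 := by linarith
      set r := √(normSq w) with hr
      have hr0 : 0 ≤ r := Real.sqrt_nonneg _
      have hr2 : r ^ 2 = normSq w := Real.sq_sqrt hN
      have hr1 : r ≤ 1 := by
        refine Real.sqrt_le_one.2 ?_
        nlinarith
      have hbn : ‖b w‖ ≤ n ^ 3 * M * r ^ 3 := by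
        have : ∀ p, ‖w p * cubicCoeff h p w‖ ≤ r * (n ^ 2 * M * normSq w) := fun p => by
          rw [norm_mul]
          exact mul_le_mul (norm_apply_le_sqrt_normSq w p)
            (norm_cubicCoeff_le hG.norm_tensor_le p w) (norm_nonneg _) hr0
        refine (norm_sum_le_of_le _ fun p _ => this p).trans_eq ?_
        rw [Finset.sum_const, Finset.card_univ, Fintype.card_fin, nsmul_eq_mul, ← hr2]
        ring
      have hMM₁ : M ≤ M₁ := by rw [hM₁]; exact le_mul_of_one_le_left hM (by
                                  have : (0 : ℝ) ≤ (n : ℝ) ^ 3 + n ^ 2 := by positivity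
                                  linarith)
      have key := norm_exp_mul_sub_le (M := M₁) (m := m) (r := r) hM₁0 hm hr0 hr1
        (x := m * (D w - normSq w)) (x₀ := m * (a w + b w)) (J := J w)
        (j₀ := α w + cubicTrace h w) ?_ ?_ ?_ ?_ ?_
      · have hR' : R w = cutoff δ w * e w * (Complex.exp (-(m * (D w - normSq w))) * J w -
            (1 - m * (a w + b w) + (α w + cubicTrace h w))) := by
          have : Complex.exp (-(m * D w)) = e w * Complex.exp (-(m * (D w - normSq w))) := by
            simp only [he]; rw [← Complex.exp_add]; ring_nf
          simp only [hR]; rw [this]; ring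
        rw [hR', norm_mul, norm_mul, henorm, Complex.norm_real,
          Real.norm_of_nonneg (cutoff_nonneg δ w)]
        calc cutoff δ w * Real.exp (-m * normSq w) * _
            ≤ 1 * Real.exp (-m * normSq w) * (C₂ / m * Real.exp (m * r ^ 2 / 4)) := by
              gcongr
              exact cutoff_le_one δ w
          _ = C₂ / m * (Real.exp (m * r ^ 2 / 4) * Real.exp (-m * normSq w)) := by ring
          _ = _ := by rw [hr2, ← Real.exp_add]; ring_nf
      · rw [← mul_sub, norm_mul, Complex.norm_real, Real.norm_of_nonneg hm.le, mul_assoc]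
        refine mul_le_mul_of_nonneg_left ?_ hm.le
        rw [sub_sub]
        exact (hG.norm_potential_sub_le w hwδ).trans (by gcongr)
      · rw [norm_mul, Complex.norm_real, Real.norm_of_nonneg hm.le, mul_assoc]
        refine mul_le_mul_of_nonneg_left ?_ hm.le
        refine (norm_add_le _ _).trans ((add_le_add (hG.norm_cubic_le w) hbn).trans ?_)
        rw [← hr, hM₁]
        have : 0 ≤ n ^ 2 * M * r ^ 3 := by positivity
        linarith
      · rw [norm_mul, Complex.norm_real, Real.norm_of_nonneg hm.le, hr2, mul_div_assoc]
        exact mul_le_mul_of_nonneg_left (hG.norm_potential_le w hwδ) hm.le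
      · exact (hG.norm_density_sub_le w hwδ).trans (by gcongr)
      · refine (norm_add_le _ _).trans ((add_le_add (hG.norm_linear_le w)
          (norm_cubicTrace_le hG.norm_tensor_le w)).trans ?_)
        rw [← hr, hM₁]
        have : 0 ≤ n ^ 3 * M * r := by positivity
        linarith
  have hI0' : ‖(∫ w, T0 w) - ((Real.pi / m) ^ n : ℝ) * f 0‖ ≤ C₀ / m * (Real.pi / m) ^ n * ‖f 0‖ := by
    rw [hI0, mul_comm (f 0), ← sub_mul, norm_mul]
    exact mul_le_mul_of_nonneg_right (H₀ m hm) (norm_nonneg _)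
  set A := ∫ w in {w | normSq w ≤ δ ^ 2 / 2}, ‖f w‖ * Real.exp (-(3 / 4 * m) * normSq w) with hA
  have hA0 : 0 ≤ A := setIntegral_nonneg (isCompact_normSq_le _).isClosed.measurableSet
    fun w _ => by positivity
  rw [hI, hI1, hI2, mul_zero, add_zero, sub_zero]
  calc _ = ‖((∫ w, T0 w) - ((Real.pi / m) ^ n : ℝ) * f 0) + (∫ w, T3 w) + ∫ w, f w * R w‖ := by
        congr 1; ring
    _ ≤ C₀ / m * (Real.pi / m) ^ n * ‖f 0‖ + C₃ / m * A + C₂ / m * A :=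
        (norm_add_le _ _).trans (add_le_add ((norm_add_le _ _).trans (add_le_add hI0' hI3)) hI4)
    _ ≤ (C₀ + C₂ + C₃) / m * A + (C₀ + C₂ + C₃) / m * (Real.pi / m) ^ n * ‖f 0‖ := by
        have h1 : C₃ / m * A + C₂ / m * A ≤ (C₀ + C₂ + C₃) / m * A := by
          rw [← add_mul, ← add_div]
          exact mul_le_mul_of_nonneg_right (div_le_div_of_nonneg_right (by linarith) hm.le) hA0
        have h2 : C₀ / m * (Real.pi / m) ^ n * ‖f 0‖ ≤
            (C₀ + C₂ + C₃) / m * (Real.pi / m) ^ n * ‖f 0‖ := by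
          gcongr
          linarith
        linarith

end Gaussian

end

noncomputable section

/-! ## Expansion of the diastasis -/

namespace SeveralVariables

open Metric Filter Topology

universe u

variable {E : Type u} [NormedAddCommGroup E] [NormedSpace ℂ E]
  {F : Type u} [NormedAddCommGroup F] [NormedSpace ℂ F]

theorem norm_fderiv_le_of_mem_ball {f : E → F} {x : E} {R M : ℝ} (hR : 0 < R)
    (hf : DifferentiableOn ℂ f (ball x R)) (hM : ∀ y ∈ ball x R, ‖f y‖ ≤ M) {y : E}
    (hy : y ∈ ball x (R / 2)) : ‖fderiv ℂ f y‖ ≤ 4 * M / R := by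
  have hsub : ball y (R / 2) ⊆ ball x R := fun z hz => by
    rw [mem_ball] at *
    linarith [dist_triangle z y x]
  refine (norm_fderiv_le (r := R / 4) (by positivity) (by linarith) (hf.mono hsub)
    fun z hz => hM z (hsub hz)).trans_eq ?_
  field_simp

/-- A second-order Taylor bound. Cauchy's estimate is used on balls of radius `R` and `R / 2` to
bound the second derivative, so the constant depends on `M` and `R` only. -/
theorem norm_sub_sub_fderiv_le [FiniteDimensional ℂ E] [CompleteSpace F] {f : E → F} {R M : ℝ}
    (hR : 0 < R) (hf : DifferentiableOn ℂ f (ball 0 R)) (hM : ∀ y ∈ ball 0 R, ‖f y‖ ≤ M) {q : E}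
    (hq : q ∈ ball (0 : E) (R / 4)) :
    ‖f q - f 0 - fderiv ℂ f 0 q‖ ≤ 32 * M / R ^ 2 * ‖q‖ ^ 2 := by
  have hf' := differentiableOn_fderiv isOpen_ball hf
  have h1 : ∀ y ∈ ball (0 : E) (R / 2), ‖fderiv ℂ f y‖ ≤ 4 * M / R := fun y hy =>
    norm_fderiv_le_of_mem_ball hR hf hM hy
  have h2 : ∀ y ∈ ball (0 : E) (R / 4), ‖fderiv ℂ (fderiv ℂ f) y‖ ≤ 32 * M / R ^ 2 :=
    fun y hy => by
      refine (norm_fderiv_le_of_mem_ball (R := R / 2) (by positivity)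
        (hf'.mono (ball_subset_ball (by linarith))) h1
          (ball_subset_ball (by linarith) hy)).trans_eq ?_
      field_simp; ring
  have hlip : ∀ y ∈ ball (0 : E) (R / 4), ‖fderiv ℂ f y - fderiv ℂ f 0‖ ≤ 32 * M / R ^ 2 * ‖y‖ := by
    intro y hy
    have := (convex_ball (0 : E) (R / 4)).norm_image_sub_le_of_norm_fderiv_le (𝕜 := ℂ)
      (fun z hz => hf'.differentiableAt (isOpen_ball.mem_nhds
        (ball_subset_ball (by linarith) hz))) h2 (mem_ball_self (by positivity)) hy
    simpa using this
  have hseg : segment ℝ 0 q ⊆ ball (0 : E) (R / 4) :=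
    (convex_ball (0 : E) (R / 4)).segment_subset (mem_ball_self (by positivity)) hq
  have hM0 : 0 ≤ M := (norm_nonneg _).trans (hM 0 (mem_ball_self hR))
  have := (convex_segment (𝕜 := ℝ) (0 : E) q).norm_image_sub_le_of_norm_fderiv_le' (𝕜 := ℂ)
    (f := f) (φ := fderiv ℂ f 0) (C := 32 * M / R ^ 2 * ‖q‖)
    (fun z hz => hf.differentiableAt (isOpen_ball.mem_nhds
      (ball_subset_ball (by linarith) (hseg hz)))) (fun z hz => ?_)
    (left_mem_segment ℝ 0 q) (right_mem_segment ℝ 0 q)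
  · rw [sub_zero] at this
    refine this.trans_eq ?_
    ring
  · refine (hlip z (hseg hz)).trans ?_
    obtain ⟨t, ht0, ht1, rfl⟩ : ∃ t : ℝ, 0 ≤ t ∧ t ≤ 1 ∧ t • q = z := by
      rw [segment_eq_image] at hz
      obtain ⟨t, ht, rfl⟩ := hz
      exact ⟨t, ht.1, ht.2, by simp⟩
    rw [norm_smul, Real.norm_of_nonneg ht0]
    gcongr
    exact mul_le_of_le_one_left (norm_nonneg _) ht1

theorem fderiv_apply_comm [FiniteDimensional ℂ E] [CompleteSpace F] {f : E → F} {U : Set E}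
    (hU : IsOpen U) (hf : DifferentiableOn ℂ f U) {x : E} (hx : x ∈ U) (v w : E) :
    fderiv ℂ (fun y => fderiv ℂ f y v) x w = fderiv ℂ (fun y => fderiv ℂ f y w) x v := by
  have hf' := differentiableOn_fderiv hU hf
  have hd := hf'.differentiableAt (hU.mem_nhds hx)
  have key : ∀ v w : E, fderiv ℂ (fun y => fderiv ℂ f y v) x w = fderiv ℂ (fderiv ℂ f) x w v := by
    intro v w
    rw [fderiv_clm_apply hd (differentiableAt_const v)]
    simp
  rw [key, key]
  exact second_derivative_symmetric_of_eventually (𝕜 := ℂ)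
    (by filter_upwards [hU.mem_nhds hx] with y hy using
      (hf.differentiableAt (hU.mem_nhds hy)).hasFDerivAt) hd.hasFDerivAt w v

theorem hasFDerivAt_det {n : ℕ} {H : E → Matrix (Fin n) (Fin n) ℂ} {x : E}
    {H' : Fin n → Fin n → E →L[ℂ] ℂ} (hH : ∀ j k, HasFDerivAt (fun q => H q j k) (H' j k) x) :
    HasFDerivAt (fun q => (H q).det) (∑ σ : Equiv.Perm (Fin n),
      ((Equiv.Perm.sign σ : ℤ) : ℂ) • ∑ i, (∏ j ∈ Finset.univ.erase i, H x (σ j) j) •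
        H' (σ i) i) x := by
  simp_rw [Matrix.det_apply']
  exact HasFDerivAt.fun_sum fun σ _ => (HasFDerivAt.finsetProd fun i _ => hH (σ i) i).const_mul _

theorem hasDerivAt_det_one_add_smul {n : ℕ} (B : Matrix (Fin n) (Fin n) ℂ) :
    HasDerivAt (fun t : ℂ => (1 + t • B).det) B.trace 0 := by
  have heq : (fun t : ℂ => (1 + t • B).det) = fun t => 1 + B.trace * t +
      ((Matrix.det (1 + (Polynomial.X : Polynomial ℂ) • B.map Polynomial.C)).divX.divX).eval t *
        t ^ 2 := funext fun t => Matrix.det_one_add_smul t B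
  rw [heq]
  have ha : HasDerivAt (fun t : ℂ => 1 + B.trace * t) B.trace 0 := by
    simpa using ((hasDerivAt_id (0 : ℂ)).const_mul B.trace).const_add 1
  have hb := (((Matrix.det (1 + (Polynomial.X : Polynomial ℂ) •
    B.map Polynomial.C)).divX.divX).hasDerivAt (0 : ℂ)).fun_mul ((hasDerivAt_id (0 : ℂ)).fun_pow 2)
  simpa using ha.fun_add hb

/-- Jacobi's formula for the derivative of a determinant at the unit matrix. -/
theorem fderiv_det_of_eq_one {n : ℕ} {G : E → Matrix (Fin n) (Fin n) ℂ} {x : E} (hG : G x = 1)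
    (hd : ∀ j k, DifferentiableAt ℂ (fun q => G q j k) x) (q : E) :
    fderiv ℂ (fun q => (G q).det) x q = ∑ p, fderiv ℂ (fun q => G q p p) x q := by
  set B : Matrix (Fin n) (Fin n) ℂ := Matrix.of fun j k => fderiv ℂ (fun q => G q j k) x q with hB
  have h1 := hasFDerivAt_det fun j k => (hd j k).hasFDerivAt
  -- The Leibniz formula for the derivative involves only the value `1` and the first derivatives of
  -- the entries. It may therefore be evaluated on the line `t ↦ 1 + t B`, where the derivative is
  -- known to be the trace.
  have h2 := hasFDerivAt_det (H := fun t : ℂ => 1 + t • B) (x := 0)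
    (H' := fun j k => ContinuousLinearMap.toSpanSingleton ℂ (B j k)) fun j k => by
      have : HasDerivAt (fun t : ℂ => (1 : Matrix (Fin n) (Fin n) ℂ) j k + t * B j k) (B j k) 0 := by
        simpa using ((hasDerivAt_id (0 : ℂ)).mul_const (B j k)).const_add
          ((1 : Matrix (Fin n) (Fin n) ℂ) j k)
      exact this.hasFDerivAt
  have h4 := h2.hasDerivAt.unique (hasDerivAt_det_one_add_smul B)
  rw [h1.fderiv]
  refine Eq.trans ?_ h4
  simp [hG, hB]

end SeveralVariables

end

/-! ### The diastasis and the mixed Hessian of a potential -/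

noncomputable section

namespace SeveralVariables

open Metric Filter Topology Gaussian

variable {n : ℕ}

/-- The matrix of mixed second derivatives `∂²L / ∂u_j ∂v_k` of a function of `(u, v)`. -/
def mixedHessian (L : (Fin n → ℂ) × (Fin n → ℂ) → ℂ) (q : (Fin n → ℂ) × (Fin n → ℂ)) :
    Matrix (Fin n) (Fin n) ℂ :=
  Matrix.of fun j k => fderiv ℂ (fun p => fderiv ℂ L p (0, Pi.single k 1)) q (Pi.single j 1, 0)

/-- Calabi's diastasis of the point `w` from the origin, for the potential `L (w, w̄)`. -/
def diastasis (L : (Fin n → ℂ) × (Fin n → ℂ) → ℂ) (w : Fin n → ℂ) : ℂ :=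
  L (w, star w) + L 0 - L (w, 0) - L (0, star w)

theorem sum_smul_single_inl (u : Fin n → ℂ) :
    ((u, 0) : (Fin n → ℂ) × (Fin n → ℂ)) = ∑ j, u j • (Pi.single j 1, 0) := by
  ext k
  · simp [Prod.fst_sum, Finset.sum_apply, Pi.single_apply]
  · simp [Prod.snd_sum]

theorem sum_smul_single_inr (v : Fin n → ℂ) :
    ((0, v) : (Fin n → ℂ) × (Fin n → ℂ)) = ∑ j, v j • (0, Pi.single j 1) := by
  ext k
  · simp [Prod.fst_sum]
  · simp [Prod.snd_sum, Finset.sum_apply, Pi.single_apply]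

section

variable {L : (Fin n → ℂ) × (Fin n → ℂ) → ℂ} {U : Set ((Fin n → ℂ) × (Fin n → ℂ))}

theorem differentiableOn_fderiv_apply (hU : IsOpen U) (hL : DifferentiableOn ℂ L U)
    (v : (Fin n → ℂ) × (Fin n → ℂ)) : DifferentiableOn ℂ (fun p => fderiv ℂ L p v) U :=
  (differentiableOn_fderiv hU hL).clm_apply (differentiableOn_const v)

theorem differentiableOn_mixedHessian (hU : IsOpen U) (hL : DifferentiableOn ℂ L U)
    (j k : Fin n) : DifferentiableOn ℂ (fun q => mixedHessian L q j k) U :=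
  differentiableOn_fderiv_apply hU (differentiableOn_fderiv_apply hU hL _) _

theorem fderiv_fderiv_eq_sum (hU : IsOpen U) (hL : DifferentiableOn ℂ L U)
    {q : (Fin n → ℂ) × (Fin n → ℂ)} (hq : q ∈ U) (u v : Fin n → ℂ) :
    fderiv ℂ (fun p => fderiv ℂ L p (0, v)) q (u, 0) =
      ∑ j, ∑ k, u j * v k * mixedHessian L q j k := by
  have h1 : (fun p => fderiv ℂ L p (0, v)) =
      fun p => ∑ k, v k • fderiv ℂ L p (0, Pi.single k 1) := by
    ext p
    rw [sum_smul_single_inr v, map_sum]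
    simp_rw [map_smul]
  have h2 : ∀ k, DifferentiableAt ℂ (fun p => fderiv ℂ L p (0, Pi.single k 1)) q := fun k =>
    (differentiableOn_fderiv_apply hU hL _).differentiableAt (hU.mem_nhds hq)
  rw [h1, fderiv_fun_sum fun k _ => (h2 k).fun_const_smul (v k), sum_smul_single_inl u, map_sum]
  refine Finset.sum_congr rfl fun j _ => ?_
  rw [map_smul, sum_apply, Finset.smul_sum]
  refine Finset.sum_congr rfl fun k _ => ?_
  rw [fderiv_fun_const_smul (h2 k)]
  simp [mixedHessian, mul_assoc]

theorem norm_prod_smul_lt {ρ s t : ℝ} {w v : Fin n → ℂ} (hw : ‖w‖ < ρ) (hv : ‖v‖ < ρ)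
    (hs : s ∈ Icc (0 : ℝ) 1) (ht : t ∈ Icc (0 : ℝ) 1) :
    (((s : ℂ) • w, (t : ℂ) • v) : (Fin n → ℂ) × (Fin n → ℂ)) ∈ ball 0 ρ := by
  rw [mem_ball_zero_iff, Prod.norm_def, max_lt_iff]
  simp only [norm_smul, Complex.norm_real, Real.norm_of_nonneg hs.1, Real.norm_of_nonneg ht.1]
  exact ⟨(mul_le_of_le_one_left (norm_nonneg _) hs.2).trans_lt hw,
    (mul_le_of_le_one_left (norm_nonneg _) ht.2).trans_lt hv⟩

/-- The diastasis is a mixed second difference, that is, the integral over `(s, t) ∈ [0, 1]²` of `∑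
w_j w̄_k G_jk(s w, t w̄)` with `G` the mixed Hessian. The comparison function `c₀ + 2 s c₁ + 2 t c₂`
has integral `c₀ + c₁ + c₂`. The mean value inequality, applied in `s` and then in `t`, replaces the
integrals. -/
theorem norm_diastasis_sub_le {ρ C : ℝ} (hL : DifferentiableOn ℂ L (ball 0 ρ)) {w : Fin n → ℂ}
    (hw : ‖w‖ < ρ) (c₀ c₁ c₂ : ℂ)
    (hC : ∀ s ∈ Icc (0 : ℝ) 1, ∀ t ∈ Icc (0 : ℝ) 1,
      ‖(∑ j, ∑ k, w j * conj (w k) * mixedHessian L ((s : ℂ) • w, (t : ℂ) • star w) j k) -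
        (c₀ + 2 * s * c₁ + 2 * t * c₂)‖ ≤ C) :
    ‖diastasis L w - (c₀ + c₁ + c₂)‖ ≤ C := by
  have hw' : ‖star w‖ < ρ := by rwa [norm_star]
  have hmem : ∀ s ∈ Icc (0 : ℝ) 1, ∀ t ∈ Icc (0 : ℝ) 1, _ := fun s hs t ht =>
    norm_prod_smul_lt hw hw' hs ht
  have hA : ∀ t ∈ Icc (0 : ℝ) 1, ‖fderiv ℂ L (w, (t : ℂ) • star w) (0, star w) -
      fderiv ℂ L (0, (t : ℂ) • star w) (0, star w) - (c₀ + c₁ + 2 * t * c₂)‖ ≤ C := by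
    intro t ht
    have hd : ∀ s ∈ Icc (0 : ℝ) 1, HasDerivWithinAt
        (fun s : ℝ => fderiv ℂ L ((s : ℂ) • w, (t : ℂ) • star w) (0, star w) -
          (s * c₀ + s ^ 2 * c₁ + 2 * s * t * c₂))
        ((∑ j, ∑ k, w j * conj (w k) * mixedHessian L ((s : ℂ) • w, (t : ℂ) • star w) j k) -
        (c₀ + 2 * s * c₁ + 2 * t * c₂)) (Icc 0 1) s := by
      intro s hs
      have h1 := hasDerivAt_line (f := fun p => fderiv ℂ L p (0, star w))
        (x := (0, (t : ℂ) • star w)) (v := (w, 0)) (ζ := (s : ℂ)) (by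
          simpa using ((differentiableOn_fderiv_apply isOpen_ball hL _).differentiableAt
            (isOpen_ball.mem_nhds (hmem s hs t ht))))
      have h2 := h1.comp_ofReal
      simp only [Prod.smul_mk, smul_zero, Prod.mk_add_mk, zero_add, add_zero] at h2
      rw [fderiv_fderiv_eq_sum isOpen_ball hL (hmem s hs t ht)] at h2
      have h3 : HasDerivAt (fun s : ℂ => s * c₀ + s ^ 2 * c₁ + 2 * s * t * c₂)
          (c₀ + 2 * s * c₁ + 2 * t * c₂) (s : ℂ) := by
        have ha := (hasDerivAt_id (s : ℂ)).mul_const c₀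
        have hb := ((hasDerivAt_id (s : ℂ)).fun_pow 2).mul_const c₁
        have hc := (((hasDerivAt_id (s : ℂ)).const_mul 2).mul_const (t : ℂ)).mul_const c₂
        convert! (ha.fun_add hb).fun_add hc using 1
        simp
      exact (h2.fun_sub h3.comp_ofReal).hasDerivWithinAt
    have := norm_image_sub_le_of_norm_deriv_le_segment_01' hd
      fun s hs => hC s (Ico_subset_Icc_self hs) t ht
    convert! this using 2
    simp
    ring
  have hd : ∀ t ∈ Icc (0 : ℝ) 1, HasDerivWithinAt
      (fun t : ℝ => L (w, (t : ℂ) • star w) - L (0, (t : ℂ) • star w) -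
        (t * c₀ + t * c₁ + t ^ 2 * c₂))
      (fderiv ℂ L (w, (t : ℂ) • star w) (0, star w) -
        fderiv ℂ L (0, (t : ℂ) • star w) (0, star w) - (c₀ + c₁ + 2 * t * c₂)) (Icc 0 1) t := by
    intro t ht
    have h1 := (hasDerivAt_line (f := L) (x := (w, 0)) (v := (0, star w)) (ζ := (t : ℂ)) (by
      simpa using (hL.differentiableAt (isOpen_ball.mem_nhds (hmem 1 (by simp) t ht))))).comp_ofReal
    have h2 := (hasDerivAt_line (f := L) (x := 0) (v := (0, star w)) (ζ := (t : ℂ)) (by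
      simpa using (hL.differentiableAt (isOpen_ball.mem_nhds (hmem 0 (by simp) t ht))))).comp_ofReal
    simp only [Prod.smul_mk, smul_zero, Prod.mk_add_mk, zero_add, add_zero] at h1 h2
    have h3 : HasDerivAt (fun t : ℂ => t * c₀ + t * c₁ + t ^ 2 * c₂)
        (c₀ + c₁ + 2 * t * c₂) (t : ℂ) := by
      have ha := (hasDerivAt_id (t : ℂ)).mul_const c₀
      have hb := (hasDerivAt_id (t : ℂ)).mul_const c₁
      have hc := ((hasDerivAt_id (t : ℂ)).fun_pow 2).mul_const c₂
      convert! (ha.fun_add hb).fun_add hc using 1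
      simp
    exact ((h1.fun_sub h2).fun_sub h3.comp_ofReal).hasDerivWithinAt
  have := norm_image_sub_le_of_norm_deriv_le_segment_01' hd
    fun t ht => hA t (Ico_subset_Icc_self ht)
  convert! this using 2
  simp only [diastasis, Complex.ofReal_one, one_smul, Complex.ofReal_zero, zero_smul]
  rw [show ((0 : Fin n → ℂ), (0 : Fin n → ℂ)) = 0 from rfl]
  ring

/-- `K` depends only on `n`, `M` and `ρ`, which later makes the estimates uniform in the base point.
Two applications of Cauchy's estimate bound the Hessian on the ball of radius `ρ / 4`, and the
Taylor bounds for its entries and determinant hold on a quarter of that radius. -/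
theorem mixedHessian_bounds (n : ℕ) {M ρ : ℝ} (hM : 0 ≤ M) (hρ : 0 < ρ) : ∃ K, 0 ≤ K ∧
    ∀ L : (Fin n → ℂ) × (Fin n → ℂ) → ℂ, DifferentiableOn ℂ L (ball 0 ρ) →
      (∀ q ∈ ball 0 ρ, ‖L q‖ ≤ M) →
      (∀ j k, ‖fderiv ℂ (fun q => mixedHessian L q j k) 0‖ ≤ K) ∧
      (∀ q ∈ ball 0 (ρ / 16), ∀ j k, ‖mixedHessian L q j k‖ ≤ K ∧
        ‖mixedHessian L q j k - mixedHessian L 0 j k -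
          fderiv ℂ (fun q => mixedHessian L q j k) 0 q‖ ≤ K * ‖q‖ ^ 2) ∧
      (∀ q ∈ ball 0 (ρ / 16), ‖(mixedHessian L q).det - (mixedHessian L 0).det -
          fderiv ℂ (fun q => (mixedHessian L q).det) 0 q‖ ≤ K * ‖q‖ ^ 2) := by
  set M₂ : ℝ := 32 * M / ρ ^ 2 with hM₂
  have hM₂0 : 0 ≤ M₂ := by positivity
  have hK1 : 0 ≤ 32 * M₂ / (ρ / 4) ^ 2 := by positivity
  have hK2 : 0 ≤ 4 * M₂ / (ρ / 4) := by positivity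
  have hK3 : 0 ≤ 32 * (n.factorial * M₂ ^ n) / (ρ / 4) ^ 2 := by positivity
  refine ⟨M₂ + 32 * M₂ / (ρ / 4) ^ 2 + 4 * M₂ / (ρ / 4) +
    32 * (n.factorial * M₂ ^ n) / (ρ / 4) ^ 2, by positivity, fun L hL hLM => ?_⟩
  have hb1 : ∀ q ∈ ball 0 (ρ / 2), ‖fderiv ℂ L q‖ ≤ 4 * M / ρ := fun q hq =>
    norm_fderiv_le_of_mem_ball hρ hL hLM hq
  have hsingle : ∀ k : Fin n, ‖((0, Pi.single k 1) : (Fin n → ℂ) × (Fin n → ℂ))‖ ≤ 1 ∧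
      ‖((Pi.single k 1, 0) : (Fin n → ℂ) × (Fin n → ℂ))‖ ≤ 1 := fun k => by
    have : ‖(Pi.single k 1 : Fin n → ℂ)‖ ≤ 1 := by
      rw [Pi.norm_single, norm_one]
    simpa [Prod.norm_def] using this
  have hb2 : ∀ k, ∀ q ∈ ball 0 (ρ / 2), ‖fderiv ℂ L q (0, Pi.single k 1)‖ ≤ 4 * M / ρ :=
    fun k q hq => ((fderiv ℂ L q).le_opNorm_of_le (hsingle k).1).trans (by simpa using hb1 q hq)
  have hG : ∀ q ∈ ball 0 (ρ / 4), ∀ j k, ‖mixedHessian L q j k‖ ≤ M₂ := fun q hq j k => by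
    refine ((fderiv ℂ _ q).le_opNorm_of_le (hsingle j).2).trans ?_
    rw [mul_one]
    refine (norm_fderiv_le_of_mem_ball (R := ρ / 2) (by positivity)
      ((differentiableOn_fderiv_apply isOpen_ball hL _).mono (ball_subset_ball (by linarith)))
      (hb2 k) (by convert! hq using 2; ring)).trans_eq ?_
    rw [hM₂]; field_simp; ring
  have hGd : ∀ j k, DifferentiableOn ℂ (fun q => mixedHessian L q j k) (ball 0 (ρ / 4)) :=
    fun j k => (differentiableOn_mixedHessian isOpen_ball hL j k).mono
      (ball_subset_ball (by linarith))
  have hdet : DifferentiableOn ℂ (fun q => (mixedHessian L q).det) (ball 0 (ρ / 4)) :=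
    fun q hq => (hasFDerivAt_det fun j k => ((hGd j k).differentiableAt
      (isOpen_ball.mem_nhds hq)).hasFDerivAt).differentiableAt.differentiableWithinAt
  have hdetb : ∀ q ∈ ball 0 (ρ / 4), ‖(mixedHessian L q).det‖ ≤ n.factorial * M₂ ^ n :=
    fun q hq => by
      have := Matrix.det_le (A := mixedHessian L q) (abv := NormedField.toAbsoluteValue ℂ)
        (x := M₂) (hG q hq)
      rw [nsmul_eq_mul, Fintype.card_fin] at this
      exact this
  refine ⟨fun j k => ?_, fun q hq j k => ⟨?_, ?_⟩, fun q hq => ?_⟩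
  · have := norm_fderiv_le_of_mem_ball (R := ρ / 4) (by positivity) (hGd j k)
      (fun q hq => hG q hq j k) (mem_ball_self (by positivity))
    linarith
  · have := hG q (ball_subset_ball (by linarith) hq) j k
    linarith
  · refine (norm_sub_sub_fderiv_le (R := ρ / 4) (by positivity) (hGd j k)
      (fun q hq => hG q hq j k) (by convert! hq using 2; ring)).trans ?_
    gcongr
    linarith
  · refine (norm_sub_sub_fderiv_le (R := ρ / 4) (by positivity) hdet hdetb
      (by convert! hq using 2; ring)).trans ?_
    gcongr
    linarith

end

end SeveralVariables

end

/-! ### Potentials with unit Hessian give approximate Gaussians -/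

noncomputable section

namespace SeveralVariables

open Metric Filter Topology Gaussian

variable {n : ℕ}

theorem continuousOn_diastasis {L : (Fin n → ℂ) × (Fin n → ℂ) → ℂ} {ρ : ℝ}
    (hL : ContinuousOn L (ball 0 ρ)) : ContinuousOn (diastasis L) (ball 0 ρ) := by
  have hstar : Continuous fun w : Fin n → ℂ => star w := continuous_star
  have h : ∀ g : (Fin n → ℂ) → (Fin n → ℂ) × (Fin n → ℂ), Continuous g → (∀ w, ‖g w‖ ≤ ‖w‖) →
      ContinuousOn (fun w => L (g w)) (ball 0 ρ) := fun g hg hn =>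
    hL.comp hg.continuousOn fun w hw => by
      rw [mem_ball_zero_iff] at *
      exact (hn w).trans_lt hw
  unfold diastasis
  refine ((ContinuousOn.add (h _ (by fun_prop) fun w => ?_) continuousOn_const).sub
    (h _ (by fun_prop) fun w => ?_)).sub (h _ (by fun_prop) fun w => ?_)
  all_goals simp [Prod.norm_def]

/-- The form `½ ∑ w_j w̄_k ∂G_{jk}(w, 0)` of type `(2, 1)` in the expansion of the diastasis. -/
def cubicForm (L : (Fin n → ℂ) × (Fin n → ℂ) → ℂ) (w : Fin n → ℂ) : ℂ :=
  1 / 2 * ∑ j, ∑ k, w j * conj (w k) * fderiv ℂ (fun q => mixedHessian L q j k) 0 (w, 0)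

/-- The tensor of type `(1, 2)` in the expansion of the diastasis. -/
def cubicTensor (L : (Fin n → ℂ) × (Fin n → ℂ) → ℂ) (p k l : Fin n) : ℂ :=
  fderiv ℂ (fun q => mixedHessian L q p k) 0 (0, Pi.single l 1)

/-- The form of type `(1, 0)` in the expansion of the volume density. -/
def linearForm (L : (Fin n → ℂ) × (Fin n → ℂ) → ℂ) (w : Fin n → ℂ) : ℂ :=
  ∑ p, fderiv ℂ (fun q => mixedHessian L q p p) 0 (w, 0)

theorem sum_mul_cubicCoeff (L : (Fin n → ℂ) × (Fin n → ℂ) → ℂ) (w : Fin n → ℂ) :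
    ∑ p, w p * cubicCoeff (cubicTensor L) p w = 1 / 2 * ∑ j, ∑ k, w j * conj (w k) *
      fderiv ℂ (fun q => mixedHessian L q j k) 0 (0, star w) := by
  rw [Finset.mul_sum]
  refine Finset.sum_congr rfl fun j _ => ?_
  rw [cubicCoeff, mul_left_comm, Finset.mul_sum]
  congr 1
  refine Finset.sum_congr rfl fun k _ => ?_
  rw [sum_smul_single_inr (star w), map_sum, Finset.mul_sum, Finset.mul_sum]
  refine Finset.sum_congr rfl fun l _ => ?_
  rw [map_smul, cubicTensor, smul_eq_mul, Pi.star_apply, Complex.star_def]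
  ring

theorem cubicTrace_cubicTensor (L : (Fin n → ℂ) × (Fin n → ℂ) → ℂ) (w : Fin n → ℂ) :
    cubicTrace (cubicTensor L) w =
      ∑ p, fderiv ℂ (fun q => mixedHessian L q p p) 0 (0, star w) := by
  refine Finset.sum_congr rfl fun p _ => ?_
  rw [sum_smul_single_inr (star w), map_sum]
  refine Finset.sum_congr rfl fun l _ => ?_
  rw [map_smul, cubicTensor, smul_eq_mul, Pi.star_apply, Complex.star_def]
  ring

/-- The tensor consists of third derivatives of `L`, two of them in the conjugate variables; these
two may be exchanged. This symmetry is what the cancellation in `integral_cubic` requires. -/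
theorem cubicTensor_symm {L : (Fin n → ℂ) × (Fin n → ℂ) → ℂ} {ρ : ℝ} (hρ : 0 < ρ)
    (hL : DifferentiableOn ℂ L (ball 0 ρ)) (p k l : Fin n) :
    cubicTensor L p k l = cubicTensor L p l k := by
  have h0 : (0 : (Fin n → ℂ) × (Fin n → ℂ)) ∈ ball 0 ρ := mem_ball_self hρ
  have hd : ∀ v, DifferentiableOn ℂ (fun q => fderiv ℂ L q v) (ball 0 ρ) :=
    differentiableOn_fderiv_apply isOpen_ball hL
  have key : ∀ k l : Fin n, cubicTensor L p k l = fderiv ℂ (fun q => fderiv ℂ (fun q =>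
      fderiv ℂ L q (0, Pi.single k 1)) q (0, Pi.single l 1)) 0 (Pi.single p 1, 0) := fun k l =>
    fderiv_apply_comm isOpen_ball (hd _) h0 _ _
  rw [key, key]
  congr 1
  refine Filter.EventuallyEq.fderiv_eq ?_
  filter_upwards [isOpen_ball.mem_nhds h0] with q hq
  exact fderiv_apply_comm isOpen_ball hL hq _ _

theorem norm_sum_sum_mul_le {w : Fin n → ℂ} {c : Fin n → Fin n → ℂ} {B : ℝ}
    (hc : ∀ j k, ‖c j k‖ ≤ B) :
    ‖∑ j, ∑ k, w j * conj (w k) * c j k‖ ≤ n ^ 2 * (√(normSq w) ^ 2 * B) := by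
  have : ∀ j k, ‖w j * conj (w k) * c j k‖ ≤ √(normSq w) ^ 2 * B := fun j k => by
    rw [norm_mul, norm_mul, RCLike.norm_conj, pow_two]
    exact mul_le_mul (mul_le_mul (norm_apply_le_sqrt_normSq w j) (norm_apply_le_sqrt_normSq w k)
      (norm_nonneg _) (Real.sqrt_nonneg _)) (hc j k) (norm_nonneg _) (by positivity)
  refine (norm_sum_le_of_le _ fun j _ => norm_sum_le_of_le _ fun k _ => this j k).trans_eq ?_
  simp
  ring

theorem continuous_fderiv_inl (g : (Fin n → ℂ) × (Fin n → ℂ) → ℂ) :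
    Continuous fun w : Fin n → ℂ => fderiv ℂ g 0 (w, 0) :=
  (fderiv ℂ g 0).continuous.comp (by fun_prop)

theorem norm_fderiv_inl_le {g : (Fin n → ℂ) × (Fin n → ℂ) → ℂ} {K : ℝ}
    (hK : ‖fderiv ℂ g 0‖ ≤ K) (w : Fin n → ℂ) :
    ‖fderiv ℂ g 0 (w, 0)‖ ≤ K * √(normSq w) ∧ ‖fderiv ℂ g 0 (0, star w)‖ ≤ K * √(normSq w) := by
  have hK0 : 0 ≤ K := (norm_nonneg _).trans hK
  have hw := norm_le_sqrt_normSq w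
  refine ⟨((fderiv ℂ g 0).le_opNorm _).trans (mul_le_mul hK ?_ (norm_nonneg _) hK0),
    ((fderiv ℂ g 0).le_opNorm _).trans (mul_le_mul hK ?_ (norm_nonneg _) hK0)⟩ <;>
  simpa [Prod.norm_def] using hw

theorem fderiv_add_prod (g : (Fin n → ℂ) × (Fin n → ℂ) → ℂ) (s t : ℂ) (u v : Fin n → ℂ) :
    fderiv ℂ g 0 (s • u, t • v) = s * fderiv ℂ g 0 (u, 0) + t * fderiv ℂ g 0 (0, v) := by
  rw [← smul_eq_mul, ← smul_eq_mul, ← map_smul, ← map_smul, ← map_add]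
  simp

set_option maxHeartbeats 1000000 in
/-- A potential whose mixed Hessian at the origin is the unit matrix gives rise to an approximate
Gaussian, with constants that depend on a bound for the potential only. -/
theorem exists_isApproxGaussian (n : ℕ) {M ρ : ℝ} (hM : 0 ≤ M) (hρ : 0 < ρ) :
    ∃ K δ, 0 ≤ K ∧ 0 < δ ∧ δ ≤ 1 ∧ δ < ρ ∧
    ∀ L P : (Fin n → ℂ) × (Fin n → ℂ) → ℂ, DifferentiableOn ℂ L (ball 0 ρ) →
      DifferentiableOn ℂ P (ball 0 ρ) → (∀ q ∈ ball 0 ρ, ‖L q‖ ≤ M) →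
      (∀ q ∈ ball 0 ρ, ‖P q‖ ≤ M) → mixedHessian L 0 = 1 →
      IsApproxGaussian K δ (diastasis L)
        (fun w => (mixedHessian L (w, star w)).det * Complex.exp (-diastasis P w))
        (cubicForm L) (linearForm L) (cubicTensor L) ∧
      ∀ w, normSq w < δ ^ 2 →
        ‖diastasis P w‖ ≤ 1 ∧ ‖(mixedHessian L (w, star w)).det - 1‖ ≤ 1 / 2 := by
  obtain ⟨K, hK0, HK⟩ := mixedHessian_bounds n hM hρ
  -- The bound `ρ / 32` keeps all points `(s w, t w̄)` in the ball where the Hessian bounds hold.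
  -- The last bound gives `(n + 1)² K δ ≤ 1 / 24`: the quartic error and the two cubic forms are
  -- then each at most `|w|² / 24`, which adds up to the `1 / 8` demanded of the potential, and
  -- likewise the determinant differs from `1` by at most `1 / 2`.
  set δ : ℝ := min (min 1 (ρ / 32)) (1 / (24 * ((n + 1) ^ 2 * K + 1))) with hδdef
  have hδ0 : 0 < δ := by positivity
  have hδ1 : δ ≤ 1 := (min_le_left _ _).trans (min_le_left _ _)
  have hδρ : δ ≤ ρ / 32 := (min_le_left _ _).trans (min_le_right _ _)
  have hδK : 24 * ((n + 1) ^ 2 * K * δ) ≤ 1 := by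
    have h1 : δ ≤ 1 / (24 * ((n + 1) ^ 2 * K + 1)) := min_le_right _ _
    rw [le_div_iff₀ (by positivity)] at h1
    nlinarith
  have hn2 : (n : ℝ) ^ 2 ≤ (n + 1) ^ 2 := by
    have : (0 : ℝ) ≤ n := n.cast_nonneg
    nlinarith
  have hn1 : (n : ℝ) + 1 ≤ (n + 1) ^ 2 := by
    have : (0 : ℝ) ≤ n := n.cast_nonneg
    nlinarith
  have hn0 : (0 : ℝ) ≤ n := n.cast_nonneg
  refine ⟨8 * (n + 1) ^ 2 * K, δ, by positivity, hδ0, hδ1, by linarith,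
    fun L P hL hP hLM hPM hL1 => ?_⟩
  obtain ⟨hLd, hLG, hLdet⟩ := HK L hL hLM
  obtain ⟨-, hPG, -⟩ := HK P hP hPM
  have hr : ∀ w : Fin n → ℂ, normSq w < δ ^ 2 → √(normSq w) < δ := fun w hw =>
    (Real.sqrt_lt' hδ0).2 hw
  have hwρ : ∀ w : Fin n → ℂ, normSq w < δ ^ 2 → ‖w‖ < ρ / 16 := fun w hw =>
    (norm_le_sqrt_normSq w).trans_lt ((hr w hw).trans_le (by linarith))
  have hq : ∀ w : Fin n → ℂ, normSq w < δ ^ 2 → ∀ s ∈ Icc (0 : ℝ) 1, ∀ t ∈ Icc (0 : ℝ) 1,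
      (((s : ℂ) • w, (t : ℂ) • star w) : (Fin n → ℂ) × (Fin n → ℂ)) ∈ ball 0 (ρ / 16) ∧
      ‖(((s : ℂ) • w, (t : ℂ) • star w) : (Fin n → ℂ) × (Fin n → ℂ))‖ ≤ √(normSq w) := by
    intro w hw s hs t ht
    refine ⟨norm_prod_smul_lt (hwρ w hw) (by rw [norm_star]; exact hwρ w hw) hs ht, ?_⟩
    rw [Prod.norm_def, max_le_iff]
    simp only [norm_smul, Complex.norm_real, Real.norm_of_nonneg hs.1, Real.norm_of_nonneg ht.1,
      norm_star]
    have := norm_le_sqrt_normSq w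
    exact ⟨(mul_le_of_le_one_left (norm_nonneg _) hs.2).trans this,
      (mul_le_of_le_one_left (norm_nonneg _) ht.2).trans this⟩
  have hq1 : ∀ w : Fin n → ℂ, normSq w < δ ^ 2 →
      ((w, star w) : (Fin n → ℂ) × (Fin n → ℂ)) ∈ ball 0 (ρ / 16) ∧
      ‖((w, star w) : (Fin n → ℂ) × (Fin n → ℂ))‖ ≤ √(normSq w) := fun w hw => by
    simpa using hq w hw 1 (by simp) 1 (by simp)
  have hdP : ∀ w : Fin n → ℂ, normSq w < δ ^ 2 → ‖diastasis P w‖ ≤ n ^ 2 * K * √(normSq w) ^ 2 := by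
    intro w hw
    have := norm_diastasis_sub_le hP (w := w) (by linarith [hwρ w hw]) 0 0 0
      (C := n ^ 2 * (√(normSq w) ^ 2 * K)) fun s hs t ht => by
        simpa using norm_sum_sum_mul_le (w := w)
          fun j k => (hPG _ (hq w hw s hs t ht).1 j k).1
    simp only [add_zero, sub_zero] at this
    linarith
  have hdP1 : ∀ w : Fin n → ℂ, normSq w < δ ^ 2 → ‖diastasis P w‖ ≤ 1 := fun w hw => by
    have h1 := hr w hw
    have h0 := Real.sqrt_nonneg (normSq w)
    calc _ ≤ n ^ 2 * K * √(normSq w) ^ 2 := hdP w hw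
      _ ≤ (n + 1) ^ 2 * K * (δ * 1) := by
          gcongr
          nlinarith
      _ ≤ 1 := by rw [mul_one]; nlinarith [mul_nonneg (mul_nonneg (sq_nonneg ((n : ℝ) + 1)) hK0) hδ0.le]
  have hGdiff : ∀ j k, DifferentiableAt ℂ (fun q => mixedHessian L q j k) 0 := fun j k =>
    (differentiableOn_mixedHessian isOpen_ball hL j k).differentiableAt
      (isOpen_ball.mem_nhds (mem_ball_self hρ))
  have hj0 : ∀ w, linearForm L w + cubicTrace (cubicTensor L) w =
      fderiv ℂ (fun q => (mixedHessian L q).det) 0 (w, star w) := fun w => by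
    rw [fderiv_det_of_eq_one hL1 hGdiff, cubicTrace_cubicTensor, linearForm,
      ← Finset.sum_add_distrib]
    refine Finset.sum_congr rfl fun p _ => ?_
    have := fderiv_add_prod (fun q => mixedHessian L q p p) 1 1 w (star w)
    simpa using this.symm
  have hlin : ∀ w, ‖linearForm L w‖ ≤ n * (K * √(normSq w)) := fun w => by
    refine (norm_sum_le_of_le _ fun p _ => (norm_fderiv_inl_le (hLd p p) w).1).trans_eq ?_
    simp
  have htr : ∀ w, ‖cubicTrace (cubicTensor L) w‖ ≤ n * (K * √(normSq w)) := fun w => by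
    rw [cubicTrace_cubicTensor]
    refine (norm_sum_le_of_le _ fun p _ => (norm_fderiv_inl_le (hLd p p) w).2).trans_eq ?_
    simp
  have hcub : ∀ w, ‖cubicForm L w‖ ≤ n ^ 2 * K * √(normSq w) ^ 3 := fun w => by
    rw [cubicForm, norm_mul]
    have := norm_sum_sum_mul_le (w := w) fun j k => (norm_fderiv_inl_le (hLd j k) w).1
    have h2 : ‖(1 / 2 : ℂ)‖ ≤ 1 := by norm_num
    calc _ ≤ 1 * (n ^ 2 * (√(normSq w) ^ 2 * (K * √(normSq w)))) :=
          mul_le_mul h2 this (norm_nonneg _) zero_le_one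
      _ = _ := by ring
  have hcub' : ∀ w, ‖∑ p, w p * cubicCoeff (cubicTensor L) p w‖ ≤ n ^ 2 * K * √(normSq w) ^ 3 :=
    fun w => by
    rw [sum_mul_cubicCoeff, norm_mul]
    have := norm_sum_sum_mul_le (w := w) fun j k => (norm_fderiv_inl_le (hLd j k) w).2
    have h2 : ‖(1 / 2 : ℂ)‖ ≤ 1 := by norm_num
    calc _ ≤ 1 * (n ^ 2 * (√(normSq w) ^ 2 * (K * √(normSq w)))) :=
          mul_le_mul h2 this (norm_nonneg _) zero_le_one
      _ = _ := by ring
  have hpot : ∀ w, normSq w < δ ^ 2 → ‖diastasis L w - (normSq w + (cubicForm L w +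
      ∑ p, w p * cubicCoeff (cubicTensor L) p w))‖ ≤ n ^ 2 * K * √(normSq w) ^ 4 := by
    intro w hw
    have := norm_diastasis_sub_le hL (w := w) (by linarith [hwρ w hw]) (normSq w) (cubicForm L w)
      (∑ p, w p * cubicCoeff (cubicTensor L) p w)
      (C := n ^ 2 * (√(normSq w) ^ 2 * (K * √(normSq w) ^ 2))) fun s hs t ht => by
        -- The unit Hessian at the origin produces `|w|²`, its derivative in the first and second
        -- variables produces twice the cubic forms with coefficients `s` and `t`, and the rest is
        -- the second-order Taylor remainder of the Hessian.
        have hsum : (∑ j, ∑ k, w j * conj (w k) *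
            mixedHessian L ((s : ℂ) • w, (t : ℂ) • star w) j k) - (normSq w + 2 * s * cubicForm L w +
            2 * t * ∑ p, w p * cubicCoeff (cubicTensor L) p w) = ∑ j, ∑ k, w j * conj (w k) *
            (mixedHessian L ((s : ℂ) • w, (t : ℂ) • star w) j k - mixedHessian L 0 j k -
            fderiv ℂ (fun q => mixedHessian L q j k) 0 ((s : ℂ) • w, (t : ℂ) • star w)) := by
          simp_rw [mul_sub, Finset.sum_sub_distrib, fderiv_add_prod, mul_add,
            Finset.sum_add_distrib, hL1]
          rw [sum_mul_cubicCoeff, cubicForm, ofReal_normSq, sub_sub, add_assoc]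
          congr 2
          · refine Finset.sum_congr rfl fun j _ => ?_
            simp [Matrix.one_apply]
          · congr 1
            · rw [show (2 : ℂ) * s * (1 / 2 * ∑ j, ∑ k, w j * conj (w k) *
                fderiv ℂ (fun q => mixedHessian L q j k) 0 (w, 0)) = s * ∑ j, ∑ k, w j * conj (w k) *
                fderiv ℂ (fun q => mixedHessian L q j k) 0 (w, 0) by ring]
              simp_rw [Finset.mul_sum]
              exact Finset.sum_congr rfl fun j _ => Finset.sum_congr rfl fun k _ => by ring
            · rw [show (2 : ℂ) * t * (1 / 2 * ∑ j, ∑ k, w j * conj (w k) *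
                fderiv ℂ (fun q => mixedHessian L q j k) 0 (0, star w)) =
                t * ∑ j, ∑ k, w j * conj (w k) *
                fderiv ℂ (fun q => mixedHessian L q j k) 0 (0, star w) by ring]
              simp_rw [Finset.mul_sum]
              exact Finset.sum_congr rfl fun j _ => Finset.sum_congr rfl fun k _ => by ring
        rw [hsum]
        refine norm_sum_sum_mul_le fun j k => ((hLG _ (hq w hw s hs t ht).1 j k).2).trans ?_
        gcongr
        exact (hq w hw s hs t ht).2
    rw [← add_assoc]
    refine this.trans_eq ?_
    ring
  have hball : {w : Fin n → ℂ | normSq w < δ ^ 2} ⊆ ball 0 ρ := fun w hw => by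
    rw [mem_ball_zero_iff]; linarith [hwρ w hw]
  have hdet0 : ∀ w, normSq w < δ ^ 2 → ‖(mixedHessian L (w, star w)).det - 1 -
      (linearForm L w + cubicTrace (cubicTensor L) w)‖ ≤ K * √(normSq w) ^ 2 := fun w hw => by
    have := hLdet _ (hq1 w hw).1
    rw [hL1, Matrix.det_one, ← hj0] at this
    refine this.trans ?_
    gcongr
    exact (hq1 w hw).2
  have hj0le : ∀ w, normSq w < δ ^ 2 →
      ‖linearForm L w + cubicTrace (cubicTensor L) w‖ ≤ 2 * n * K * √(normSq w) := fun w _ =>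
    (norm_add_le _ _).trans (by linarith [hlin w, htr w])
  refine ⟨⟨(continuousOn_diastasis hL.continuousOn).mono hball, ?_, ?_, ?_, ?_, ?_,
    cubicTensor_symm hρ hL, ?_, ?_, ?_, ?_, ?_, ?_⟩, fun w hw => ⟨hdP1 w hw, ?_⟩⟩
  · refine ContinuousOn.mul ?_ ((continuousOn_diastasis hP.continuousOn).mono hball).neg.cexp
    have hGc : ∀ j k, ContinuousOn (fun w => mixedHessian L (w, star w) j k)
        {w | normSq w < δ ^ 2} := fun j k =>
      (differentiableOn_mixedHessian isOpen_ball hL j k).continuousOn.comp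
        (f := fun w => (w, star w)) (by fun_prop)
        fun w hw => ball_subset_ball (by linarith) (hq1 w hw).1
    simp_rw [Matrix.det_apply]
    exact continuousOn_finsetSum _ fun σ _ => (continuousOn_finsetProd _
      fun i _ => hGc (σ i) i).const_smul _
  · unfold cubicForm
    have := fun j k => continuous_fderiv_inl fun q => mixedHessian L q j k
    have hc : ∀ k : Fin n, Continuous fun w : Fin n → ℂ => conj (w k) := fun k =>
      Complex.continuous_conj.comp (continuous_apply k)
    fun_prop
  · unfold linearForm
    exact continuous_finsetSum _ fun p _ => continuous_fderiv_inl _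
  · intro c hc w
    have hcc : c * conj c = 1 := by
      rw [Complex.mul_conj, Complex.normSq_eq_norm_sq, hc]; simp
    simp only [cubicForm, Pi.smul_apply, smul_eq_mul, map_mul, Finset.mul_sum]
    refine Finset.sum_congr rfl fun j _ => Finset.sum_congr rfl fun k _ => ?_
    have := fderiv_add_prod (fun q => mixedHessian L q j k) c 0 w 0
    simp only [zero_smul, zero_mul, add_zero] at this
    rw [this]
    linear_combination (1 / 2 * w j * conj (w k) * c *
      fderiv ℂ (fun q => mixedHessian L q j k) 0 (w, 0)) * hcc
  · intro c hc w
    simp only [linearForm, Finset.mul_sum]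
    refine Finset.sum_congr rfl fun j _ => ?_
    have := fderiv_add_prod (fun q => mixedHessian L q j j) c 0 w 0
    simpa only [zero_smul, zero_mul, add_zero] using this
  · intro w
    refine (hcub w).trans ?_
    have : (n : ℝ) ^ 2 ≤ 8 * (n + 1) ^ 2 := by nlinarith
    gcongr
  · intro w
    refine (hlin w).trans ?_
    rw [← mul_assoc]
    have : (n : ℝ) ≤ 8 * (n + 1) ^ 2 := by nlinarith
    gcongr
  · intro p k l
    refine ((fderiv ℂ _ 0).le_opNorm_of_le (c := 1) ?_).trans ?_
    · simp [Prod.norm_def, Pi.norm_single]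
    · rw [mul_one]
      refine (hLd p k).trans (le_mul_of_one_le_left hK0 ?_)
      nlinarith
  · intro w hw
    refine (hpot w hw).trans ?_
    have : (n : ℝ) ^ 2 ≤ 8 * (n + 1) ^ 2 := by nlinarith
    gcongr
  · intro w hw
    have e1 := hdet0 w hw
    have e2 := hdP w hw
    have e3 := hdP1 w hw
    set r := √(normSq w) with hrdef
    set j₀ := linearForm L w + cubicTrace (cubicTensor L) w with hj₀
    set d := (mixedHessian L (w, star w)).det with hd
    set X := diastasis P w with hX
    have hrδ : r < δ := hr w hw
    have hr0 : 0 ≤ r := Real.sqrt_nonneg _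
    have e4 : ‖1 + j₀‖ ≤ 2 := by
      refine (norm_add_le _ _).trans ?_
      have h5 := hj0le w hw
      have : 2 * n * K * r ≤ 2 * ((n + 1) ^ 2 * K * δ) := by
        calc 2 * n * K * r ≤ 2 * (n + 1) ^ 2 * K * δ := by
              have : (n : ℝ) ≤ (n + 1) ^ 2 := by linarith
              gcongr
          _ = _ := by ring
      rw [norm_one]
      linarith
    have e5 : ‖Complex.exp (-X) - 1‖ ≤ 2 * ‖X‖ := by
      have := Complex.norm_exp_sub_one_le (x := -X) (by rwa [norm_neg])
      rwa [norm_neg] at this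
    have e6 : ‖Complex.exp (-X)‖ ≤ 3 := by
      calc ‖Complex.exp (-X)‖ = ‖(Complex.exp (-X) - 1) + 1‖ := by ring_nf
        _ ≤ _ := (norm_add_le _ _).trans (by rw [norm_one]; linarith)
    -- The diastasis `X` of the potential `P` is `O(|w|²)`, so the factor coming from `P` does not
    -- affect the linear part of the density.
    calc ‖d * Complex.exp (-X) - 1 - j₀‖
        = ‖(d - 1 - j₀) * Complex.exp (-X) + (1 + j₀) * (Complex.exp (-X) - 1)‖ := by ring_nf
      _ ≤ ‖d - 1 - j₀‖ * ‖Complex.exp (-X)‖ + ‖1 + j₀‖ * ‖Complex.exp (-X) - 1‖ := by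
          rw [← norm_mul, ← norm_mul]; exact norm_add_le _ _
      _ ≤ (K * r ^ 2) * 3 + 2 * (2 * (n ^ 2 * K * r ^ 2)) := by
          gcongr
          exact e5.trans (by gcongr)
      _ = (3 + 4 * n ^ 2) * K * r ^ 2 := by ring
      _ ≤ _ := by
          have : 3 + 4 * (n : ℝ) ^ 2 ≤ 8 * (n + 1) ^ 2 := by nlinarith
          gcongr
  · intro w hw
    have e1 := hpot w hw
    have e2 := hcub w
    have e3 := hcub' w
    have hrδ := hr w hw
    have hr2 : √(normSq w) ^ 2 = normSq w := Real.sq_sqrt (normSq_nonneg w)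
    have hr0 : 0 ≤ √(normSq w) := Real.sqrt_nonneg _
    set r := √(normSq w) with hrdef
    have h4 : r ^ 4 ≤ r ^ 3 := pow_le_pow_of_le_one hr0 (by linarith) (by norm_num)
    have h5 : n ^ 2 * K * r ^ 4 ≤ n ^ 2 * K * r ^ 3 := by gcongr
    have h6 : n ^ 2 * K * r ^ 3 ≤ (n + 1) ^ 2 * K * δ * r ^ 2 := by
      calc n ^ 2 * K * r ^ 3 = n ^ 2 * K * r * r ^ 2 := by ring
        _ ≤ _ := by gcongr
    have h7 : (n + 1) ^ 2 * K * δ * r ^ 2 ≤ 1 / 24 * r ^ 2 := by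
      have : (n + 1) ^ 2 * K * δ ≤ 1 / 24 := by linarith
      gcongr
    calc _ = ‖(diastasis L w - (normSq w + (cubicForm L w +
          ∑ p, w p * cubicCoeff (cubicTensor L) p w))) + cubicForm L w +
          ∑ p, w p * cubicCoeff (cubicTensor L) p w‖ := by congr 1; ring
      _ ≤ n ^ 2 * K * r ^ 4 + n ^ 2 * K * r ^ 3 + n ^ 2 * K * r ^ 3 :=
          (norm_add_le _ _).trans (add_le_add ((norm_add_le _ _).trans (add_le_add e1 e2)) e3)
      _ ≤ _ := by linarith
  · have e1 := hdet0 w hw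
    have e2 := hj0le w hw
    have hrδ := hr w hw
    have hr0 : 0 ≤ √(normSq w) := Real.sqrt_nonneg _
    set r := √(normSq w) with hrdef
    have h1 : K * r ^ 2 ≤ (n + 1) ^ 2 * K * δ := by
      calc K * r ^ 2 ≤ ((n + 1) ^ 2 * K) * (δ * 1) := by
            have : K ≤ (n + 1) ^ 2 * K := le_mul_of_one_le_left hK0 (by linarith)
            gcongr
            nlinarith
        _ = _ := by ring
    have h2 : 2 * n * K * r ≤ 2 * ((n + 1) ^ 2 * K * δ) := by
      calc 2 * n * K * r ≤ 2 * (n + 1) ^ 2 * K * δ := by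
            have : (n : ℝ) ≤ (n + 1) ^ 2 := by linarith
            gcongr
        _ = _ := by ring
    calc _ = ‖((mixedHessian L (w, star w)).det - 1 - (linearForm L w +
          cubicTrace (cubicTensor L) w)) + (linearForm L w + cubicTrace (cubicTensor L) w)‖ := by
          congr 1; ring
      _ ≤ K * r ^ 2 + 2 * n * K * r := (norm_add_le _ _).trans (add_le_add e1 e2)
      _ ≤ _ := by linarith

end SeveralVariables

end

noncomputable section

/-! ## The mixed logarithmic Hessian and the curvature -/

namespace SeveralVariables

open Metric Filter Topology

variable {n : ℕ}

/-- The mixed second derivative `∂_u ∂_v log ρ` of a non-vanishing function of two groups of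
variables, in a form that does not involve the logarithm. -/
def logHess (ρ : (Fin n → ℂ) × (Fin n → ℂ) → ℂ) (q : (Fin n → ℂ) × (Fin n → ℂ))
    (u v : Fin n → ℂ) : ℂ :=
  fderiv ℂ (fun p => fderiv ℂ ρ p (0, v) / ρ p) q (u, 0)

/-- Polarization: restricting a holomorphic function of `(u, v)` to `v = z̄` turns `∂/∂z_j` and
`∂/∂z̄_j` into its derivatives in `u_j` and `v_j`. -/
theorem dz_comp_star {F : (Fin n → ℂ) × (Fin n → ℂ) → ℂ} {z : Fin n → ℂ}
    (hF : DifferentiableAt ℂ F (z, star z)) (j : Fin n) :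
    dz j (fun z => F (z, star z)) z = fderiv ℂ F (z, star z) (Pi.single j 1, 0) ∧
    dzbar j (fun z => F (z, star z)) z = fderiv ℂ F (z, star z) (0, Pi.single j 1) := by
  have h1 : HasFDerivAt (fun z : Fin n → ℂ => (z, star z))
      ((ContinuousLinearMap.id ℝ (Fin n → ℂ)).prod
        ((starL' ℝ : (Fin n → ℂ) ≃L[ℝ] (Fin n → ℂ)) : (Fin n → ℂ) →L[ℝ] (Fin n → ℂ))) z :=
    (hasFDerivAt_id z).prodMk (starL' ℝ : (Fin n → ℂ) ≃L[ℝ] (Fin n → ℂ)).hasFDerivAt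
  have h2 := ((hF.hasFDerivAt.restrictScalars ℝ).comp z h1).fderiv
  have hI : (Pi.single j Complex.I : Fin n → ℂ) = Complex.I • Pi.single j 1 := by
    rw [← Pi.single_smul]; simp
  have hs : ∀ c : ℂ, star (Pi.single j c : Fin n → ℂ) = Pi.single j (conj c) := fun c => by
    ext k
    by_cases h : k = j
    · subst h; simp
    · simp [h]
  have hsplit : ∀ u v : Fin n → ℂ, fderiv ℂ F (z, star z) (u, v) =
      fderiv ℂ F (z, star z) (u, 0) + fderiv ℂ F (z, star z) (0, v) := fun u v => by
    rw [← map_add]; simp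
  have e1 : fderiv ℝ (fun z => F (z, star z)) z (Pi.single j 1) =
      fderiv ℂ F (z, star z) (Pi.single j 1, 0) + fderiv ℂ F (z, star z) (0, Pi.single j 1) := by
    rw [← hsplit]
    refine (congrArg (fun φ => φ (Pi.single j 1)) h2).trans ?_
    simp [hs]
  have e2 : fderiv ℝ (fun z => F (z, star z)) z (Pi.single j Complex.I) =
      Complex.I * fderiv ℂ F (z, star z) (Pi.single j 1, 0) -
        Complex.I * fderiv ℂ F (z, star z) (0, Pi.single j 1) := by
    have e3 : fderiv ℝ (fun z => F (z, star z)) z (Pi.single j Complex.I) =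
        fderiv ℂ F (z, star z) (Complex.I • Pi.single j 1, (-Complex.I) • Pi.single j 1) := by
      refine (congrArg (fun φ => φ (Pi.single j Complex.I)) h2).trans ?_
      have : (-Complex.I) • (Pi.single j 1 : Fin n → ℂ) = star (Pi.single j Complex.I) := by
        rw [hs, ← Pi.single_smul]; simp
      rw [this, ← hI]
      simp
    have h3 : ((Complex.I • Pi.single j 1, 0) : (Fin n → ℂ) × (Fin n → ℂ)) =
        Complex.I • (Pi.single j 1, 0) := by simp
    have h4 : ((0, (-Complex.I) • Pi.single j 1) : (Fin n → ℂ) × (Fin n → ℂ)) =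
        (-Complex.I) • (0, Pi.single j 1) := by simp
    rw [e3, hsplit, h3, h4, map_smul, map_smul, smul_eq_mul, smul_eq_mul]
    ring
  simp only [dz, dzbar, e1, e2]
  constructor
  · linear_combination (-1 / 2 * fderiv ℂ F (z, star z) (Pi.single j 1, 0) +
      1 / 2 * fderiv ℂ F (z, star z) (0, Pi.single j 1)) * Complex.I_mul_I
  · linear_combination (1 / 2 * fderiv ℂ F (z, star z) (Pi.single j 1, 0) -
      1 / 2 * fderiv ℂ F (z, star z) (0, Pi.single j 1)) * Complex.I_mul_I

theorem differentiableAt_logDeriv {ρ : (Fin n → ℂ) × (Fin n → ℂ) → ℂ}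
    {W : Set ((Fin n → ℂ) × (Fin n → ℂ))} (hW : IsOpen W) (hρ : DifferentiableOn ℂ ρ W)
    {q : (Fin n → ℂ) × (Fin n → ℂ)} (hq : q ∈ W) (h0 : ρ q ≠ 0) (v : (Fin n → ℂ) × (Fin n → ℂ)) :
    DifferentiableAt ℂ (fun p => fderiv ℂ ρ p v / ρ p) q := by
  simp_rw [div_eq_mul_inv]
  exact ((differentiableOn_fderiv_apply hW hρ v).differentiableAt (hW.mem_nhds hq)).fun_mul
    ((hρ.differentiableAt (hW.mem_nhds hq)).fun_inv h0)

/-- On the diagonal `v = z̄` the function `ρ` is positive, so the real logarithm agrees there with a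
holomorphic branch and polarization applies to it. -/
theorem dz_dzbar_log {ρ : (Fin n → ℂ) × (Fin n → ℂ) → ℂ} {W : Set ((Fin n → ℂ) × (Fin n → ℂ))}
    (hW : IsOpen W) (hρ : DifferentiableOn ℂ ρ W) {V : Set (Fin n → ℂ)} (hV : IsOpen V)
    (hVW : ∀ z ∈ V, (z, star z) ∈ W) (hpos : ∀ z ∈ V, 0 < ρ (z, star z)) {z : Fin n → ℂ}
    (hz : z ∈ V) (j k : Fin n) :
    dz j (dzbar k fun z => (Real.log (ρ (z, star z)).re : ℂ)) z =
      logHess ρ (z, star z) (Pi.single j 1) (Pi.single k 1) := by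
  have hlog : ∀ z ∈ V, (Real.log (ρ (z, star z)).re : ℂ) = Complex.log (ρ (z, star z)) := by
    intro z hz
    obtain ⟨h1, h2⟩ := Complex.pos_iff.1 (hpos z hz)
    rw [Complex.ofReal_log h1.le]
    congr 1
    exact Complex.ext (by simp) (by simpa using h2)
  have hb : ∀ z ∈ V, dzbar k (fun z => (Real.log (ρ (z, star z)).re : ℂ)) z =
      fderiv ℂ ρ (z, star z) (0, Pi.single k 1) / ρ (z, star z) := by
    intro z hz
    have hd := (hρ.differentiableAt (hW.mem_nhds (hVW z hz))).hasFDerivAt.clog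
      (Or.inl (Complex.pos_iff.1 (hpos z hz)).1)
    have heq : (fun z => (Real.log (ρ (z, star z)).re : ℂ)) =ᶠ[𝓝 z]
        fun z => Complex.log (ρ (z, star z)) := by
      filter_upwards [hV.mem_nhds hz] with y hy using hlog y hy
    rw [dzbar, heq.fderiv_eq]
    refine (dz_comp_star (F := fun q => Complex.log (ρ q)) hd.differentiableAt k).2.trans ?_
    rw [hd.fderiv]
    simp [div_eq_inv_mul]
  have heq : (dzbar k fun z => (Real.log (ρ (z, star z)).re : ℂ)) =ᶠ[𝓝 z]
      fun z => fderiv ℂ ρ (z, star z) (0, Pi.single k 1) / ρ (z, star z) := by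
    filter_upwards [hV.mem_nhds hz] with y hy using hb y hy
  rw [dz, heq.fderiv_eq]
  exact (dz_comp_star (F := fun p => fderiv ℂ ρ p (0, Pi.single k 1) / ρ p)
    (differentiableAt_logDeriv hW hρ (hVW z hz) (hpos z hz).ne' _) j).1

/-- The mixed logarithmic Hessian under a change of coordinates and of frames. -/
theorem logHess_comp {ρ ρ' : (Fin n → ℂ) × (Fin n → ℂ) → ℂ}
    {W W' : Set ((Fin n → ℂ) × (Fin n → ℂ))}
    (hW : IsOpen W) (hρ : DifferentiableOn ℂ ρ W) (hW' : IsOpen W') (hρ' : DifferentiableOn ℂ ρ' W')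
    {τ σ : (Fin n → ℂ) → (Fin n → ℂ)} {h k : (Fin n → ℂ) → ℂ}
    {q : (Fin n → ℂ) × (Fin n → ℂ)} (hq' : q ∈ W') (hq : (τ q.1, σ q.2) ∈ W)
    (h0 : ρ (τ q.1, σ q.2) ≠ 0) (hτ : ∀ᶠ x in 𝓝 q.1, DifferentiableAt ℂ τ x)
    (hσ : DifferentiableAt ℂ σ q.2) (hh : ∀ᶠ x in 𝓝 q.1, DifferentiableAt ℂ h x)
    (hk : DifferentiableAt ℂ k q.2) (hh0 : h q.1 ≠ 0) (hk0 : k q.2 ≠ 0)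
    (heq : ∀ᶠ p in 𝓝 q, ρ' p = ρ (τ p.1, σ p.2) * (h p.1 * k p.2)) (u v : Fin n → ℂ) :
    logHess ρ' q u v = logHess ρ (τ q.1, σ q.2) (fderiv ℂ τ q.1 u) (fderiv ℂ σ q.2 v) := by
  obtain ⟨x, y⟩ := q
  simp only at *
  have hτx := hτ.self_of_nhds
  have hTc : ContinuousAt (fun x' => (τ x', σ y)) x :=
    hτx.continuousAt.prodMk continuousAt_const
  have hline : Tendsto (fun x' : Fin n → ℂ => (x', y)) (𝓝 x) (𝓝 (x, y)) :=
    (Continuous.prodMk_left y).tendsto x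
  have hρ0 : ∀ᶠ x' in 𝓝 x, ρ (τ x', σ y) ≠ 0 :=
    ((hρ.differentiableAt (hW.mem_nhds hq)).continuousAt.comp (f := fun x' => (τ x', σ y))
      hTc).eventually_ne h0
  have hmem : ∀ᶠ x' in 𝓝 x, (τ x', σ y) ∈ W := hTc (hW.mem_nhds hq)
  have hh0' : ∀ᶠ x' in 𝓝 x, h x' ≠ 0 := hh.self_of_nhds.continuousAt.eventually_ne hh0
  -- The logarithmic derivative in the second variable is additive: `h` is constant in that
  -- variable, and `k` contributes a term independent of `x'`, which the derivative in the first
  -- variable kills.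
  have hslice : ∀ᶠ x' in 𝓝 x, fderiv ℂ ρ' (x', y) (0, v) / ρ' (x', y) =
      fderiv ℂ ρ (τ x', σ y) (0, fderiv ℂ σ y v) / ρ (τ x', σ y) + fderiv ℂ k y v / k y := by
    filter_upwards [hρ0, hmem, hh0', hτ, hh, hline.eventually heq.eventually_nhds]
      with x' h1 h2 h3 h4 h5 h6
    have hT : HasFDerivAt (fun p : (Fin n → ℂ) × (Fin n → ℂ) => (τ p.1, σ p.2))
        (((fderiv ℂ τ x').comp (ContinuousLinearMap.fst ℂ _ _)).prod
          ((fderiv ℂ σ y).comp (ContinuousLinearMap.snd ℂ _ _))) (x', y) :=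
      (h4.hasFDerivAt.comp (x', y) hasFDerivAt_fst).prodMk
        (hσ.hasFDerivAt.comp (x', y) hasFDerivAt_snd)
    have hA := (hρ.differentiableAt (hW.mem_nhds h2)).hasFDerivAt.comp (x', y) hT
    have hB : HasFDerivAt (fun p : (Fin n → ℂ) × (Fin n → ℂ) => h p.1 * k p.2) _ (x', y) :=
      (h5.hasFDerivAt.comp (x', y) hasFDerivAt_fst).mul
        (hk.hasFDerivAt.comp (x', y) hasFDerivAt_snd)
    have hC := ((hA.mul hB).congr_of_eventuallyEq h6).fderiv
    rw [hC, h6.self_of_nhds]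
    simp
    field_simp
    ring
  have hd' : DifferentiableAt ℂ (fun p => fderiv ℂ ρ' p (0, v) / ρ' p) (x, y) := by
    refine differentiableAt_logDeriv hW' hρ' hq' ?_ _
    rw [heq.self_of_nhds]
    exact mul_ne_zero h0 (mul_ne_zero hh0 hk0)
  have hd := differentiableAt_logDeriv hW hρ hq h0 (0, fderiv ℂ σ y v)
  have e1 : HasFDerivAt (fun x' => fderiv ℂ ρ' (x', y) (0, v) / ρ' (x', y))
      ((fderiv ℂ (fun p => fderiv ℂ ρ' p (0, v) / ρ' p) (x, y)).comp
        (ContinuousLinearMap.inl ℂ _ _)) x :=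
    hd'.hasFDerivAt.comp (f := fun x' => (x', y)) x (hasFDerivAt_prodMk_left x y)
  have e2 : HasFDerivAt (fun x' => fderiv ℂ ρ (τ x', σ y) (0, fderiv ℂ σ y v) / ρ (τ x', σ y) +
      fderiv ℂ k y v / k y) ((fderiv ℂ (fun p => fderiv ℂ ρ p (0, fderiv ℂ σ y v) / ρ p)
        (τ x, σ y)).comp ((fderiv ℂ τ x).prod 0)) x :=
    (hd.hasFDerivAt.comp x (hτx.hasFDerivAt.prodMk (hasFDerivAt_const (σ y) x))).add_const _
  have e3 := (e2.congr_of_eventuallyEq hslice).unique e1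
  have := congrArg (fun φ => φ u) e3
  simpa [logHess] using this.symm

theorem mixedHessian_clog {ρ : (Fin n → ℂ) × (Fin n → ℂ) → ℂ}
    {W : Set ((Fin n → ℂ) × (Fin n → ℂ))} (hW : IsOpen W) (hρ : DifferentiableOn ℂ ρ W)
    (hs : ∀ q ∈ W, ρ q ∈ Complex.slitPlane) {q : (Fin n → ℂ) × (Fin n → ℂ)} (hq : q ∈ W)
    (j k : Fin n) : mixedHessian (fun p => Complex.log (ρ p)) q j k =
      logHess ρ q (Pi.single j 1) (Pi.single k 1) := by
  simp only [mixedHessian, Matrix.of_apply, logHess]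
  congr 1
  refine Filter.EventuallyEq.fderiv_eq ?_
  filter_upwards [hW.mem_nhds hq] with p hp
  rw [((hρ.differentiableAt (hW.mem_nhds hp)).hasFDerivAt.clog (hs p hp)).fderiv]
  simp [div_eq_inv_mul]

theorem logHess_eq_sum {ρ : (Fin n → ℂ) × (Fin n → ℂ) → ℂ} {W : Set ((Fin n → ℂ) × (Fin n → ℂ))}
    (hW : IsOpen W) (hρ : DifferentiableOn ℂ ρ W) {q : (Fin n → ℂ) × (Fin n → ℂ)} (hq : q ∈ W)
    (h0 : ρ q ≠ 0) (u v : Fin n → ℂ) : logHess ρ q u v =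
      ∑ j, ∑ k, u j * v k * logHess ρ q (Pi.single j 1) (Pi.single k 1) := by
  have h1 : (fun p => fderiv ℂ ρ p (0, v) / ρ p) =
      fun p => ∑ k, v k • (fderiv ℂ ρ p (0, Pi.single k 1) / ρ p) := by
    ext p
    rw [sum_smul_single_inr v, map_sum, Finset.sum_div]
    simp_rw [map_smul, smul_eq_mul, mul_div_assoc]
  have h2 : ∀ k : Fin n, DifferentiableAt ℂ (fun p => fderiv ℂ ρ p (0, Pi.single k 1) / ρ p) q :=
    fun k => differentiableAt_logDeriv hW hρ hq h0 _
  rw [logHess, h1, fderiv_fun_sum fun k _ => (h2 k).fun_const_smul (v k), sum_smul_single_inl u,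
    map_sum]
  refine Finset.sum_congr rfl fun j _ => ?_
  rw [map_smul, sum_apply, Finset.smul_sum]
  refine Finset.sum_congr rfl fun k _ => ?_
  rw [fderiv_fun_const_smul (h2 k)]
  simp [logHess, mul_assoc]

end SeveralVariables

end

noncomputable section

/-! ## Local representatives -/

namespace LineBundle

variable {X : Type*} [TopologicalSpace X] {ι : Type*} {Z : VectorBundleCore ℂ X ℂ ι}

theorem frameFactor_change {i j : ι} {x : X} (hi : x ∈ Z.baseSet i) (hj : x ∈ Z.baseSet j) :
    frameFactor Z j x = transitionFn Z i j x * frameFactor Z i x :=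
  (trans_mul Z (Z.indexAt x) i j ⟨⟨Z.mem_baseSet_at x, hi⟩, hj⟩).symm

theorem frameFactor_ne_zero {i : ι} {x : X} (hi : x ∈ Z.baseSet i) : frameFactor Z i x ≠ 0 := by
  have h := trans_mul Z (Z.indexAt x) i (Z.indexAt x)
    ⟨⟨Z.mem_baseSet_at x, hi⟩, Z.mem_baseSet_at x⟩
  rw [trans_self Z _ (Z.mem_baseSet_at x)] at h
  exact right_ne_zero_of_mul_eq_one h

theorem transitionFn_ne_zero {i j : ι} {x : X} (hi : x ∈ Z.baseSet i) (hj : x ∈ Z.baseSet j) :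
    transitionFn Z i j x ≠ 0 := by
  have h := trans_mul Z i j i ⟨⟨hi, hj⟩, hi⟩
  rw [trans_self Z _ hi] at h
  exact right_ne_zero_of_mul_eq_one h

variable {n : ℕ} [ChartedSpace (Fin n → ℂ) X]

/-- The part of the chart at `a` over which the frame `i` is defined. -/
def frameDomain (n : ℕ) {X : Type*} [TopologicalSpace X] [ChartedSpace (Fin n → ℂ) X] {ι : Type*}
    (Z : VectorBundleCore ℂ X ℂ ι) (a : X) (i : ι) : Set (Fin n → ℂ) :=
  {z | z ∈ (chartAt (Fin n → ℂ) a).target ∧ (chartAt (Fin n → ℂ) a).symm z ∈ Z.baseSet i}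

theorem isOpen_frameDomain (a : X) (i : ι) : IsOpen (frameDomain n Z a i) :=
  (chartAt (Fin n → ℂ) a).symm.isOpen_inter_preimage (Z.isOpen_baseSet i)

/-- The domain of a local representative of a Hermitian algebraic function. -/
def frameDomainProd (n : ℕ) {X : Type*} [TopologicalSpace X] [ChartedSpace (Fin n → ℂ) X]
    {ι : Type*} (Z : VectorBundleCore ℂ X ℂ ι) (a b : X) (i j : ι) : Set ((Fin n → ℂ) × (Fin n → ℂ)) :=
  {p | p.1 ∈ frameDomain n Z a i ∧ star p.2 ∈ frameDomain n Z b j}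

theorem isOpen_frameDomainProd (a b : X) (i j : ι) : IsOpen (frameDomainProd n Z a b i j) :=
  ((isOpen_frameDomain a i).preimage continuous_fst).inter
    ((isOpen_frameDomain b j).preimage (continuous_star.comp continuous_snd))

theorem mem_frameDomainProd_star {a : X} {i : ι} {z : Fin n → ℂ} (hz : z ∈ frameDomain n Z a i) :
    (z, star z) ∈ frameDomainProd n Z a a i i := ⟨hz, by simpa using hz⟩

theorem mem_frameDomain_chart {a x : X} {i : ι} (hx : x ∈ (chartAt (Fin n → ℂ) a).source)
    (hi : x ∈ Z.baseSet i) : chartAt (Fin n → ℂ) a x ∈ frameDomain n Z a i :=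
  ⟨(chartAt (Fin n → ℂ) a).map_source hx, by rwa [(chartAt (Fin n → ℂ) a).left_inv hx]⟩

theorem differentiableOn_transitionFn [IsManifold 𝓘(ℂ, Fin n → ℂ) ω X]
    [Z.IsContMDiff 𝓘(ℂ, Fin n → ℂ) ω] (a : X) (i j : ι) :
    DifferentiableOn ℂ (fun z => transitionFn Z i j ((chartAt (Fin n → ℂ) a).symm z))
      (frameDomain n Z a i ∩ frameDomain n Z a j) := by
  have h := (contMDiffOn_trans (n := n) Z i j).comp
    ((contMDiffOn_chart_symm (I := 𝓘(ℂ, Fin n → ℂ)) (n := ω) (x := a)).mono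
      (t := frameDomain n Z a i ∩ frameDomain n Z a j) fun z hz => hz.1.1)
    fun z hz => ⟨hz.1.2, hz.2.2⟩
  exact (contMDiffOn_iff_contDiffOn.1 h).differentiableOn (by simp)

end LineBundle

open LineBundle

namespace HermitianAlgebraic

open SeveralVariables Filter Topology

variable {n : ℕ} {X : Type*} [TopologicalSpace X] [ChartedSpace (Fin n → ℂ) X] {ι : Type*}
  {Z : VectorBundleCore ℂ X ℂ ι}

/-- The local representative of a Hermitian algebraic function in charts and frames. -/
def localRep (Q : HermitianAlgebraic n Z) (a b : X) (i j : ι) (p : (Fin n → ℂ) × (Fin n → ℂ)) : ℂ :=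
  frameFactor Z i ((chartAt (Fin n → ℂ) a).symm p.1) *
    conj (frameFactor Z j ((chartAt (Fin n → ℂ) b).symm (star p.2))) *
    Q.toFun ((chartAt (Fin n → ℂ) a).symm p.1) ((chartAt (Fin n → ℂ) b).symm (star p.2))

theorem differentiableOn_localRep (Q : HermitianAlgebraic n Z) (a b : X) (i j : ι) :
    DifferentiableOn ℂ (Q.localRep a b i j) (frameDomainProd n Z a b i j) := Q.holomorphic i j a b

theorem IsPositive.toFun_pos {Q : HermitianAlgebraic n Z} (hQ : Q.IsPositive) (x : X) :
    0 < Q.toFun x x := by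
  have h := hQ ⟨x, (1 : ℂ)⟩ (one_ne_zero (α := ℂ))
  simp only [onDual, coord, map_one, mul_one] at h
  refine Complex.pos_iff.2 ⟨h, ?_⟩
  exact (Complex.conj_eq_iff_im.1 (Q.hermitian x x).symm).symm

theorem IsPositive.mul {ι' : Type*} {Z' : VectorBundleCore ℂ X ℂ ι'} {Q : HermitianAlgebraic n Z}
    {Q' : HermitianAlgebraic n Z'} (hQ : Q.IsPositive) (hQ' : Q'.IsPositive) :
    (Q.mul Q').IsPositive := by
  intro v hv
  have hv' : coord (dual (tensor Z Z')) v.snd ≠ 0 := hv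
  have h : (Q.mul Q').onDual v v = Q.toFun v.proj v.proj * Q'.toFun v.proj v.proj *
      (coord (dual (tensor Z Z')) v.snd * conj (coord (dual (tensor Z Z')) v.snd)) := by
    simp only [onDual, HermitianAlgebraic.mul]; ring
  rw [h, Complex.mul_conj]
  have hp := mul_pos (mul_pos (hQ.toFun_pos v.proj) (hQ'.toFun_pos v.proj))
    (Complex.zero_lt_real.2 (Complex.normSq_pos.2 hv'))
  exact (Complex.pos_iff.1 hp).1

theorem IsPositive.pow {Q : HermitianAlgebraic n Z} (hQ : Q.IsPositive) (m : ℕ) :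
    (Q.pow m).IsPositive := by
  intro v hv
  have hv' : coord (dual (tpow Z m)) v.snd ≠ 0 := hv
  have h : (Q.pow m).onDual v v = Q.toFun v.proj v.proj ^ m *
      (coord (dual (tpow Z m)) v.snd * conj (coord (dual (tpow Z m)) v.snd)) := by
    simp only [onDual, HermitianAlgebraic.pow]; ring
  rw [h, Complex.mul_conj]
  have hp := mul_pos (pow_pos (hQ.toFun_pos v.proj) m)
    (Complex.zero_lt_real.2 (Complex.normSq_pos.2 hv'))
  exact (Complex.pos_iff.1 hp).1

theorem localRep_star {Q : HermitianAlgebraic n Z} (a : X) (i : ι) (z : Fin n → ℂ) :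
    Q.localRep a a i i (z, star z) =
      (‖frameFactor Z i ((chartAt (Fin n → ℂ) a).symm z)‖ ^ 2 : ℝ) *
        Q.toFun ((chartAt (Fin n → ℂ) a).symm z) ((chartAt (Fin n → ℂ) a).symm z) := by
  simp only [localRep, star_star]
  rw [Complex.mul_conj, Complex.normSq_eq_norm_sq]

theorem IsPositive.localRep_pos {Q : HermitianAlgebraic n Z} (hQ : Q.IsPositive) {a : X} {i : ι}
    {z : Fin n → ℂ} (hz : z ∈ frameDomain n Z a i) : 0 < Q.localRep a a i i (z, star z) := by
  rw [localRep_star]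
  have h0 : 0 < ‖frameFactor Z i ((chartAt (Fin n → ℂ) a).symm z)‖ ^ 2 :=
    pow_pos (norm_pos_iff.2 (frameFactor_ne_zero hz.2)) 2
  exact mul_pos (Complex.zero_lt_real.2 h0) (hQ.toFun_pos _)

theorem logMetric_eq (Q : HermitianAlgebraic n Z) (a : X) (i : ι) (z : Fin n → ℂ) :
    Q.logMetric i ((chartAt (Fin n → ℂ) a).symm z) =
      Real.log (Q.localRep a a i i (z, star z)).re := by
  have : Q.metric ((chartAt (Fin n → ℂ) a).symm z) (dualFrame Z i _) (dualFrame Z i _) =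
      Q.localRep a a i i (z, star z) := by
    simp only [metric, onDual, dualFrame, coord, localRep, star_star]
    ring
  rw [logMetric, this]

/-- A change of frame multiplies the local representative by a function of the first variable times
a function of the second, which `logHess` does not see. The frame attached to the point in
`curvature` may thus be replaced by one fixed on a neighbourhood. -/
theorem neg_curvature_apply [IsManifold 𝓘(ℂ, Fin n → ℂ) ω X] [Z.IsContMDiff 𝓘(ℂ, Fin n → ℂ) ω]
    {Q : HermitianAlgebraic n Z} (hQ : Q.IsPositive) {a : X} {i : ι} {z : Fin n → ℂ}
    (hz : z ∈ frameDomain n Z a i) (j k : Fin n) :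
    (-Q.curvature a z) j k =
      logHess (Q.localRep a a i i) (z, star z) (Pi.single j 1) (Pi.single k 1) := by
  set i₀ := Z.indexAt ((chartAt (Fin n → ℂ) a).symm z) with hi₀
  have hz₀ : z ∈ frameDomain n Z a i₀ := ⟨hz.1, Z.mem_baseSet_at _⟩
  have h1 : (-Q.curvature a z) j k =
      logHess (Q.localRep a a i₀ i₀) (z, star z) (Pi.single j 1) (Pi.single k 1) := by
    rw [← dz_dzbar_log (isOpen_frameDomainProd a a i₀ i₀) (Q.differentiableOn_localRep a a i₀ i₀)
      (isOpen_frameDomain a i₀) (fun z hz => mem_frameDomainProd_star hz)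
      (fun z hz => hQ.localRep_pos hz) hz₀]
    simp only [curvature, Matrix.neg_apply, Matrix.of_apply, neg_neg]
    simp_rw [logMetric_eq]
    rfl
  have hd : ∀ x ∈ frameDomain n Z a i ∩ frameDomain n Z a i₀, DifferentiableAt ℂ
      (fun z => transitionFn Z i i₀ ((chartAt (Fin n → ℂ) a).symm z)) x := fun x hx =>
    (differentiableOn_transitionFn a i i₀).differentiableAt
      (((isOpen_frameDomain a i).inter (isOpen_frameDomain a i₀)).mem_nhds hx)
  have hk0 := transitionFn_ne_zero hz.2 hz₀.2
  rw [h1, logHess_comp (ρ := Q.localRep a a i i) (τ := id) (σ := id)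
    (h := fun z => transitionFn Z i i₀ ((chartAt (Fin n → ℂ) a).symm z))
    (k := star ∘ (fun z => transitionFn Z i i₀ ((chartAt (Fin n → ℂ) a).symm z)) ∘ star)
    (isOpen_frameDomainProd a a i i) (Q.differentiableOn_localRep a a i i)
    (isOpen_frameDomainProd a a i₀ i₀) (Q.differentiableOn_localRep a a i₀ i₀)
    (mem_frameDomainProd_star hz₀) (mem_frameDomainProd_star hz) (hQ.localRep_pos hz).ne'
    (Eventually.of_forall fun _ => differentiableAt_id) differentiableAt_id ?_
    (hd z ⟨hz, hz₀⟩).star_star hk0 (by simpa using hk0) ?_]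
  · simp
  · filter_upwards [((isOpen_frameDomain a i).inter (isOpen_frameDomain a i₀)).mem_nhds
      ⟨hz, hz₀⟩] with x hx using hd x hx
  · filter_upwards [((isOpen_frameDomainProd a a i i).inter
      (isOpen_frameDomainProd a a i₀ i₀)).mem_nhds
      ⟨mem_frameDomainProd_star hz, mem_frameDomainProd_star hz₀⟩] with p hp
    simp only [localRep, id, Function.comp, Complex.star_def]
    rw [frameFactor_change hp.1.1.2 hp.2.1.2, frameFactor_change hp.1.2.2 hp.2.2.2, map_mul]
    ring

theorem differentiableAt_transition [IsManifold 𝓘(ℂ, Fin n → ℂ) ω X] (a b : X) {z : Fin n → ℂ}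
    (hz : z ∈ (chartAt (Fin n → ℂ) a).target)
    (hb : (chartAt (Fin n → ℂ) a).symm z ∈ (chartAt (Fin n → ℂ) b).source) :
    DifferentiableAt ℂ (fun z => chartAt (Fin n → ℂ) b ((chartAt (Fin n → ℂ) a).symm z)) z := by
  have ho := (chartAt (Fin n → ℂ) a).symm.isOpen_inter_preimage
    (chartAt (Fin n → ℂ) b).open_source
  have h := (contMDiffOn_chart (I := 𝓘(ℂ, Fin n → ℂ)) (n := ω) (x := b)).comp
    ((contMDiffOn_chart_symm (I := 𝓘(ℂ, Fin n → ℂ)) (n := ω) (x := a)).mono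
      (t := (chartAt (Fin n → ℂ) a).symm.source ∩ (chartAt (Fin n → ℂ) a).symm ⁻¹'
        (chartAt (Fin n → ℂ) b).source) fun z hz => hz.1) fun z hz => hz.2
  exact ((contMDiffOn_iff_contDiffOn.1 h).differentiableOn (by simp)).differentiableAt
    (ho.mem_nhds ⟨hz, hb⟩)

/-- With `T` the complex Jacobian matrix of the transition, the curvature matrices are related by
`Tᵀ (·) T̄`. The determinant acquires `|det T|²`, which is the real Jacobian determinant of a
holomorphic map. -/
theorem det_neg_curvature_transition [IsManifold 𝓘(ℂ, Fin n → ℂ) ω X]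
    [Z.IsContMDiff 𝓘(ℂ, Fin n → ℂ) ω] {Q : HermitianAlgebraic n Z} (hQ : Q.IsPositive) (a b : X)
    {z : Fin n → ℂ} (hz : z ∈ (chartAt (Fin n → ℂ) a).target)
    (hb : (chartAt (Fin n → ℂ) a).symm z ∈ (chartAt (Fin n → ℂ) b).source) :
    (-Q.curvature a z).det =
      (|((fderiv ℂ (fun z => chartAt (Fin n → ℂ) b ((chartAt (Fin n → ℂ) a).symm z)) z).restrictScalars
        ℝ).det| : ℝ) *
      (-Q.curvature b (chartAt (Fin n → ℂ) b ((chartAt (Fin n → ℂ) a).symm z))).det := by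
  set τ : (Fin n → ℂ) → (Fin n → ℂ) :=
    fun z => chartAt (Fin n → ℂ) b ((chartAt (Fin n → ℂ) a).symm z) with hτ
  set i := Z.indexAt ((chartAt (Fin n → ℂ) a).symm z) with hi
  have hza : z ∈ frameDomain n Z a i := ⟨hz, Z.mem_baseSet_at _⟩
  have hzb : τ z ∈ frameDomain n Z b i := mem_frameDomain_chart hb (Z.mem_baseSet_at _)
  have ho := (chartAt (Fin n → ℂ) a).symm.isOpen_inter_preimage
    (chartAt (Fin n → ℂ) b).open_source
  have hd := differentiableAt_transition a b hz hb
  have hstar : (τ z, (star ∘ τ ∘ star) (star z)) = (τ z, star (τ z)) := by simp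
  have hfs : fderiv ℂ (star ∘ τ ∘ star) (star z) = _ := hd.hasFDerivAt.star_star.fderiv
  have hmemb : (τ z, (star ∘ τ ∘ star) (star z)) ∈ frameDomainProd n Z b b i i := by
    rw [hstar]; exact mem_frameDomainProd_star hzb
  have hne : Q.localRep b b i i (τ z, (star ∘ τ ∘ star) (star z)) ≠ 0 := by
    rw [hstar]; exact (hQ.localRep_pos hzb).ne'
  have hcomp := fun u v => logHess_comp (u := u) (v := v) (ρ := Q.localRep b b i i)
    (ρ' := Q.localRep a a i i) (τ := τ) (σ := star ∘ τ ∘ star) (h := fun _ => 1) (k := fun _ => 1)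
    (q := (z, star z))
    (isOpen_frameDomainProd b b i i) (Q.differentiableOn_localRep b b i i)
    (isOpen_frameDomainProd a a i i) (Q.differentiableOn_localRep a a i i)
    (mem_frameDomainProd_star hza) hmemb hne
    (by filter_upwards [ho.mem_nhds ⟨hz, hb⟩] with x hx using
      differentiableAt_transition a b hx.1 hx.2) hd.star_star
    (Eventually.of_forall fun _ => differentiableAt_const _) (differentiableAt_const _)
    one_ne_zero one_ne_zero
    (by
      have hev : ∀ᶠ p : (Fin n → ℂ) × (Fin n → ℂ) in 𝓝 (z, star z),
          (chartAt (Fin n → ℂ) a).symm p.1 ∈ (chartAt (Fin n → ℂ) b).source ∧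
          (chartAt (Fin n → ℂ) a).symm (star p.2) ∈ (chartAt (Fin n → ℂ) b).source := by
        filter_upwards [(ho.preimage continuous_fst).inter
          (ho.preimage (continuous_star.comp continuous_snd)) |>.mem_nhds
          ⟨⟨hz, hb⟩, (by simpa using (⟨hz, hb⟩ : _ ∧ _))⟩] with p hp using ⟨hp.1.2, hp.2.2⟩
      filter_upwards [hev] with p hp
      simp only [localRep, hτ, Function.comp, star_star, mul_one]
      rw [(chartAt (Fin n → ℂ) b).left_inv hp.1, (chartAt (Fin n → ℂ) b).left_inv hp.2])
  set T : Matrix (Fin n) (Fin n) ℂ := LinearMap.toMatrix' (fderiv ℂ τ z).toLinearMap with hT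
  have hTapp : ∀ l j, T l j = fderiv ℂ τ z (Pi.single j 1) l := fun l j => by
    simp [hT, LinearMap.toMatrix'_apply, ← Pi.single_apply]
  have hmat : -Q.curvature a z = T.transpose * (-Q.curvature b (τ z)) * T.map conj := by
    ext j k
    rw [neg_curvature_apply hQ hza, hcomp, hfs]
    simp only [hstar]
    rw [logHess_eq_sum (isOpen_frameDomainProd b b i i) (Q.differentiableOn_localRep b b i i)
      (mem_frameDomainProd_star hzb) (hQ.localRep_pos hzb).ne', Matrix.mul_apply]
    simp_rw [Matrix.mul_apply, Finset.sum_mul]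
    rw [Finset.sum_comm]
    refine Finset.sum_congr rfl fun p _ => Finset.sum_congr rfl fun l _ => ?_
    have hsk : star (Pi.single k (1 : ℂ)) = (Pi.single k 1 : Fin n → ℂ) := by
      ext l
      by_cases h : l = k
      · subst h; simp
      · simp [h]
    rw [← neg_curvature_apply hQ hzb, Matrix.transpose_apply, Matrix.map_apply, hTapp, hTapp]
    simp [hsk]
    ring
  have hdetT : ((fderiv ℂ τ z).restrictScalars ℝ).det = Complex.normSq T.det := by
    have h1 : ((fderiv ℂ τ z).restrictScalars ℝ).det =
        LinearMap.det ((fderiv ℂ τ z).toLinearMap.restrictScalars ℝ) := rfl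
    rw [h1, LinearMap.det_restrictScalars, Algebra.norm_complex_apply, hT, LinearMap.det_toMatrix']
  have hconj : (T.map conj).det = conj T.det := by
    rw [← RingHom.mapMatrix_apply, ← RingHom.map_det]
  rw [hmat, Matrix.det_mul, Matrix.det_mul, Matrix.det_transpose, hconj, hdetT,
    abs_of_nonneg (Complex.normSq_nonneg _), ← Complex.mul_conj]
  ring

end HermitianAlgebraic

end

noncomputable section

/-! ## The volume form in a chart -/

open LineBundle

theorem ContinuousOn.measurableSet_inter_preimage {α β : Type*} [TopologicalSpace α]
    [MeasurableSpace α] [OpensMeasurableSpace α] [TopologicalSpace β] [MeasurableSpace β]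
    [BorelSpace β] {f : α → β} {U : Set α} (hf : ContinuousOn f U) (hU : MeasurableSet U)
    {S : Set β} (hS : MeasurableSet S) : MeasurableSet (U ∩ f ⁻¹' S) := by
  have h := MeasurableSet.subtype_image hU (hf.domRestrict.measurable hS)
  rwa [show Subtype.val '' (U.domRestrict f ⁻¹' S) = U ∩ f ⁻¹' S by
    ext x
    simp only [mem_image, mem_preimage, domRestrict_apply, Subtype.exists, mem_inter_iff,
      exists_and_right, exists_eq_right, exists_prop]] at h

namespace HermitianAlgebraic

open SeveralVariables Filter Topology

section Density

variable {n : ℕ} {X : Type*} [TopologicalSpace X] [ChartedSpace (Fin n → ℂ) X] {ι : Type*}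
  {Z : VectorBundleCore ℂ X ℂ ι}

/-- The density of the volume form in a chart. -/
def density (Q : HermitianAlgebraic n Z) (a : X) (z : Fin n → ℂ) : ℝ := (-Q.curvature a z).det.re

theorem IsSGCS.density_pos {Q : HermitianAlgebraic n Z} (hQ : Q.IsSGCS) {a : X} {z : Fin n → ℂ}
    (hz : z ∈ (chartAt (Fin n → ℂ) a).target) : 0 < Q.density a z :=
  (Complex.pos_iff.1 (hQ.curvature_neg a z hz).det_pos).1

theorem IsSGCS.ofReal_density {Q : HermitianAlgebraic n Z} (hQ : Q.IsSGCS) {a : X} {z : Fin n → ℂ}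
    (hz : z ∈ (chartAt (Fin n → ℂ) a).target) : (Q.density a z : ℂ) = (-Q.curvature a z).det :=
  (Complex.eq_re_of_ofReal_le (hQ.curvature_neg a z hz).det_pos.le).symm

variable [IsManifold 𝓘(ℂ, Fin n → ℂ) ω X] [Z.IsContMDiff 𝓘(ℂ, Fin n → ℂ) ω]

theorem continuousOn_neg_curvature {Q : HermitianAlgebraic n Z} (hQ : Q.IsPositive) (a : X) :
    ContinuousOn (fun z => -Q.curvature a z) (chartAt (Fin n → ℂ) a).target := by
  intro z hz
  refine ContinuousAt.continuousWithinAt ?_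
  refine continuousAt_pi.2 fun j => continuousAt_pi.2 fun k => ?_
  set i := Z.indexAt ((chartAt (Fin n → ℂ) a).symm z)
  have hza : z ∈ frameDomain n Z a i := ⟨hz, Z.mem_baseSet_at _⟩
  have hev : (fun z => logHess (Q.localRep a a i i) (z, star z) (Pi.single j 1) (Pi.single k 1))
      =ᶠ[𝓝 z] fun z => (-Q.curvature a z) j k := by
    filter_upwards [(isOpen_frameDomain a i).mem_nhds hza] with y hy
    rw [neg_curvature_apply hQ hy]
  refine ContinuousAt.congr ?_ hev
  have hW : IsOpen (frameDomainProd n Z a a i i ∩ Q.localRep a a i i ⁻¹' {0}ᶜ) :=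
    (Q.differentiableOn_localRep a a i i).continuousOn.isOpen_inter_preimage
      (isOpen_frameDomainProd a a i i) isOpen_compl_singleton
  have hd : DifferentiableOn ℂ (fun p => fderiv ℂ (Q.localRep a a i i) p (0, Pi.single k 1) /
      Q.localRep a a i i p) (frameDomainProd n Z a a i i ∩ Q.localRep a a i i ⁻¹' {0}ᶜ) := by
    exact fun p hp => (differentiableAt_logDeriv (isOpen_frameDomainProd a a i i)
      (Q.differentiableOn_localRep a a i i) hp.1 hp.2 _).differentiableWithinAt
  have hc := (continuousOn_fderiv hW hd).clm_apply
    (continuousOn_const (c := ((Pi.single j 1, 0) : (Fin n → ℂ) × (Fin n → ℂ))))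
  have hz' : (z, star z) ∈ frameDomainProd n Z a a i i ∩ Q.localRep a a i i ⁻¹' {0}ᶜ :=
    ⟨mem_frameDomainProd_star hza, (hQ.localRep_pos hza).ne'⟩
  exact ContinuousAt.comp (f := fun z : Fin n → ℂ => (z, star z)) (x := z)
    (hc.continuousAt (hW.mem_nhds hz')) (by fun_prop)

theorem continuousOn_density {Q : HermitianAlgebraic n Z} (hQ : Q.IsPositive) (a : X) :
    ContinuousOn (Q.density a) (chartAt (Fin n → ℂ) a).target :=
  Complex.continuous_re.comp_continuousOn
    ((Continuous.matrix_det continuous_id).comp_continuousOn (continuousOn_neg_curvature hQ a))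

theorem aemeasurable_ofReal_density {Q : HermitianAlgebraic n Z} (hQ : Q.IsPositive) (a : X) :
    AEMeasurable (fun z => ENNReal.ofReal (Q.density a z))
      (volume.restrict (chartAt (Fin n → ℂ) a).target) :=
  ((continuousOn_density hQ a).aemeasurable
    (chartAt (Fin n → ℂ) a).open_target.measurableSet).ennreal_ofReal

theorem ofReal_density_transition {Q : HermitianAlgebraic n Z} (hQ : Q.IsPositive) (a b : X)
    {z : Fin n → ℂ} (hz : z ∈ (chartAt (Fin n → ℂ) a).target)
    (hb : (chartAt (Fin n → ℂ) a).symm z ∈ (chartAt (Fin n → ℂ) b).source) :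
    ENNReal.ofReal (Q.density a z) = ENNReal.ofReal
      |((fderiv ℂ (fun z => chartAt (Fin n → ℂ) b ((chartAt (Fin n → ℂ) a).symm z)) z).restrictScalars
        ℝ).det| *
      ENNReal.ofReal (Q.density b (chartAt (Fin n → ℂ) b ((chartAt (Fin n → ℂ) a).symm z))) := by
  rw [← ENNReal.ofReal_mul (abs_nonneg _), density, density,
    det_neg_curvature_transition hQ a b hz hb, Complex.re_ofReal_mul]

end Density

section Volume

variable {n : ℕ} {X : Type*} [TopologicalSpace X] [ChartedSpace (Fin n → ℂ) X] {ι : Type*}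
  {Z : VectorBundleCore ℂ X ℂ ι}

theorem _root_.measurableSet_coverPiece [CompactSpace X] [MeasurableSpace X] [BorelSpace X]
    (i : Fin (coverCard n X)) : MeasurableSet (coverPiece n X i) := by
  have : coverPiece n X i = (chartAt (Fin n → ℂ) (coverPt n X i)).source ∩
      ⋂ j, ⋂ (_ : j < i), (chartAt (Fin n → ℂ) (coverPt n X j)).sourceᶜ := by
    ext x; simp [coverPiece]
  rw [this]
  exact (chartAt (Fin n → ℂ) (coverPt n X i)).open_source.measurableSet.inter
    (MeasurableSet.iInter fun j => MeasurableSet.iInter fun _ =>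
      (chartAt (Fin n → ℂ) (coverPt n X j)).open_source.measurableSet.compl)

theorem _root_.iUnion_coverPiece [CompactSpace X] : ⋃ i, coverPiece n X i = univ := by
  classical
  refine eq_univ_of_forall fun x => ?_
  have hx := (exists_chart_cover n X).choose_spec.choose_spec x
  have hne : (Finset.univ.filter fun i : Fin (coverCard n X) =>
      x ∈ (chartAt (Fin n → ℂ) (coverPt n X i)).source).Nonempty := by
    obtain ⟨i, hi⟩ := hx
    exact ⟨i, Finset.mem_filter.2 ⟨Finset.mem_univ _, hi⟩⟩
  refine mem_iUnion.2 ⟨Finset.min' _ hne, (Finset.mem_filter.1 (Finset.min'_mem _ hne)).2, ?_⟩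
  intro j hj hxj
  exact (Finset.min'_le _ j (Finset.mem_filter.2 ⟨Finset.mem_univ _, hxj⟩)).not_gt hj

theorem _root_.pairwise_disjoint_coverPiece [CompactSpace X] :
    Pairwise (Function.onFun Disjoint (coverPiece n X)) := by
  intro i j hij
  refine disjoint_left.2 fun x hi hj => ?_
  rcases lt_or_gt_of_ne hij with h | h
  · exact hj.2 i h hi.1
  · exact hi.2 j h hj.1

variable [MeasurableSpace X] [BorelSpace X]

theorem measurableSet_chart_target_inter (a : X) {S : Set X} (hS : MeasurableSet S) :
    MeasurableSet ((chartAt (Fin n → ℂ) a).target ∩ (chartAt (Fin n → ℂ) a).symm ⁻¹' S) :=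
  (chartAt (Fin n → ℂ) a).continuousOn_symm.measurableSet_inter_preimage
    (chartAt (Fin n → ℂ) a).open_target.measurableSet hS

variable [IsManifold 𝓘(ℂ, Fin n → ℂ) ω X] [Z.IsContMDiff 𝓘(ℂ, Fin n → ℂ) ω]

theorem lintegral_density_transition {Q : HermitianAlgebraic n Z} (hQ : Q.IsPositive) (a b : X)
    {S : Set X} (hS : MeasurableSet S) (ha : S ⊆ (chartAt (Fin n → ℂ) a).source)
    (hb : S ⊆ (chartAt (Fin n → ℂ) b).source) :
    ∫⁻ z in (chartAt (Fin n → ℂ) b).target ∩ (chartAt (Fin n → ℂ) b).symm ⁻¹' S,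
        ENNReal.ofReal (Q.density b z) =
      ∫⁻ z in (chartAt (Fin n → ℂ) a).target ∩ (chartAt (Fin n → ℂ) a).symm ⁻¹' S,
        ENNReal.ofReal (Q.density a z) := by
  have himg : (chartAt (Fin n → ℂ) b).target ∩ (chartAt (Fin n → ℂ) b).symm ⁻¹' S =
      (fun z => chartAt (Fin n → ℂ) b ((chartAt (Fin n → ℂ) a).symm z)) ''
        ((chartAt (Fin n → ℂ) a).target ∩ (chartAt (Fin n → ℂ) a).symm ⁻¹' S) := by
    rw [← (chartAt (Fin n → ℂ) a).image_eq_target_inter_inv_preimage ha,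
      ← (chartAt (Fin n → ℂ) b).image_eq_target_inter_inv_preimage hb, image_image]
    refine image_congr fun x hx => ?_
    rw [(chartAt (Fin n → ℂ) a).left_inv (ha hx)]
  have hinj : InjOn (fun z => chartAt (Fin n → ℂ) b ((chartAt (Fin n → ℂ) a).symm z))
      ((chartAt (Fin n → ℂ) a).target ∩ (chartAt (Fin n → ℂ) a).symm ⁻¹' S) := by
    intro z hz w hw h
    have := (chartAt (Fin n → ℂ) b).injOn (hb hz.2) (hb hw.2) h
    exact (chartAt (Fin n → ℂ) a).symm.injOn hz.1 hw.1 this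
  rw [himg, lintegral_image_eq_lintegral_abs_det_fderiv_mul volume
    (measurableSet_chart_target_inter a hS) (fun z hz =>
      ((differentiableAt_transition a b hz.1 (hb hz.2)).hasFDerivAt.restrictScalars
        ℝ).hasFDerivWithinAt) hinj]
  refine setLIntegral_congr_fun (measurableSet_chart_target_inter a hS) fun z hz => ?_
  exact (ofReal_density_transition hQ a b hz.1 (hb hz.2)).symm

variable [CompactSpace X]

/-- Independence of the chosen cover: `S` is cut along the pieces of the partition and each part is
carried to the chart at `a` by the transformation law of the density. -/
theorem volumeMeasure_apply {Q : HermitianAlgebraic n Z} (hQ : Q.IsPositive) (a : X)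
    {S : Set X} (hS : MeasurableSet S) (ha : S ⊆ (chartAt (Fin n → ℂ) a).source) :
    Q.volumeMeasure S =
      ∫⁻ z in (chartAt (Fin n → ℂ) a).target ∩ (chartAt (Fin n → ℂ) a).symm ⁻¹' S,
        ENNReal.ofReal (Q.density a z) := by
  have hSi : ∀ i, MeasurableSet (coverPiece n X i ∩ S) := fun i =>
    (measurableSet_coverPiece i).inter hS
  have hS' : (chartAt (Fin n → ℂ) a).target ∩ (chartAt (Fin n → ℂ) a).symm ⁻¹' S =
      ⋃ i, ((chartAt (Fin n → ℂ) a).target ∩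
        (chartAt (Fin n → ℂ) a).symm ⁻¹' (coverPiece n X i ∩ S)) := by
    rw [← inter_iUnion, ← preimage_iUnion, ← iUnion_inter, iUnion_coverPiece, univ_inter]
  rw [hS', lintegral_iUnion (fun i => measurableSet_chart_target_inter a (hSi i)) ?_,
    volumeMeasure, Measure.sum_apply _ hS]
  · refine tsum_congr fun i => ?_
    rw [← lintegral_density_transition hQ a (coverPt n X i) (hSi i)
      (inter_subset_right.trans ha) (inter_subset_left.trans fun x hx => hx.1)]
    have hA : chartAt (Fin n → ℂ) (coverPt n X i) '' coverPiece n X i =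
        (chartAt (Fin n → ℂ) (coverPt n X i)).target ∩
          (chartAt (Fin n → ℂ) (coverPt n X i)).symm ⁻¹' coverPiece n X i :=
      (chartAt (Fin n → ℂ) (coverPt n X i)).image_eq_target_inter_inv_preimage fun x hx => hx.1
    have hAm := measurableSet_chart_target_inter (n := n) (coverPt n X i)
      (measurableSet_coverPiece (n := n) (X := X) i)
    rw [hA, Measure.map_apply_of_aemeasurable _ hS, Measure.restrict_apply' hAm,
      withDensity_apply']
    · congr 2
      ext z
      simp only [mem_inter_iff, mem_preimage]
      tauto
    · exact ((chartAt (Fin n → ℂ) (coverPt n X i)).continuousOn_symm.mono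
        inter_subset_left).aemeasurable hAm
  · intro i j hij
    refine disjoint_left.2 fun z hi hj => ?_
    exact disjoint_left.1 (pairwise_disjoint_coverPiece (n := n) (X := X) hij) hi.2.1 hj.2.1

/-- The density is bounded on compact subsets of a chart, so the measure is locally finite, hence
finite on the compact `X`. -/
theorem isFiniteMeasure_volumeMeasure {Q : HermitianAlgebraic n Z} (hQ : Q.IsPositive) :
    IsFiniteMeasure Q.volumeMeasure := by
  have : IsLocallyFiniteMeasure Q.volumeMeasure := by
    refine ⟨fun x => ?_⟩
    obtain ⟨K, hK, hKx, hKc⟩ := local_compact_nhds ((chartAt (Fin n → ℂ) x).open_target.mem_nhds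
      (mem_chart_target (Fin n → ℂ) x))
    refine ⟨(chartAt (Fin n → ℂ) x).source ∩ chartAt (Fin n → ℂ) x ⁻¹' interior K, ?_, ?_⟩
    · exact ((chartAt (Fin n → ℂ) x).isOpen_inter_preimage isOpen_interior).mem_nhds
        ⟨mem_chart_source _ x, mem_interior_iff_mem_nhds.2 hK⟩
    · rw [volumeMeasure_apply hQ x ((chartAt (Fin n → ℂ) x).isOpen_inter_preimage
        isOpen_interior).measurableSet inter_subset_left]
      have hsub : (chartAt (Fin n → ℂ) x).target ∩ (chartAt (Fin n → ℂ) x).symm ⁻¹'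
          ((chartAt (Fin n → ℂ) x).source ∩ chartAt (Fin n → ℂ) x ⁻¹' interior K) ⊆ K := by
        intro z hz
        have := hz.2.2
        rw [mem_preimage, (chartAt (Fin n → ℂ) x).right_inv hz.1] at this
        exact interior_subset this
      refine (lintegral_mono_set hsub).trans_lt ?_
      obtain ⟨c, hc⟩ := hKc.exists_bound_of_continuousOn ((continuousOn_density hQ x).mono hKx)
      refine (setLIntegral_mono' hKc.measurableSet (g := fun _ => ENNReal.ofReal c)
        fun z hz => ENNReal.ofReal_le_ofReal ((le_abs_self _).trans (hc z hz))).trans_lt ?_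
      rw [setLIntegral_const]
      exact ENNReal.mul_lt_top ENNReal.ofReal_lt_top hKc.measure_lt_top
  infer_instance

theorem isOpenPosMeasure_volumeMeasure {Q : HermitianAlgebraic n Z} (hQ : Q.IsPositive)
    (hS : Q.IsSGCS) : Q.volumeMeasure.IsOpenPosMeasure := by
  refine ⟨fun U hU ⟨x, hx⟩ h0 => ?_⟩
  have ho : IsOpen (U ∩ (chartAt (Fin n → ℂ) x).source) :=
    hU.inter (chartAt (Fin n → ℂ) x).open_source
  have h1 := measure_mono_null (inter_subset_left (t := (chartAt (Fin n → ℂ) x).source)) h0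
  have hT : IsOpen ((chartAt (Fin n → ℂ) x).target ∩ (chartAt (Fin n → ℂ) x).symm ⁻¹'
      (U ∩ (chartAt (Fin n → ℂ) x).source)) :=
    (chartAt (Fin n → ℂ) x).symm.isOpen_inter_preimage ho
  rw [volumeMeasure_apply hQ x ho.measurableSet inter_subset_right,
    setLIntegral_eq_zero_iff' hT.measurableSet
      ((aemeasurable_ofReal_density hQ x).mono_set inter_subset_left)] at h1
  have h2 : volume ((chartAt (Fin n → ℂ) x).target ∩ (chartAt (Fin n → ℂ) x).symm ⁻¹'
      (U ∩ (chartAt (Fin n → ℂ) x).source)) = 0 := by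
    refine measure_mono_null (fun z hz => ?_) (ae_iff.1 h1)
    rw [Set.mem_ofPred_eq, Classical.not_imp]
    exact ⟨hz, (ENNReal.ofReal_pos.2 (hS.density_pos hz.1)).ne'⟩
  refine (hT.measure_pos volume ⟨chartAt (Fin n → ℂ) x x, mem_chart_target _ x, ?_⟩).ne' h2
  rw [mem_preimage, (chartAt (Fin n → ℂ) x).left_inv (mem_chart_source _ x)]
  exact ⟨hx, mem_chart_source _ x⟩

end Volume

end HermitianAlgebraic

end

noncomputable section

/-! ## Sections in local frames -/

namespace LineBundle

variable {n : ℕ} {X : Type*} [TopologicalSpace X] [ChartedSpace (Fin n → ℂ) X] {ι : Type*}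
  {Z : VectorBundleCore ℂ X ℂ ι}

theorem contMDiffOn_section_iff [IsManifold 𝓘(ℂ, Fin n → ℂ) ω X]
    [Z.IsContMDiff 𝓘(ℂ, Fin n → ℂ) ω] (i : ι) (s : ∀ x, Z.Fiber x) :
    ContMDiffOn 𝓘(ℂ, Fin n → ℂ) (𝓘(ℂ, Fin n → ℂ).prod 𝓘(ℂ, ℂ)) ω
        (fun x => TotalSpace.mk' ℂ x (s x)) (Z.baseSet i) ↔
      ContMDiffOn 𝓘(ℂ, Fin n → ℂ) 𝓘(ℂ, ℂ) ω (fun x => frameFactor Z i x * coord Z (s x))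
        (Z.baseSet i) := by
  have : MemTrivializationAtlas (Z.localTriv i) := ⟨⟨i, rfl⟩⟩
  refine ((Z.localTriv i).contMDiffOn_section_baseSet_iff (IB := 𝓘(ℂ, Fin n → ℂ)) (n := ω)
    (s := s)).trans ?_
  refine contMDiffOn_congr fun x _ => ?_
  rw [VectorBundleCore.localTriv_apply]
  exact coordChange_apply Z _ _ _ _

theorem contMDiffOn_mul_sval [IsManifold 𝓘(ℂ, Fin n → ℂ) ω X] [Z.IsContMDiff 𝓘(ℂ, Fin n → ℂ) ω]
    (i : ι) (s : Sections n Z) :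
    ContMDiffOn 𝓘(ℂ, Fin n → ℂ) 𝓘(ℂ, ℂ) ω (fun x => frameFactor Z i x * sval s x) (Z.baseSet i) :=
  (contMDiffOn_section_iff i s).1 s.contMDiff.contMDiffOn

theorem differentiableOn_mul_sval [IsManifold 𝓘(ℂ, Fin n → ℂ) ω X]
    [Z.IsContMDiff 𝓘(ℂ, Fin n → ℂ) ω] (a : X) (i : ι) (s : Sections n Z) :
    DifferentiableOn ℂ (fun z => frameFactor Z i ((chartAt (Fin n → ℂ) a).symm z) *
      sval s ((chartAt (Fin n → ℂ) a).symm z)) (frameDomain n Z a i) := by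
  have h := (contMDiffOn_mul_sval i s).comp
    ((contMDiffOn_chart_symm (I := 𝓘(ℂ, Fin n → ℂ)) (n := ω) (x := a)).mono
      (t := frameDomain n Z a i) fun z hz => hz.1) fun z hz => hz.2
  exact (contMDiffOn_iff_contDiffOn.1 h).differentiableOn (by simp)

end LineBundle

open LineBundle

namespace HermitianAlgebraic

open SeveralVariables Filter Topology

variable {n : ℕ} {X : Type*} [TopologicalSpace X] [ChartedSpace (Fin n → ℂ) X] {ι : Type*}
  {Z : VectorBundleCore ℂ X ℂ ι}

theorem continuousOn_mul_toFun (Q : HermitianAlgebraic n Z) (i j : ι) :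
    ContinuousOn (fun p : X × X => frameFactor Z i p.1 * conj (frameFactor Z j p.2) *
      Q.toFun p.1 p.2) (Z.baseSet i ×ˢ Z.baseSet j) := by
  rintro ⟨x, y⟩ ⟨hx, hy⟩
  refine ContinuousAt.continuousWithinAt ?_
  have hmem : (chartAt (Fin n → ℂ) x x, star (chartAt (Fin n → ℂ) y y)) ∈
      frameDomainProd n Z x y i j :=
    ⟨mem_frameDomain_chart (mem_chart_source _ x) hx,
      by simpa using mem_frameDomain_chart (n := n) (mem_chart_source _ y) hy⟩
  have h1 := (Q.differentiableOn_localRep x y i j).continuousOn.continuousAt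
    ((isOpen_frameDomainProd x y i j).mem_nhds hmem)
  have hcx := (chartAt (Fin n → ℂ) x).continuousAt (mem_chart_source _ x)
  have hcy := (chartAt (Fin n → ℂ) y).continuousAt (mem_chart_source _ y)
  have h2 : ContinuousAt (fun p : X × X =>
      (chartAt (Fin n → ℂ) x p.1, star (chartAt (Fin n → ℂ) y p.2))) (x, y) :=
    (hcx.comp (f := Prod.fst) (x := (x, y)) continuousAt_fst).prodMk
      (continuous_star.continuousAt.comp (hcy.comp (f := Prod.snd) (x := (x, y)) continuousAt_snd))
  refine (ContinuousAt.comp (x := (x, y)) (f := fun p : X × X =>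
      (chartAt (Fin n → ℂ) x p.1, star (chartAt (Fin n → ℂ) y p.2))) h1 h2).congr ?_
  filter_upwards [prod_mem_nhds ((chartAt (Fin n → ℂ) x).open_source.mem_nhds (mem_chart_source _ x))
    ((chartAt (Fin n → ℂ) y).open_source.mem_nhds (mem_chart_source _ y))] with p hp
  simp only [Function.comp, localRep, star_star, (chartAt (Fin n → ℂ) x).left_inv hp.1,
    (chartAt (Fin n → ℂ) y).left_inv hp.2]

theorem norm_toFun_comm (Q : HermitianAlgebraic n Z) (x y : X) : ‖Q.toFun y x‖ = ‖Q.toFun x y‖ := by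
  rw [Q.hermitian x y, RCLike.norm_conj]

/-- `|Q(x, ȳ)|² / (Q(x, x̄) Q(y, ȳ))`, a function on `X × X`. -/
def cosSq (Q : HermitianAlgebraic n Z) (x y : X) : ℝ :=
  ‖Q.toFun x y‖ ^ 2 / (‖Q.toFun x x‖ * ‖Q.toFun y y‖)

/-- The pointwise norm of a section. -/
def normAt (Q : HermitianAlgebraic n Z) (s : Sections n Z) (x : X) : ℝ :=
  ‖sval s x‖ / √‖Q.toFun x x‖

/-- The kernel `Q(x, ȳ) / Q(y, ȳ)` applied to `s(y)`. -/
def weighted (Q : HermitianAlgebraic n Z) (s : Sections n Z) (x y : X) : ℂ :=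
  Q.toFun x y * sval s y / Q.toFun y y

theorem cosSq_comm (Q : HermitianAlgebraic n Z) (x y : X) : Q.cosSq x y = Q.cosSq y x := by
  rw [cosSq, cosSq, Q.norm_toFun_comm, mul_comm]

theorem cosSq_nonneg (Q : HermitianAlgebraic n Z) (x y : X) : 0 ≤ Q.cosSq x y := by
  unfold cosSq; positivity

theorem normAt_nonneg (Q : HermitianAlgebraic n Z) (s : Sections n Z) (x : X) :
    0 ≤ Q.normAt s x := by
  unfold normAt; positivity

theorem IsPositive.ofReal_norm {Q : HermitianAlgebraic n Z} (hQ : Q.IsPositive) (x : X) :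
    ((‖Q.toFun x x‖ : ℝ) : ℂ) = Q.toFun x x := Complex.norm_of_nonneg' (hQ.toFun_pos x).le

theorem IsPositive.norm_pos {Q : HermitianAlgebraic n Z} (hQ : Q.IsPositive) (x : X) :
    0 < ‖Q.toFun x x‖ := norm_pos_iff.2 (hQ.toFun_pos x).ne'

theorem IsSGCS.cosSq_lt_one {Q : HermitianAlgebraic n Z} (hQ : Q.IsSGCS) (hp : Q.IsPositive)
    {x y : X} (hxy : x ≠ y) : Q.cosSq x y < 1 := by
  have h := hQ.cauchySchwarz ⟨x, (1 : ℂ)⟩ ⟨y, (1 : ℂ)⟩ (one_ne_zero (α := ℂ))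
    (one_ne_zero (α := ℂ)) hxy
  simp only [onDual, coord, map_one, mul_one] at h
  rw [← hp.ofReal_norm x, ← hp.ofReal_norm y, Complex.ofReal_re, Complex.ofReal_re] at h
  rwa [cosSq, div_lt_one (mul_pos (hp.norm_pos x) (hp.norm_pos y))]

theorem cosSq_mul {ι' : Type*} {Z' : VectorBundleCore ℂ X ℂ ι'} (Q : HermitianAlgebraic n Z)
    (Q' : HermitianAlgebraic n Z') (x y : X) :
    (Q.mul Q').cosSq x y = Q.cosSq x y * Q'.cosSq x y := by
  simp only [cosSq, HermitianAlgebraic.mul, norm_mul]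
  rw [div_mul_div_comm]
  congr 1 <;> ring

theorem cosSq_pow (Q : HermitianAlgebraic n Z) (m : ℕ) (x y : X) :
    (Q.pow m).cosSq x y = Q.cosSq x y ^ m := by
  simp only [cosSq, HermitianAlgebraic.pow, norm_pow, div_pow, mul_pow]
  congr 1
  ring

theorem IsPositive.normAt_sq {Q : HermitianAlgebraic n Z} (hQ : Q.IsPositive)
    (s : Sections n Z) (x : X) :
    ((Q.normAt s x ^ 2 : ℝ) : ℂ) = sval s x * conj (sval s x) / Q.toFun x x := by
  rw [Complex.mul_conj, Complex.normSq_eq_norm_sq, ← hQ.ofReal_norm x, ← Complex.ofReal_div, normAt,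
    div_pow, Real.sq_sqrt (norm_nonneg _)]

theorem continuous_of_frames {Y : Type*} [TopologicalSpace Y] {f : X × X → Y}
    (h : ∀ i j, ContinuousOn f (Z.baseSet i ×ˢ Z.baseSet j)) : Continuous f := by
  refine continuous_iff_continuousAt.2 fun p => ?_
  refine (h (Z.indexAt p.1) (Z.indexAt p.2)).continuousAt ?_
  exact ((Z.isOpen_baseSet _).prod (Z.isOpen_baseSet _)).mem_nhds
    ⟨Z.mem_baseSet_at _, Z.mem_baseSet_at _⟩

theorem continuousOn_mul_toFun_self (Q : HermitianAlgebraic n Z) (i : ι) :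
    ContinuousOn (fun x => frameFactor Z i x * conj (frameFactor Z i x) * Q.toFun x x)
      (Z.baseSet i) :=
  (Q.continuousOn_mul_toFun i i).comp (f := fun x => (x, x)) (by fun_prop) fun _ hx => ⟨hx, hx⟩

/-- `toFun` need not be continuous, because the frame `indexAt x` may jump with `x`. In invariant
quotients the frame factors cancel, so continuity can be checked on representatives in fixed frames.
-/
theorem IsPositive.continuous_cosSq {Q : HermitianAlgebraic n Z} (hQ : Q.IsPositive) :
    Continuous fun p : X × X => Q.cosSq p.1 p.2 := by
  refine continuous_of_frames (Z := Z) fun i j => ?_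
  have h1 := (Q.continuousOn_mul_toFun i j).norm.pow 2
  have h2 := ((Q.continuousOn_mul_toFun_self i).norm.comp continuousOn_fst
    (fun p (hp : p ∈ Z.baseSet i ×ˢ Z.baseSet j) => hp.1)).mul
    ((Q.continuousOn_mul_toFun_self j).norm.comp continuousOn_snd
    (fun p (hp : p ∈ Z.baseSet i ×ˢ Z.baseSet j) => hp.2))
  refine (h1.div h2 fun p hp => ?_).congr fun p hp => ?_
  all_goals
    have hi := norm_pos_iff.2 (frameFactor_ne_zero hp.1)
    have hj := norm_pos_iff.2 (frameFactor_ne_zero hp.2)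
    have hx := hQ.norm_pos p.1
    have hy := hQ.norm_pos p.2
    simp only [Function.comp, norm_mul, RCLike.norm_conj, Pi.mul_apply]
  · positivity
  · simp only [cosSq, Pi.div_apply, Pi.pow_apply, Pi.mul_apply, Function.comp, norm_mul,
      RCLike.norm_conj]
    field_simp

variable [IsManifold 𝓘(ℂ, Fin n → ℂ) ω X] [Z.IsContMDiff 𝓘(ℂ, Fin n → ℂ) ω]

theorem IsPositive.continuous_pairing {Q : HermitianAlgebraic n Z} (hQ : Q.IsPositive)
    (s t : Sections n Z) :
    Continuous fun x : X => sval s x * conj (sval t x) / Q.toFun x x := by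
  refine continuous_iff_continuousAt.2 fun x => ?_
  set i := Z.indexAt x
  have hs := (contMDiffOn_mul_sval i s).continuousOn
  have ht := (contMDiffOn_mul_sval i t).continuousOn
  refine ContinuousOn.continuousAt (s := Z.baseSet i) ?_
    ((Z.isOpen_baseSet i).mem_nhds (Z.mem_baseSet_at x))
  refine ((hs.mul (continuous_star.comp_continuousOn ht)).div
    (Q.continuousOn_mul_toFun_self i) fun p hp => ?_).congr fun p hp => ?_
  all_goals
    have hi := frameFactor_ne_zero hp
    have hi' : conj (frameFactor Z i p) ≠ 0 := by simpa using hi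
    have hx := (hQ.toFun_pos p).ne'
  · exact mul_ne_zero (mul_ne_zero hi hi') hx
  · simp only [Function.comp, Pi.mul_apply, Pi.div_apply, Complex.star_def, map_mul]
    field_simp

theorem IsPositive.continuous_normAt {Q : HermitianAlgebraic n Z} (hQ : Q.IsPositive)
    (s : Sections n Z) : Continuous (Q.normAt s) := by
  have h : Q.normAt s = fun x => √(‖sval s x * conj (sval s x) / Q.toFun x x‖) := by
    funext x
    rw [← hQ.normAt_sq, Complex.norm_real, Real.norm_of_nonneg (sq_nonneg _),
      Real.sqrt_sq (Q.normAt_nonneg s x)]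
  rw [h]
  exact Real.continuous_sqrt.comp (hQ.continuous_pairing s s).norm

theorem IsPositive.continuous_weighted {Q : HermitianAlgebraic n Z} (hQ : Q.IsPositive)
    (s : Sections n Z) (x : X) : Continuous (Q.weighted s x) := by
  refine continuous_iff_continuousAt.2 fun y => ?_
  set i := Z.indexAt y
  set j := Z.indexAt x
  have hs := (contMDiffOn_mul_sval i s).continuousOn
  have hq : ContinuousOn (fun y => frameFactor Z j x * conj (frameFactor Z i y) * Q.toFun x y)
      (Z.baseSet i) := (Q.continuousOn_mul_toFun j i).comp (f := fun y => (x, y)) (by fun_prop)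
    fun _ hy => ⟨Z.mem_baseSet_at x, hy⟩
  refine ContinuousOn.continuousAt (s := Z.baseSet i) ?_
    ((Z.isOpen_baseSet i).mem_nhds (Z.mem_baseSet_at y))
  refine (((hq.mul hs).div (Q.continuousOn_mul_toFun_self i) fun p hp => ?_).div_const
    (frameFactor Z j x)).congr fun p hp => ?_
  all_goals
    have hi := frameFactor_ne_zero hp
    have hj : frameFactor Z j x ≠ 0 := frameFactor_ne_zero (Z.mem_baseSet_at x)
    have hi' : conj (frameFactor Z i p) ≠ 0 := by simpa using hi
    have hx := (hQ.toFun_pos p).ne'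
  · exact mul_ne_zero (mul_ne_zero hi hi') hx
  · simp only [Pi.mul_apply, Pi.div_apply, weighted]
    field_simp

/-- The integrand of the kernel form is continuous. -/
theorem IsPositive.continuous_kernel {Q : HermitianAlgebraic n Z} (hQ : Q.IsPositive)
    (s t : Sections n Z) : Continuous fun p : X × X =>
      Q.toFun p.1 p.2 * sval s p.2 * conj (sval t p.1) / (Q.toFun p.1 p.1 * Q.toFun p.2 p.2) := by
  refine continuous_of_frames (Z := Z) fun i j => ?_
  have hs := (contMDiffOn_mul_sval j s).continuousOn.comp continuousOn_snd
    (fun p (hp : p ∈ Z.baseSet i ×ˢ Z.baseSet j) => hp.2)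
  have ht := (continuous_star.comp_continuousOn (contMDiffOn_mul_sval i t).continuousOn).comp
    continuousOn_fst (fun p (hp : p ∈ Z.baseSet i ×ˢ Z.baseSet j) => hp.1)
  have h2 := ((Q.continuousOn_mul_toFun_self i).comp continuousOn_fst
    (fun p (hp : p ∈ Z.baseSet i ×ˢ Z.baseSet j) => hp.1)).mul
    ((Q.continuousOn_mul_toFun_self j).comp continuousOn_snd
    (fun p (hp : p ∈ Z.baseSet i ×ˢ Z.baseSet j) => hp.2))
  refine ((((Q.continuousOn_mul_toFun i j).mul hs).mul ht).div h2 fun p hp => ?_).congr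
    fun p hp => ?_
  all_goals
    have hi := frameFactor_ne_zero hp.1
    have hj := frameFactor_ne_zero hp.2
    have hi' : conj (frameFactor Z i p.1) ≠ 0 := by simpa using hi
    have hj' : conj (frameFactor Z j p.2) ≠ 0 := by simpa using hj
    have hx := (hQ.toFun_pos p.1).ne'
    have hy := (hQ.toFun_pos p.2).ne'
  · exact mul_ne_zero (mul_ne_zero (mul_ne_zero hi hi') hx) (mul_ne_zero (mul_ne_zero hj hj') hy)
  · simp only [Pi.mul_apply, Pi.div_apply, Function.comp, Complex.star_def, map_mul]
    field_simp

end HermitianAlgebraic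

end

noncomputable section

/-! ## The reproducing property of `Q` up to an error -/

open LineBundle

namespace HermitianAlgebraic

open Gaussian Filter Topology

section Pointwise

variable {n : ℕ} {X : Type*} [TopologicalSpace X] [ChartedSpace (Fin n → ℂ) X] {ι : Type*}
  {Z : VectorBundleCore ℂ X ℂ ι}

theorem IsPositive.norm_toFun {Q : HermitianAlgebraic n Z} (hQ : Q.IsPositive) (x y : X) :
    ‖Q.toFun x y‖ = √(Q.cosSq x y) * (√‖Q.toFun x x‖ * √‖Q.toFun y y‖) := by
  have hx := hQ.norm_pos x
  have hy := hQ.norm_pos y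
  rw [cosSq, Real.sqrt_div (sq_nonneg _), Real.sqrt_sq (norm_nonneg _),
    Real.sqrt_mul (norm_nonneg _), div_mul_cancel₀]
  positivity

theorem IsPositive.norm_sval {Q : HermitianAlgebraic n Z} (hQ : Q.IsPositive) (s : Sections n Z)
    (x : X) : ‖sval s x‖ = √‖Q.toFun x x‖ * Q.normAt s x := by
  rw [normAt, mul_div_cancel₀ _ (Real.sqrt_pos.2 (hQ.norm_pos x)).ne']

theorem IsPositive.norm_weighted {Q : HermitianAlgebraic n Z} (hQ : Q.IsPositive)
    (s : Sections n Z) (x y : X) :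
    ‖Q.weighted s x y‖ = √‖Q.toFun x x‖ * (√(Q.cosSq x y) * Q.normAt s y) := by
  have hy := hQ.norm_pos y
  have hy' : √‖Q.toFun y y‖ * √‖Q.toFun y y‖ = ‖Q.toFun y y‖ := Real.mul_self_sqrt hy.le
  rw [weighted, norm_div, norm_mul, hQ.norm_toFun, hQ.norm_sval s y, div_eq_iff hy.ne']
  linear_combination √(Q.cosSq x y) * √‖Q.toFun x x‖ * Q.normAt s y * hy'

theorem IsPositive.ofReal_cosSq {Q : HermitianAlgebraic n Z} (hQ : Q.IsPositive) (x y : X) :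
    (Q.cosSq x y : ℂ) = Q.toFun x y * Q.toFun y x / (Q.toFun x x * Q.toFun y y) := by
  rw [Q.hermitian x y, Complex.mul_conj, Complex.normSq_eq_norm_sq, cosSq, ← hQ.ofReal_norm x,
    ← hQ.ofReal_norm y]
  push_cast
  simp

/-- The decisive factorization: as a function of `y`, the quotient `s(y) / Q(y, x̄)` is holomorphic
near `x`, and the whole non-holomorphic part is the nearly Gaussian weight `cosSq`. -/
theorem IsPositive.weighted_eq {Q : HermitianAlgebraic n Z} (hQ : Q.IsPositive)
    (s : Sections n Z) {x y : X} (h : Q.cosSq x y ≠ 0) :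
    Q.weighted s x y = Q.toFun x x * (sval s y / Q.toFun y x * Q.cosSq x y) := by
  have hx := (hQ.toFun_pos x).ne'
  have hy := (hQ.toFun_pos y).ne'
  have h0 : Q.toFun y x ≠ 0 := by
    intro h0
    exact h (by rw [cosSq, ← Q.norm_toFun_comm, h0]; simp)
  rw [hQ.ofReal_cosSq, weighted]
  field_simp

theorem IsPositive.norm_div_toFun {Q : HermitianAlgebraic n Z} (hQ : Q.IsPositive)
    (s : Sections n Z) {x y : X} (h : 0 < Q.cosSq x y) :
    ‖sval s y / Q.toFun y x‖ = Q.normAt s y / (√‖Q.toFun x x‖ * √(Q.cosSq x y)) := by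
  have hx := Real.sqrt_pos.2 (hQ.norm_pos x)
  have hy := Real.sqrt_pos.2 (hQ.norm_pos y)
  have hc := Real.sqrt_pos.2 h
  rw [norm_div, hQ.norm_sval s y, Q.norm_toFun_comm x y, hQ.norm_toFun x y]
  field_simp

end Pointwise

/-- Since `1/2 = 1/6 + 1/3`, the power `m / 6` is kept for Schur's test and the power `m / 3`, at
most `exp(-ε m / 3)`, provides the gain `1 / m` away from `x`. -/
theorem _root_.Real.sqrt_pow_le_rpow_of_le_exp {r ε : ℝ} (hr0 : 0 ≤ r) (hε : 0 < ε)
    (hr : r ≤ Real.exp (-ε)) {m : ℕ} (hm : 1 ≤ m) :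
    √(r ^ m) ≤ r ^ (m / 6 : ℝ) * (3 / ε / m) := by
  have hm0 : (0 : ℝ) < m := by exact_mod_cast hm
  have h1 : √(r ^ m) = r ^ (m / 6 : ℝ) * r ^ (m / 3 : ℝ) := by
    rw [Real.sqrt_eq_rpow, ← Real.rpow_natCast, ← Real.rpow_mul hr0,
      ← Real.rpow_add_of_nonneg hr0 (by positivity) (by positivity)]
    congr 1
    ring
  rw [h1]
  refine mul_le_mul_of_nonneg_left ?_ (Real.rpow_nonneg hr0 _)
  calc r ^ (m / 3 : ℝ) ≤ Real.exp (-ε) ^ (m / 3 : ℝ) :=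
        Real.rpow_le_rpow hr0 hr (by positivity)
    _ = (Real.exp (ε * m / 3))⁻¹ := by rw [← Real.exp_mul, ← Real.exp_neg]; ring_nf
    _ ≤ (ε * m / 3)⁻¹ := by
        refine inv_anti₀ (by positivity) ?_
        linarith [Real.add_one_le_exp (ε * m / 3)]
    _ = 3 / ε / m := by field_simp

theorem _root_.Gaussian.integrableOn_of_norm_le {n : ℕ} {V : Type*} [NormedAddCommGroup V]
    {g : (Fin n → ℂ) → V} {δ M : ℝ} (hg : ContinuousOn g {w | normSq w < δ ^ 2})
    (hM : ∀ w, normSq w < δ ^ 2 → ‖g w‖ ≤ M) : IntegrableOn g {w | normSq w < δ ^ 2} := by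
  refine IntegrableOn.of_bound ((measure_mono fun w (hw : normSq w < δ ^ 2) => hw.le).trans_lt
    (isCompact_normSq_le (δ ^ 2)).measure_lt_top)
    (hg.aestronglyMeasurable (isOpen_normSq_lt _).measurableSet) M
    (ae_restrict_of_forall_mem (isOpen_normSq_lt _).measurableSet hM)

variable {n : ℕ} {X : Type*} [TopologicalSpace X] [ChartedSpace (Fin n → ℂ) X] {ι ι' : Type*}
  {L : VectorBundleCore ℂ X ℂ ι} {E : VectorBundleCore ℂ X ℂ ι'}
  [CompactSpace X] [MeasurableSpace X]

/-- A parametrization of a neighbourhood of `x` in which the diastasis of `R` at `x` is an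
approximate Gaussian potential. -/
structure IsNormalChart (R : HermitianAlgebraic n L) (P : HermitianAlgebraic n E) (K δ ε : ℝ) (x : X)
    (θ : (Fin n → ℂ) → X) (G : (Fin n → ℂ) → ℝ) : Prop where
  map_zero : θ 0 = x
  continuousOn : ContinuousOn θ {w | normSq w < δ ^ 2}
  continuousOn_density : ContinuousOn G {w | normSq w < δ ^ 2}
  half_le_density : ∀ w, normSq w < δ ^ 2 → 1 / 2 ≤ G w
  density_le_two : ∀ w, normSq w < δ ^ 2 → G w ≤ 2
  measurableSet_image : MeasurableSet (θ '' {w | normSq w < δ ^ 2})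
  restrict_image : R.volumeMeasure.restrict (θ '' {w | normSq w < δ ^ 2}) =
    ((volume.restrict {w | normSq w < δ ^ 2}).withDensity fun w => ENNReal.ofReal (G w)).map θ
  differentiableOn_quotient : ∀ (m : ℕ) (s : Sections n (tensor (tpow L m) E)),
    DifferentiableOn ℂ (fun w => sval s (θ w) / ((R.pow m).mul P).toFun (θ w) x)
      {w | normSq w < δ ^ 2}
  exists_isApproxGaussian : ∃ D J a α h, IsApproxGaussian K δ D J a α h ∧
    ∀ w, normSq w < δ ^ 2 → Complex.exp (-D w) = R.cosSq x (θ w) ∧ J w = G w * P.cosSq x (θ w)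
  exp_le_cosSq : ∀ w, normSq w < δ ^ 2 → Real.exp (-1) ≤ P.cosSq x (θ w)
  cosSq_le_exp : ∀ y ∉ θ '' {w | normSq w < δ ^ 2}, R.cosSq x y ≤ Real.exp (-ε)

namespace IsNormalChart

variable {R : HermitianAlgebraic n L} {P : HermitianAlgebraic n E} {K δ ε : ℝ} {x : X}
  {θ : (Fin n → ℂ) → X} {G : (Fin n → ℂ) → ℝ}

theorem setIntegral_image (hθ : IsNormalChart R P K δ ε x θ G) {V : Type*} [NormedAddCommGroup V]
    [NormedSpace ℝ V] {h : X → V} (hh : AEStronglyMeasurable h R.volumeMeasure)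
    [BorelSpace X] :
    ∫ y in θ '' {w | normSq w < δ ^ 2}, h y ∂(R.volumeMeasure) =
      ∫ w in {w | normSq w < δ ^ 2}, G w • h (θ w) := by
  have hB := (isOpen_normSq_lt (n := n) (δ ^ 2)).measurableSet
  have hae : AEMeasurable θ ((volume.restrict {w | normSq w < δ ^ 2}).withDensity
      fun w => ENNReal.ofReal (G w)) := by
    by_cases hX : Nonempty X
    · exact (hθ.continuousOn.aemeasurable hB).mono_ac (withDensity_absolutelyContinuous _ _)
    · exact (hX ⟨x⟩).elim
  have hh' := hh.restrict (s := θ '' {w | normSq w < δ ^ 2})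
  rw [hθ.restrict_image] at hh' ⊢
  rw [integral_map hae hh', integral_withDensity_eq_integral_toReal_smul₀
    (hθ.continuousOn_density.aemeasurable hB).ennreal_ofReal
    (Eventually.of_forall fun _ => ENNReal.ofReal_lt_top)]
  refine setIntegral_congr_fun hB fun w hw => ?_
  have h0 : 0 ≤ G w := by linarith [hθ.half_le_density w hw]
  simp only [ENNReal.toReal_ofReal h0]

/-- `R.cosSq x (θ w)` is `exp` of minus a diastasis that differs from `|w|²` by at most `|w|² / 8`.
-/
theorem cosSq_mem (hθ : IsNormalChart R P K δ ε x θ G) {w : Fin n → ℂ} (hw : normSq w < δ ^ 2) :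
    Real.exp (-(9 / 8 * normSq w)) ≤ R.cosSq x (θ w) ∧
      R.cosSq x (θ w) ≤ Real.exp (-(7 / 8 * normSq w)) := by
  obtain ⟨D, J, a, α, h, hA, hD⟩ := hθ.exists_isApproxGaussian
  have h1 : R.cosSq x (θ w) = Real.exp (-(D w).re) := by
    rw [← Real.norm_of_nonneg (R.cosSq_nonneg x (θ w)), ← Complex.norm_real, ← (hD w hw).1,
      Complex.norm_exp, Complex.neg_re]
  have h2 := (Complex.abs_re_le_norm _).trans (hA.norm_potential_le w hw)
  rw [Complex.sub_re, Complex.ofReal_re, abs_le] at h2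
  rw [h1]
  constructor <;> apply Real.exp_le_exp.2 <;> linarith

end IsNormalChart

end HermitianAlgebraic

end

/-! ### Pointwise estimates in a normal chart -/

noncomputable section

open LineBundle

namespace HermitianAlgebraic

open Gaussian Filter Topology

variable {n : ℕ} {X : Type*} [TopologicalSpace X] [ChartedSpace (Fin n → ℂ) X] {ι ι' : Type*}
  {L : VectorBundleCore ℂ X ℂ ι} {E : VectorBundleCore ℂ X ℂ ι'}
  [CompactSpace X] [MeasurableSpace X]

namespace IsNormalChart

variable {R : HermitianAlgebraic n L} {P : HermitianAlgebraic n E} {K δ ε : ℝ} {x : X}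
  {θ : (Fin n → ℂ) → X} {G : (Fin n → ℂ) → ℝ}

theorem integrableOn_density_smul (hθ : IsNormalChart R P K δ ε x θ G) {V : Type*}
    [NormedAddCommGroup V] [NormedSpace ℝ V] {h : X → V} (hh : Continuous h) {c : (Fin n → ℂ) → ℝ}
    (hc : Continuous c) (hc1 : ∀ w, |c w| ≤ 1) :
    IntegrableOn (fun w => c w • G w • h (θ w)) {w | normSq w < δ ^ 2} := by
  obtain ⟨M, hM⟩ := isCompact_univ.exists_bound_of_continuousOn hh.continuousOn
  refine integrableOn_of_norm_le (M := 1 * (2 * M)) (hc.continuousOn.smul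
    (hθ.continuousOn_density.smul (hh.comp_continuousOn hθ.continuousOn))) fun w hw => ?_
  rw [norm_smul, norm_smul]
  have h1 := hθ.half_le_density w hw
  have h2 := hθ.density_le_two w hw
  have h3 := hM (θ w) (mem_univ _)
  refine mul_le_mul (hc1 w) ?_ (by positivity) zero_le_one
  refine mul_le_mul ?_ h3 (norm_nonneg _) (by norm_num)
  rw [Real.norm_of_nonneg (by linarith)]
  exact h2

/-- The row bound for Schur's test. In the normal chart the kernel is below a Gaussian of rate `7m /
48 = (7/8)(m/6)`, whose integral is of order `m⁻ⁿ`; outside it is exponentially small in `m`, hence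
also of that order. -/
theorem integral_cosSq_le [BorelSpace X] [IsManifold 𝓘(ℂ, Fin n → ℂ) ω X]
    [L.IsContMDiff 𝓘(ℂ, Fin n → ℂ) ω] (hR : R.IsPositive)
    (P : HermitianAlgebraic n E) (K δ : ℝ) (hε : 0 < ε) :
    ∃ C, 0 ≤ C ∧ ∀ (x : X) (θ : (Fin n → ℂ) → X) (G : (Fin n → ℂ) → ℝ),
      IsNormalChart R P K δ ε x θ G → ∀ m : ℕ, 1 ≤ m →
        ∫ y, R.cosSq x y ^ (m / 6 : ℝ) ∂(R.volumeMeasure) ≤ C / m ^ n := by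
  have := isFiniteMeasure_volumeMeasure hR
  set V := R.volumeMeasure.real univ with hV
  refine ⟨2 * (Real.pi / (7 / 48)) ^ n + V * (n.factorial * (6 / ε) ^ n),
    by positivity, fun x θ G hθ m hm => ?_⟩
  have hm0 : (0 : ℝ) < m := by exact_mod_cast hm
  have hB := (isOpen_normSq_lt (n := n) (δ ^ 2)).measurableSet
  have hcont : Continuous fun y => R.cosSq x y ^ (m / 6 : ℝ) :=
    (hR.continuous_cosSq.comp (f := fun y => (x, y)) (by fun_prop)).rpow_const
      fun y => Or.inr (by positivity)
  have hint : Integrable (fun y => R.cosSq x y ^ (m / 6 : ℝ)) R.volumeMeasure :=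
    hcont.integrable_of_hasCompactSupport (HasCompactSupport.of_compactSpace _)
  rw [← integral_add_compl hθ.measurableSet_image hint,
    hθ.setIntegral_image hcont.aestronglyMeasurable, add_div]
  refine add_le_add ?_ ?_
  · have hg := integrable_exp_neg_mul_normSq (n := n) (b := 7 / 48 * m) (by positivity)
    have h1 : IntegrableOn (fun w => G w • R.cosSq x (θ w) ^ (m / 6 : ℝ))
        {w | normSq w < δ ^ 2} := by
      simpa using hθ.integrableOn_density_smul hcont (continuous_const (y := (1 : ℝ)))
        (by simp)
    calc ∫ w in {w | normSq w < δ ^ 2}, G w • R.cosSq x (θ w) ^ (m / 6 : ℝ)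
        ≤ ∫ w in {w | normSq w < δ ^ 2}, 2 * Real.exp (-(7 / 48 * m) * normSq w) := by
          refine setIntegral_mono_on h1 (hg.const_mul 2).integrableOn hB fun w hw => ?_
          have hG := hθ.half_le_density w hw
          have hc := (hθ.cosSq_mem hw).2
          refine mul_le_mul (hθ.density_le_two w hw) ?_ (Real.rpow_nonneg (R.cosSq_nonneg _ _) _)
            (by norm_num)
          refine (Real.rpow_le_rpow (R.cosSq_nonneg _ _) hc (by positivity)).trans_eq ?_
          rw [← Real.exp_mul]
          ring_nf
      _ ≤ ∫ w : Fin n → ℂ, 2 * Real.exp (-(7 / 48 * m) * normSq w) :=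
          setIntegral_le_integral (hg.const_mul 2)
            (Eventually.of_forall fun w => by dsimp only [Pi.zero_apply]; positivity)
      _ = 2 * (Real.pi / (7 / 48)) ^ n / m ^ n := by
          rw [integral_const_mul, integral_exp_neg_mul_normSq (by positivity), ← div_div, div_pow,
            mul_div_assoc]
  · have hle : ∀ y ∈ (θ '' {w | normSq w < δ ^ 2})ᶜ,
        ‖R.cosSq x y ^ (m / 6 : ℝ)‖ ≤ n.factorial * (6 / ε) ^ n / m ^ n := by
      intro y hy
      rw [Real.norm_of_nonneg (Real.rpow_nonneg (R.cosSq_nonneg _ _) _)]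
      calc R.cosSq x y ^ (m / 6 : ℝ) ≤ Real.exp (-ε) ^ (m / 6 : ℝ) :=
            Real.rpow_le_rpow (R.cosSq_nonneg _ _) (hθ.cosSq_le_exp y hy) (by positivity)
        _ = (Real.exp (ε * m / 6))⁻¹ := by rw [← Real.exp_mul, ← Real.exp_neg]; ring_nf
        _ ≤ ((ε * m / 6) ^ n / n.factorial)⁻¹ :=
            inv_anti₀ (by positivity) (Real.pow_div_factorial_le_exp _ (by positivity) n)
        _ = n.factorial * (6 / ε) ^ n / m ^ n := by
            rw [inv_div, div_eq_div_iff (by positivity) (by positivity), mul_assoc, ← mul_pow]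
            congr 2
            field_simp
    refine (le_abs_self _).trans ((norm_setIntegral_le_of_norm_le_const
      (measure_lt_top _ _) hle).trans ?_)
    rw [mul_comm, mul_div_assoc V]
    exact mul_le_mul_of_nonneg_right 
      (measureReal_mono (subset_univ _) (measure_ne_top R.volumeMeasure _)) (by positivity)

/-- The exponents are tuned by `(9/8)(1/6 + 1/2) = 3/4`: the decay `exp(-(3/4) m |w|²)` left over in
the Gaussian estimates is bounded by the product of `R.cosSq ^ (m/6)` and the factor `√(R.cosSq ^
m)` that converts the holomorphic quotient into the pointwise norm of `s`. -/
theorem norm_quotient_mul_exp_le (hθ : IsNormalChart R P K δ ε x θ G) (hR : R.IsPositive)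
    (hP : P.IsPositive) (m : ℕ) (s : Sections n (tensor (tpow L m) E)) {w : Fin n → ℂ}
    (hw : normSq w < δ ^ 2) :
    ‖sval s (θ w) / ((R.pow m).mul P).toFun (θ w) x‖ * Real.exp (-(3 / 4 * m) * normSq w) ≤
      Real.exp 1 / √‖((R.pow m).mul P).toFun x x‖ *
        (R.cosSq x (θ w) ^ (m / 6 : ℝ) * ((R.pow m).mul P).normAt s (θ w)) := by
  have hQ := (hR.pow m).mul hP
  have hc := (hθ.cosSq_mem hw).1
  have hr : 0 < R.cosSq x (θ w) := (Real.exp_pos _).trans_le hc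
  have hp := hθ.exp_le_cosSq w hw
  have hp0 : 0 < P.cosSq x (θ w) := (Real.exp_pos _).trans_le hp
  have hcos : ((R.pow m).mul P).cosSq x (θ w) = R.cosSq x (θ w) ^ m * P.cosSq x (θ w) := by
    rw [cosSq_mul, cosSq_pow]
  have hpos : 0 < ((R.pow m).mul P).cosSq x (θ w) := by rw [hcos]; positivity
  have hx := Real.sqrt_pos.2 (hQ.norm_pos x)
  rw [hQ.norm_div_toFun s hpos, hcos, Real.sqrt_mul (by positivity)]
  have h1 : Real.exp (-(3 / 4 * m) * normSq w) ≤
      R.cosSq x (θ w) ^ (m / 6 : ℝ) * √(R.cosSq x (θ w) ^ m) := by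
    rw [Real.sqrt_eq_rpow, ← Real.rpow_natCast, ← Real.rpow_mul hr.le, ← Real.rpow_add hr]
    calc Real.exp (-(3 / 4 * m) * normSq w) =
          Real.exp (-(9 / 8 * normSq w)) ^ (m / 6 + m * (1 / 2) : ℝ) := by
          rw [← Real.exp_mul]; ring_nf
      _ ≤ _ := Real.rpow_le_rpow (Real.exp_pos _).le hc (by positivity)
  have h2 : 1 ≤ Real.exp 1 * √(P.cosSq x (θ w)) := by
    have h3 : 1 ≤ √(Real.exp 1 ^ 2 * P.cosSq x (θ w)) := Real.one_le_sqrt.2 ?_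
    · rwa [Real.sqrt_mul (by positivity), Real.sqrt_sq (Real.exp_pos 1).le] at h3
    calc (1 : ℝ) ≤ Real.exp 1 ^ 2 * Real.exp (-1) := by
          rw [← Real.exp_nat_mul, ← Real.exp_add]; norm_num
      _ ≤ _ := mul_le_mul_of_nonneg_left hp (by positivity)
  have hN := ((R.pow m).mul P).normAt_nonneg s (θ w)
  set N := ((R.pow m).mul P).normAt s (θ w)
  set u := √(R.cosSq x (θ w) ^ m)
  have hu : 0 < u := Real.sqrt_pos.2 (by positivity)
  set v := √(P.cosSq x (θ w))
  have hv : 0 < v := Real.sqrt_pos.2 hp0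
  set c := √‖((R.pow m).mul P).toFun x x‖
  have hT : 0 ≤ R.cosSq x (θ w) ^ (m / 6 : ℝ) := Real.rpow_nonneg hr.le _
  set T := R.cosSq x (θ w) ^ (m / 6 : ℝ)
  calc N / (c * (u * v)) * Real.exp (-(3 / 4 * m) * normSq w)
      ≤ N / (c * (u * v)) * (T * u * (Real.exp 1 * v)) := by
        refine mul_le_mul_of_nonneg_left (h1.trans ?_) (by positivity)
        exact le_mul_of_one_le_right (by positivity) h2
    _ = Real.exp 1 / c * (T * N) := by field_simp

/-- The integral splits into the part outside the normal chart, the part inside it weighted by `1 -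
χ`, and the part weighted by the cut-off `χ`. The first two are small because `R.cosSq` is bounded
by `exp(-ε')` there; the third is `Q(x, x̄)` times a model integral for the holomorphic function `s
/ Q(·, x̄)`. -/
theorem norm_integral_weighted_sub_le [BorelSpace X] [IsManifold 𝓘(ℂ, Fin n → ℂ) ω X]
    [L.IsContMDiff 𝓘(ℂ, Fin n → ℂ) ω] [E.IsContMDiff 𝓘(ℂ, Fin n → ℂ) ω]
    (hR : R.IsPositive) (hP : P.IsPositive) (hK : 0 ≤ K) (hδ : 0 < δ) (hδ1 : δ ≤ 1)
    (hε : 0 < ε) :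
    ∃ C, 0 ≤ C ∧ ∀ (x : X) (θ : (Fin n → ℂ) → X) (G : (Fin n → ℂ) → ℝ),
      IsNormalChart R P K δ ε x θ G → ∀ m : ℕ, 1 ≤ m → ∀ s : Sections n (tensor (tpow L m) E),
      ‖(∫ y, ((R.pow m).mul P).weighted s x y ∂(R.volumeMeasure)) -
          ((Real.pi / m) ^ n : ℝ) * sval s x‖ ≤
        √‖((R.pow m).mul P).toFun x x‖ *
          (C / m * (∫ y, R.cosSq x y ^ (m / 6 : ℝ) * ((R.pow m).mul P).normAt s y
            ∂(R.volumeMeasure)) + C / m * (Real.pi / m) ^ n * ((R.pow m).mul P).normAt s x) := by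
  have := isFiniteMeasure_volumeMeasure hR
  obtain ⟨C₀, hC₀, hmain⟩ := exists_norm_integral_sub_le n hK hδ hδ1
  obtain ⟨b, hb⟩ := isCompact_univ.exists_bound_of_continuousOn
    (hP.continuous_cosSq (X := X)).continuousOn
  have hb' : ∀ x y : X, P.cosSq x y ≤ |b| := fun x y =>
    (le_abs_self _).trans ((hb (x, y) (mem_univ _)).trans (le_abs_self _))
  -- The second entry serves the region where `1 - χ` is not zero: there `|w|² > δ² / 4`, so
  -- `R.cosSq ≤ exp(-(7/8) δ² / 4)`.
  set ε' := min ε (7 / 8 * (δ ^ 2 / 4)) with hε'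
  have hε'0 : 0 < ε' := lt_min hε (by positivity)
  set C₁ := √|b| * (3 / ε') with hC₁
  have hC₁0 : 0 ≤ C₁ := by positivity
  refine ⟨C₀ * (2 * Real.exp 1) + C₀ + 2 * C₁, by positivity, fun x θ G hθ m hm s => ?_⟩
  have hm0 : (0 : ℝ) < m := by exact_mod_cast hm
  have hB := (isOpen_normSq_lt (n := n) (δ ^ 2)).measurableSet
  set Q := (R.pow m).mul P with hQdef
  have hQ : Q.IsPositive := (hR.pow m).mul hP
  set c := √‖Q.toFun x x‖ with hcdef
  have hc0 : 0 < c := Real.sqrt_pos.2 (hQ.norm_pos x)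
  have hcc : c * c = ‖Q.toFun x x‖ := Real.mul_self_sqrt (norm_nonneg _)
  set H : X → ℝ := fun y => R.cosSq x y ^ (m / 6 : ℝ) * Q.normAt s y with hH
  have hH0 : ∀ y, 0 ≤ H y := fun y =>
    mul_nonneg (Real.rpow_nonneg (R.cosSq_nonneg _ _) _) (Q.normAt_nonneg s y)
  have hHc : Continuous H :=
    ((hR.continuous_cosSq.comp (f := fun y => (x, y)) (by fun_prop)).rpow_const
      fun y => Or.inr (by positivity)).mul (hQ.continuous_normAt s)
  have hHi : Integrable H R.volumeMeasure :=
    hHc.integrable_of_hasCompactSupport (HasCompactSupport.of_compactSpace _)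
  have hFc : Continuous (Q.weighted s x) := hQ.continuous_weighted s x
  have hFi : Integrable (Q.weighted s x) R.volumeMeasure :=
    hFc.integrable_of_hasCompactSupport (HasCompactSupport.of_compactSpace _)
  have hcos : ∀ y, Q.cosSq x y = R.cosSq x y ^ m * P.cosSq x y := fun y => by
    rw [hQdef, cosSq_mul, cosSq_pow]
  have hfar : ∀ y, R.cosSq x y ≤ Real.exp (-ε') → ‖Q.weighted s x y‖ ≤ c * (C₁ / m) * H y := by
    intro y hy
    have h1 := Real.sqrt_pow_le_rpow_of_le_exp (R.cosSq_nonneg x y) hε'0 hy hm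
    rw [hQ.norm_weighted, hcos, Real.sqrt_mul (pow_nonneg (R.cosSq_nonneg x y) m)]
    calc c * (√(R.cosSq x y ^ m) * √(P.cosSq x y) * Q.normAt s y)
        ≤ c * (R.cosSq x y ^ (m / 6 : ℝ) * (3 / ε' / m) * √|b| * Q.normAt s y) := by
          have h2 := R.cosSq_nonneg x y
          gcongr
          · exact Q.normAt_nonneg s y
          · exact hb' x y
      _ = c * (C₁ / m) * H y := by rw [hC₁, hH]; ring
  set I := ∫ y, H y ∂(R.volumeMeasure) with hI
  have hImage : ∫ w in {w | normSq w < δ ^ 2}, G w * H (θ w) ≤ I := by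
    have h1 := hθ.setIntegral_image hHc.aestronglyMeasurable
    simp only [smul_eq_mul] at h1
    rw [← h1]
    exact setIntegral_le_integral hHi (Eventually.of_forall hH0)
  have hGH : IntegrableOn (fun w => G w * H (θ w)) {w | normSq w < δ ^ 2} := by
    simpa using hθ.integrableOn_density_smul hHc (continuous_const (y := (1 : ℝ))) (by simp)
  -- the part away from `x`
  have hcompl : ‖∫ y in (θ '' {w | normSq w < δ ^ 2})ᶜ, Q.weighted s x y ∂(R.volumeMeasure)‖ ≤
      c * (C₁ / m) * I := by
    refine (norm_integral_le_of_norm_le (hHi.const_mul (c * (C₁ / m))).integrableOn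
      (ae_restrict_of_forall_mem hθ.measurableSet_image.compl fun y hy => hfar y
        ((hθ.cosSq_le_exp y hy).trans
          (Real.exp_le_exp.2 (neg_le_neg (min_le_left _ _)))))).trans ?_
    rw [integral_const_mul]
    exact mul_le_mul_of_nonneg_left (setIntegral_le_integral hHi (Eventually.of_forall hH0))
      (by positivity)
  have hcut := fun w : Fin n → ℂ => abs_le.2
    ⟨by linarith [cutoff_nonneg δ w], cutoff_le_one δ w⟩
  have hint1 := hθ.integrableOn_density_smul hFc (continuous_cutoff δ) hcut
  have hint2 := hθ.integrableOn_density_smul hFc (c := fun w => 1 - cutoff δ w)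
    (by have := continuous_cutoff (n := n) δ; fun_prop)
    (fun w => abs_le.2 ⟨by linarith [cutoff_le_one δ w], by linarith [cutoff_nonneg δ w]⟩)
  have hannulus : ‖∫ w in {w | normSq w < δ ^ 2}, (1 - cutoff δ w) • G w • Q.weighted s x (θ w)‖ ≤
      c * (C₁ / m) * I := by
    have hb2 : ‖∫ w in {w | normSq w < δ ^ 2}, (1 - cutoff δ w) • G w • Q.weighted s x (θ w)‖ ≤
        ∫ w in {w | normSq w < δ ^ 2}, c * (C₁ / m) * (G w * H (θ w)) := by
      refine norm_integral_le_of_norm_le (hGH.const_mul _)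
        (ae_restrict_of_forall_mem hB fun w hw => ?_)
      have hG : 0 ≤ G w := by linarith [hθ.half_le_density w hw]
      by_cases hw' : normSq w ≤ δ ^ 2 / 4
      · rw [cutoff_eq_one hδ hw', sub_self, zero_smul, norm_zero]
        exact mul_nonneg (by positivity) (mul_nonneg hG (hH0 _))
      · rw [norm_smul, norm_smul, Real.norm_of_nonneg (by linarith [cutoff_le_one δ w]),
          Real.norm_of_nonneg hG]
        have h1 : ‖Q.weighted s x (θ w)‖ ≤ c * (C₁ / m) * H (θ w) := by
          refine hfar _ ((hθ.cosSq_mem hw).2.trans (Real.exp_le_exp.2 (neg_le_neg ?_)))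
          exact (min_le_right _ _).trans (by linarith)
        calc (1 - cutoff δ w) * (G w * ‖Q.weighted s x (θ w)‖)
            ≤ 1 * (G w * (c * (C₁ / m) * H (θ w))) := by
              refine mul_le_mul (by linarith [cutoff_nonneg δ w])
                (mul_le_mul_of_nonneg_left h1 hG) (by positivity) zero_le_one
          _ = c * (C₁ / m) * (G w * H (θ w)) := by ring
    refine hb2.trans ?_
    rw [integral_const_mul]
    exact mul_le_mul_of_nonneg_left hImage (by positivity)
  -- the part near `x`
  obtain ⟨D, J, a, α, h, hA, hDJ⟩ := hθ.exists_isApproxGaussian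
  set f : (Fin n → ℂ) → ℂ := fun w => sval s (θ w) / Q.toFun (θ w) x with hf
  have hfd : DifferentiableOn ℂ f {w | normSq w < δ ^ 2} := hθ.differentiableOn_quotient m s
  have hnear := hmain m hm0 f D J a α h hfd hA
  have hf0 : Q.toFun x x * f 0 = sval s x := by
    rw [hf]
    simp only [hθ.map_zero]
    exact mul_div_cancel₀ _ (hQ.toFun_pos x).ne'
  have hnf0 : c * ‖f 0‖ = Q.normAt s x := by
    have h1 : ‖Q.toFun x x‖ * ‖f 0‖ = c * Q.normAt s x := by
      rw [← norm_mul, hf0, hQ.norm_sval]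
    rw [← hcc, mul_assoc] at h1
    exact mul_left_cancel₀ hc0.ne' h1
  -- The density `G` and `P.cosSq` make up `J`, and `R.cosSq ^ m` is `exp(-m D)`, so the cut-off
  -- integral is exactly the one treated for approximate Gaussians.
  have heq : ∫ w in {w | normSq w < δ ^ 2}, cutoff δ w • G w • Q.weighted s x (θ w) =
      Q.toFun x x * ∫ w, f w * (cutoff δ w * (Complex.exp (-(m * D w)) * J w)) := by
    have hzero : ∀ w ∉ {w : Fin n → ℂ | normSq w < δ ^ 2},
        Q.toFun x x * (f w * (cutoff δ w * (Complex.exp (-(m * D w)) * J w))) = 0 := by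
      intro w hw
      have hw' : ¬ normSq w < δ ^ 2 := hw
      rw [cutoff_eq_zero hδ (by nlinarith [sq_nonneg δ])]
      simp
    rw [← integral_const_mul, ← setIntegral_eq_integral_of_forall_compl_eq_zero hzero]
    refine setIntegral_congr_fun hB fun w hw => ?_
    have hr : 0 < R.cosSq x (θ w) := (Real.exp_pos _).trans_le (hθ.cosSq_mem hw).1
    have hp : 0 < P.cosSq x (θ w) := (Real.exp_pos _).trans_le (hθ.exp_le_cosSq w hw)
    have hq : Q.cosSq x (θ w) ≠ 0 := by rw [hcos]; positivity
    have he : Complex.exp (-(m * D w)) = (R.cosSq x (θ w) : ℂ) ^ m := by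
      rw [← (hDJ w hw).1, ← Complex.exp_nat_mul]
      ring_nf
    simp only [Complex.real_smul]
    rw [hQ.weighted_eq s hq, he, (hDJ w hw).2, hcos, hf]
    push_cast
    ring
  have hf_int : ∫ w in {w | normSq w ≤ δ ^ 2 / 2}, ‖f w‖ * Real.exp (-(3 / 4 * m) * normSq w) ≤
      Real.exp 1 / c * 2 * I := by
    have hsub : {w : Fin n → ℂ | normSq w ≤ δ ^ 2 / 2} ⊆ {w | normSq w < δ ^ 2} := by
      intro w (hw : normSq w ≤ δ ^ 2 / 2)
      have : 0 < δ ^ 2 := by positivity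
      exact show normSq w < δ ^ 2 by linarith
    have hpt : ∀ w, normSq w < δ ^ 2 → ‖f w‖ * Real.exp (-(3 / 4 * m) * normSq w) ≤
        Real.exp 1 / c * 2 * (G w * H (θ w)) := by
      intro w hw
      refine (hθ.norm_quotient_mul_exp_le hR hP m s hw).trans ?_
      have hG := hθ.half_le_density w hw
      rw [mul_assoc]
      refine mul_le_mul_of_nonneg_left ?_ (by positivity)
      have := hH0 (θ w)
      change H (θ w) ≤ _
      nlinarith
    have hi : IntegrableOn (fun w => Real.exp 1 / c * 2 * (G w * H (θ w)))
        {w | normSq w < δ ^ 2} := hGH.const_mul _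
    have hi' : IntegrableOn (fun w => ‖f w‖ * Real.exp (-(3 / 4 * m) * normSq w))
        {w : Fin n → ℂ | normSq w ≤ δ ^ 2 / 2} := by
      refine ContinuousOn.integrableOn_compact (isCompact_normSq_le _) ?_
      exact (hfd.continuousOn.mono hsub).norm.mul
        (by have := continuous_normSq (n := n); fun_prop)
    calc ∫ w in {w | normSq w ≤ δ ^ 2 / 2}, ‖f w‖ * Real.exp (-(3 / 4 * m) * normSq w)
        ≤ ∫ w in {w | normSq w ≤ δ ^ 2 / 2}, Real.exp 1 / c * 2 * (G w * H (θ w)) :=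
          setIntegral_mono_on hi' (hi.mono_set hsub) (isCompact_normSq_le _).measurableSet
            fun w hw => hpt w (hsub hw)
      _ ≤ ∫ w in {w | normSq w < δ ^ 2}, Real.exp 1 / c * 2 * (G w * H (θ w)) := by
          refine setIntegral_mono_set hi (ae_restrict_of_forall_mem hB fun w hw => ?_)
            (LE.le.eventuallyLE hsub)
          have hG := hθ.half_le_density w hw
          exact mul_nonneg (by positivity) (mul_nonneg (by linarith) (hH0 _))
      _ ≤ Real.exp 1 / c * 2 * I := by
          rw [integral_const_mul]
          exact mul_le_mul_of_nonneg_left hImage (by positivity)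
  have hI0 : 0 ≤ I := integral_nonneg hH0
  have hN0 := Q.normAt_nonneg s x
  have hnear' : ‖(∫ w in {w | normSq w < δ ^ 2}, cutoff δ w • G w • Q.weighted s x (θ w)) -
      ((Real.pi / m) ^ n : ℝ) * sval s x‖ ≤
      c * (C₀ * (2 * Real.exp 1) / m * I + C₀ / m * (Real.pi / m) ^ n * Q.normAt s x) := by
    rw [heq, ← hf0, mul_left_comm, ← mul_sub, norm_mul, ← hcc]
    calc c * c * ‖_‖ ≤ c * c * (C₀ / m * (Real.exp 1 / c * 2 * I) +
          C₀ / m * (Real.pi / m) ^ n * ‖f 0‖) := by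
          refine mul_le_mul_of_nonneg_left (hnear.trans ?_) (by positivity)
          gcongr
      _ = _ := by
          rw [← hnf0]
          field_simp
  have hsplit : ∫ y, Q.weighted s x y ∂(R.volumeMeasure) =
      (∫ w in {w | normSq w < δ ^ 2}, cutoff δ w • G w • Q.weighted s x (θ w)) +
      (∫ w in {w | normSq w < δ ^ 2}, (1 - cutoff δ w) • G w • Q.weighted s x (θ w)) +
      ∫ y in (θ '' {w | normSq w < δ ^ 2})ᶜ, Q.weighted s x y ∂(R.volumeMeasure) := by
    rw [← integral_add_compl hθ.measurableSet_image hFi,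
      hθ.setIntegral_image hFc.aestronglyMeasurable, ← integral_add hint1 hint2]
    congr 2
    funext w
    rw [← add_smul]
    simp
  rw [hsplit]
  calc ‖_‖ = ‖((∫ w in {w | normSq w < δ ^ 2}, cutoff δ w • G w • Q.weighted s x (θ w)) -
        ((Real.pi / m) ^ n : ℝ) * sval s x) +
      (∫ w in {w | normSq w < δ ^ 2}, (1 - cutoff δ w) • G w • Q.weighted s x (θ w)) +
      ∫ y in (θ '' {w | normSq w < δ ^ 2})ᶜ, Q.weighted s x y ∂(R.volumeMeasure)‖ := by
        congr 1; ring
    _ ≤ _ := norm_add₃_le.trans (add_le_add (add_le_add hnear' hannulus) hcompl)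
    _ ≤ _ := by
        have h1 : 0 ≤ c * (2 * C₁ / m * (Real.pi / m) ^ n * Q.normAt s x) := by positivity
        have h2 : 0 ≤ c * (C₀ * (2 * Real.exp 1) / m * (Real.pi / m) ^ n * Q.normAt s x) := by
          positivity
        have h3 : 0 ≤ c * (C₀ / m * I) := by positivity
        have h4 : c * ((C₀ * (2 * Real.exp 1) + C₀ + 2 * C₁) / m * I +
            (C₀ * (2 * Real.exp 1) + C₀ + 2 * C₁) / m * (Real.pi / m) ^ n * Q.normAt s x) =
            c * (C₀ * (2 * Real.exp 1) / m * I + C₀ / m * (Real.pi / m) ^ n * Q.normAt s x) +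
            c * (C₁ / m) * I + c * (C₁ / m) * I +
            c * (2 * C₁ / m * (Real.pi / m) ^ n * Q.normAt s x) +
            c * (C₀ * (2 * Real.exp 1) / m * (Real.pi / m) ^ n * Q.normAt s x) +
            c * (C₀ / m * I) := by ring
        rw [h4]
        linarith

end IsNormalChart

end HermitianAlgebraic

end

/-! ### Schur's test and the asymptotic bound -/

noncomputable section

open LineBundle

namespace HermitianAlgebraic

open Gaussian Filter Topology

variable {n : ℕ} {X : Type*} [TopologicalSpace X] [ChartedSpace (Fin n → ℂ) X] {ι ι' : Type*}
  {L : VectorBundleCore ℂ X ℂ ι} {E : VectorBundleCore ℂ X ℂ ι'}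
  [CompactSpace X] [MeasurableSpace X] [BorelSpace X] [IsManifold 𝓘(ℂ, Fin n → ℂ) ω X]

theorem _root_.Continuous.integrable_of_compactSpace {Y V : Type*} [TopologicalSpace Y]
    [CompactSpace Y] [MeasurableSpace Y] [OpensMeasurableSpace Y] [NormedAddCommGroup V]
    [SecondCountableTopologyEither Y V] {μ : Measure Y} [IsFiniteMeasure μ] {f : Y → V}
    (hf : Continuous f) : Integrable f μ :=
  hf.integrable_of_hasCompactSupport (HasCompactSupport.of_compactSpace _)

section Forms

variable {Z : VectorBundleCore ℂ X ℂ ι} [Z.IsContMDiff 𝓘(ℂ, Fin n → ℂ) ω]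

theorem IsPositive.l2Inner_self {Q : HermitianAlgebraic n Z} (hQ : Q.IsPositive) (Ω : Measure X)
    (s : Sections n Z) : Q.l2Inner Ω s s = ((∫ x, Q.normAt s x ^ 2 ∂Ω : ℝ) : ℂ) := by
  rw [l2Inner, ← integral_complex_ofReal]
  exact integral_congr_ae (Eventually.of_forall fun x => (hQ.normAt_sq s x).symm)

theorem IsPositive.l2Norm_sq {Q : HermitianAlgebraic n Z} (hQ : Q.IsPositive) (Ω : Measure X)
    (s : Sections n Z) : Q.l2Norm Ω s ^ 2 = ∫ x, Q.normAt s x ^ 2 ∂Ω := by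
  rw [l2Norm, hQ.l2Inner_self, Complex.ofReal_re, Real.sq_sqrt]
  exact integral_nonneg fun x => sq_nonneg _

theorem IsPositive.integrable_kernel {Q : HermitianAlgebraic n Z} (hQ : Q.IsPositive)
    (Ω : Measure X) [IsFiniteMeasure Ω] (s t : Sections n Z) :
    Integrable (fun p : X × X => Q.toFun p.1 p.2 * sval s p.2 * conj (sval t p.1) /
      (Q.toFun p.1 p.1 * Q.toFun p.2 p.2)) (Ω.prod Ω) := by
  have := ChartedSpace.secondCountable_of_sigmaCompact (Fin n → ℂ) X
  exact (hQ.continuous_kernel s t).integrable_of_compactSpace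

theorem kernel_eq (Q : HermitianAlgebraic n Z) (s t : Sections n Z) (x y : X) :
    Q.toFun x y * sval s y * conj (sval t x) / (Q.toFun x x * Q.toFun y y) =
      conj (sval t x) / Q.toFun x x * Q.weighted s x y := by
  rw [weighted, div_mul_div_comm]
  congr 1
  ring

theorem IsPositive.kernelForm_eq {Q : HermitianAlgebraic n Z} (hQ : Q.IsPositive) (Ω : Measure X)
    [IsFiniteMeasure Ω] (s t : Sections n Z) :
    Q.kernelForm Ω s t = ∫ x, conj (sval t x) / Q.toFun x x * ∫ y, Q.weighted s x y ∂Ω ∂Ω := by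
  rw [kernelForm, integral_prod _ (hQ.integrable_kernel Ω s t)]
  simp_rw [kernel_eq, integral_const_mul]

theorem IsPositive.norm_conj_div {Q : HermitianAlgebraic n Z} (hQ : Q.IsPositive)
    (s : Sections n Z) (x : X) :
    ‖conj (sval s x) / Q.toFun x x‖ = Q.normAt s x / √‖Q.toFun x x‖ := by
  have h := Real.mul_self_sqrt (norm_nonneg (Q.toFun x x))
  have h0 := Real.sqrt_pos.2 (hQ.norm_pos x)
  rw [norm_div, RCLike.norm_conj, hQ.norm_sval s x, div_eq_div_iff (hQ.norm_pos x).ne' h0.ne']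
  linear_combination Q.normAt s x * h

/-- Schur's test for a symmetric continuous kernel. -/
theorem _root_.integral_mul_mul_le_of_symm [SecondCountableTopology X] {Ω : Measure X}
    [IsFiniteMeasure Ω] {k : X → X → ℝ} (hk : Continuous fun p : X × X => k p.1 p.2)
    (hk0 : ∀ x y, 0 ≤ k x y) (hsymm : ∀ x y, k x y = k y x) {f : X → ℝ} (hf : Continuous f) {B : ℝ}
    (hB : ∀ x, ∫ y, k x y ∂Ω ≤ B) :
    ∫ x, ∫ y, f x * (k x y * f y) ∂Ω ∂Ω ≤ B * ∫ x, f x ^ 2 ∂Ω := by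
  have h1 : Continuous fun p : X × X => f p.1 * (k p.1 p.2 * f p.2) := by fun_prop
  have h2 : Continuous fun p : X × X => f p.1 ^ 2 * k p.1 p.2 := by fun_prop
  have h3 : Continuous fun p : X × X => f p.2 ^ 2 * k p.2 p.1 :=
    h2.comp (f := Prod.swap) continuous_swap
  have i1 := h1.integrable_of_compactSpace (μ := Ω.prod Ω)
  have i2 := h2.integrable_of_compactSpace (μ := Ω.prod Ω)
  have i3 := h3.integrable_of_compactSpace (μ := Ω.prod Ω)
  have hswap : ∫ p : X × X, f p.2 ^ 2 * k p.2 p.1 ∂(Ω.prod Ω) =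
      ∫ p : X × X, f p.1 ^ 2 * k p.1 p.2 ∂(Ω.prod Ω) :=
    integral_prod_swap (μ := Ω) (ν := Ω) fun p : X × X => f p.1 ^ 2 * k p.1 p.2
  rw [← integral_prod _ i1]
  -- The inequality `2 f(x) f(y) ≤ f(x)² + f(y)²` is weighted by `k`; by symmetry of `k` both terms
  -- on the right have the same integral.
  calc ∫ p, f p.1 * (k p.1 p.2 * f p.2) ∂(Ω.prod Ω)
      ≤ ∫ p : X × X, (1 / 2) * (f p.1 ^ 2 * k p.1 p.2 + f p.2 ^ 2 * k p.2 p.1) ∂(Ω.prod Ω) := by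
        refine integral_mono i1 ((i2.add i3).const_mul (1 / 2)) fun p => ?_
        dsimp only [Pi.add_apply]
        rw [hsymm p.2 p.1]
        nlinarith [mul_nonneg (hk0 p.1 p.2) (sq_nonneg (f p.1 - f p.2))]
    _ = ∫ p : X × X, f p.1 ^ 2 * k p.1 p.2 ∂(Ω.prod Ω) := by
        rw [integral_const_mul, integral_add i2 i3, hswap]
        ring
    _ = ∫ x, f x ^ 2 * ∫ y, k x y ∂Ω ∂Ω := by
        rw [integral_prod _ i2]
        simp_rw [integral_const_mul]
    _ ≤ ∫ x, f x ^ 2 * B ∂Ω := by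
        have i4 := i2.integral_prod_left
        simp_rw [integral_const_mul] at i4
        refine integral_mono i4 (Continuous.integrable_of_compactSpace (by fun_prop)) fun x => ?_
        exact mul_le_mul_of_nonneg_left (hB x) (sq_nonneg _)
    _ = B * ∫ x, f x ^ 2 ∂Ω := by rw [integral_mul_const, mul_comm]

end Forms

variable {R : HermitianAlgebraic n L} {P : HermitianAlgebraic n E}
  [L.IsContMDiff 𝓘(ℂ, Fin n → ℂ) ω] [E.IsContMDiff 𝓘(ℂ, Fin n → ℂ) ω]

/-- The operator with kernel `Q(x, ȳ) / Q(y, ȳ)`, `Q = R^m P`, approximates `(π / m)^n` times the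
identity at `x`, with an error controlled by a kernel that obeys Schur's test. -/
def ApproxReproduces (R : HermitianAlgebraic n L) (P : HermitianAlgebraic n E) (C : ℝ) (x : X) :
    Prop :=
  ∀ m : ℕ, 1 ≤ m → (∫ y, R.cosSq x y ^ (m / 6 : ℝ) ∂(R.volumeMeasure) ≤ C / m ^ n) ∧
    ∀ s : Sections n (tensor (tpow L m) E),
      ‖(∫ y, ((R.pow m).mul P).weighted s x y ∂(R.volumeMeasure)) -
          ((Real.pi / m) ^ n : ℝ) * sval s x‖ ≤
        √‖((R.pow m).mul P).toFun x x‖ *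
          (C / m * (∫ y, R.cosSq x y ^ (m / 6 : ℝ) * ((R.pow m).mul P).normAt s y
            ∂(R.volumeMeasure)) +
            C / m * (Real.pi / m) ^ n * ((R.pow m).mul P).normAt s x)

theorem integral_cosSq_mul_normAt_nonneg (R : HermitianAlgebraic n L) {Z : VectorBundleCore ℂ X ℂ ι'}
    (Q : HermitianAlgebraic n Z) (s : Sections n Z) (x : X) (t : ℝ) (Ω : Measure X) :
    0 ≤ ∫ y, R.cosSq x y ^ t * Q.normAt s y ∂Ω :=
  integral_nonneg fun y => mul_nonneg (Real.rpow_nonneg (R.cosSq_nonneg _ _) _) (normAt_nonneg _ _ _)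

theorem ApproxReproduces.mono {C C' : ℝ} {x : X} (h : ApproxReproduces R P C x) (hC : C ≤ C') :
    ApproxReproduces R P C' x := by
  intro m hm
  refine ⟨((h m hm).1).trans (by gcongr), fun s => ((h m hm).2 s).trans ?_⟩
  have h1 := integral_cosSq_mul_normAt_nonneg R ((R.pow m).mul P) s x (m / 6) R.volumeMeasure
  have h2 := ((R.pow m).mul P).normAt_nonneg s x
  gcongr

/-- Possessing a uniform constant is inherited by subsets and finite unions and holds near each
point, so compactness makes the constant global. -/
theorem exists_approxReproduces (hR : R.IsPositive) (hP : P.IsPositive)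
    (hloc : ∀ x₀ : X, ∃ U ∈ 𝓝 x₀, ∃ K δ ε : ℝ, 0 ≤ K ∧ 0 < δ ∧ δ ≤ 1 ∧ 0 < ε ∧
      ∀ x ∈ U, ∃ θ G, IsNormalChart R P K δ ε x θ G) :
    ∃ C, 0 ≤ C ∧ ∀ x : X, ApproxReproduces R P C x := by
  have key : ∃ C, 0 ≤ C ∧ ∀ x ∈ (univ : Set X), ApproxReproduces R P C x := by
    refine isCompact_univ.induction_on
      (p := fun S : Set X => ∃ C, 0 ≤ C ∧ ∀ x ∈ S, ApproxReproduces R P C x)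
      ⟨0, le_rfl, fun x hx => hx.elim⟩ ?_ ?_ ?_
    · rintro S T hST ⟨C, hC, h⟩
      exact ⟨C, hC, fun x hx => h x (hST hx)⟩
    · rintro S T ⟨C, hC, h⟩ ⟨C', hC', h'⟩
      refine ⟨C + C', by positivity, fun x hx => ?_⟩
      rcases hx with hx | hx
      · exact (h x hx).mono (by linarith)
      · exact (h' x hx).mono (by linarith)
    · intro x₀ _
      obtain ⟨U, hU, K, δ, ε, hK, hδ, hδ1, hε, hθ⟩ := hloc x₀
      obtain ⟨C₁, hC₁, h₁⟩ := IsNormalChart.integral_cosSq_le hR P K δ hε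
      obtain ⟨C₂, hC₂, h₂⟩ := IsNormalChart.norm_integral_weighted_sub_le hR hP hK hδ hδ1 hε
      refine ⟨U, mem_nhdsWithin_of_mem_nhds hU, C₁ + C₂, by positivity, fun x hx m hm => ?_⟩
      obtain ⟨θ, G, h⟩ := hθ x hx
      refine ⟨(h₁ x θ G h m hm).trans (by gcongr; linarith), fun s =>
        (h₂ x θ G h m hm s).trans ?_⟩
      have h3 := integral_cosSq_mul_normAt_nonneg R ((R.pow m).mul P) s x (m / 6) R.volumeMeasure
      have h4 := ((R.pow m).mul P).normAt_nonneg s x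
      gcongr <;> linarith
  obtain ⟨C, hC, h⟩ := key
  exact ⟨C, hC, fun x => h x (mem_univ x)⟩

/-- The pointwise estimate is paired with `conj(s(x)) / Q(x, x̄)` and integrated in `x`. The weight
`√Q(x, x̄)` cancels, and Schur's test bounds the resulting double integral by the squared `L²` norm.
-/
theorem exists_asymptoticBound (hR : R.IsPositive) (hP : P.IsPositive)
    (hloc : ∀ x₀ : X, ∃ U ∈ 𝓝 x₀, ∃ K δ ε : ℝ, 0 ≤ K ∧ 0 < δ ∧ δ ≤ 1 ∧ 0 < ε ∧
      ∀ x ∈ U, ∃ θ G, IsNormalChart R P K δ ε x θ G) :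
    ∃ C : ℝ, 0 < C ∧ AsymptoticBound R P C := by
  have := isFiniteMeasure_volumeMeasure hR
  have := ChartedSpace.secondCountable_of_sigmaCompact (Fin n → ℂ) X
  obtain ⟨C, hC, hb⟩ := exists_approxReproduces hR hP hloc
  -- `C * C` is the factor `C / m` times the row bound `C / m^n`, `C * π^n` comes from the diagonal
  -- error term, and `+ 1` ensures positivity.
  refine ⟨C * C + C * Real.pi ^ n + 1, by positivity, fun m hm s => ?_⟩
  have hm0 : (0 : ℝ) < m := by exact_mod_cast hm
  set Q := (R.pow m).mul P with hQdef
  have hQ : Q.IsPositive := (hR.pow m).mul hP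
  set Ω := R.volumeMeasure with hΩ
  set N := Q.normAt s with hN
  have hNc : Continuous N := hQ.continuous_normAt s
  have hN0 : ∀ x, 0 ≤ N x := Q.normAt_nonneg s
  set k : X → X → ℝ := fun x y => R.cosSq x y ^ (m / 6 : ℝ) with hk
  have hkc : Continuous fun p : X × X => k p.1 p.2 :=
    hR.continuous_cosSq.rpow_const fun p => Or.inr (by positivity)
  have hk0 : ∀ x y, 0 ≤ k x y := fun x y => Real.rpow_nonneg (R.cosSq_nonneg _ _) _
  have hksymm : ∀ x y, k x y = k y x := fun x y => by simp only [hk]; rw [R.cosSq_comm]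
  have hN2 : Integrable (fun x => N x ^ 2) Ω := (hNc.pow 2).integrable_of_compactSpace
  rw [hQ.l2Norm_sq, hQ.kernelForm_eq, ← hN]
  have h1 : ((Real.pi ^ n / m ^ n * ∫ x, N x ^ 2 ∂Ω : ℝ) : ℂ) =
      ∫ x, conj (sval s x) / Q.toFun x x * (((Real.pi / m) ^ n : ℝ) * sval s x) ∂Ω := by
    rw [← integral_const_mul, ← integral_complex_ofReal]
    refine integral_congr_ae (Eventually.of_forall fun x => ?_)
    dsimp only
    rw [Complex.ofReal_mul, hN, hQ.normAt_sq, div_pow]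
    ring
  have hi1 : Integrable (fun x => conj (sval s x) / Q.toFun x x * ∫ y, Q.weighted s x y ∂Ω) Ω := by
    have := (hQ.integrable_kernel Ω s s).integral_prod_left
    simp_rw [kernel_eq, integral_const_mul] at this
    exact this
  have hi2 : Integrable (fun x => conj (sval s x) / Q.toFun x x *
      (((Real.pi / m) ^ n : ℝ) * sval s x)) Ω := by
    have h := (hQ.continuous_pairing s s).integrable_of_compactSpace (μ := Ω)
    refine (h.const_mul (((Real.pi / m) ^ n : ℝ) : ℂ)).congr (Eventually.of_forall fun x => ?_)
    dsimp only
    ring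
  rw [h1, ← integral_sub hi1 hi2]
  have hkNc : Continuous fun p : X × X => N p.1 * (k p.1 p.2 * N p.2) := by fun_prop
  have hi3 := (hkNc.integrable_of_compactSpace (μ := Ω.prod Ω)).integral_prod_left
  simp_rw [integral_const_mul] at hi3
  have hschur := integral_mul_mul_le_of_symm hkc hk0 hksymm hNc (Ω := Ω)
    fun x => (hb x m hm).1
  simp_rw [integral_const_mul] at hschur
  have hpt : ∀ x, ‖conj (sval s x) / Q.toFun x x * (∫ y, Q.weighted s x y ∂Ω) -
      conj (sval s x) / Q.toFun x x * (((Real.pi / m) ^ n : ℝ) * sval s x)‖ ≤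
      C / m * (N x * ∫ y, k x y * N y ∂Ω) + C / m * (Real.pi / m) ^ n * N x ^ 2 := by
    intro x
    have hq := Real.sqrt_pos.2 (hQ.norm_pos x)
    rw [← mul_sub, norm_mul, hQ.norm_conj_div]
    calc N x / √‖Q.toFun x x‖ * _ ≤ N x / √‖Q.toFun x x‖ * _ :=
          mul_le_mul_of_nonneg_left ((hb x m hm).2 s) (div_nonneg (hN0 x) hq.le)
      _ = _ := by
          field_simp
          ring
  refine (norm_integral_le_of_norm_le ((hi3.const_mul (C / m)).add
    (hN2.const_mul (C / m * (Real.pi / m) ^ n))) (Eventually.of_forall hpt)).trans ?_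
  simp only [Pi.add_apply]
  rw [integral_add (hi3.const_mul (C / m)) (hN2.const_mul (C / m * (Real.pi / m) ^ n)),
    integral_const_mul, integral_const_mul]
  have hI0 : 0 ≤ ∫ x, N x ^ 2 ∂Ω := integral_nonneg fun x => sq_nonneg _
  calc _ ≤ C / m * (C / m ^ n * ∫ x, N x ^ 2 ∂Ω) +
        C / m * (Real.pi / m) ^ n * ∫ x, N x ^ 2 ∂Ω := by gcongr
    _ = (C * C + C * Real.pi ^ n) / m ^ (n + 1) * ∫ x, N x ^ 2 ∂Ω := by
        rw [div_pow]
        field_simp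
        ring
    _ ≤ _ := mul_le_mul_of_nonneg_right
        (div_le_div_of_nonneg_right (by linarith) (by positivity)) hI0

end HermitianAlgebraic

end

noncomputable section

/-! ## Linear normalization of a positive definite matrix -/

namespace Gaussian

open Filter Topology Matrix

variable {n : ℕ}

/-- The value at `v` of the Hermitian form with matrix `g`. -/
def hermForm (g : Matrix (Fin n) (Fin n) ℂ) (v : Fin n → ℂ) : ℝ := (v ⬝ᵥ (g *ᵥ star v)).re

theorem star_mulVec_eq (A : Matrix (Fin n) (Fin n) ℂ) (v : Fin n → ℂ) :
    star (A *ᵥ v) = A.map conj *ᵥ star v := by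
  ext j
  simp [Matrix.mulVec, dotProduct]

theorem normSq_eq_dotProduct (w : Fin n → ℂ) : normSq w = (w ⬝ᵥ star w).re := by
  simp [normSq, dotProduct, Complex.mul_conj, Complex.normSq_eq_norm_sq, ← Complex.ofReal_pow]

theorem hermForm_mulVec (g A : Matrix (Fin n) (Fin n) ℂ) (w : Fin n → ℂ) :
    hermForm g (A *ᵥ w) = hermForm (Aᵀ * g * A.map conj) w := by
  rw [hermForm, hermForm, star_mulVec_eq, ← Matrix.mulVec_mulVec, ← Matrix.mulVec_mulVec,
    Matrix.dotProduct_mulVec w, Matrix.vecMul_transpose]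

theorem hermForm_one (w : Fin n → ℂ) : hermForm 1 w = normSq w := by
  rw [hermForm, Matrix.one_mulVec, normSq_eq_dotProduct]

theorem hermForm_pos {g : Matrix (Fin n) (Fin n) ℂ} (hg : g.PosDef) {v : Fin n → ℂ} (hv : v ≠ 0) :
    0 < hermForm g v := by
  have h := hg.dotProduct_mulVec_pos (x := star v) (by simpa using hv)
  rw [star_star] at h
  exact (Complex.pos_iff.1 h).1

theorem hermForm_smul (g : Matrix (Fin n) (Fin n) ℂ) (c : ℝ) (v : Fin n → ℂ) :
    hermForm g ((c : ℂ) • v) = c ^ 2 * hermForm g v := by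
  rw [hermForm, hermForm, star_smul, Matrix.mulVec_smul, smul_dotProduct, dotProduct_smul]
  simp only [Complex.star_def, Complex.conj_ofReal, smul_eq_mul, Complex.re_ofReal_mul]
  ring

open scoped MatrixOrder in
theorem exists_eq_conjTranspose_mul_self {N : ℕ} {c : Matrix (Fin N) (Fin N) ℂ}
    (hc : c.PosSemidef) : ∃ B : Matrix (Fin N) (Fin N) ℂ, c = Bᴴ * B :=
  CStarAlgebra.nonneg_iff_eq_star_mul_self.mp hc.nonneg

/-- With `g = Bᴴ B` and `B` invertible, the complex conjugate of `B⁻¹` does it. -/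
theorem exists_transpose_mul_mul_eq_one {g : Matrix (Fin n) (Fin n) ℂ} (hg : g.PosDef) :
    ∃ A : Matrix (Fin n) (Fin n) ℂ, Aᵀ * g * A.map conj = 1 := by
  obtain ⟨B, rfl⟩ := exists_eq_conjTranspose_mul_self hg.posSemidef
  have hdet : IsUnit B.det := by
    have h := hg.det_pos.ne'
    rw [Matrix.det_mul] at h
    exact isUnit_iff_ne_zero.2 (right_ne_zero_of_mul h)
  refine ⟨(B⁻¹).map conj, ?_⟩
  have h1 : ((B⁻¹).map conj).map conj = B⁻¹ := by
    ext i j; simp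
  have h2 : ((B⁻¹).map conj)ᵀ = (B⁻¹)ᴴ := by
    ext i j; simp
  rw [h1, h2, ← Matrix.mul_assoc, ← Matrix.conjTranspose_mul, Matrix.mul_assoc,
    Matrix.mul_nonsing_inv _ hdet]
  simp

/-- The form is continuous and positive on the product of `S` with the unit sphere, so it and its
inverse are bounded there; homogeneity extends the bounds to all vectors. The bounds do not depend
on `z`, so the normalizing matrices are controlled uniformly. -/
theorem exists_hermForm_bounds {S : Set (Fin n → ℂ)} (hS : IsCompact S)
    {g : (Fin n → ℂ) → Matrix (Fin n) (Fin n) ℂ} (hg : ContinuousOn g S)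
    (hpos : ∀ z ∈ S, (g z).PosDef) :
    ∃ lo hi : ℝ, 0 < lo ∧ 0 < hi ∧ ∀ z ∈ S, ∀ v, lo * normSq v ≤ hermForm (g z) v ∧
      hermForm (g z) v ≤ hi * normSq v := by
  have hsphere : IsCompact {v : Fin n → ℂ | normSq v = 1} :=
    (isCompact_normSq_le 1).of_isClosed_subset (isClosed_eq continuous_normSq continuous_const)
      fun v (hv : normSq v = 1) => hv.le
  have hF : ContinuousOn (fun p : (Fin n → ℂ) × (Fin n → ℂ) => hermForm (g p.1) p.2)
      (S ×ˢ {v | normSq v = 1}) := by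
    have hH : Continuous fun p : Matrix (Fin n) (Fin n) ℂ × (Fin n → ℂ) => hermForm p.1 p.2 :=
      Complex.continuous_re.comp (continuous_snd.dotProduct
        (continuous_fst.matrix_mulVec (continuous_star.comp continuous_snd)))
    exact hH.comp_continuousOn (f := fun p : (Fin n → ℂ) × (Fin n → ℂ) => (g p.1, p.2))
      ((hg.comp continuousOn_fst fun p hp => hp.1).prodMk continuousOn_snd)
  have hne : ∀ v : Fin n → ℂ, normSq v = 1 → v ≠ 0 := by
    rintro v hv rfl
    simp [normSq_zero] at hv
  obtain ⟨b, hb⟩ := (hS.prod hsphere).exists_bound_of_continuousOn hF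
  obtain ⟨c, hc⟩ := (hS.prod hsphere).exists_bound_of_continuousOn (hF.inv₀ fun p hp =>
    (hermForm_pos (hpos p.1 hp.1) (hne p.2 hp.2)).ne')
  refine ⟨(|c| + 1)⁻¹, |b| + 1, by positivity, by positivity, fun z hz v => ?_⟩
  by_cases hv : normSq v = 0
  · have h0 : v = 0 := by
      have := norm_le_sqrt_normSq v
      rw [hv, Real.sqrt_zero] at this
      exact norm_le_zero_iff.1 this
    subst h0
    simp [hermForm, normSq_zero]
  · have hv0 : 0 < normSq v := lt_of_le_of_ne (normSq_nonneg v) (Ne.symm hv)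
    have hsq := Real.sq_sqrt hv0.le
    have hs0 : 0 < √(normSq v) := Real.sqrt_pos.2 hv0
    set u : Fin n → ℂ := (((√(normSq v))⁻¹ : ℝ) : ℂ) • v with hu
    have hvu : v = ((√(normSq v) : ℝ) : ℂ) • u := by
      rw [hu, smul_smul, ← Complex.ofReal_mul, mul_inv_cancel₀ hs0.ne', Complex.ofReal_one, one_smul]
    have hNu : normSq u = 1 := by
      rw [hu, normSq_smul, Complex.norm_real, Real.norm_of_nonneg (by positivity), inv_pow, hsq,
        inv_mul_cancel₀ hv]
    have hq : hermForm (g z) v = normSq v * hermForm (g z) u := by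
      conv_lhs => rw [hvu]
      rw [hermForm_smul, hsq]
    have hupos := hermForm_pos (hpos z hz) (hne u hNu)
    have h1 : hermForm (g z) u ≤ |b| :=
      (le_abs_self _).trans ((hb (z, u) ⟨hz, hNu⟩).trans (le_abs_self b))
    have h2 : (hermForm (g z) u)⁻¹ ≤ |c| :=
      (le_abs_self _).trans ((hc (z, u) ⟨hz, hNu⟩).trans (le_abs_self c))
    have h3 : (|c| + 1)⁻¹ ≤ hermForm (g z) u := by
      rw [inv_le_comm₀ (by positivity) hupos]
      linarith
    rw [hq]
    constructor <;> nlinarith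

end Gaussian

open LineBundle

namespace HermitianAlgebraic

open SeveralVariables Gaussian Filter Topology Matrix

variable {n : ℕ} {X : Type*} [TopologicalSpace X] [ChartedSpace (Fin n → ℂ) X] {ι : Type*}
  {Z : VectorBundleCore ℂ X ℂ ι}

/-- The extension to `(w, w')` of the affine map `w ↦ z + A w`, conjugate in the second
variable. -/
def affineExt (z : Fin n → ℂ) (A : Matrix (Fin n) (Fin n) ℂ) (p : (Fin n → ℂ) × (Fin n → ℂ)) :
    (Fin n → ℂ) × (Fin n → ℂ) :=
  (z + A *ᵥ p.1, star z + A.map conj *ᵥ p.2)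

theorem affineExt_star (z : Fin n → ℂ) (A : Matrix (Fin n) (Fin n) ℂ) (w : Fin n → ℂ) :
    affineExt z A (w, star w) = (z + A *ᵥ w, star (z + A *ᵥ w)) := by
  rw [affineExt, star_add, star_mulVec_eq]

theorem hasFDerivAt_affine (z : Fin n → ℂ) (A : Matrix (Fin n) (Fin n) ℂ) (w : Fin n → ℂ) :
    HasFDerivAt (fun w => z + A *ᵥ w) (LinearMap.toContinuousLinearMap (Matrix.toLin' A)) w :=
  ((LinearMap.toContinuousLinearMap (Matrix.toLin' A)).hasFDerivAt (x := w)).const_add z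

theorem continuous_affine (z : Fin n → ℂ) (A : Matrix (Fin n) (Fin n) ℂ) :
    Continuous fun w => z + A *ᵥ w :=
  continuous_iff_continuousAt.2 fun w => (hasFDerivAt_affine z A w).continuousAt

theorem differentiable_affineExt (z : Fin n → ℂ) (A : Matrix (Fin n) (Fin n) ℂ) :
    Differentiable ℂ (affineExt z A) := fun p =>
  ((hasFDerivAt_affine z A p.1).differentiableAt.comp p differentiableAt_fst).prodMk
    ((hasFDerivAt_affine (star z) (A.map conj) p.2).differentiableAt.comp p differentiableAt_snd)

theorem logHess_affine [IsManifold 𝓘(ℂ, Fin n → ℂ) ω X] [Z.IsContMDiff 𝓘(ℂ, Fin n → ℂ) ω]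
    {Q : HermitianAlgebraic n Z} (hQ : Q.IsPositive) {a : X} {i : ι} (z : Fin n → ℂ)
    (A : Matrix (Fin n) (Fin n) ℂ) {w : Fin n → ℂ} (hw : z + A *ᵥ w ∈ frameDomain n Z a i)
    (j k : Fin n) :
    logHess (Q.localRep a a i i ∘ affineExt z A) (w, star w) (Pi.single j 1) (Pi.single k 1) =
      (Aᵀ * (-Q.curvature a (z + A *ᵥ w)) * A.map conj) j k := by
  have hmem : affineExt z A (w, star w) ∈ frameDomainProd n Z a a i i := by
    rw [affineExt_star]; exact mem_frameDomainProd_star hw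
  have hne : Q.localRep a a i i (affineExt z A (w, star w)) ≠ 0 := by
    rw [affineExt_star]; exact (hQ.localRep_pos hw).ne'
  have hopen : IsOpen (affineExt z A ⁻¹' frameDomainProd n Z a a i i) :=
    (isOpen_frameDomainProd a a i i).preimage (differentiable_affineExt z A).continuous
  rw [logHess_comp (ρ := Q.localRep a a i i) (τ := fun w => z + A *ᵥ w)
    (σ := fun w => star z + A.map conj *ᵥ w) (h := fun _ => 1) (k := fun _ => 1)
    (isOpen_frameDomainProd a a i i) (Q.differentiableOn_localRep a a i i) hopen
    ((Q.differentiableOn_localRep a a i i).comp (differentiable_affineExt z A).differentiableOn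
      fun p hp => hp) hmem hmem hne
    (Eventually.of_forall fun w => (hasFDerivAt_affine z A w).differentiableAt)
    (hasFDerivAt_affine _ _ _).differentiableAt
    (Eventually.of_forall fun _ => differentiableAt_const _) (differentiableAt_const _)
    one_ne_zero one_ne_zero (Eventually.of_forall fun p => by simp [affineExt])]
  dsimp only
  rw [(hasFDerivAt_affine z A w).fderiv, (hasFDerivAt_affine (star z) (A.map conj) (star w)).fderiv]
  change logHess _ (affineExt z A (w, star w)) _ _ = _
  rw [affineExt_star, logHess_eq_sum (isOpen_frameDomainProd a a i i)
    (Q.differentiableOn_localRep a a i i) (mem_frameDomainProd_star hw) (hQ.localRep_pos hw).ne',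
    Matrix.mul_apply]
  simp_rw [Matrix.mul_apply, Finset.sum_mul]
  rw [Finset.sum_comm]
  refine Finset.sum_congr rfl fun p _ => Finset.sum_congr rfl fun l _ => ?_
  rw [← neg_curvature_apply hQ hw]
  simp
  ring

/-- The exponential of minus the diastasis of the local logarithm of `Q`. -/
theorem IsPositive.cosSq_eq_localRep {Q : HermitianAlgebraic n Z} (hQ : Q.IsPositive) {a : X} {i : ι}
    {z ζ : Fin n → ℂ} (hz : z ∈ frameDomain n Z a i) (hζ : ζ ∈ frameDomain n Z a i) :
    (Q.cosSq ((chartAt (Fin n → ℂ) a).symm z) ((chartAt (Fin n → ℂ) a).symm ζ) : ℂ) =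
      Q.localRep a a i i (ζ, star z) * Q.localRep a a i i (z, star ζ) /
        (Q.localRep a a i i (ζ, star ζ) * Q.localRep a a i i (z, star z)) := by
  have h1 := frameFactor_ne_zero hz.2
  have h2 := frameFactor_ne_zero hζ.2
  have h1' : conj (frameFactor Z i ((chartAt (Fin n → ℂ) a).symm z)) ≠ 0 := by simpa using h1
  have h2' : conj (frameFactor Z i ((chartAt (Fin n → ℂ) a).symm ζ)) ≠ 0 := by simpa using h2
  have h3 := (hQ.toFun_pos ((chartAt (Fin n → ℂ) a).symm z)).ne'
  have h4 := (hQ.toFun_pos ((chartAt (Fin n → ℂ) a).symm ζ)).ne'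
  rw [hQ.ofReal_cosSq]
  simp only [localRep, star_star]
  field_simp

/-- Exponentiating the four logarithms of the diastasis gives a cross-ratio of values of `Q` in
which the frame factors cancel. The choice of branch is immaterial, so only non-vanishing is needed.
-/
theorem IsPositive.exp_neg_diastasis {Q : HermitianAlgebraic n Z} (hQ : Q.IsPositive) {a : X} {i : ι}
    {z w : Fin n → ℂ} (A : Matrix (Fin n) (Fin n) ℂ) (hz : z ∈ frameDomain n Z a i)
    (hw : z + A *ᵥ w ∈ frameDomain n Z a i) (h1 : Q.localRep a a i i (z + A *ᵥ w, star z) ≠ 0)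
    (h2 : Q.localRep a a i i (z, star (z + A *ᵥ w)) ≠ 0) :
    Complex.exp (-diastasis (fun p => Complex.log (Q.localRep a a i i (affineExt z A p))) w) =
      Q.cosSq ((chartAt (Fin n → ℂ) a).symm z) ((chartAt (Fin n → ℂ) a).symm (z + A *ᵥ w)) := by
  have e1 : affineExt z A 0 = (z, star z) := by simp [affineExt]
  have e2 : affineExt z A (w, 0) = (z + A *ᵥ w, star z) := by simp [affineExt]
  have e3 : affineExt z A (0, star w) = (z, star (z + A *ᵥ w)) := by
    rw [affineExt, star_add, star_mulVec_eq]; simp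
  rw [diastasis, affineExt_star, e1, e2, e3, hQ.cosSq_eq_localRep hz hw]
  have h3 := (hQ.localRep_pos hz).ne'
  have h4 := (hQ.localRep_pos hw).ne'
  rw [show ∀ a b c d : ℂ, -(a + b - c - d) = c + d - (a + b) by intros; ring, Complex.exp_sub,
    Complex.exp_add, Complex.exp_add, Complex.exp_log h1, Complex.exp_log h2, Complex.exp_log h3,
    Complex.exp_log h4]

/-- A diagonal value is positive, hence in the slit plane; by continuity a holomorphic logarithm
exists and is bounded near that point. This bound is the only datum entering the Gaussian constants.
-/
theorem IsPositive.exists_log_bound {Q : HermitianAlgebraic n Z} (hQ : Q.IsPositive) {a : X} {i : ι}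
    {z₀ : Fin n → ℂ} (hz : z₀ ∈ frameDomain n Z a i) :
    ∃ r M : ℝ, 0 < r ∧ 0 ≤ M ∧ Metric.ball z₀ r ⊆ frameDomain n Z a i ∧
      ∀ p ∈ Metric.ball z₀ r ×ˢ Metric.ball (star z₀) r,
        Q.localRep a a i i p ∈ Complex.slitPlane ∧ ‖Complex.log (Q.localRep a a i i p)‖ ≤ M := by
  have hc : ContinuousAt (Q.localRep a a i i) (z₀, star z₀) :=
    (Q.differentiableOn_localRep a a i i).continuousOn.continuousAt
      ((isOpen_frameDomainProd a a i i).mem_nhds (mem_frameDomainProd_star hz))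
  have hs : Q.localRep a a i i (z₀, star z₀) ∈ Complex.slitPlane :=
    Or.inl (Complex.pos_iff.1 (hQ.localRep_pos hz)).1
  have h1 := hc.eventually (Complex.isOpen_slitPlane.mem_nhds hs)
  have h2 := (hc.clog hs).norm.eventually (Iio_mem_nhds (lt_add_one _))
  obtain ⟨r₁, hr₁, h3⟩ := Metric.eventually_nhds_iff_ball.1 (h1.and h2)
  obtain ⟨r₂, hr₂, h4⟩ := Metric.isOpen_iff.1 (isOpen_frameDomain a i) z₀ hz
  refine ⟨min r₁ r₂, ‖Complex.log (Q.localRep a a i i (z₀, star z₀))‖ + 1, lt_min hr₁ hr₂, add_nonneg (norm_nonneg _) zero_le_one,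
    (Metric.ball_subset_ball (min_le_right _ _)).trans h4, fun p hp => ?_⟩
  have hp' : p ∈ Metric.ball (z₀, star z₀) r₁ := by
    rw [← ball_prod_same]
    exact ⟨Metric.ball_subset_ball (min_le_left _ _) hp.1,
      Metric.ball_subset_ball (min_le_left _ _) hp.2⟩
  exact ⟨(h3 p hp').1, (h3 p hp').2.le⟩

end HermitianAlgebraic

end

noncomputable section

/-! ## Existence of normal charts -/

open LineBundle

namespace HermitianAlgebraic

open SeveralVariables Gaussian Filter Topology Matrix

variable {n : ℕ} {X : Type*} [TopologicalSpace X] [ChartedSpace (Fin n → ℂ) X] {ι ι' : Type*}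
  {L : VectorBundleCore ℂ X ℂ ι} {E : VectorBundleCore ℂ X ℂ ι'}
  {R : HermitianAlgebraic n L} {P : HermitianAlgebraic n E}

theorem abs_det_toLin' (A : Matrix (Fin n) (Fin n) ℂ) :
    |((LinearMap.toContinuousLinearMap (Matrix.toLin' A)).restrictScalars ℝ).det| =
      Complex.normSq A.det := by
  have h1 : ((LinearMap.toContinuousLinearMap (Matrix.toLin' A)).restrictScalars ℝ).det =
      LinearMap.det ((Matrix.toLin' A).restrictScalars ℝ) := rfl
  rw [h1, LinearMap.det_restrictScalars, Algebra.norm_complex_apply, LinearMap.det_toLin',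
    abs_of_nonneg (Complex.normSq_nonneg _)]

theorem affine_image_eq {A : Matrix (Fin n) (Fin n) ℂ} (hA : IsUnit A.det) (z : Fin n → ℂ)
    (S : Set (Fin n → ℂ)) : (fun w => z + A *ᵥ w) '' S = {ζ | A⁻¹ *ᵥ (ζ - z) ∈ S} := by
  ext ζ
  constructor
  · rintro ⟨w, hw, rfl⟩
    simpa [Matrix.mulVec_mulVec, Matrix.nonsing_inv_mul _ hA] using hw
  · intro h
    exact ⟨_, h, by simp [Matrix.mulVec_mulVec, Matrix.mul_nonsing_inv _ hA]⟩

theorem affine_injective {A : Matrix (Fin n) (Fin n) ℂ} (hA : IsUnit A.det) (z : Fin n → ℂ) :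
    Function.Injective fun w => z + A *ᵥ w := by
  intro v w h
  have h' := congrArg (A⁻¹ *ᵥ ·) (add_left_cancel h)
  simpa [Matrix.mulVec_mulVec, Matrix.nonsing_inv_mul _ hA] using h'

section Measure

variable [MeasurableSpace X] [BorelSpace X]

theorem measurableSet_image_affine {A : Matrix (Fin n) (Fin n) ℂ} (hA : IsUnit A.det) (a : X)
    {z : Fin n → ℂ} {B : Set (Fin n → ℂ)} (hB : IsOpen B)
    (hBt : ∀ w ∈ B, z + A *ᵥ w ∈ (chartAt (Fin n → ℂ) a).target) :
    MeasurableSet ((fun w => (chartAt (Fin n → ℂ) a).symm (z + A *ᵥ w)) '' B) := by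
  have h1 : (fun w => (chartAt (Fin n → ℂ) a).symm (z + A *ᵥ w)) '' B =
      (chartAt (Fin n → ℂ) a).source ∩ chartAt (Fin n → ℂ) a ⁻¹' ((fun w => z + A *ᵥ w) '' B) := by
    rw [← (chartAt (Fin n → ℂ) a).symm_image_eq_source_inter_preimage, image_image]
    rintro _ ⟨w, hw, rfl⟩
    exact hBt w hw
  rw [h1, affine_image_eq hA]
  refine ((chartAt (Fin n → ℂ) a).isOpen_inter_preimage (hB.preimage ?_)).measurableSet
  have hc : Continuous fun v : Fin n → ℂ => A⁻¹ *ᵥ v :=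
    (LinearMap.toContinuousLinearMap (Matrix.toLin' A⁻¹)).continuous
  exact hc.comp (continuous_id.sub continuous_const)

theorem volumeMeasure_restrict_image_affine [CompactSpace X] [IsManifold 𝓘(ℂ, Fin n → ℂ) ω X]
    [L.IsContMDiff 𝓘(ℂ, Fin n → ℂ) ω] (hR : R.IsPositive) {A : Matrix (Fin n) (Fin n) ℂ}
    (hA : IsUnit A.det) (a : X) {z : Fin n → ℂ} {B : Set (Fin n → ℂ)} (hB : IsOpen B)
    (hBt : ∀ w ∈ B, z + A *ᵥ w ∈ (chartAt (Fin n → ℂ) a).target) :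
    R.volumeMeasure.restrict ((fun w => (chartAt (Fin n → ℂ) a).symm (z + A *ᵥ w)) '' B) =
      ((volume.restrict B).withDensity fun w =>
        ENNReal.ofReal (Complex.normSq A.det * R.density a (z + A *ᵥ w))).map
          fun w => (chartAt (Fin n → ℂ) a).symm (z + A *ᵥ w) := by
  set θ := fun w => (chartAt (Fin n → ℂ) a).symm (z + A *ᵥ w) with hθ
  have hθc : ContinuousOn θ B :=
    (chartAt (Fin n → ℂ) a).continuousOn_symm.comp (continuous_affine z A).continuousOn hBt
  have hae : AEMeasurable θ ((volume.restrict B).withDensity fun w =>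
      ENNReal.ofReal (Complex.normSq A.det * R.density a (z + A *ᵥ w))) :=
    (hθc.aemeasurable hB.measurableSet).mono_ac (withDensity_absolutelyContinuous _ _)
  have hm := measurableSet_image_affine hA a hB hBt
  ext S hS
  have hsub : S ∩ θ '' B ⊆ (chartAt (Fin n → ℂ) a).source := by
    rintro _ ⟨_, w, hw, rfl⟩
    exact (chartAt (Fin n → ℂ) a).map_target (hBt w hw)
  have hset : (chartAt (Fin n → ℂ) a).target ∩ (chartAt (Fin n → ℂ) a).symm ⁻¹' (S ∩ θ '' B) =
      (fun w => z + A *ᵥ w) '' (B ∩ θ ⁻¹' S) := by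
    ext ζ
    constructor
    · rintro ⟨hζ, hζS, w, hw, hwζ⟩
      have := (chartAt (Fin n → ℂ) a).symm.injOn (hBt w hw) hζ hwζ
      refine ⟨w, ⟨hw, ?_⟩, this⟩
      rw [mem_preimage, hwζ]
      exact hζS
    · rintro ⟨w, ⟨hw, hwS⟩, rfl⟩
      exact ⟨hBt w hw, hwS, w, hw, rfl⟩
  have hBS : MeasurableSet (B ∩ θ ⁻¹' S) :=
    hθc.measurableSet_inter_preimage hB.measurableSet hS
  rw [Measure.restrict_apply hS, volumeMeasure_apply hR a (hS.inter hm) hsub, hset,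
    lintegral_image_eq_lintegral_abs_det_fderiv_mul volume hBS (fun w _ =>
      ((hasFDerivAt_affine z A w).restrictScalars ℝ).hasFDerivWithinAt)
      (affine_injective hA z).injOn,
    Measure.map_apply_of_aemeasurable hae hS, withDensity_apply',
    Measure.restrict_restrict' hB.measurableSet, inter_comm]
  refine lintegral_congr fun w => ?_
  rw [abs_det_toLin', ENNReal.ofReal_mul (Complex.normSq_nonneg _)]

end Measure

/-- The pairs `(x, y)` in question lie in a compact set disjoint from the diagonal. There `cosSq`
attains a maximum, which is below `1` by strict Cauchy-Schwarz; `ε` is one minus this maximum, by `1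
+ t ≤ exp t`. This is where Cauchy-Schwarz between different points enters. -/
theorem IsSGCS.exists_cosSq_le_exp [T2Space X] [CompactSpace X] (hS : R.IsSGCS) (hR : R.IsPositive)
    (a : X) {S : Set X} (hSc : IsCompact S) (hSs : S ⊆ (chartAt (Fin n → ℂ) a).source) {κ : ℝ}
    (hκ : 0 < κ) : ∃ ε, 0 < ε ∧ ∀ x ∈ S, ∀ y,
      ¬(y ∈ (chartAt (Fin n → ℂ) a).source ∧
        ‖chartAt (Fin n → ℂ) a y - chartAt (Fin n → ℂ) a x‖ < κ) →
      R.cosSq x y ≤ Real.exp (-ε) := by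
  set e := chartAt (Fin n → ℂ) a
  set O : Set (X × X) := (e.source ×ˢ e.source) ∩ {p | ‖e p.2 - e p.1‖ < κ} with hO
  have hOo : IsOpen O := by
    have hc : ContinuousOn (fun p : X × X => ‖e p.2 - e p.1‖) (e.source ×ˢ e.source) :=
      ((e.continuousOn.comp continuousOn_snd fun p hp => hp.2).sub
        (e.continuousOn.comp continuousOn_fst fun p hp => hp.1)).norm
    exact hc.isOpen_inter_preimage (e.open_source.prod e.open_source) isOpen_Iio
  set C : Set (X × X) := (S ×ˢ univ) ∩ Oᶜ with hC
  have hCc : IsCompact C := (hSc.prod isCompact_univ).inter_right hOo.isClosed_compl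
  have hmem : ∀ x ∈ S, ∀ y, ¬(y ∈ e.source ∧ ‖e y - e x‖ < κ) → (x, y) ∈ C := fun x hx y h =>
    ⟨⟨hx, mem_univ _⟩, fun h' => h ⟨h'.1.2, h'.2⟩⟩
  rcases C.eq_empty_or_nonempty with hCe | hCn
  · refine ⟨1, one_pos, fun x hx y h => ?_⟩
    have := hmem x hx y h
    rw [hCe] at this
    exact this.elim
  · obtain ⟨p, hp, hmax⟩ := hCc.exists_isMaxOn hCn (hR.continuous_cosSq (X := X)).continuousOn
    have hlt : R.cosSq p.1 p.2 < 1 := by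
      refine hS.cosSq_lt_one hR fun h => hp.2 ?_
      have hp1 := hSs hp.1.1
      refine ⟨⟨hp1, h ▸ hp1⟩, ?_⟩
      simpa [h] using hκ
    refine ⟨1 - R.cosSq p.1 p.2, by linarith, fun x hx y h => ?_⟩
    have h1 : R.cosSq x y ≤ R.cosSq p.1 p.2 := hmax (hmem x hx y h)
    have h2 := Real.add_one_le_exp (-(1 - R.cosSq p.1 p.2))
    linarith

theorem differentiableOn_div_toFun_affine [IsManifold 𝓘(ℂ, Fin n → ℂ) ω X]
    {Z : VectorBundleCore ℂ X ℂ ι} [Z.IsContMDiff 𝓘(ℂ, Fin n → ℂ) ω] (Q : HermitianAlgebraic n Z)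
    {a : X} {i : ι} {z : Fin n → ℂ} {A : Matrix (Fin n) (Fin n) ℂ} {B : Set (Fin n → ℂ)}
    (hz : z ∈ frameDomain n Z a i) (hB : ∀ w ∈ B, z + A *ᵥ w ∈ frameDomain n Z a i)
    (hQ0 : ∀ w ∈ B, Q.localRep a a i i (z + A *ᵥ w, star z) ≠ 0) (s : Sections n Z) :
    DifferentiableOn ℂ (fun w => sval s ((chartAt (Fin n → ℂ) a).symm (z + A *ᵥ w)) /
      Q.toFun ((chartAt (Fin n → ℂ) a).symm (z + A *ᵥ w)) ((chartAt (Fin n → ℂ) a).symm z)) B := by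
  have haff : Differentiable ℂ fun w => z + A *ᵥ w := fun w =>
    (hasFDerivAt_affine z A w).differentiableAt
  have hnum := (differentiableOn_mul_sval a i s).comp haff.differentiableOn hB
  have hden : DifferentiableOn ℂ (fun w => Q.localRep a a i i (z + A *ᵥ w, star z)) B :=
    (Q.differentiableOn_localRep a a i i).comp
      (f := fun w => (z + A *ᵥ w, star z)) (haff.prodMk (differentiable_const _)).differentiableOn
      fun w hw => ⟨hB w hw, by simpa using hz⟩
  refine ((hnum.fun_mul (hden.fun_inv hQ0)).const_mul
    (conj (frameFactor Z i ((chartAt (Fin n → ℂ) a).symm z)))).congr fun w hw => ?_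
  have h0 : conj (frameFactor Z i ((chartAt (Fin n → ℂ) a).symm z)) ≠ 0 := by
    simpa using frameFactor_ne_zero hz.2
  have h1 := frameFactor_ne_zero (hB w hw).2
  have h2 := hQ0 w hw
  simp only [Function.comp, localRep, star_star] at h2 ⊢
  have h3 := right_ne_zero_of_mul h2
  field_simp

theorem localRep_mul_pow (R : HermitianAlgebraic n L) (P : HermitianAlgebraic n E) (m : ℕ) (a : X)
    (i : ι) (j : ι') (p : (Fin n → ℂ) × (Fin n → ℂ)) :
    ((R.pow m).mul P).localRep a a (i, j) (i, j) p =
      R.localRep a a i i p ^ m * P.localRep a a j j p := by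
  simp only [localRep, HermitianAlgebraic.mul, HermitianAlgebraic.pow, frameFactor, trans_tensor,
    trans_tpow, map_mul, map_pow]
  simp only [tensor, tpow]
  ring

section Existence

open Metric

variable [T2Space X] [CompactSpace X] [MeasurableSpace X] [BorelSpace X]
  [IsManifold 𝓘(ℂ, Fin n → ℂ) ω X] [L.IsContMDiff 𝓘(ℂ, Fin n → ℂ) ω]
  [E.IsContMDiff 𝓘(ℂ, Fin n → ℂ) ω]

/-- The parametrization is `w ↦ z + A w` followed by the inverse of the fixed chart at `x₀`, with
`A` normalizing the curvature at `x` to the identity. Only `z` and `A` vary with `x`; the bounds on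
the potentials, the metric and the distant values of `cosSq` are uniform on a compact neighbourhood.
-/
theorem exists_isNormalChart (hR : R.IsPositive) (hP : P.IsPositive) (hS : R.IsSGCS) (x₀ : X) :
    ∃ U ∈ 𝓝 x₀, ∃ K δ ε : ℝ, 0 ≤ K ∧ 0 < δ ∧ δ ≤ 1 ∧ 0 < ε ∧
      ∀ x ∈ U, ∃ θ G, IsNormalChart R P K δ ε x θ G := by
  set e := chartAt (Fin n → ℂ) x₀ with he
  set i := L.indexAt x₀
  set j := E.indexAt x₀
  have hsrc : x₀ ∈ e.source := mem_chart_source _ x₀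
  obtain ⟨r₁, M₁, hr₁, hM₁, hb₁, hl₁⟩ := hR.exists_log_bound
    (mem_frameDomain_chart (n := n) hsrc (L.mem_baseSet_at x₀))
  obtain ⟨r₂, M₂, hr₂, hM₂, hb₂, hl₂⟩ := hP.exists_log_bound
    (mem_frameDomain_chart (n := n) hsrc (E.mem_baseSet_at x₀))
  set z₀ := e x₀ with hz₀
  set r := min r₁ r₂ with hr
  have hr0 : 0 < r := lt_min hr₁ hr₂
  have hsub₁ : ball z₀ r ⊆ ball z₀ r₁ := ball_subset_ball (min_le_left _ _)
  have hsub₂ : ball z₀ r ⊆ ball z₀ r₂ := ball_subset_ball (min_le_right _ _)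
  have hdom : ∀ z ∈ ball z₀ r, z ∈ frameDomain n L x₀ i ∩ frameDomain n E x₀ j := fun z hz =>
    ⟨hb₁ (hsub₁ hz), hb₂ (hsub₂ hz)⟩
  have hstar : ∀ z ∈ ball z₀ r, star z ∈ ball (star z₀) r := fun z hz => by
    rw [mem_ball, dist_eq_norm, ← star_sub, norm_star, ← dist_eq_norm]; exact hz
  have hstar' : ∀ z ∈ ball (star z₀) r, star z ∈ ball z₀ r := fun z hz => by
    rw [mem_ball, dist_eq_norm, ← norm_star, star_sub, star_star, ← dist_eq_norm]; exact hz
  have hlR : ∀ p ∈ ball z₀ r ×ˢ ball (star z₀) r, R.localRep x₀ x₀ i i p ∈ Complex.slitPlane ∧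
      ‖Complex.log (R.localRep x₀ x₀ i i p)‖ ≤ max M₁ M₂ := fun p hp => by
    have := hl₁ p ⟨hsub₁ hp.1, ball_subset_ball (min_le_left _ _) hp.2⟩
    exact ⟨this.1, this.2.trans (le_max_left _ _)⟩
  have hlP : ∀ p ∈ ball z₀ r ×ˢ ball (star z₀) r, P.localRep x₀ x₀ j j p ∈ Complex.slitPlane ∧
      ‖Complex.log (P.localRep x₀ x₀ j j p)‖ ≤ max M₁ M₂ := fun p hp => by
    have := hl₂ p ⟨hsub₂ hp.1, ball_subset_ball (min_le_right _ _) hp.2⟩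
    exact ⟨this.1, this.2.trans (le_max_right _ _)⟩
  -- uniform bounds on the metric
  have hcb : closedBall z₀ (r / 2) ⊆ ball z₀ r := closedBall_subset_ball (by linarith)
  obtain ⟨lo, hi, hlo, hhi, hform⟩ := exists_hermForm_bounds (isCompact_closedBall z₀ (r / 2))
    ((continuousOn_neg_curvature hR x₀).mono fun z hz => (hdom z (hcb hz)).1.1)
    fun z hz => hS.curvature_neg x₀ z (hdom z (hcb hz)).1.1
  -- From `lo |A w|² ≤ |w|² ≤ n ‖w‖²`, with Euclidean norms `|·|` and the sup norm `‖·‖`, the matrix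
  -- `A` sends the ball of radius `ρ` into that of radius `r / 2`.
  set ρ := r / 2 / (√(n / lo) + 1) with hρ
  have hρ0 : 0 < ρ := by positivity
  obtain ⟨K, δ, hK, hδ, hδ1, hδρ, hmain⟩ :=
    exists_isApproxGaussian n (le_max_of_le_left hM₁ : 0 ≤ max M₁ M₂) hρ0
  -- If `v` has sup norm below `κ`, then `|A⁻¹ v|²` is the value of the metric form at `v`, at most
  -- `hi n κ² < δ²`. Points of the chart within `κ` of `z` thus lie in the image of the ball of
  -- radius `δ`; the `+ 1` keeps the root positive.
  set κ := δ / √(hi * n + 1) with hκ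
  have hκ0 : 0 < κ := by positivity
  -- the neighbourhood of `x₀`
  have hnhds : e.source ∩ e ⁻¹' ball z₀ (r / 2) ∈ 𝓝 x₀ :=
    (e.isOpen_inter_preimage isOpen_ball).mem_nhds ⟨hsrc, mem_ball_self (by linarith)⟩
  obtain ⟨S, hSn, hSsub, hSc⟩ : ∃ S ∈ 𝓝 x₀, S ⊆ e.source ∩ e ⁻¹' ball z₀ (r / 2) ∧ IsCompact S := by
    have := ChartedSpace.locallyCompactSpace (Fin n → ℂ) X
    obtain ⟨S, h1, h2, h3⟩ := local_compact_nhds hnhds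
    exact ⟨S, h1, h2, h3⟩
  obtain ⟨ε, hε, hfar⟩ := hS.exists_cosSq_le_exp hR x₀ hSc (fun x hx => (hSsub hx).1) hκ0
  refine ⟨S, hSn, K, δ, ε, hK, hδ, hδ1, hε, fun x hx => ?_⟩
  set z := e x with hz
  have hxs : x ∈ e.source := (hSsub hx).1
  have hzb : z ∈ ball z₀ (r / 2) := (hSsub hx).2
  have hzr : z ∈ ball z₀ r := ball_subset_ball (by linarith) hzb
  have hzx : e.symm z = x := e.left_inv hxs
  have hgz := hS.curvature_neg x₀ z (hdom z hzr).1.1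
  obtain ⟨A, hA⟩ := exists_transpose_mul_mul_eq_one hgz
  have hAdet : IsUnit A.det := by
    have h := congrArg Matrix.det hA
    rw [Matrix.mul_assoc, Matrix.det_mul, Matrix.det_transpose, Matrix.det_one] at h
    exact isUnit_iff_ne_zero.2 (left_ne_zero_of_mul_eq_one h)
  have hAform : ∀ w, hermForm (-R.curvature x₀ z) (A *ᵥ w) = normSq w := fun w => by
    rw [hermForm_mulVec, hA, hermForm_one]
  have hAnorm : ∀ w : Fin n → ℂ, ‖w‖ < ρ → ‖A *ᵥ w‖ < r / 2 := by
    intro w hw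
    have h1 := (hform z (ball_subset_closedBall hzb) (A *ᵥ w)).1
    rw [hAform] at h1
    have h2 : ‖A *ᵥ w‖ ≤ √(n / lo) * ‖w‖ := by
      refine (norm_le_sqrt_normSq _).trans ?_
      rw [← Real.sqrt_sq (norm_nonneg w), ← Real.sqrt_mul (by positivity)]
      refine Real.sqrt_le_sqrt ?_
      rw [div_mul_eq_mul_div, le_div_iff₀ hlo, mul_comm]
      exact h1.trans (normSq_le_card_mul_norm_sq w)
    have h3 : (√(n / lo) + 1) * ρ = r / 2 := by rw [hρ]; field_simp
    have h4 := Real.sqrt_nonneg (n / lo)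
    nlinarith [norm_nonneg w]
  have hball : ∀ w : Fin n → ℂ, ‖w‖ < ρ → z + A *ᵥ w ∈ ball z₀ r := by
    intro w hw
    rw [mem_ball, dist_eq_norm] at hzb ⊢
    calc ‖z + A *ᵥ w - z₀‖ = ‖(z - z₀) + A *ᵥ w‖ := by congr 1; abel
      _ ≤ ‖z - z₀‖ + ‖A *ᵥ w‖ := norm_add_le _ _
      _ < r := by linarith [hAnorm w hw]
  have hext : ∀ p ∈ ball (0 : (Fin n → ℂ) × (Fin n → ℂ)) ρ,
      affineExt z A p ∈ ball z₀ r ×ˢ ball (star z₀) r := by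
    intro p hp
    rw [mem_ball_zero_iff, Prod.norm_def, max_lt_iff] at hp
    refine ⟨hball p.1 hp.1, ?_⟩
    have h1 : (affineExt z A p).2 = star (z + A *ᵥ star p.2) := by
      rw [star_add, star_mulVec_eq, star_star]; rfl
    rw [h1]
    exact hstar _ (hball _ (by rw [norm_star]; exact hp.2))
  have hnorm : ∀ w : Fin n → ℂ, normSq w < δ ^ 2 → ‖w‖ < ρ := fun w hw =>
    ((norm_le_sqrt_normSq w).trans_lt ((Real.sqrt_lt' hδ).2 hw)).trans hδρ
  have hBall : ∀ w : Fin n → ℂ, normSq w < δ ^ 2 → z + A *ᵥ w ∈ ball z₀ r := fun w hw =>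
    hball w (hnorm w hw)
  have hBt : ∀ w ∈ {w : Fin n → ℂ | normSq w < δ ^ 2}, z + A *ᵥ w ∈ e.target := fun w hw =>
    (hdom _ (hBall w hw)).1.1
  have hopen : IsOpen (ball (0 : (Fin n → ℂ) × (Fin n → ℂ)) ρ) := isOpen_ball
  have hext' : ∀ p ∈ ball (0 : (Fin n → ℂ) × (Fin n → ℂ)) ρ,
      star (affineExt z A p).2 ∈ ball z₀ r := by
    intro p hp
    have := hstar' _ (hext p hp).2
    exact this
  have hdR : DifferentiableOn ℂ (fun p => R.localRep x₀ x₀ i i (affineExt z A p))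
      (ball (0 : (Fin n → ℂ) × (Fin n → ℂ)) ρ) :=
    (R.differentiableOn_localRep x₀ x₀ i i).comp (differentiable_affineExt z A).differentiableOn
      fun p hp => ⟨(hdom _ (hext p hp).1).1, (hdom _ (hext' p hp)).1⟩
  have hdP : DifferentiableOn ℂ (fun p => P.localRep x₀ x₀ j j (affineExt z A p))
      (ball (0 : (Fin n → ℂ) × (Fin n → ℂ)) ρ) :=
    (P.differentiableOn_localRep x₀ x₀ j j).comp (differentiable_affineExt z A).differentiableOn
      fun p hp => ⟨(hdom _ (hext p hp).1).2, (hdom _ (hext' p hp)).2⟩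
  set ΛR := fun p => Complex.log (R.localRep x₀ x₀ i i (affineExt z A p)) with hΛR
  set ΛP := fun p => Complex.log (P.localRep x₀ x₀ j j (affineExt z A p)) with hΛP
  have hhess : ∀ w : Fin n → ℂ, ‖w‖ < ρ → mixedHessian ΛR (w, star w) =
      Aᵀ * (-R.curvature x₀ (z + A *ᵥ w)) * A.map conj := by
    intro w hw
    have hmem : (w, star w) ∈ ball (0 : (Fin n → ℂ) × (Fin n → ℂ)) ρ := by
      rw [mem_ball_zero_iff, Prod.norm_def, norm_star, max_self]
      exact hw
    ext k l
    rw [hΛR, mixedHessian_clog hopen hdR (fun p hp => (hlR _ (hext p hp)).1) hmem]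
    exact logHess_affine hR z A (hdom _ (hball w hw)).1 k l
  have hdet : ∀ w : Fin n → ℂ, ‖w‖ < ρ → (mixedHessian ΛR (w, star w)).det =
      ((Complex.normSq A.det * R.density x₀ (z + A *ᵥ w) : ℝ) : ℂ) := by
    intro w hw
    have hconj : (A.map conj).det = conj A.det := by
      rw [← RingHom.mapMatrix_apply, ← RingHom.map_det]
    rw [hhess w hw, Matrix.det_mul, Matrix.det_mul, Matrix.det_transpose, hconj,
      Complex.ofReal_mul, hS.ofReal_density (hdom _ (hball w hw)).1.1, ← Complex.mul_conj]
    ring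
  have hone : mixedHessian ΛR 0 = 1 := by
    have := hhess 0 (by rwa [norm_zero])
    rw [star_zero, Matrix.mulVec_zero, add_zero, hA] at this
    exact this
  obtain ⟨hAG, hbd⟩ := hmain ΛR ΛP (hdR.clog fun p hp => (hlR _ (hext p hp)).1)
    (hdP.clog fun p hp => (hlP _ (hext p hp)).1) (fun p hp => (hlR _ (hext p hp)).2)
    (fun p hp => (hlP _ (hext p hp)).2) hone
  have hexpR : ∀ w, normSq w < δ ^ 2 →
      Complex.exp (-diastasis ΛR w) = R.cosSq x (e.symm (z + A *ᵥ w)) := by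
    intro w hw
    have h := hR.exp_neg_diastasis A (hdom z hzr).1 (hdom _ (hBall w hw)).1
      (Complex.slitPlane_ne_zero (hlR (_, _) ⟨hBall w hw, hstar z hzr⟩).1)
      (Complex.slitPlane_ne_zero (hlR (_, _) ⟨hzr, hstar _ (hBall w hw)⟩).1)
    rwa [← he, hzx] at h
  have hexpP : ∀ w, normSq w < δ ^ 2 →
      Complex.exp (-diastasis ΛP w) = P.cosSq x (e.symm (z + A *ᵥ w)) := by
    intro w hw
    have h := hP.exp_neg_diastasis A (hdom z hzr).2 (hdom _ (hBall w hw)).2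
      (Complex.slitPlane_ne_zero (hlP (_, _) ⟨hBall w hw, hstar z hzr⟩).1)
      (Complex.slitPlane_ne_zero (hlP (_, _) ⟨hzr, hstar _ (hBall w hw)⟩).1)
    rwa [← he, hzx] at h
  have hG : ∀ w, normSq w < δ ^ 2 →
      |Complex.normSq A.det * R.density x₀ (z + A *ᵥ w) - 1| ≤ 1 / 2 := by
    intro w hw
    have h := (hbd w hw).2
    rwa [hdet w (hnorm w hw), ← Complex.ofReal_one, ← Complex.ofReal_sub, Complex.norm_real,
      Real.norm_eq_abs] at h
  have hB := isOpen_normSq_lt (n := n) (δ ^ 2)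
  refine ⟨fun w => e.symm (z + A *ᵥ w),
    fun w => Complex.normSq A.det * R.density x₀ (z + A *ᵥ w), ?_⟩
  exact
    { map_zero := by simpa using hzx
      continuousOn := e.continuousOn_symm.comp (continuous_affine z A).continuousOn hBt
      continuousOn_density := continuousOn_const.mul ((continuousOn_density hR x₀).comp
        (continuous_affine z A).continuousOn hBt)
      half_le_density := fun w hw => by linarith [(abs_le.1 (hG w hw)).1]
      density_le_two := fun w hw => by linarith [(abs_le.1 (hG w hw)).2]
      measurableSet_image := measurableSet_image_affine hAdet x₀ hB hBt
      restrict_image := volumeMeasure_restrict_image_affine hR hAdet x₀ hB hBt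
      differentiableOn_quotient := by
        intro m s
        have h := differentiableOn_div_toFun_affine ((R.pow m).mul P) (a := x₀) (i := (i, j))
          (z := z) (A := A) (B := {w | normSq w < δ ^ 2})
          ⟨(hdom z hzr).1.1, (hdom z hzr).1.2, (hdom z hzr).2.2⟩
          (fun w hw => ⟨hBt w hw, (hdom _ (hBall w hw)).1.2, (hdom _ (hBall w hw)).2.2⟩)
          (fun w hw => by
            rw [localRep_mul_pow]
            exact mul_ne_zero (pow_ne_zero m
              (Complex.slitPlane_ne_zero (hlR (_, _) ⟨hBall w hw, hstar z hzr⟩).1))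
              (Complex.slitPlane_ne_zero (hlP (_, _) ⟨hBall w hw, hstar z hzr⟩).1)) s
        rwa [← he, hzx] at h
      exists_isApproxGaussian := ⟨_, _, _, _, _, hAG, fun w hw => ⟨hexpR w hw, by
        rw [hdet w (hnorm w hw), hexpP w hw]⟩⟩
      exp_le_cosSq := by
        intro w hw
        have h1 : P.cosSq x (e.symm (z + A *ᵥ w)) = Real.exp (-(diastasis ΛP w).re) := by
          rw [← Real.norm_of_nonneg (P.cosSq_nonneg _ _), ← Complex.norm_real, ← hexpP w hw,
            Complex.norm_exp, Complex.neg_re]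
        have h2 := (Complex.re_le_norm (diastasis ΛP w)).trans (hbd w hw).1
        rw [h1]
        exact Real.exp_le_exp.2 (neg_le_neg h2)
      cosSq_le_exp := by
        intro y hy
        refine hfar x hx y fun hy' => hy ?_
        refine ⟨A⁻¹ *ᵥ (e y - z), ?_, ?_⟩
        · have h1 := (hform z (ball_subset_closedBall hzb) (e y - z)).2
          have h2 : A *ᵥ (A⁻¹ *ᵥ (e y - z)) = e y - z := by
            rw [Matrix.mulVec_mulVec, Matrix.mul_nonsing_inv _ hAdet, Matrix.one_mulVec]
          rw [← h2, hAform, h2] at h1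
          have h3 := normSq_le_card_mul_norm_sq (e y - z)
          have h4 : ‖e y - z‖ ^ 2 < κ ^ 2 := pow_lt_pow_left₀ hy'.2 (norm_nonneg _) two_ne_zero
          have h5 : κ ^ 2 * (hi * n + 1) = δ ^ 2 := by
            rw [hκ, div_pow, Real.sq_sqrt (by positivity)]
            field_simp
          have h6 : (0 : ℝ) < hi * n + 1 := by positivity
          change normSq _ < δ ^ 2
          nlinarith [sq_nonneg ‖e y - z‖, mul_le_mul_of_nonneg_left h3 hhi.le]
        · dsimp only
          rw [Matrix.mulVec_mulVec, Matrix.mul_nonsing_inv _ hAdet, Matrix.one_mulVec,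
            add_sub_cancel, e.left_inv hy'.1] }

end Existence

end HermitianAlgebraic

end

noncomputable section

/-! ## Finite-dimensionality of the space of sections -/

open LineBundle

namespace HermitianAlgebraic

open Gaussian Filter Topology Matrix

variable {n : ℕ} {X : Type*} [TopologicalSpace X] [CompactSpace X] [MeasurableSpace X]
  [ChartedSpace (Fin n → ℂ) X] {ι ι' : Type*}

section SupBound

variable [BorelSpace X] [IsManifold 𝓘(ℂ, Fin n → ℂ) ω X]
  {L : VectorBundleCore ℂ X ℂ ι} {E : VectorBundleCore ℂ X ℂ ι'}
  [L.IsContMDiff 𝓘(ℂ, Fin n → ℂ) ω] [E.IsContMDiff 𝓘(ℂ, Fin n → ℂ) ω]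
  {R : HermitianAlgebraic n L} {P : HermitianAlgebraic n E}

theorem _root_.Gaussian.integral_cutoff_pos {δ : ℝ} (hδ : 0 < δ) :
    0 < ∫ w : Fin n → ℂ, cutoff δ w := by
  refine (continuous_cutoff δ).integral_pos_of_hasCompactSupport_nonneg_nonzero
    (HasCompactSupport.intro (isCompact_normSq_le (δ ^ 2 / 2)) fun w hw =>
      cutoff_eq_zero hδ (not_le.1 hw).le)
    (fun w => cutoff_nonneg δ w) (x := 0) ?_
  rw [cutoff_eq_one hδ (by rw [normSq_zero]; positivity)]
  exact one_ne_zero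

/-- Mean value estimate for the holomorphic function `s / Q(·, x̄)`. The power `m` is fixed, so a
constant growing exponentially in `m` is harmless. -/
theorem IsNormalChart.normAt_sq_le {K δ ε : ℝ} (hR : R.IsPositive) (hP : P.IsPositive) (hδ : 0 < δ)
    (hδ1 : δ ≤ 1) (m : ℕ) : ∃ C, 0 ≤ C ∧ ∀ (x : X) (θ : (Fin n → ℂ) → X) (G : (Fin n → ℂ) → ℝ),
      IsNormalChart R P K δ ε x θ G → ∀ s : Sections n (tensor (tpow L m) E),
      ((R.pow m).mul P).normAt s x ^ 2 ≤
        C * ∫ y, ((R.pow m).mul P).normAt s y ^ 2 ∂(R.volumeMeasure) := by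
  have := isFiniteMeasure_volumeMeasure hR
  have hI := integral_cutoff_pos (n := n) hδ
  refine ⟨(2 * Real.exp (m + 1) ^ 2) / ∫ w : Fin n → ℂ, cutoff δ w, by positivity,
    fun x θ G hθ s => ?_⟩
  set Q := (R.pow m).mul P
  have hQ : Q.IsPositive := (hR.pow m).mul hP
  have hB := (isOpen_normSq_lt (n := n) (δ ^ 2)).measurableSet
  set c := √‖Q.toFun x x‖ with hc
  have hc0 : 0 < c := Real.sqrt_pos.2 (hQ.norm_pos x)
  set f : (Fin n → ℂ) → ℂ := fun w => sval s (θ w) / Q.toFun (θ w) x with hf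
  have hfd : DifferentiableOn ℂ f {w | normSq w < δ ^ 2} := hθ.differentiableOn_quotient m s
  have hnf0 : ‖f 0‖ = Q.normAt s x / c := by
    rw [hf]
    dsimp only
    have hcc : c * c = ‖Q.toFun x x‖ := Real.mul_self_sqrt (norm_nonneg _)
    rw [hθ.map_zero, norm_div, hQ.norm_sval, div_eq_div_iff (hQ.norm_pos x).ne' hc0.ne', ← hc]
    linear_combination Q.normAt s x * hcc
  have hfw : ∀ w, normSq w < δ ^ 2 → ‖f w‖ ≤ Real.exp (m + 1) / c * Q.normAt s (θ w) := by
    intro w hw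
    have h1 := hθ.norm_quotient_mul_exp_le hR hP m s hw
    have h2 : R.cosSq x (θ w) ^ (m / 6 : ℝ) ≤ 1 := by
      refine Real.rpow_le_one (R.cosSq_nonneg _ _) ((hθ.cosSq_mem hw).2.trans ?_) (by positivity)
      exact Real.exp_le_one_iff.2 (by have := normSq_nonneg w; linarith)
    have h3 : Real.exp (-m) ≤ Real.exp (-(3 / 4 * m) * normSq w) := by
      refine Real.exp_le_exp.2 ?_
      have h4 : normSq w ≤ 1 := by nlinarith
      have h5 := normSq_nonneg w
      have h6 : (0 : ℝ) ≤ m := by positivity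
      nlinarith [mul_le_mul_of_nonneg_left h4 h6]
    have hN := Q.normAt_nonneg s (θ w)
    have h7 : ‖f w‖ * Real.exp (-m) ≤ Real.exp 1 / c * (1 * Q.normAt s (θ w)) :=
      (mul_le_mul_of_nonneg_left h3 (norm_nonneg _)).trans (h1.trans (by gcongr))
    have h8 : ‖f w‖ = ‖f w‖ * Real.exp (-m) * Real.exp m := by
      rw [mul_assoc, ← Real.exp_add, neg_add_cancel, Real.exp_zero, mul_one]
    rw [h8, Real.exp_add]
    calc _ ≤ Real.exp 1 / c * (1 * Q.normAt s (θ w)) * Real.exp m :=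
          mul_le_mul_of_nonneg_right h7 (Real.exp_pos _).le
      _ = _ := by ring
  have hcut0 : ∀ w : Fin n → ℂ, δ ^ 2 / 2 < normSq w → (cutoff δ w : ℂ) = 0 := fun w hw => by
    rw [cutoff_eq_zero hδ hw.le, Complex.ofReal_zero]
  -- The square `f²` is holomorphic, so its integral against the circle-invariant cut-off is `f(0)²`
  -- times the total mass; taking absolute values gives an `L²` bound directly.
  have hmean := integral_mul_of_homogeneous (f := fun w => f w ^ 2) (k := fun w => (cutoff δ w : ℂ))
    (r := δ ^ 2) (r' := δ ^ 2 / 2) (by nlinarith [sq_pos_of_pos hδ]) (hfd.pow 2)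
    (Complex.continuous_ofReal.comp (continuous_cutoff δ)) hcut0 0
    (fun c hc w => by rw [cutoff_smul δ hc, pow_zero, one_mul])
  rw [pow_zero, one_mul, integral_complex_ofReal] at hmean
  have hNi : Continuous fun y => Q.normAt s y ^ 2 := (hQ.continuous_normAt s).pow 2
  have hGi : IntegrableOn (fun w => G w * Q.normAt s (θ w) ^ 2) {w | normSq w < δ ^ 2} := by
    simpa using hθ.integrableOn_density_smul hNi (continuous_const (y := (1 : ℝ))) (by simp)
  have hbound : ‖∫ w, f w ^ 2 * (cutoff δ w : ℂ)‖ ≤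
      2 * Real.exp (m + 1) ^ 2 / c ^ 2 * ∫ y, Q.normAt s y ^ 2 ∂(R.volumeMeasure) := by
    rw [← setIntegral_eq_integral_of_forall_compl_eq_zero
      (s := {w : Fin n → ℂ | normSq w < δ ^ 2}) fun w hw => by
        rw [hcut0 w (lt_of_lt_of_le (by nlinarith [sq_pos_of_pos hδ]) (not_lt.1 hw)), mul_zero]]
    refine (norm_integral_le_of_norm_le (hGi.const_mul (2 * Real.exp (m + 1) ^ 2 / c ^ 2))
      (ae_restrict_of_forall_mem hB fun w hw => ?_)).trans ?_
    · have h1 := pow_le_pow_left₀ (norm_nonneg _) (hfw w hw) 2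
      have h2 := hθ.half_le_density w hw
      have h3 : ‖(cutoff δ w : ℂ)‖ ≤ 1 := by
        rw [Complex.norm_real, Real.norm_of_nonneg (cutoff_nonneg δ w)]
        exact cutoff_le_one δ w
      rw [norm_mul, norm_pow]
      calc ‖f w‖ ^ 2 * ‖(cutoff δ w : ℂ)‖ ≤ ‖f w‖ ^ 2 * 1 := by gcongr
        _ ≤ (Real.exp (m + 1) / c * Q.normAt s (θ w)) ^ 2 * (2 * G w) :=
            mul_le_mul h1 (by linarith) zero_le_one (by positivity)
        _ = _ := by ring
    · rw [integral_const_mul]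
      refine mul_le_mul_of_nonneg_left ?_ (by positivity)
      have h1 := hθ.setIntegral_image hNi.aestronglyMeasurable
      simp only [smul_eq_mul] at h1
      rw [← h1]
      exact setIntegral_le_integral hNi.integrable_of_compactSpace
        (Eventually.of_forall fun y => sq_nonneg _)
  rw [hmean, norm_mul, norm_pow, hnf0, Complex.norm_real, Real.norm_of_nonneg hI.le, div_pow] at hbound
  rw [div_mul_eq_mul_div, le_div_iff₀ hI]
  rw [div_mul_eq_mul_div, div_mul_eq_mul_div, div_le_div_iff_of_pos_right (by positivity)] at hbound
  exact hbound

theorem exists_normAt_sq_le [T2Space X] (hR : R.IsPositive) (hP : P.IsPositive) (hS : R.IsSGCS)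
    (m : ℕ) : ∃ C, 0 ≤ C ∧ ∀ (x : X) (s : Sections n (tensor (tpow L m) E)),
      ((R.pow m).mul P).normAt s x ^ 2 ≤
        C * ∫ y, ((R.pow m).mul P).normAt s y ^ 2 ∂(R.volumeMeasure) := by
  have hI : ∀ s : Sections n (tensor (tpow L m) E),
      0 ≤ ∫ y, ((R.pow m).mul P).normAt s y ^ 2 ∂(R.volumeMeasure) :=
    fun s => integral_nonneg fun y => sq_nonneg _
  have key : ∃ C, 0 ≤ C ∧ ∀ x ∈ (univ : Set X), ∀ (s : Sections n (tensor (tpow L m) E)),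
      ((R.pow m).mul P).normAt s x ^ 2 ≤
        C * ∫ y, ((R.pow m).mul P).normAt s y ^ 2 ∂(R.volumeMeasure) := by
    refine isCompact_univ.induction_on (p := fun S : Set X => ∃ C, 0 ≤ C ∧ ∀ x ∈ S,
      ∀ (s : Sections n (tensor (tpow L m) E)), ((R.pow m).mul P).normAt s x ^ 2 ≤
        C * ∫ y, ((R.pow m).mul P).normAt s y ^ 2 ∂(R.volumeMeasure))
      ⟨0, le_rfl, fun x hx => hx.elim⟩ ?_ ?_ ?_
    · rintro S T hST ⟨C, hC, h⟩
      exact ⟨C, hC, fun x hx => h x (hST hx)⟩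
    · rintro S T ⟨C, hC, h⟩ ⟨C', hC', h'⟩
      refine ⟨C + C', by positivity, fun x hx s => ?_⟩
      rcases hx with hx | hx
      · exact (h x hx s).trans (mul_le_mul_of_nonneg_right (by linarith) (hI s))
      · exact (h' x hx s).trans (mul_le_mul_of_nonneg_right (by linarith) (hI s))
    · intro x₀ _
      obtain ⟨U, hU, K, δ, ε, hK, hδ, hδ1, hε, hθ⟩ := exists_isNormalChart hR hP hS x₀
      obtain ⟨C, hC, h⟩ := IsNormalChart.normAt_sq_le (K := K) (ε := ε) hR hP hδ hδ1 m
      refine ⟨U, mem_nhdsWithin_of_mem_nhds hU, C, hC, fun x hx s => ?_⟩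
      obtain ⟨θ, G, hx⟩ := hθ x hx
      exact h x θ G hx s
  obtain ⟨C, hC, h⟩ := key
  exact ⟨C, hC, fun x => h x (mem_univ x)⟩

end SupBound

end HermitianAlgebraic

end

/-! ### Orthonormal bases of the space of sections -/

noncomputable section

/-- The span of a finite linearly independent family has an orthonormal basis of the same
cardinality, so a bound for orthonormal families bounds the rank. -/
theorem InnerProductSpace.Core.exists_orthonormal_basis {V : Type*} [AddCommGroup V] [Module ℂ V]
    (c : InnerProductSpace.Core ℂ V) {N : ℕ}
    (hN : ∀ (k : ℕ) (e : Fin k → V),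
      (∀ i j, c.inner (e i) (e j) = if i = j then 1 else 0) → k ≤ N) :
    ∃ (d : ℕ) (b : Module.Basis (Fin d) ℂ V),
      ∀ i j, c.inner (b i) (b j) = if i = j then 1 else 0 := by
  letI : NormedAddCommGroup V := c.toNormedAddCommGroup
  letI : InnerProductSpace ℂ V := InnerProductSpace.ofCore c.toCore
  have hrank : Module.rank ℂ V ≤ N := by
    refine rank_le fun s hs => ?_
    have hd : Module.finrank ℂ (Submodule.span ℂ (s : Set V)) = s.card :=
      finrank_span_finset_eq_card hs
    rw [← hd]
    exact hN _ (fun i => (stdOrthonormalBasis ℂ (Submodule.span ℂ (s : Set V)) i : V))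
      fun i j => orthonormal_iff_ite.1 (stdOrthonormalBasis ℂ _).orthonormal i j
  have hfin : FiniteDimensional ℂ V :=
    Module.rank_lt_aleph0_iff.1 (hrank.trans_lt Cardinal.natCast_lt_aleph0)
  refine ⟨_, (stdOrthonormalBasis ℂ V).toBasis, fun i j => ?_⟩
  rw [OrthonormalBasis.coe_toBasis]
  exact orthonormal_iff_ite.1 (stdOrthonormalBasis ℂ V).orthonormal i j

open LineBundle

section Sections

variable {n : ℕ} {X : Type*} [TopologicalSpace X] [ChartedSpace (Fin n → ℂ) X] {ι : Type*}
  {Z : VectorBundleCore ℂ X ℂ ι}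

variable (n Z) in
/-- Evaluation of sections at `x`, in the frame attached to `x`. -/
def LineBundle.evalAt (x : X) : Sections n Z →ₗ[ℂ] ℂ where
  toFun s := sval s x
  map_add' _ _ := rfl
  map_smul' _ _ := rfl

theorem LineBundle.sval_smul (c : ℂ) (s : Sections n Z) (x : X) : sval (c • s) x = c * sval s x :=
  rfl

theorem LineBundle.sval_sum_smul {κ : Type*} (S : Finset κ) (c : κ → ℂ) (e : κ → Sections n Z)
    (x : X) : sval (∑ k ∈ S, c k • e k) x = ∑ k ∈ S, c k * sval (e k) x := by
  have h := map_sum (evalAt n Z x) (fun k => c k • e k) S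
  simp only [map_smul] at h
  exact h

theorem LineBundle.sections_ext {s t : Sections n Z} (h : ∀ x, sval s x = sval t x) : s = t :=
  ContMDiffSection.ext h

namespace HermitianAlgebraic

variable [CompactSpace X] [MeasurableSpace X] [BorelSpace X] [IsManifold 𝓘(ℂ, Fin n → ℂ) ω X]
  [Z.IsContMDiff 𝓘(ℂ, Fin n → ℂ) ω]
  {Q : HermitianAlgebraic n Z} {Ω : Measure X} [IsFiniteMeasure Ω]

theorem conj_toFun_self (Q : HermitianAlgebraic n Z) (x : X) : conj (Q.toFun x x) = Q.toFun x x :=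
  (Q.hermitian x x).symm

theorem conj_l2Inner (Q : HermitianAlgebraic n Z) (Ω : Measure X) (s t : Sections n Z) :
    conj (Q.l2Inner Ω s t) = Q.l2Inner Ω t s := by
  rw [l2Inner, ← integral_conj, l2Inner]
  refine integral_congr_ae (Filter.Eventually.of_forall fun x => ?_)
  dsimp only
  rw [map_div₀, map_mul, Complex.conj_conj, Q.conj_toFun_self, mul_comm]

theorem IsPositive.l2Inner_sum_smul (hQ : Q.IsPositive) {κ : Type*} (S : Finset κ) (c : κ → ℂ)
    (e : κ → Sections n Z) (t : Sections n Z) :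
    Q.l2Inner Ω (∑ k ∈ S, c k • e k) t = ∑ k ∈ S, c k * Q.l2Inner Ω (e k) t := by
  simp only [l2Inner, ← integral_const_mul]
  rw [← integral_finsetSum _ fun k _ =>
    ((hQ.continuous_pairing (e k) t).integrable_of_compactSpace).const_mul (c k)]
  refine integral_congr_ae (Filter.Eventually.of_forall fun x => ?_)
  dsimp only
  rw [sval_sum_smul, Finset.sum_mul, Finset.sum_div]
  exact Finset.sum_congr rfl fun k _ => by ring

/-- The `L²` product as an inner product. -/
@[reducible]
def IsPositive.l2Core (hQ : Q.IsPositive) (Ω : Measure X) [IsFiniteMeasure Ω]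
    [Ω.IsOpenPosMeasure] : InnerProductSpace.Core ℂ (Sections n Z) where
  inner s t := Q.l2Inner Ω t s
  conj_inner_symm s t := Q.conj_l2Inner Ω s t
  re_inner_nonneg s := by
    rw [hQ.l2Inner_self]
    exact integral_nonneg fun x => sq_nonneg _
  add_left s t u := by
    rw [← Q.conj_l2Inner Ω (s + t), ← Q.conj_l2Inner Ω s, ← Q.conj_l2Inner Ω t, ← map_add]
    congr 1
    have := hQ.l2Inner_sum_smul (Ω := Ω) Finset.univ ![1, 1] ![s, t] u
    simpa using this
  smul_left s t c := by
    rw [← Q.conj_l2Inner Ω (c • s), ← Q.conj_l2Inner Ω s, ← map_mul]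
    congr 1
    have := hQ.l2Inner_sum_smul (Ω := Ω) Finset.univ ![c] ![s] t
    simpa using this
  definite s hs := by
    rw [hQ.l2Inner_self, Complex.ofReal_eq_zero] at hs
    by_contra h
    obtain ⟨x, hx⟩ : ∃ x, sval s x ≠ 0 := by
      by_contra! h'
      exact h (sections_ext h')
    have := ((hQ.continuous_normAt s).pow 2).integral_pos_of_hasCompactSupport_nonneg_nonzero
      (μ := Ω) (HasCompactSupport.of_compactSpace _) (fun x => sq_nonneg _) (x := x)
      (pow_ne_zero 2 (div_ne_zero (norm_ne_zero_iff.2 hx) (Real.sqrt_pos.2 (hQ.norm_pos x)).ne'))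
    exact this.ne' hs

/-- For an orthonormal family the supremum bound yields `∑ |e_i(x)|² ≤ C` at each point, in the
metric of `Q`. Integration shows that the family has at most `C Ω(X)` members. -/
theorem IsPositive.exists_orthonormal_basis (hQ : Q.IsPositive) (Ω : Measure X) [IsFiniteMeasure Ω]
    [Ω.IsOpenPosMeasure] {C : ℝ} (hC0 : 0 ≤ C) (hC : ∀ (x : X) (s : Sections n Z),
      Q.normAt s x ^ 2 ≤ C * ∫ y, Q.normAt s y ^ 2 ∂Ω) :
    ∃ (d : ℕ) (b : Module.Basis (Fin d) ℂ (Sections n Z)),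
      ∀ i j, Q.l2Inner Ω (b i) (b j) = if i = j then 1 else 0 := by
  obtain ⟨N, hN⟩ := exists_nat_ge (C * Ω.real univ)
  obtain ⟨d, b, hb⟩ := (hQ.l2Core Ω).exists_orthonormal_basis (N := N) fun k e he => by
    have he' : ∀ i j, Q.l2Inner Ω (e i) (e j) = if i = j then 1 else 0 := fun i j =>
      (he j i).trans (if_congr eq_comm rfl rfl)
    have hI : ∀ i, ∫ y, Q.normAt (e i) y ^ 2 ∂Ω = 1 := fun i => by
      have := he' i i
      rw [hQ.l2Inner_self, if_pos rfl] at this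
      exact_mod_cast this
    have hpt : ∀ x, ∑ i, Q.normAt (e i) x ^ 2 ≤ C := fun x => by
      set T : ℝ := ∑ i, Q.normAt (e i) x ^ 2 with hT
      -- The extremal section for evaluation at `x`: its value at `x` and its squared `L²` norm are
      -- both `∑ |e_i(x)|²` in coordinates, so the supremum bound applied to it becomes a bound on
      -- that sum.
      set s : Sections n Z := ∑ i, conj (sval (e i) x) • e i with hs
      have hx := hQ.norm_pos x
      have h1 : ∀ t : Sections n Z, Q.normAt t x ^ 2 = ‖sval t x‖ ^ 2 / ‖Q.toFun x x‖ := fun t => by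
        rw [normAt, div_pow, Real.sq_sqrt hx.le]
      have h2 : sval s x = ((T * ‖Q.toFun x x‖ : ℝ) : ℂ) := by
        rw [hs, sval_sum_smul, hT, Finset.sum_mul, Complex.ofReal_sum]
        refine Finset.sum_congr rfl fun i _ => ?_
        rw [h1, div_mul_cancel₀ _ hx.ne', ← Complex.normSq_eq_norm_sq, Complex.normSq_eq_conj_mul_self]
      have h3 : ∫ y, Q.normAt s y ^ 2 ∂Ω = T * ‖Q.toFun x x‖ := by
        have h4 : Q.l2Inner Ω s s = ((T * ‖Q.toFun x x‖ : ℝ) : ℂ) := by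
          rw [← h2]
          nth_rw 1 [hs]
          rw [hs, hQ.l2Inner_sum_smul, sval_sum_smul]
          refine Finset.sum_congr rfl fun i _ => ?_
          congr 1
          rw [← conj_l2Inner, hQ.l2Inner_sum_smul, map_sum]
          simp [he', apply_ite conj]
        rw [hQ.l2Inner_self] at h4
        exact_mod_cast h4
      have h5 := hC x s
      rw [h1, h2, h3, Complex.norm_real, Real.norm_eq_abs, sq_abs] at h5
      have hT0 : 0 ≤ T := Finset.sum_nonneg fun i _ => sq_nonneg _
      rcases hT0.eq_or_lt with h0 | h0
      · rwa [← h0]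
      · have h6 : T * (T * ‖Q.toFun x x‖) ≤ C * (T * ‖Q.toFun x x‖) := by
          convert h5 using 1
          field_simp
        exact le_of_mul_le_mul_right h6 (by positivity)
    have hi : ∀ i, Integrable (fun x => Q.normAt (e i) x ^ 2) Ω := fun i =>
      ((hQ.continuous_normAt (e i)).pow 2).integrable_of_compactSpace
    have h7 : ∫ x, ∑ i, Q.normAt (e i) x ^ 2 ∂Ω ≤ ∫ _, C ∂Ω :=
      integral_mono (integrable_finsetSum _ fun i _ =>
        hi i) (integrable_const C) hpt
    rw [integral_finsetSum _ fun i _ => hi i] at h7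
    simp only [hI, integral_const, Finset.sum_const, Finset.card_univ, Fintype.card_fin,
      nsmul_eq_mul, mul_one, smul_eq_mul] at h7
    rw [mul_comm] at h7
    exact_mod_cast h7.trans hN
  exact ⟨d, b, fun i j => (hb j i).trans (if_congr eq_comm rfl rfl)⟩

end HermitianAlgebraic

end Sections

end

noncomputable section

/-! ## Expansion of a Hermitian algebraic function in an orthonormal basis -/

open LineBundle

theorem Matrix.IsHermitian.apply_eq_sum_eigenvalues {d : ℕ} {c : Matrix (Fin d) (Fin d) ℂ}
    (hc : c.IsHermitian) (i j : Fin d) :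
    c i j = ∑ k, hc.eigenvalues k * (hc.eigenvectorBasis k i * conj (hc.eigenvectorBasis k j)) := by
  have h := congrFun (congrFun hc.spectral_theorem i) j
  rw [Unitary.conjStarAlgAut_apply, Matrix.mul_apply] at h
  rw [h]
  refine Finset.sum_congr rfl fun k _ => ?_
  rw [Matrix.mul_diagonal, Matrix.star_apply, hc.eigenvectorUnitary_apply,
    hc.eigenvectorUnitary_apply]
  simp only [Function.comp, Complex.star_def, Complex.coe_algebraMap, RCLike.ofReal]
  ring

theorem Matrix.IsHermitian.sum_mul_conj_eq {d : ℕ} {c : Matrix (Fin d) (Fin d) ℂ}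
    (hc : c.IsHermitian) (v : Fin d → ℂ) :
    ∑ i, ∑ j, c i j * (v i * conj (v j)) = ∑ k, hc.eigenvalues k *
      ((∑ i, hc.eigenvectorBasis k i * v i) * conj (∑ i, hc.eigenvectorBasis k i * v i)) := by
  have h : ∀ k, (hc.eigenvalues k : ℂ) * ((∑ i, hc.eigenvectorBasis k i * v i) *
      conj (∑ i, hc.eigenvectorBasis k i * v i)) = ∑ i, ∑ j, hc.eigenvalues k *
      (hc.eigenvectorBasis k i * conj (hc.eigenvectorBasis k j)) * (v i * conj (v j)) := fun k => by
    rw [map_sum, Finset.sum_mul_sum, Finset.mul_sum]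
    refine Finset.sum_congr rfl fun i _ => ?_
    rw [Finset.mul_sum]
    refine Finset.sum_congr rfl fun j _ => ?_
    rw [map_mul]
    ring
  rw [eq_comm, Finset.sum_congr rfl fun k _ => h k, Finset.sum_comm]
  refine Finset.sum_congr rfl fun i _ => ?_
  rw [Finset.sum_comm]
  refine Finset.sum_congr rfl fun j _ => ?_
  rw [← Finset.sum_mul, ← hc.apply_eq_sum_eigenvalues]

section Kernel

variable {n : ℕ} {X : Type*} [TopologicalSpace X] [ChartedSpace (Fin n → ℂ) X] {ι : Type*}
  {Z : VectorBundleCore ℂ X ℂ ι} [IsManifold 𝓘(ℂ, Fin n → ℂ) ω X]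

theorem contMDiffOn_of_differentiableOn_charts {f : X → ℂ} {S : Set X} (hS : IsOpen S)
    (hf : ∀ a : X, DifferentiableOn ℂ (fun z => f ((chartAt (Fin n → ℂ) a).symm z))
      ((chartAt (Fin n → ℂ) a).target ∩ (chartAt (Fin n → ℂ) a).symm ⁻¹' S)) :
    ContMDiffOn 𝓘(ℂ, Fin n → ℂ) 𝓘(ℂ, ℂ) ω f S := by
  intro x hx
  have hopen := (chartAt (Fin n → ℂ) x).symm.isOpen_inter_preimage hS
  have hmem : chartAt (Fin n → ℂ) x x ∈
      (chartAt (Fin n → ℂ) x).target ∩ (chartAt (Fin n → ℂ) x).symm ⁻¹' S :=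
    ⟨mem_chart_target _ x, by
      rwa [mem_preimage, (chartAt (Fin n → ℂ) x).left_inv (mem_chart_source _ x)]⟩
  have h1 := ((SeveralVariables.contDiffOn (k := ω) hopen (hf x)).contDiffAt
    (hopen.mem_nhds hmem)).contMDiffAt
  have h2 : ContMDiffAt 𝓘(ℂ, Fin n → ℂ) 𝓘(ℂ, Fin n → ℂ) ω (chartAt (Fin n → ℂ) x) x :=
    (contMDiffOn_chart (I := 𝓘(ℂ, Fin n → ℂ)) (n := ω) (x := x)).contMDiffAt
      (chart_source_mem_nhds _ x)
  refine ((h1.comp x h2).congr_of_eventuallyEq ?_).contMDiffWithinAt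
  filter_upwards [chart_source_mem_nhds (Fin n → ℂ) x] with y hy
  rw [Function.comp, (chartAt (Fin n → ℂ) x).left_inv hy]

variable [Z.IsContMDiff 𝓘(ℂ, Fin n → ℂ) ω]

/-- A section of `Z` whose coordinates are holomorphic in local frames. -/
def LineBundle.mkSection (f : X → ℂ) (hf : ∀ i, ContMDiffOn 𝓘(ℂ, Fin n → ℂ) 𝓘(ℂ, ℂ) ω
    (fun x => frameFactor Z i x * f x) (Z.baseSet i)) : Sections n Z where
  toFun x := f x
  contMDiff_toFun x := ((contMDiffOn_section_iff (Z.indexAt x) f).2 (hf _)).contMDiffAt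
    ((Z.isOpen_baseSet _).mem_nhds (Z.mem_baseSet_at x))

namespace HermitianAlgebraic

theorem differentiableOn_mul_toFun_left (Q : HermitianAlgebraic n Z) (a : X) (i : ι) (y : X) :
    DifferentiableOn ℂ (fun z => frameFactor Z i ((chartAt (Fin n → ℂ) a).symm z) *
      Q.toFun ((chartAt (Fin n → ℂ) a).symm z) y) (frameDomain n Z a i) := by
  set j := Z.indexAt y
  have hj : conj (frameFactor Z j y) ≠ 0 := by
    simpa using frameFactor_ne_zero (Z.mem_baseSet_at y)
  have hy := mem_frameDomain_chart (n := n) (mem_chart_source (Fin n → ℂ) y) (Z.mem_baseSet_at y)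
  have h : DifferentiableOn ℂ (fun z => Q.localRep a y i j (z, star (chartAt (Fin n → ℂ) y y)))
      (frameDomain n Z a i) := by
    refine DifferentiableOn.comp (g := Q.localRep a y i j)
      (Q.differentiableOn_localRep a y i j) ?_ fun z hz => ⟨hz, by simpa using hy⟩
    exact differentiableOn_id.prodMk (differentiableOn_const _)
  refine (h.mul_const (conj (frameFactor Z j y))⁻¹).congr fun z hz => ?_
  simp only [Function.comp, localRep, star_star,
    (chartAt (Fin n → ℂ) y).left_inv (mem_chart_source (Fin n → ℂ) y)]
  field_simp

/-- The holomorphic section `x ↦ Q(x, ȳ)`, in the frame attached to `y`. -/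
def kernelSection (Q : HermitianAlgebraic n Z) (y : X) : Sections n Z :=
  mkSection (fun x => Q.toFun x y) fun i => contMDiffOn_of_differentiableOn_charts
    (Z.isOpen_baseSet i) fun a => Q.differentiableOn_mul_toFun_left a i y

theorem sval_kernelSection (Q : HermitianAlgebraic n Z) (x y : X) :
    sval (Q.kernelSection y) x = Q.toFun x y := rfl

variable [CompactSpace X] [MeasurableSpace X] [BorelSpace X]
  {Q : HermitianAlgebraic n Z} {Ω : Measure X} [IsFiniteMeasure Ω]

theorem conj_l2Inner_kernelSection (Q : HermitianAlgebraic n Z) (Ω : Measure X) (s : Sections n Z)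
    (y : X) : conj (Q.l2Inner Ω (Q.kernelSection y) s) = ∫ x, Q.weighted s y x ∂Ω := by
  rw [conj_l2Inner, l2Inner]
  refine integral_congr_ae (Filter.Eventually.of_forall fun x => ?_)
  dsimp only
  rw [sval_kernelSection, weighted, Q.hermitian x y, mul_comm (sval s x)]

theorem IsPositive.kernelForm_sum_smul (hQ : Q.IsPositive) {κ : Type*} (S : Finset κ) (c : κ → ℂ)
    (e : κ → Sections n Z) (t : Sections n Z) :
    Q.kernelForm Ω (∑ k ∈ S, c k • e k) t = ∑ k ∈ S, c k * Q.kernelForm Ω (e k) t := by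
  simp only [kernelForm, ← integral_const_mul]
  rw [← integral_finsetSum _ fun k _ => (hQ.integrable_kernel Ω (e k) t).const_mul (c k)]
  refine integral_congr_ae (Filter.Eventually.of_forall fun x => ?_)
  dsimp only
  rw [sval_sum_smul, Finset.mul_sum, Finset.sum_mul, Finset.sum_div]
  exact Finset.sum_congr rfl fun k _ => by ring

theorem conj_kernelForm (Q : HermitianAlgebraic n Z) (Ω : Measure X) [IsFiniteMeasure Ω]
    (s t : Sections n Z) : conj (Q.kernelForm Ω s t) = Q.kernelForm Ω t s := by
  rw [kernelForm, ← integral_conj, kernelForm, ← integral_prod_swap]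
  refine integral_congr_ae (Filter.Eventually.of_forall fun p => ?_)
  dsimp only [Prod.fst_swap, Prod.snd_swap]
  rw [map_div₀, map_mul, map_mul, map_mul, Complex.conj_conj, Q.conj_toFun_self, Q.conj_toFun_self,
    ← Q.hermitian]
  ring

variable {d : ℕ} {b : Module.Basis (Fin d) ℂ (Sections n Z)}

theorem IsPositive.repr_eq (hQ : Q.IsPositive)
    (hb : ∀ i j, Q.l2Inner Ω (b i) (b j) = if i = j then 1 else 0) (s : Sections n Z) (i : Fin d) :
    b.repr s i = Q.l2Inner Ω s (b i) := by
  conv_rhs => rw [← b.sum_repr s, hQ.l2Inner_sum_smul]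
  simp [hb]

theorem IsPositive.toFun_eq_sum (hQ : Q.IsPositive)
    (hb : ∀ i j, Q.l2Inner Ω (b i) (b j) = if i = j then 1 else 0) (x y : X) :
    Q.toFun x y = ∑ i, Q.l2Inner Ω (Q.kernelSection y) (b i) * sval (b i) x := by
  rw [← sval_kernelSection, ← b.sum_repr (Q.kernelSection y), sval_sum_smul, b.sum_repr]
  simp only [hQ.repr_eq hb]

/-- The Fourier coefficients of `Q(·, ȳ)` depend antiholomorphically on `y`. Expanding the kernel
once more, in the other variable, identifies their coefficients with the matrix of the kernel form.
-/
theorem IsPositive.l2Inner_kernelSection (hQ : Q.IsPositive)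
    (hb : ∀ i j, Q.l2Inner Ω (b i) (b j) = if i = j then 1 else 0) (y : X) (i : Fin d) :
    Q.l2Inner Ω (Q.kernelSection y) (b i) =
      ∑ j, Q.kernelForm Ω (b j) (b i) * conj (sval (b j) y) := by
  have hint : ∀ j, Integrable (fun x =>
      conj (sval (b i) x) / Q.toFun x x * ∫ y, Q.weighted (b j) x y ∂Ω) Ω := fun j => by
    have := (hQ.integrable_kernel Ω (b j) (b i)).integral_prod_left
    simp_rw [kernel_eq, integral_const_mul] at this
    exact this
  simp only [hQ.kernelForm_eq, ← integral_mul_const]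
  rw [← integral_finsetSum _ fun j _ => (hint j).mul_const _,
    ← Complex.conj_conj (Q.l2Inner Ω _ _), conj_l2Inner_kernelSection, ← integral_conj]
  refine integral_congr_ae (Filter.Eventually.of_forall fun x => ?_)
  dsimp only
  rw [weighted, hQ.toFun_eq_sum hb y x, map_div₀, map_mul, map_sum, Q.conj_toFun_self,
    Finset.sum_mul, Finset.sum_div]
  refine Finset.sum_congr rfl fun j _ => ?_
  rw [map_mul, conj_l2Inner_kernelSection]
  ring

/-- The bridge between analysis and algebra: positivity of the integral operator becomes positivity
of the matrix of coefficients of `Q`. -/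
theorem IsPositive.toFun_self_eq_sum (hQ : Q.IsPositive)
    (hb : ∀ i j, Q.l2Inner Ω (b i) (b j) = if i = j then 1 else 0) (x : X) :
    Q.toFun x x = ∑ i, ∑ j, Q.kernelForm Ω (b j) (b i) * (sval (b i) x * conj (sval (b j) x)) := by
  rw [hQ.toFun_eq_sum hb]
  refine Finset.sum_congr rfl fun i _ => ?_
  rw [hQ.l2Inner_kernelSection hb, Finset.sum_mul]
  exact Finset.sum_congr rfl fun j _ => by ring

theorem isHermitian_kernelForm (Q : HermitianAlgebraic n Z) (Ω : Measure X) [IsFiniteMeasure Ω]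
    (b : Fin d → Sections n Z) :
    (Matrix.of fun i j => Q.kernelForm Ω (b j) (b i)).IsHermitian :=
  Matrix.IsHermitian.ext fun i j => Q.conj_kernelForm Ω _ _

theorem IsPositive.star_dotProduct_kernelForm (hQ : Q.IsPositive) (b : Fin d → Sections n Z)
    (a : Fin d → ℂ) :
    star a ⬝ᵥ ((Matrix.of fun i j => Q.kernelForm Ω (b j) (b i)).mulVec a) =
      Q.kernelForm Ω (∑ i, a i • b i) (∑ i, a i • b i) := by
  rw [hQ.kernelForm_sum_smul]
  simp only [← Q.conj_kernelForm Ω (∑ i, a i • b i), hQ.kernelForm_sum_smul, map_sum, map_mul,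
    Q.conj_kernelForm, Matrix.mulVec, dotProduct, Matrix.of_apply, Finset.mul_sum]
  rw [Finset.sum_comm]
  refine Finset.sum_congr rfl fun i _ => Finset.sum_congr rfl fun j _ => ?_
  simp only [Pi.star_apply, Complex.star_def]
  ring

/-- The diagonalization of the kernel form in an orthonormal basis. -/
theorem IsPositive.exists_basis_sum_squares (hQ : Q.IsPositive)
    (hb : ∀ i j, Q.l2Inner Ω (b i) (b j) = if i = j then 1 else 0)
    (hK : ∀ s, 0 ≤ Q.kernelForm Ω s s) :
    ∃ (μ : Fin d → ℝ) (u : Module.Basis (Fin d) ℂ (Sections n Z)),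
      (∀ k, 0 ≤ μ k) ∧ ((∀ s ≠ 0, 0 < Q.kernelForm Ω s s) → ∀ k, 0 < μ k) ∧
      ∀ x, Q.toFun x x = ∑ k, μ k * (sval (u k) x * conj (sval (u k) x)) := by
  have hc := Q.isHermitian_kernelForm Ω b
  -- The orthonormal eigenvectors are read as coordinate vectors with respect to `b`, giving a basis
  -- of sections in which the kernel form is diagonal.
  refine ⟨hc.eigenvalues, (hc.eigenvectorBasis.toBasis.map (WithLp.linearEquiv 2 ℂ _)).map
    b.equivFun.symm, ?_, ?_, fun x => ?_⟩
  · refine Matrix.PosSemidef.eigenvalues_nonneg (Matrix.PosSemidef.of_dotProduct_mulVec_nonneg hc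
      fun a => ?_)
    rw [hQ.star_dotProduct_kernelForm]
    exact hK _
  · intro hpos
    refine Matrix.PosDef.eigenvalues_pos (Matrix.PosDef.of_dotProduct_mulVec_pos hc fun a ha => ?_)
    rw [hQ.star_dotProduct_kernelForm]
    refine hpos _ fun h => ha ?_
    rw [← b.equivFun_symm_apply] at h
    exact b.equivFun.symm.map_eq_zero_iff.1 h
  · have hu : ∀ k, sval (((hc.eigenvectorBasis.toBasis.map (WithLp.linearEquiv 2 ℂ _)).map
        b.equivFun.symm) k) x = ∑ i, hc.eigenvectorBasis k i * sval (b i) x := fun k => by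
      rw [Module.Basis.map_apply, Module.Basis.equivFun_symm_apply, sval_sum_smul]
      simp
    rw [hQ.toFun_self_eq_sum hb]
    simp only [hu]
    exact hc.sum_mul_conj_eq fun i => sval (b i) x

end HermitianAlgebraic

end Kernel

end

noncomputable section

/-! ## Sums of squares -/

open LineBundle

namespace HermitianAlgebraic

variable {n : ℕ} {X : Type*} [TopologicalSpace X] [ChartedSpace (Fin n → ℂ) X] {ι ι' : Type*}
  {Z : VectorBundleCore ℂ X ℂ ι} [Z.IsContMDiff 𝓘(ℂ, Fin n → ℂ) ω] {Q : HermitianAlgebraic n Z}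
  {d : ℕ} {μ : Fin d → ℝ} {u : Module.Basis (Fin d) ℂ (Sections n Z)}

theorem sqrt_smul_mul_conj {r : ℝ} (hr : 0 ≤ r) (s : Sections n Z) (x : X) :
    sval ((√r : ℂ) • s) x * conj (sval ((√r : ℂ) • s) x) = r * (sval s x * conj (sval s x)) := by
  rw [sval_smul, map_mul, Complex.conj_ofReal, mul_mul_mul_comm, ← Complex.ofReal_mul,
    Real.mul_self_sqrt hr]

/-- Indices with eigenvalue zero are discarded: all of them would give the zero section, and a
finite set cannot repeat an element. The remaining rescaled basis sections are distinct. -/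
theorem isSumOfSquares_of_basis (hμ : ∀ k, 0 ≤ μ k)
    (hu : ∀ x, Q.toFun x x = ∑ k, μ k * (sval (u k) x * conj (sval (u k) x))) :
    Q.IsSumOfSquares := by
  classical
  refine ⟨(Finset.univ.filter fun k => μ k ≠ 0).image fun k => (√(μ k) : ℂ) • u k, fun x => ?_⟩
  rw [Finset.sum_image, hu, Finset.sum_filter]
  · refine Finset.sum_congr rfl fun k _ => ?_
    rw [sqrt_smul_mul_conj (hμ k)]
    split_ifs with h
    · rfl
    · rw [not_not.1 h, Complex.ofReal_zero, zero_mul]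
  · intro k hk l _ hkl
    by_contra h
    have h1 := congrArg (fun s => u.repr s k) hkl
    simp only [map_smul, Module.Basis.repr_self, Finsupp.smul_apply, Finsupp.single_eq_same,
      Finsupp.single_eq_of_ne h, smul_eq_mul, mul_one, mul_zero, Complex.ofReal_eq_zero] at h1
    exact (Finset.mem_filter.1 hk).2 ((Real.sqrt_eq_zero (hμ k)).1 h1)

theorem IsPositive.isMaximalSumOfSquares_of_basis [Nonempty X] (hQ : Q.IsPositive)
    (hμ : ∀ k, 0 < μ k)
    (hu : ∀ x, Q.toFun x x = ∑ k, μ k * (sval (u k) x * conj (sval (u k) x))) :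
    Q.IsMaximalSumOfSquares := by
  -- An empty basis is impossible, since `Q` would vanish at a point of the non-empty `X`.
  obtain _ | N := d
  · obtain ⟨x⟩ := ‹Nonempty X›
    exact absurd (hu x) (by simpa using (hQ.toFun_pos x).ne')
  · refine ⟨N, u.isUnitSMul (w := fun k => (√(μ k) : ℂ)) fun k => isUnit_iff_ne_zero.2 ?_,
      fun x => ?_⟩
    · exact Complex.ofReal_ne_zero.2 (Real.sqrt_pos.2 (hμ k)).ne'
    · rw [hu]
      refine Finset.sum_congr rfl fun k _ => ?_
      rw [Module.Basis.isUnitSMul_apply, sqrt_smul_mul_conj (hμ k).le]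

theorem IsPositive.exists_family_of_isSumOfSquares [Nonempty X] (hQ : Q.IsPositive)
    (h : Q.IsSumOfSquares) : ∃ (N : ℕ) (t : Fin (N + 1) → Sections n Z),
      ∀ x, Q.toFun x x = ∑ i, sval (t i) x * conj (sval (t i) x) := by
  obtain ⟨S, hS⟩ := h
  obtain ⟨N, hN⟩ : ∃ N, S.card = N + 1 := by
    refine Nat.exists_eq_succ_of_ne_zero fun h0 => ?_
    obtain ⟨x⟩ := ‹Nonempty X›
    have := hS x
    rw [Finset.card_eq_zero.1 h0, Finset.sum_empty] at this
    exact (hQ.toFun_pos x).ne' this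
  refine ⟨N, fun i => (S.equivFinOfCardEq hN).symm i, fun x => ?_⟩
  rw [hS, ← Finset.sum_coe_sort S]
  exact ((S.equivFinOfCardEq hN).symm.sum_comp fun s : S => sval s.1 x * conj (sval s.1 x)).symm

variable [IsManifold 𝓘(ℂ, Fin n → ℂ) ω X] [CompactSpace X] [MeasurableSpace X] [BorelSpace X]
  {L : VectorBundleCore ℂ X ℂ ι} {E : VectorBundleCore ℂ X ℂ ι'}
  [L.IsContMDiff 𝓘(ℂ, Fin n → ℂ) ω] [E.IsContMDiff 𝓘(ℂ, Fin n → ℂ) ω]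
  {R : HermitianAlgebraic n L} {P : HermitianAlgebraic n E}

/-- The kernel form is Hermitian, so its diagonal values are real and the bound on the absolute
value becomes a lower bound. -/
theorem _root_.AsymptoticBound.le_kernelForm (hR : R.IsPositive) {C : ℝ}
    (h : AsymptoticBound R P C) {m : ℕ} (hm : 1 ≤ m) (s : Sections n (tensor (tpow L m) E)) :
    ((((Real.pi ^ n - C / m) / m ^ n) * ((R.pow m).mul P).l2Norm R.volumeMeasure s ^ 2 : ℝ) : ℂ) ≤
      ((R.pow m).mul P).kernelForm R.volumeMeasure s s := by
  have := isFiniteMeasure_volumeMeasure hR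
  obtain ⟨r, hr⟩ := Complex.conj_eq_iff_real.1
    (((R.pow m).mul P).conj_kernelForm R.volumeMeasure s s)
  have h1 := h m hm s
  have hm0 : (0 : ℝ) < m := by exact_mod_cast hm
  rw [hr] at h1 ⊢
  rw [← Complex.ofReal_sub, Complex.norm_real, Real.norm_eq_abs] at h1
  rw [Complex.real_le_real]
  refine le_trans (le_of_eq ?_) (sub_le_of_abs_sub_le_left h1)
  field_simp
  ring

/-- If the kernel form is nonnegative (resp. positive definite), then `R^m P` is a sum (resp. a
maximal sum) of squares. -/
theorem exists_basis_of_asymptoticBound [T2Space X] (hR : R.IsPositive) (hP : P.IsPositive)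
    (hS : R.IsSGCS) {C : ℝ} (hC : 0 < C) (h : AsymptoticBound R P C) {m : ℕ}
    (hm : C / Real.pi ^ n ≤ m) :
    ∃ (d : ℕ) (μ : Fin d → ℝ) (u : Module.Basis (Fin d) ℂ (Sections n (tensor (tpow L m) E))),
      (∀ k, 0 ≤ μ k) ∧ (C / Real.pi ^ n < m → ∀ k, 0 < μ k) ∧
      ∀ x, ((R.pow m).mul P).toFun x x = ∑ k, μ k * (sval (u k) x * conj (sval (u k) x)) := by
  have := isFiniteMeasure_volumeMeasure hR
  have := isOpenPosMeasure_volumeMeasure hR hS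
  have hQ : ((R.pow m).mul P).IsPositive := (hR.pow m).mul hP
  -- Positivity of `C` rules out `m = 0`, to which the asymptotic bound does not apply.
  have hm0 : (0 : ℝ) < m := lt_of_lt_of_le (by positivity) hm
  have hm1 : 1 ≤ m := by exact_mod_cast hm0
  have hπ : C / m ≤ Real.pi ^ n := by
    rwa [div_le_iff₀ hm0, mul_comm, ← div_le_iff₀ (by positivity)]
  obtain ⟨B, hB0, hB⟩ := exists_normAt_sq_le hR hP hS m
  obtain ⟨d, b, hb⟩ := hQ.exists_orthonormal_basis R.volumeMeasure hB0 hB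
  obtain ⟨μ, u, h0, h1, h2⟩ := hQ.exists_basis_sum_squares hb fun s => by
    refine le_trans ?_ (h.le_kernelForm hR hm1 s)
    rw [Complex.zero_le_real]
    exact mul_nonneg (div_nonneg (sub_nonneg.2 hπ) (by positivity)) (sq_nonneg _)
  refine ⟨d, μ, u, h0, fun hlt => h1 fun s hs => ?_, h2⟩
  have hπ' : C / m < Real.pi ^ n := by
    rwa [div_lt_iff₀ hm0, mul_comm, ← div_lt_iff₀ (by positivity)]
  refine lt_of_lt_of_le ?_ (h.le_kernelForm hR hm1 s)
  rw [Complex.zero_lt_real]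
  refine mul_pos (div_pos (sub_pos.2 hπ') (by positivity)) (lt_of_le_of_ne (sq_nonneg _) ?_)
  intro h3
  refine hs ((hQ.l2Core R.volumeMeasure).definite s ?_)
  change ((R.pow m).mul P).l2Inner R.volumeMeasure s s = 0
  rw [hQ.l2Inner_self, ← hQ.l2Norm_sq, ← h3, Complex.ofReal_zero]

end HermitianAlgebraic

end

noncomputable section

/-! ## The map to projective space -/

open LineBundle

namespace HermitianAlgebraic

variable {n : ℕ} {X : Type*} [TopologicalSpace X] [ChartedSpace (Fin n → ℂ) X] {ι : Type*}
  {Z : VectorBundleCore ℂ X ℂ ι} {Q : HermitianAlgebraic n Z} {N : ℕ}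
  {t : Fin (N + 1) → Sections n Z}

theorem IsPositive.family_ne_zero (hQ : Q.IsPositive)
    (ht : ∀ x, Q.toFun x x = ∑ i, sval (t i) x * conj (sval (t i) x)) (x : X) :
    (fun i => sval (t i) x) ≠ 0 := fun h => (hQ.toFun_pos x).ne' <| by
  rw [ht]
  exact Finset.sum_eq_zero fun i _ => by rw [congrFun h i, Pi.zero_apply, zero_mul]

/-- The map to projective space given by sections without common zeros. -/
def toProj (t : Fin (N + 1) → Sections n Z) (h : ∀ x, (fun i => sval (t i) x) ≠ 0) (x : X) :
    ℙ ℂ (Fin (N + 1) → ℂ) := Projectivization.mk ℂ (fun i => sval (t i) x) (h x)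

/-- `rep` is an arbitrary representative, known only up to a scalar depending on `x`; non-vanishing
and quotients of coordinates are independent of it. -/
theorem exists_rep_toProj (h : ∀ x, (fun i => sval (t i) x) ≠ 0) (x : X) :
    ∃ a : ℂ, a ≠ 0 ∧ ∀ i, (toProj t h x).rep i = a * sval (t i) x := by
  obtain ⟨a, ha⟩ := Projectivization.exists_smul_eq_mk_rep ℂ (fun i => sval (t i) x) (h x)
  exact ⟨a, a.ne_zero, fun i => (congrFun ha i).symm⟩

theorem rep_toProj_ne_zero_iff (h : ∀ x, (fun i => sval (t i) x) ≠ 0) (x : X) (i : Fin (N + 1)) :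
    (toProj t h x).rep i ≠ 0 ↔ sval (t i) x ≠ 0 := by
  obtain ⟨a, ha, hr⟩ := exists_rep_toProj h x
  rw [hr, mul_ne_zero_iff, and_iff_right ha]

theorem rep_toProj_div (h : ∀ x, (fun i => sval (t i) x) ≠ 0) (x : X) (i j : Fin (N + 1)) :
    (toProj t h x).rep j / (toProj t h x).rep i = sval (t j) x / sval (t i) x := by
  obtain ⟨a, ha, hr⟩ := exists_rep_toProj h x
  rw [hr, hr, mul_div_mul_left _ _ ha]

theorem frameFactor_dual_mul (Z : VectorBundleCore ℂ X ℂ ι) {i : ι} {x : X}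
    (hx : x ∈ Z.baseSet i) : frameFactor (dual Z) i x * frameFactor Z i x = 1 := by
  change transitionFn Z i (Z.indexAt x) x * transitionFn Z (Z.indexAt x) i x = 1
  rw [trans_mul Z _ _ _ ⟨⟨Z.mem_baseSet_at x, hx⟩, Z.mem_baseSet_at x⟩,
    trans_self Z _ (Z.mem_baseSet_at x)]

variable [IsManifold 𝓘(ℂ, Fin n → ℂ) ω X] [Z.IsContMDiff 𝓘(ℂ, Fin n → ℂ) ω]

theorem contMDiffAt_mul_sval {i : ι} {x : X} (hx : x ∈ Z.baseSet i) (s : Sections n Z) :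
    ContMDiffAt 𝓘(ℂ, Fin n → ℂ) 𝓘(ℂ, ℂ) ω (fun x => frameFactor Z i x * sval s x) x :=
  (contMDiffOn_mul_sval i s).contMDiffAt ((Z.isOpen_baseSet i).mem_nhds hx)

theorem isHolomorphicToProj_toProj (h : ∀ x, (fun i => sval (t i) x) ≠ 0) :
    IsHolomorphicToProj n (toProj t h) := by
  intro i
  simp only [rep_toProj_ne_zero_iff, rep_toProj_div]
  constructor
  · refine isOpen_iff_mem_nhds.2 fun x hx => ?_
    have hx0 := frameFactor_ne_zero (Z.mem_baseSet_at x)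
    filter_upwards [(contMDiffAt_mul_sval (Z.mem_baseSet_at x) (t i)).continuousAt.eventually_ne
      (mul_ne_zero hx0 hx)] with y hy
    exact right_ne_zero_of_mul hy
  · intro j x hx
    have hx0 := frameFactor_ne_zero (Z.mem_baseSet_at x)
    refine (((contMDiffAt_mul_sval (Z.mem_baseSet_at x) (t j)).div₀
      (contMDiffAt_mul_sval (Z.mem_baseSet_at x) (t i))
      (mul_ne_zero hx0 hx)).congr_of_eventuallyEq ?_).contMDiffWithinAt
    filter_upwards [(Z.isOpen_baseSet _).mem_nhds (Z.mem_baseSet_at x)] with y hy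
    exact (mul_div_mul_left _ _ (frameFactor_ne_zero hy)).symm

/-- The pairing of `F^*` with a section of `F`. In a frame the factors of the dual and of the
original bundle are inverse to each other, so the pairing is a product of holomorphic local
coordinates. -/
theorem contMDiff_coord_mul_sval (s : Sections n Z) :
    ContMDiff (𝓘(ℂ, Fin n → ℂ).prod 𝓘(ℂ, ℂ)) 𝓘(ℂ, ℂ) ω
      (fun v : TotalSpace ℂ (dual Z).Fiber => coord (dual Z) v.snd * sval s v.proj) := by
  intro v
  set i := Z.indexAt v.proj with hi
  have hv : v.proj ∈ Z.baseSet i := Z.mem_baseSet_at v.proj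
  have : MemTrivializationAtlas ((dual Z).localTriv i) := ⟨⟨i, rfl⟩⟩
  have hsrc : v ∈ ((dual Z).localTriv i).source := ((dual Z).localTriv i).mem_source.2 hv
  have h1 := (((dual Z).localTriv i).contMDiffOn (IB := 𝓘(ℂ, Fin n → ℂ)) (n := ω)).contMDiffAt
    (((dual Z).localTriv i).open_source.mem_nhds hsrc)
  have h2 := (contMDiffAt_mul_sval hv s).comp v
    (contMDiff_proj (dual Z).Fiber (IB := 𝓘(ℂ, Fin n → ℂ)) (n := ω)).contMDiffAt
  refine (h1.snd.mul h2).congr_of_eventuallyEq ?_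
  filter_upwards [((dual Z).localTriv i).open_source.mem_nhds hsrc] with w hw
  have hw' : w.proj ∈ Z.baseSet i := ((dual Z).localTriv i).mem_source.1 hw
  have h3 : (((dual Z).localTriv i) w).2 =
      frameFactor (dual Z) i w.proj * coord (dual Z) w.snd := by
    rw [VectorBundleCore.localTriv_apply]
    exact coordChange_apply (dual Z) _ _ _ _
  rw [Pi.mul_apply, Function.comp, h3]
  linear_combination (-(coord (dual Z) w.snd * sval s w.proj)) * frameFactor_dual_mul Z hw'

/-- The fibre of the dual bundle as the line in `ℂ^{N+1}` spanned by the values of the sections. -/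
def dualFiberEquiv (t : Fin (N + 1) → Sections n Z) (h : ∀ x, (fun i => sval (t i) x) ≠ 0) (x : X) :
    (dual Z).Fiber x ≃ₗ[ℂ] (toProj t h x).submodule :=
  (LinearEquiv.toSpanNonzeroSingleton ℂ (Fin (N + 1) → ℂ) (fun i => sval (t i) x) (h x)).trans
    (LinearEquiv.ofEq _ _ (Projectivization.submodule_mk _ _).symm)

theorem dualFiberEquiv_apply (h : ∀ x, (fun i => sval (t i) x) ≠ 0) (x : X)
    (v : (dual Z).Fiber x) (i : Fin (N + 1)) :
    (dualFiberEquiv t h x v : Fin (N + 1) → ℂ) i = coord (dual Z) v * sval (t i) x := rfl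

/-- The isomorphism sends `v` to the tuple of its pairings with the sections. The metric on a fibre
involves only the diagonal values `Q(x, x̄)`, so the sum of squares is precisely the isometry
condition. -/
theorem IsPositive.isometricToPullback_toProj (hQ : Q.IsPositive)
    (ht : ∀ x, Q.toFun x x = ∑ i, sval (t i) x * conj (sval (t i) x)) :
    Q.IsometricToPullback (toProj t (hQ.family_ne_zero ht)) := by
  refine ⟨dualFiberEquiv t _, contMDiff_pi_space.2 fun i => ?_, fun x v w => ?_⟩
  · exact contMDiff_coord_mul_sval (t i)
  · simp only [dualFiberEquiv_apply, metric, onDual, ht, Finset.sum_mul, map_mul]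
    exact Finset.sum_congr rfl fun i _ => by ring

end HermitianAlgebraic

end

/-! ### The main theorem -/

theorem corollary1p2 {n : ℕ} {X : Type*} [TopologicalSpace X] [T2Space X] [CompactSpace X]
    [Nonempty X] [MeasurableSpace X] [BorelSpace X]
    [ChartedSpace (Fin n → ℂ) X] [IsManifold 𝓘(ℂ, Fin n → ℂ) ω X]
    {ι ι' : Type*}
    (L : VectorBundleCore ℂ X ℂ ι) [L.IsContMDiff 𝓘(ℂ, Fin n → ℂ) ω]
    (E : VectorBundleCore ℂ X ℂ ι') [E.IsContMDiff 𝓘(ℂ, Fin n → ℂ) ω]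
    (R : HermitianAlgebraic n L) (P : HermitianAlgebraic n E)
    (hR : R.IsPositive) (hP : P.IsPositive) (hSGCS : R.IsSGCS) :
    (∃ C : ℝ, 0 < C ∧ AsymptoticBound R P C) ∧
    ∀ C : ℝ, 0 < C → AsymptoticBound R P C → ∀ m : ℕ,
      (C / Real.pi ^ n < m → ((R.pow m).mul P).IsMaximalSumOfSquares) ∧
      (C / Real.pi ^ n ≤ m → ((R.pow m).mul P).IsSumOfSquares) ∧
      (C / Real.pi ^ n ≤ m → ∃ (N : ℕ) (φ : X → ℙ ℂ (Fin (N + 1) → ℂ)),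
        IsHolomorphicToProj n φ ∧ ((R.pow m).mul P).IsometricToPullback φ) := by
  refine ⟨HermitianAlgebraic.exists_asymptoticBound hR hP (HermitianAlgebraic.exists_isNormalChart hR hP hSGCS), fun C hC h m => ?_⟩
  have hQ : ((R.pow m).mul P).IsPositive := (hR.pow m).mul hP
  have hsum (hm : C / Real.pi ^ n ≤ m) : ((R.pow m).mul P).IsSumOfSquares := by
    obtain ⟨d, μ, u, h0, _, hu⟩ := HermitianAlgebraic.exists_basis_of_asymptoticBound hR hP hSGCS hC h hm
    exact HermitianAlgebraic.isSumOfSquares_of_basis h0 hu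
  refine ⟨fun hm => ?_, hsum, fun hm => ?_⟩
  · obtain ⟨d, μ, u, _, h1, hu⟩ := HermitianAlgebraic.exists_basis_of_asymptoticBound hR hP hSGCS hC h hm.le
    exact hQ.isMaximalSumOfSquares_of_basis (h1 hm) hu
  · obtain ⟨N, t, ht⟩ := hQ.exists_family_of_isSumOfSquares (hsum hm)
    exact ⟨N, _, HermitianAlgebraic.isHolomorphicToProj_toProj _, hQ.isometricToPullback_toProj ht⟩
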